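/- Let $\mathfrak g$ be a finite-dimensional semisimple complex Lie algebra with Cartan subalgebra, simple roots $\alpha_i$ and simple coroots $\alpha_i^\vee$ ($i\in I$). Fix a Weyl-invariant symmetric bilinear form $(\cdot,\cdot)$ and an integer $p\geq 1$ such that the rescaled coroot lattice $\Lambda=\sqrt p\,\Lambda_{\mathfrak g}^\vee=\bigoplus_i\mathbb Z\sqrt p\,\alpha_i^\vee$ is even and positive definite, i.e. $q_i:=\tfrac12(\sqrt p\,\alpha_i^\vee,\sqrt p\,\alpha_i^\vee)=2p/(\alpha_i,\alpha_i)$ is a positive integer for all $i$ (for simply-laced $\mathfrak g$ with $(\alpha_i,\alpha_i)=2$ one has $q_i=p$). Let $\mathcal V_\Lambda$ be the lattice vertex algebra of $\Lambda$ (with respect to any normalized 2-cocycle $\varepsilon$ with $\varepsilon(a,b)=(-1)^{(a,b)}\varepsilon(b,a)$), and let $\mathcal W_{\mathfrak g,p}\subset\mathcal V_\Lambda$ be the Feigin–Tipunin algebra, defined as the intersection over $i\in I$ of the kernels of the short screening operators $\mathrm{Res}\,\mathcal Y(e^{-\alpha_i/\sqrt p},z)$. For $\lambda$ in the dual lattice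 $\Lambda^*$ let $\mathcal V_\lambda=\bigoplus_{c\in\Lambda}S(t^{-1}\mathfrak h[t^{-1}])\,e^{\lambda+c}$ ($\mathfrak h=\mathbb C\otimes\Lambda$); it represents the class of $\lambda$ in $\Lambda^*/\Lambda$. For $i\in I$ let $x^{(i)}=e^{\sqrt p\,\alpha_i^\vee}\in\mathcal V_\Lambda$, with modes $\mathcal Y(x^{(i)},z)=\sum_n x^{(i)}_nz^{-n-1}$; $x^{(i)}_0$ is the long screening operator. For a locally nilpotent derivation $D$ of a vertex algebra $\mathcal V$ with vacuum $\mathbf 1$, a (weak) $D$-twisted module is a vector space $\mathcal M$ with a bilinear map $(a,v)\mapsto\mathcal Y_{\mathcal M}(a,z)v\in\mathcal M((z))[\log z]$ such that $\mathcal Y_{\mathcal M}(\mathbf 1,z)=\mathrm{id}$, $\mathcal Y_{\mathcal M}(e^{2\pi i D}a,z)=e^{2\pi i\,z\partial_z}\mathcal Y_{\mathcal M}(a,z)$ (the right-hand side means $\log z\mapsto\log z+2\pi i$), $\mathcal Y_{\mathcal M}(a_{-2}\mathbf 1,z)=\frac{d}{dz}\mathcal Y_{\mathcal M}(a,z)$,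 and the modes $a^{\mathcal M}_m$ of the logarithm-free part $\sum_m a_m^{\mathcal M}z^{-m-1}$ of $\mathcal Y_{\mathcal M}(a,z)$ satisfy, for all $a,b\in\mathcal V$ and $m,k,n\in\mathbb Z$, the twisted Borcherds identity $$\sum_{j\ge0}(-1)^j\binom nj\left(a^{\mathcal M}_{m+n-j}b^{\mathcal M}_{k+j}-(-1)^nb^{\mathcal M}_{k+n-j}a^{\mathcal M}_{m+j}\right)=\sum_{j\ge0}\left(\Big(\tbinom{m-D}{j}a\Big)_{n+j}b\right)^{\mathcal M}_{m+k-j}.$$ Then: 1. $\mathcal V_\Lambda$ is a vertex algebra, $\mathcal W_{\mathfrak g,p}$ is a vertex subalgebra, and for every $\lambda\in\Lambda^*$, $\mathcal V_\lambda$ is a simple $\mathcal V_\Lambda$-module generated by $e^\lambda$. 2. Let $\lambda\in\Lambda^*$, $i\in I$, $x=x^{(i)}$. Then $x_0$ is a locally nilpotent derivation of $\mathcal V_\Lambda$; for every $a\in\mathcal V_\Lambda$, $$\Delta(x,z)a=\exp\Big(x_0\log z+\sum_{n\ge1}\frac{x_n}{-n}(-z)^{-n}\Big)a$$ is a polynomial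 in $\log z$ and $z^{-1}$; and the $\Delta$-deformation $$\mathcal Y_{\widetilde{\mathcal V}_\lambda}(a,z):=\mathcal Y_{\mathcal V_\lambda}(\Delta(x,z)a,z)$$ is an $x_0$-twisted $\mathcal V_\Lambda$-module structure on the vector space $\mathcal V_\lambda$, denoted $\widetilde{\mathcal V}_\lambda$. 3. If moreover $q_i\ne1$, then $x_0$ preserves $\mathcal W_{\mathfrak g,p}$ and restricts to a locally nilpotent derivation of it, and the restriction of $\widetilde{\mathcal V}_\lambda$ to $\mathcal W_{\mathfrak g,p}$ is an $x_0$-twisted module of $\mathcal W_{\mathfrak g,p}$ (the $x$-twisted Verma module of weight $\lambda$). 4. (The Borel action.) Put $s^{(i)}=\alpha_i^\vee{}_{,-1}\mathbf 1$. The operators $s^{(i)}_0$ and $x^{(i)}_0$ are derivations of $\mathcal V_\Lambda$; $s^{(i)}_0$ acts on charge $c\in\Lambda$ by the scalar $(\alpha_i^\vee,c)$; and $[s_0^{(i)},s_0^{(j)}]=0$, $[s_0^{(i)},x_0^{(j)}]=(\alpha_i^\vee,\sqrt p\,\alpha_j^\vee)\,x_0^{(j)}$, $\mathrm{ad}(x_0^{(i)})^{1-\langle\alpha_i,\alpha_j^\vee\rangle}x_0^{(j)}=0$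 for $i\neq j$, which are the relations of the Borel subalgebra of the Langlands dual Lie algebra. The exponentials $\exp(t\,x_0^{(i)})$ ($t\in\mathbb C$) and $\exp(\sum_it_is_0^{(i)})$ ($t\in\mathbb C^I$) are vertex algebra automorphisms of $\mathcal V_\Lambda$, hence so is every element of the group they generate. If $q_i\neq1$ for all $i$, every element of this group maps $\mathcal W_{\mathfrak g,p}$ to itself and restricts to a vertex algebra automorphism of $\mathcal W_{\mathfrak g,p}$. -/

import Mathlib

noncomputable section

/-! ### Vertex algebras, their modules and their twisted modules

A vertex algebra over `ℂ` is given by a vacuum vector `vac` and by its modes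
`Y a n b = a₍ₙ₎ b`, i.e. `Y(a, z) b = ∑ₙ (a₍ₙ₎ b) z^(-n-1)`. -/

section VertexAlgebras

variable {V M : Type*} [AddCommGroup V] [Module ℂ V] [AddCommGroup M] [Module ℂ M]

/-- `YM` makes `M` a (weak) module over the vertex algebra `(V, vac, Y)`. The last field is the
Borcherds (Jacobi) identity; all its sums are finite because of `truncation`. -/
structure IsVertexModule (vac : V) (Y : V → ℤ → V → V) (YM : V → ℤ → M → M) : Prop where
  add_left : ∀ a b n v, YM (a + b) n v = YM a n v + YM b n v
  smul_left : ∀ (t : ℂ) a n v, YM (t • a) n v = t • YM a n v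
  add_right : ∀ a n v w, YM a n (v + w) = YM a n v + YM a n w
  smul_right : ∀ (t : ℂ) a n v, YM a n (t • v) = t • YM a n v
  truncation : ∀ a v, ∃ N : ℤ, ∀ n, N ≤ n → YM a n v = 0
  vacuum : ∀ n v, YM vac n v = if n = -1 then v else 0
  borcherds : ∀ (a b : V) (v : M) (m k n : ℤ),
    (∑ᶠ j : ℕ, ((-1 : ℂ) ^ j * (Ring.choose n j : ℤ)) •
      (YM a (m + n - j) (YM b (k + j) v) -
        ((-1 : ℂ) ^ n) • YM b (k + n - j) (YM a (m + j) v))) =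
    ∑ᶠ j : ℕ, ((Ring.choose m j : ℤ) : ℂ) • YM (Y a (n + j) b) (m + k - j) v

/-- `(V, vac, Y)` is a vertex algebra. -/
structure IsVertexAlgebra (vac : V) (Y : V → ℤ → V → V) : Prop
    extends IsVertexModule vac Y Y where
  creation : ∀ a, Y a (-1) vac = a
  creation_nonneg : ∀ a n, 0 ≤ n → Y a n vac = 0

/-- `f` is an automorphism of the vertex algebra `(V, vac, Y)`. -/
structure IsVertexAut (vac : V) (Y : V → ℤ → V → V) (f : V → V) : Prop where
  bijective : Function.Bijective f
  add : ∀ a b, f (a + b) = f a + f b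
  smul : ∀ (t : ℂ) a, f (t • a) = t • f a
  vacuum : f vac = vac
  mode : ∀ a n b, f (Y a n b) = Y (f a) n (f b)

/-- `D` is a derivation (infinitesimal automorphism) of the vertex algebra `(V, vac, Y)`. -/
structure IsVertexDerivation (vac : V) (Y : V → ℤ → V → V) (D : V → V) : Prop where
  add : ∀ a b, D (a + b) = D a + D b
  smul : ∀ (t : ℂ) a, D (t • a) = t • D a
  vacuum : D vac = 0
  mode : ∀ a n b, D (Y a n b) = Y (D a) n b + Y a n (D b)

/-- `D` is locally nilpotent. -/
def IsLocallyNilpotent (D : V → V) : Prop := ∀ a, ∃ r : ℕ, D^[r] a = 0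

/-- The exponential `exp (t D)` of a locally nilpotent operator (a finite sum). -/
def expOp (D : V → V) (t : ℂ) (a : V) : V :=
  ∑ᶠ r : ℕ, (t ^ r / (r.factorial : ℂ)) • D^[r] a

/-- `binomOp D m j a` is the vector `binom(m - D, j) a`, where
`binom(m - D, j) = (m - D) (m - 1 - D) ⋯ (m - j + 1 - D) / j!`. -/
def binomOp (D : V → V) (m : ℤ) : ℕ → V → V
  | 0, a => a
  | j + 1, a => ((j : ℂ) + 1)⁻¹ •
      (((m : ℂ) - j) • binomOp D m j a - D (binomOp D m j a))

/-- `YM` makes `M` a (weak) `D`-twisted module over `(V, vac, Y)`, for a locally nilpotent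
derivation `D`, i.e. a module twisted by the unipotent automorphism `exp (2πi D)`. Here
`Y_M(a, z) v = ∑_{k, n} (YM a k n v) (log z)^k z^(-n-1)`,
which for given `a`, `v` is a polynomial in `log z` with coefficients in `M((z))`.

* `monodromy` is `Y_M(exp(2πi D) a, z) = exp(2πi z ∂/∂z) Y_M(a, z)`, the right-hand side being
  the substitution `log z ↦ log z + 2πi`.
* `derivative` is `Y_M(T a, z) = (d/dz) Y_M(a, z)` with `T a = a₍₋₂₎ vac` and
  `(d/dz) log z = z⁻¹`.
* `borcherds` is the twisted Borcherds identity for the modes `a^M_m = YM a 0 m`, the coefficients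
  of the terms without logarithm; those with logarithms follow by `monodromy`. -/
structure IsTwistedModule (vac : V) (Y : V → ℤ → V → V) (D : V → V)
    (YM : V → ℕ → ℤ → M → M) : Prop where
  add_left : ∀ a b k n v, YM (a + b) k n v = YM a k n v + YM b k n v
  smul_left : ∀ (t : ℂ) a k n v, YM (t • a) k n v = t • YM a k n v
  add_right : ∀ a k n v w, YM a k n (v + w) = YM a k n v + YM a k n w
  smul_right : ∀ (t : ℂ) a k n v, YM a k n (t • v) = t • YM a k n v
  truncation : ∀ a v, ∃ (K : ℕ) (N : ℤ), ∀ k n, K ≤ k ∨ N ≤ n → YM a k n v = 0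
  vacuum : ∀ k n v, YM vac k n v = if k = 0 ∧ n = -1 then v else 0
  monodromy : ∀ a k n v, YM (expOp D (2 * Real.pi * Complex.I) a) k n v =
    ∑ᶠ j : ℕ, (((k + j).choose k : ℂ) * (2 * Real.pi * Complex.I) ^ j) • YM a (k + j) n v
  derivative : ∀ a k n v, YM (Y a (-2) vac) k n v =
    (-(n : ℂ)) • YM a k (n - 1) v + ((k : ℂ) + 1) • YM a (k + 1) (n - 1) v
  borcherds : ∀ (a b : V) (v : M) (m k n : ℤ),
    (∑ᶠ j : ℕ, ((-1 : ℂ) ^ j * (Ring.choose n j : ℤ)) •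
      (YM a 0 (m + n - j) (YM b 0 (k + j) v) -
        ((-1 : ℂ) ^ n) • YM b 0 (k + n - j) (YM a 0 (m + j) v))) =
    ∑ᶠ j : ℕ, YM (Y (binomOp D m j a) (n + j) b) 0 (m + k - j) v

/-- A subspace of the module `M` that is stable under all modes. -/
def IsModeStable (YM : V → ℤ → M → M) (N : Submodule ℂ M) : Prop :=
  ∀ a n, ∀ v ∈ N, YM a n v ∈ N

/-- The module `M` is simple: it is nonzero and has no proper nonzero submodule. -/
def IsSimpleVertexModule (YM : V → ℤ → M → M) : Prop :=
  Nontrivial M ∧ ∀ N : Submodule ℂ M, IsModeStable YM N → N = ⊥ ∨ N = ⊤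

/-- The module `M` is generated by the vector `v`. -/
def IsGeneratedBy (YM : V → ℤ → M → M) (v : M) : Prop :=
  ∀ N : Submodule ℂ M, IsModeStable YM N → v ∈ N → N = ⊤

/-- The subspace `W` is a vertex subalgebra: it contains the vacuum and is closed under all
products. -/
structure IsVertexSubalgebra (vac : V) (Y : V → ℤ → V → V) (W : Submodule ℂ V) : Prop where
  vacuum_mem : vac ∈ W
  mode_mem : ∀ a ∈ W, ∀ n, ∀ b ∈ W, Y a n b ∈ W

/-- The vacuum of a vertex subalgebra. -/
def IsVertexSubalgebra.vac {vac : V} {Y : V → ℤ → V → V} {W : Submodule ℂ V}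
    (hW : IsVertexSubalgebra vac Y W) : W := ⟨vac, hW.vacuum_mem⟩

/-- The modes of a vertex subalgebra. -/
def IsVertexSubalgebra.mode {vac : V} {Y : V → ℤ → V → V} {W : Submodule ℂ V}
    (hW : IsVertexSubalgebra vac Y W) (a : W) (n : ℤ) (b : W) : W :=
  ⟨Y a n b, hW.mode_mem a a.2 n b b.2⟩

/-- The restriction to `W` of a map that preserves `W`. -/
def restrictMap {W : Submodule ℂ V} {D : V → V} (hD : ∀ a ∈ W, D a ∈ W) (a : W) : W :=
  ⟨D a, hD a a.2⟩

/-- The commutator of two operators. -/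
def opBracket (f g : V → V) : V → V := fun v => f (g v) - g (f v)

/-! ### The `Δ`-deformation -/

/-- For `F = ∑ F k q (log z)^k z^(-q)` in `V⟦log z, z⁻¹⟧`, the series
`(x₀ log z + ∑_{n ≥ 1} x_n / (-n) (-z)^(-n)) F`. -/
def deltaExponent (Y : V → ℤ → V → V) (x : V) (F : ℕ → ℕ → V) : ℕ → ℕ → V :=
  fun k q =>
    (if k = 0 then 0 else Y x 0 (F (k - 1) q)) +
    ∑ n ∈ Finset.Icc 1 q, ((-1 : ℂ) ^ n / (-(n : ℂ))) • Y x n (F k (q - n))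

/-- The coefficient of `(log z)^k z^(-q)` in
`Δ(x, z) a = exp (x₀ log z + ∑_{n ≥ 1} x_n / (-n) (-z)^(-n)) a`.
Each application of the exponent raises `k + q` by at least one, so that only the
terms `r ≤ k + q` of the exponential series contribute. -/
def deltaCoeff (Y : V → ℤ → V → V) (x a : V) (k q : ℕ) : V :=
  ∑ r ∈ Finset.range (k + q + 1), ((r.factorial : ℂ)⁻¹) •
    ((deltaExponent Y x)^[r] (fun k' q' => if k' = 0 ∧ q' = 0 then a else 0)) k q

/-- The `Δ`-deformation `Ỹ_M(a, z) = Y_M(Δ(x, z) a, z)` of a module: the coefficient of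
`(log z)^k z^(-n-1)`. -/
def deltaDeform (Y : V → ℤ → V → V) (YM : V → ℤ → M → M) (x : V)
    (a : V) (k : ℕ) (n : ℤ) (v : M) : M :=
  ∑ᶠ q : ℕ, YM (deltaCoeff Y x a k q) (n - q) v

end VertexAlgebras

/-! ### Lattice vertex algebras

`Λ = ⊕ᵢ ℤ eᵢ` is an even lattice with Gram matrix `G i j = (eᵢ, eⱼ)`; an element of `Λ` is the
vector of its coordinates in `I → ℤ`. An element `λ` of the dual lattice `Λ* = Hom(Λ, ℤ)` is
given by the integers `lam i = (λ, eᵢ)`. -/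

section Lattice

variable {I : Type*} [Fintype I]

/-- The underlying vector space of `𝒱_λ = ⊕_{c ∈ Λ} S(t⁻¹ 𝔥[t⁻¹]) e^(λ+c)`, `𝔥 = ℂ ⊗ Λ`. The
variable `X (i, n)` stands for the creation operator `(eᵢ)_{-n-1}`, and `single c Q` for the
vector `Q e^(λ+c)`. -/
abbrev LatticeFock (I : Type*) := (I → ℤ) →₀ MvPolynomial (I × ℕ) ℂ

/-- The bilinear form of the lattice. -/
def latPair (G : Matrix I I ℤ) (c c' : I → ℤ) : ℤ := ∑ i, ∑ j, c i * G i j * c' j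

/-- The integer `(eᵢ, λ + c)`. -/
def chargePair (G : Matrix I I ℤ) (lam c : I → ℤ) (i : I) : ℤ := lam i + ∑ j, G i j * c j

/-- A normalized 2-cocycle on the lattice with commutator `(-1)^(c, c')`. -/
structure LatticeCocycle (G : Matrix I I ℤ) where
  ε : (I → ℤ) → (I → ℤ) → ℂˣ
  zero_left : ∀ c, ε 0 c = 1
  zero_right : ∀ c, ε c 0 = 1
  cocycle : ∀ a b c, ε a b * ε (a + b) c = ε b c * ε a (b + c)
  comm : ∀ a b, ε a b = (-1) ^ latPair G a b * ε b a

/-- Such cocycles exist on every even lattice. -/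
theorem LatticeCocycle.nonempty (G : Matrix I I ℤ) (hs : ∀ i j, G i j = G j i)
    (he : ∀ i, Even (G i i)) : Nonempty (LatticeCocycle G) := by
  classical
  let e := Fintype.equivFin I
  let F : (I → ℤ) → (I → ℤ) → ℤ := fun a b =>
    ∑ i, ∑ j, if e i < e j then a i * G i j * b j else 0
  have F_add_left : ∀ a b c, F (a + b) c = F a c + F b c := by
    intro a b c
    simp only [F, ← Finset.sum_add_distrib]
    refine Finset.sum_congr rfl fun i _ => Finset.sum_congr rfl fun j _ => ?_
    split_ifs <;> simp [add_mul]
  have F_add_right : ∀ a b c, F a (b + c) = F a b + F a c := by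
    intro a b c
    simp only [F, ← Finset.sum_add_distrib]
    refine Finset.sum_congr rfl fun i _ => Finset.sum_congr rfl fun j _ => ?_
    split_ifs <;> simp [mul_add]
  have key : ∀ a b, latPair G a b = F a b + F b a + ∑ i, a i * G i i * b i := by
    intro a b
    have h1 : F b a = ∑ i, ∑ j, if e j < e i then a i * G i j * b j else 0 := by
      simp only [F]
      rw [Finset.sum_comm]
      refine Finset.sum_congr rfl fun i _ => Finset.sum_congr rfl fun j _ => ?_
      split_ifs
      · rw [hs j i]; ring
      · rfl
    have h2 : (∑ i, a i * G i i * b i) =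
        ∑ i, ∑ j, if i = j then a i * G i j * b j else 0 := by
      simp
    rw [h1, h2]
    simp only [F, latPair, ← Finset.sum_add_distrib]
    refine Finset.sum_congr rfl fun i _ => Finset.sum_congr rfl fun j _ => ?_
    rcases lt_trichotomy (e i) (e j) with h | h | h
    · have : i ≠ j := fun h' => by simp [h'] at h
      simp [h, h.not_gt, this]
    · have : i = j := e.injective h
      simp [this]
    · have : i ≠ j := fun h' => by simp [h'] at h
      simp [h, h.not_gt, this]
  have hev : ∀ a b : I → ℤ, Even (∑ i, a i * G i i * b i) := fun a b =>
    Finset.even_sum _ fun i _ => ((he i).mul_left (a i)).mul_right (b i)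
  refine ⟨⟨fun a b => (-1) ^ F a b, fun c => by simp [F], fun c => by simp [F], ?_, ?_⟩⟩
  · intro a b c
    rw [← zpow_add, ← zpow_add, F_add_left, F_add_right]
    congr 1; ring
  · intro a b
    rw [← zpow_add, key]
    have h : F a b + F b a + ∑ i, a i * G i i * b i + F b a =
        F a b + (F b a + F b a + ∑ i, a i * G i i * b i) := by ring
    rw [h, zpow_add]
    have h3 : Even (F b a + F b a + ∑ i, a i * G i i * b i) := (Even.add_self _).add (hev a b)
    rw [h3.neg_one_zpow, mul_one]

/-- The action of the Heisenberg mode `(eᵢ)_m` on a Fock space with zero mode `(eᵢ)_0 = h`. -/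
def heisFock (G : Matrix I I ℤ) (h : ℤ) (i : I) (m : ℤ) :
    MvPolynomial (I × ℕ) ℂ →ₗ[ℂ] MvPolynomial (I × ℕ) ℂ :=
  if m < 0 then LinearMap.mulLeft ℂ (MvPolynomial.X (i, (-m - 1).toNat))
  else if m = 0 then (h : ℂ) • LinearMap.id
  else ∑ j, ((m : ℂ) * (G i j : ℂ)) •
    (MvPolynomial.pderiv (R := ℂ) (j, (m - 1).toNat) :
      MvPolynomial (I × ℕ) ℂ →ₗ[ℂ] MvPolynomial (I × ℕ) ℂ)

/-- The Heisenberg mode `(eᵢ)_m` on `𝒱_λ`. -/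
def heisMode (G : Matrix I I ℤ) (lam : I → ℤ) (i : I) (m : ℤ) :
    LatticeFock I →ₗ[ℂ] LatticeFock I :=
  Finsupp.lsum ℂ fun c => Finsupp.lsingle c ∘ₗ heisFock G (chargePair G lam c i) i m

/-- For `μ = ∑ u i • eᵢ` in `𝔥`, the coefficient of `z^N` in `exp (∑_{k ≥ 1} μ_{-k} z^k / k)`
(zero if `N < 0`); the inner series has no constant term. -/
def creationCoeff (u : I → ℂ) (N : ℤ) : MvPolynomial (I × ℕ) ℂ :=
  if N < 0 then 0 else
    ∑ r ∈ Finset.range (N.toNat + 1), ((r.factorial : ℂ)⁻¹) •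
      PowerSeries.coeff N.toNat
        ((PowerSeries.mk fun k : ℕ => if k = 0 then (0 : MvPolynomial (I × ℕ) ℂ) else
          ∑ i, (u i / (k : ℂ)) • MvPolynomial.X (i, k - 1)) ^ r)

/-- For `μ` in `𝔥` with `(μ, eⱼ) = w j`, the operator `exp (-∑_{k ≥ 1} μ_k z^(-k) / k)` with values
in polynomials in `z⁻¹`. As `μ_k = k ∑ⱼ w j ∂/∂X(j, k-1)`, it is the algebra homomorphism
`X (j, n) ↦ X (j, n) - w j z^(-n-1)`. -/
def annihilationShift (w : I → ℤ) :
    MvPolynomial (I × ℕ) ℂ →ₐ[ℂ] Polynomial (MvPolynomial (I × ℕ) ℂ) :=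
  MvPolynomial.aeval fun s : I × ℕ =>
    Polynomial.C (MvPolynomial.X s) -
      Polynomial.monomial (s.2 + 1) (MvPolynomial.C ((w s.1 : ℤ) : ℂ))

/-- For `μ = ∑ u i • eᵢ` with `(μ, eⱼ) = w j`, the coefficient of `z^N` in
`exp (∑_{k ≥ 1} μ_{-k} z^k / k) exp (-∑_{k ≥ 1} μ_k z^(-k) / k)`. -/
def expFock (u : I → ℂ) (w : I → ℤ) (N : ℤ) :
    MvPolynomial (I × ℕ) ℂ →ₗ[ℂ] MvPolynomial (I × ℕ) ℂ :=
  (Polynomial.lsum fun q : ℕ => LinearMap.mulLeft ℂ (creationCoeff u (N + q))) ∘ₗ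
    (annihilationShift w).toLinearMap

/-- The mode `(e^γ)_m` on `𝒱_λ`, for `γ ∈ Λ`, from
`Y(e^γ, z) Q e^(λ+c) = ε(γ, c) z^(γ, λ+c) exp (∑ γ_{-k} z^k / k) exp (-∑ γ_k z^(-k) / k) Q
e^(λ+γ+c)`. -/
def expMode (G : Matrix I I ℤ) (E : LatticeCocycle G) (lam γ : I → ℤ) (m : ℤ) :
    LatticeFock I →ₗ[ℂ] LatticeFock I :=
  Finsupp.lsum ℂ fun c => Finsupp.lsingle (γ + c) ∘ₗ
    ((E.ε γ c : ℂ) • expFock (fun i => (γ i : ℂ)) (fun j => ∑ i, G j i * γ i)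
      (-m - 1 - ∑ i, γ i * chargePair G lam c i))

/-- The modes on `𝒱_λ` of the state `(e_{i₁})_{-n₁-1} ⋯ (e_{iₛ})_{-nₛ-1} e^γ`, where the list is
`[(i₁, n₁), …, (iₛ, nₛ)]`: the field is the normally ordered product of the fields
`∂^n eᵢ(z) / n!` and `Y(e^γ, z)`. -/
def stateMode (G : Matrix I I ℤ) (E : LatticeCocycle G) (lam γ : I → ℤ) :
    List (I × ℕ) → ℤ → LatticeFock I → LatticeFock I
  | [], m, v => expMode G E lam γ m v
  | s :: L, m, v => ∑ᶠ j : ℕ, ((s.2 + j).choose j : ℂ) •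
      (heisMode G lam s.1 (-(s.2 : ℤ) - 1 - j) (stateMode G E lam γ L (m + j) v) +
        ((-1 : ℂ) ^ s.2) •
          stateMode G E lam γ L (m - s.2 - 1 - j) (heisMode G lam s.1 j v))

/-- The modes `a₍ₘ₎` on `𝒱_λ` of an arbitrary state `a` of the lattice vertex algebra. (The order
of the factors of a monomial is irrelevant.) For `lam = 0` this is the lattice vertex algebra. -/
def latticeMode (G : Matrix I I ℤ) (E : LatticeCocycle G) (lam : I → ℤ)
    (a : LatticeFock I) (m : ℤ) (v : LatticeFock I) : LatticeFock I :=
  ∑ γ ∈ a.support, ∑ s ∈ (a γ).support,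
    MvPolynomial.coeff s (a γ) • stateMode G E lam γ (Finsupp.toMultiset s).toList m v

/-- The vacuum of the lattice vertex algebra; in `𝒱_λ` the same expression is `e^λ`. -/
def latticeVac (I : Type*) : LatticeFock I := Finsupp.single 0 1

/-- The basis vector `eᵢ` of the lattice. -/
def latticeBasis (i : I) : I → ℤ := by
  classical exact Pi.single i 1

/-- The state `e^{eᵢ}`. -/
def longScreening (i : I) : LatticeFock I := Finsupp.single (latticeBasis i) 1

/-! ### The Feigin–Tipunin algebra

`A i j = ⟨αᵢ, αⱼ^∨⟩` is a Cartan matrix, and `Λ = √p Λ^∨` is the rescaled coroot lattice with basis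
`eᵢ = √p αᵢ^∨`. With `q i = (eᵢ, eᵢ) / 2` one has `αᵢ / √p = (1 / q i) eᵢ` and
`(αᵢ / √p, eⱼ) = A i j`. -/

/-- The Gram matrix `(√p αᵢ^∨, √p αⱼ^∨) = q i * ⟨αᵢ, αⱼ^∨⟩` of `√p Λ^∨`. -/
def corootGram (A : Matrix I I ℤ) (q : I → ℕ) : Matrix I I ℤ := fun i j => (q i : ℤ) * A i j

/-- The short screening operator `y₀ = Res Y(e^{-αᵢ/√p}, z)` from `𝒱_Λ = ⊕_c S e^c` to
`𝒱_{Λ-αᵢ/√p} = ⊕_c S e^{c-αᵢ/√p}`; it is the coefficient of `z⁻¹`. Its kernel does not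
depend on the choice of a nonzero scalar in each charge `c`. -/
def shortScreening (A : Matrix I I ℤ) (q : I → ℕ) (i : I) :
    LatticeFock I →ₗ[ℂ] LatticeFock I :=
  Finsupp.lsum ℂ fun c => Finsupp.lsingle c ∘ₗ
    expFock (fun j => -((latticeBasis i j : ℂ) / (q i : ℂ))) (fun j => -A i j)
      (-1 + ∑ j, A i j * c j)

/-- The Feigin–Tipunin algebra: the intersection of the kernels of all short screenings. -/
def feiginTipunin (A : Matrix I I ℤ) (q : I → ℕ) : Submodule ℂ (LatticeFock I) :=
  ⨅ i, LinearMap.ker (shortScreening A q i)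

/-- The state `s = ∂φ_{αᵢ^∨} = (αᵢ^∨)_{-1} 1`, with `αᵢ^∨ = eᵢ / √p`. -/
def cartanState (p : ℕ) (i : I) : LatticeFock I :=
  Finsupp.single 0 (((Real.sqrt p : ℝ) : ℂ)⁻¹ • MvPolynomial.X (i, 0))

/-- The exponential of `∑ᵢ t i • s₀^{αᵢ^∨}`; the zero mode `s₀^{αᵢ^∨}` acts on charge `c` by the
scalar `(αᵢ^∨, c) = (eᵢ, c) / √p`. -/
def torusExp (G : Matrix I I ℤ) (p : ℕ) (t : I → ℂ) : LatticeFock I → LatticeFock I :=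
  fun v => v.sum fun c Q => Finsupp.single c
    (Complex.exp (∑ i, t i * ((chargePair G 0 c i : ℂ) / ((Real.sqrt p : ℝ) : ℂ))) • Q)

/-- The group of permutations of `𝒱_Λ` generated by the exponentials of the long screening
operators and of the operators `s₀`: the group through which the Borel subgroup acts. -/
def borelGroup (G : Matrix I I ℤ) (E : LatticeCocycle G) (p : ℕ) :
    Subgroup (Equiv.Perm (LatticeFock I)) :=
  Subgroup.closure
    ({g | ∃ (i : I) (t : ℂ), ⇑g = expOp (latticeMode G E 0 (longScreening i) 0) t} ∪
      {g | ∃ t : I → ℂ, ⇑g = torusExp G p t})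

end Lattice

end

/-! The core is the Borcherds identity for the lattice vertex algebra acting on `𝒱_λ`. In the index
n both sides satisfy the recursion that expresses (z - w)^(n+1) = z (z - w)^n - w (z - w)^n. Hence
for a fixed pair of states the identity follows from its case n = N for one N, together with the
iterate formula below N (`IsFieldMap.borcherds_of_base`). The identity passes to products in the
first state (`Borcherds.mode_left`), and skew-symmetry exchanges the two states (`Borcherds.symm`).
It therefore suffices to treat generators (`borcherds_of_generators`): a Heisenberg state against
anything, and two exponentials.

For a Heisenberg state the iterate formula is built into normal ordering, and the commutator formula
follows by induction on the number of Heisenberg factors (`latticeMode_heisState_commutator`). For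
two exponentials, the difference of the two sides is a family of operators whose commutators with
Heisenberg modes stay in the family. Since the Gram matrix is invertible, positive Heisenberg modes
recover all partial derivatives, and such a family is determined by its constant terms on ground
states (`heis_family_eq_zero`). Those constant terms are binomial coefficients: Vandermonde and
`cbz_locality` match them, and the cocycle condition matches the scalars. Simplicity of `𝒱_λ` uses
the same tools: zero modes separate charges, derivatives lead down to a ground state, exponentials
reach all other charges.

A short screening is, up to a sign on each charge, the zero mode of the intertwining operator e^(zT)
Y(b, -z) w with w a ground state (`expField_eq_intertwiner`, again by uniqueness). The kernel of
such a zero mode is closed under products (`mode_intertwiner_of_mem_ker`), so 𝒲 is a subalgebra. The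
long screening x₀ preserves it for two reasons. If j ≠ i, then x itself lies in the kernel of the
j-th screening. If j = i, the commutator of x₀ with the screening is the zero mode attached to x₀ w,
and for qᵢ ≠ 1 this vector lies in the image of T, so that the zero mode vanishes
(`longScreening_mem_ker_self`).

For the twisted modules, (x, x) = 2 qᵢ > 0 gives x_n x = 0 for n ≥ 0, so the modes of x commute. The
operator Δ then satisfies one differential equation in log z and one Euler equation in z. By
induction on the degree these yield the compatibility of Δ with products, twisted by binom(m - x₀,
j) (`sum_deltaMode_deltaZ`); inserting it into the ordinary Borcherds identity of the module gives
the twisted one (`deltaDeform_borcherds`). Finiteness of Δ is a degree count: r modes of x lower the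
degree by an amount quadratic in r (`modeWord_exp`). The same count gives local nilpotency of x₀ and
the Serre relations.

For the Borel action, zero modes are derivations, exponentials of locally nilpotent derivations are
automorphisms, and the torus acts by characters of the charge lattice. Stability of 𝒲 in both
directions holds on the generators of the group, because their inverses have the same form. -/

noncomputable section
set_option linter.unusedSectionVars false

/-! ### Binomial coefficients and finite sums -/

/-- The binomial coefficient `binom(n, j)` of an integer `n`, as a complex number. -/
def cb (n : ℤ) (j : ℕ) : ℂ := ((Ring.choose n j : ℤ) : ℂ)

@[simp] theorem cb_zero_right (n : ℤ) : cb n 0 = 1 := by simp [cb]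

theorem cb_natCast (N j : ℕ) : cb (N : ℤ) j = (N.choose j : ℂ) := by
  simp [cb, Ring.choose_natCast]

theorem cb_zero_left (j : ℕ) : cb 0 j = if j = 0 then 1 else 0 := by
  cases j with
  | zero => simp
  | succ j => simp [cb, Ring.choose_zero_succ]

theorem cb_pascal (n : ℤ) (j : ℕ) : cb (n + 1) (j + 1) = cb n j + cb n (j + 1) := by
  simp [cb, Ring.choose_succ_succ]

theorem cb_add (m n : ℤ) (r : ℕ) :
    cb (m + n) r = ∑ ij ∈ Finset.HasAntidiagonal.antidiagonal r, cb m ij.1 * cb n ij.2 := by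
  simp [cb, Ring.add_choose_eq r (Commute.all m n)]

theorem cb_mul_choose (n : ℤ) (s j : ℕ) :
    cb n (s + j) * cb ((s + j : ℕ) : ℤ) s = cb n s * cb (n - s) j := by
  have := Ring.choose_smul_choose n (Nat.le_add_right s j)
  rw [Nat.add_sub_cancel_left, nsmul_eq_mul] at this
  rw [cb_natCast, mul_comm]
  simp only [cb]
  exact_mod_cast this

theorem cb_natCast_of_lt {N j : ℕ} (h : N < j) : cb (N : ℤ) j = 0 := by
  rw [cb_natCast, Nat.choose_eq_zero_of_lt h, Nat.cast_zero]

theorem cb_mul_comm (n : ℤ) (j s : ℕ) : cb n j * cb (n - j) s = cb n s * cb (n - s) j := by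
  rw [← cb_mul_choose, ← cb_mul_choose, add_comm s j, cb_natCast, cb_natCast,
    Nat.choose_symm_add]

theorem cb_one_right (n : ℤ) : cb n 1 = n := by simp [cb]

theorem cb_succ_mul (n : ℤ) (j : ℕ) : ((j : ℂ) + 1) * cb n (j + 1) = (n - j) * cb n j := by
  have := cb_mul_choose n j 1
  rw [cb_natCast, cb_one_right, Nat.choose_succ_self_right] at this
  push_cast at this
  linear_combination this

theorem cb_succ_mul' (n : ℤ) (j : ℕ) : ((j : ℂ) + 1) * cb n (j + 1) = n * cb (n - 1) j := by
  have := cb_mul_choose n 1 j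
  rw [cb_natCast, cb_one_right, Nat.choose_one_right, add_comm 1 j] at this
  push_cast at this
  linear_combination this

theorem cb_neg (n : ℤ) (j : ℕ) : cb (-n) j = (-1) ^ j * cb (n + j - 1) j := by
  simp only [cb, Ring.choose_neg]
  rw [Int.negOnePow_def]
  simp [Units.smul_def]

theorem neg_one_zpow_add_natCast (n : ℤ) (j : ℕ) :
    (-1 : ℂ) ^ (n + j) = (-1) ^ n * (-1) ^ j := by
  rw [zpow_add₀ (by norm_num), zpow_natCast]

theorem neg_one_zpow_sub_natCast (n : ℤ) (j : ℕ) :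
    (-1 : ℂ) ^ (n - j) = (-1) ^ n * (-1) ^ j := by
  rw [zpow_sub₀ (by norm_num), zpow_natCast]
  rcases neg_one_pow_eq_or ℂ j with h | h <;> simp [h, div_neg]

theorem neg_one_zpow_succ (n : ℤ) : (-1 : ℂ) ^ (n + 1) = -(-1) ^ n := by
  rw [zpow_add_one₀ (by norm_num)]; ring

theorem neg_one_zpow_mul_self (n : ℤ) : (-1 : ℂ) ^ n * (-1) ^ n = 1 := by
  rw [← mul_zpow]; simp

theorem neg_one_pow_mul_self (n : ℕ) : (-1 : ℂ) ^ n * (-1) ^ n = 1 := by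
  rw [← mul_pow]; simp

section Sums

variable {M : Type*} [AddCommGroup M]

theorem finsum_eq_range {f : ℕ → M} {L : ℕ} (h : ∀ j, L ≤ j → f j = 0) :
    ∑ᶠ j, f j = ∑ j ∈ Finset.range L, f j := by
  apply finsum_eq_sum_of_support_subset
  intro j hj
  simp only [Finset.coe_range, Set.mem_Iio]
  by_contra hc
  exact hj (h j (not_lt.mp hc))

/-- Beyond the triangle t + s < L nothing contributes. Sums are always cut to a common finite range,
and Cauchy products are rearranged in this form. -/
theorem sum_range_antidiagonal {F : ℕ → ℕ → M} {L : ℕ} (h : ∀ t s, L ≤ t + s → F t s = 0) :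
    ∑ r ∈ Finset.range L, ∑ ij ∈ Finset.HasAntidiagonal.antidiagonal r, F ij.1 ij.2 =
      ∑ t ∈ Finset.range L, ∑ s ∈ Finset.range L, F t s := by
  rw [Finset.sum_sigma', ← Finset.sum_product']
  refine Finset.sum_bij_ne_zero (fun x _ _ => x.2) ?_ ?_ ?_ ?_
  · rintro ⟨r, i, j⟩ h1 _
    simp only [Finset.mem_sigma, Finset.mem_range, Finset.HasAntidiagonal.mem_antidiagonal,
      Finset.mem_product] at h1 ⊢
    omega
  · rintro ⟨r, i, j⟩ h1 _ ⟨r', i', j'⟩ h2 _ h3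
    simp only [Finset.mem_sigma, Finset.mem_range, Finset.HasAntidiagonal.mem_antidiagonal] at h1 h2
    simp only [Prod.mk.injEq] at h3
    obtain ⟨rfl, rfl⟩ := h3
    obtain rfl : r = r' := by omega
    rfl
  · rintro ⟨i, j⟩ _ h2
    refine ⟨⟨i + j, i, j⟩, ?_, h2, rfl⟩
    simp only [Finset.mem_sigma, Finset.mem_range, Finset.HasAntidiagonal.mem_antidiagonal, and_true]
    by_contra hc
    exact h2 (h i j (not_lt.mp hc))
  · intros; rfl

theorem sum_range_shift {f : ℕ → M} {L s : ℕ} (h : ∀ J, L ≤ J → f J = 0)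
    (h' : ∀ J, J < s → f J = 0) :
    ∑ J ∈ Finset.range L, f J = ∑ j ∈ Finset.range L, f (s + j) := by
  have h1 : ∑ J ∈ Finset.range L, f J = ∑ J ∈ Finset.range (s + L), f J := by
    apply Finset.sum_subset
    · intro x; simp only [Finset.mem_range]; omega
    · intro x _ hx
      exact h x (not_lt.mp fun hc => hx (Finset.mem_range.mpr hc))
  rw [h1, Finset.sum_range_add, Finset.sum_eq_zero, zero_add]
  intro J hJ
  exact h' J (Finset.mem_range.mp hJ)

variable [Module ℂ M]

/-- This is (1 - z)^p (1 - z)^q = (1 - z)^(p+q) applied to a finitely supported sequence. -/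
theorem sum_range_vandermonde {g : ℕ → M} {L : ℕ} (p q : ℤ) (h : ∀ r, L ≤ r → g r = 0) :
    ∑ i ∈ Finset.range L, ∑ j ∈ Finset.range L,
      ((-1 : ℂ) ^ i * cb p i * ((-1) ^ j * cb q j)) • g (i + j) =
    ∑ r ∈ Finset.range L, ((-1 : ℂ) ^ r * cb (p + q) r) • g r := by
  rw [← sum_range_antidiagonal (F := fun i j =>
    ((-1 : ℂ) ^ i * cb p i * ((-1) ^ j * cb q j)) • g (i + j))]
  · refine Finset.sum_congr rfl fun r _ => ?_
    rw [cb_add, Finset.mul_sum, Finset.sum_smul]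
    refine Finset.sum_congr rfl fun ij hij => ?_
    rw [Finset.HasAntidiagonal.mem_antidiagonal] at hij
    rw [hij, ← hij, pow_add]
    congr 1; ring
  · intro t s hts
    rw [h _ hts, smul_zero]

/-- Vandermonde splits binom(m + J, τ) along τ = t + s. Then binom(n, J) binom(J, s) = binom(n, s)
binom(n - s, J - s), and J = s + j. It serves the terms of `Borcherds.mode_left` in which h acts
last. -/
theorem sum_range_reindex_left {g : ℕ → ℕ → M} {L : ℕ} (m n : ℤ)
    (h : ∀ J τ, L ≤ J ∨ L ≤ τ → g J τ = 0) :
    ∑ J ∈ Finset.range L, ∑ τ ∈ Finset.range L, ((-1 : ℂ) ^ J * cb n J * cb (m + J) τ) • g J τ =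
    ∑ t ∈ Finset.range L, ∑ s ∈ Finset.range L, ∑ j ∈ Finset.range L,
      (cb m t * ((-1) ^ s * cb n s) * ((-1) ^ j * cb (n - s) j)) • g (s + j) (t + s) := by
  have h1 : ∀ J, ∑ τ ∈ Finset.range L, ((-1 : ℂ) ^ J * cb n J * cb (m + J) τ) • g J τ =
      ∑ t ∈ Finset.range L, ∑ s ∈ Finset.range L,
        ((-1 : ℂ) ^ J * cb n J * (cb m t * cb J s)) • g J (t + s) := by
    intro J
    rw [← sum_range_antidiagonal (F := fun t s =>
      ((-1 : ℂ) ^ J * cb n J * (cb m t * cb J s)) • g J (t + s))]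
    · refine Finset.sum_congr rfl fun r _ => ?_
      rw [cb_add, Finset.mul_sum, Finset.sum_smul]
      refine Finset.sum_congr rfl fun ij hij => ?_
      rw [Finset.HasAntidiagonal.mem_antidiagonal] at hij
      rw [hij]
    · intro t s hts
      rw [h _ _ (Or.inr hts), smul_zero]
  rw [Finset.sum_congr rfl fun J _ => h1 J, Finset.sum_comm]
  refine Finset.sum_congr rfl fun t _ => ?_
  rw [Finset.sum_comm]
  refine Finset.sum_congr rfl fun s _ => ?_
  rw [sum_range_shift (s := s)]
  · refine Finset.sum_congr rfl fun j _ => ?_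
    congr 1
    have := cb_mul_choose n s j
    rw [pow_add]
    linear_combination (-1) ^ s * (-1) ^ j * cb m t * this
  · intro J hJ
    rw [h _ _ (Or.inl hJ), smul_zero]
  · intro J hJ
    rw [cb_natCast_of_lt hJ]; simp

/-- The companion for the terms in which h acts first: binom(n, j) binom(n - j, s) is symmetric in j
and s, so no shift of j is needed. -/
theorem sum_range_reindex_right {g : ℕ → ℕ → M} {L : ℕ} (m n : ℤ)
    (h : ∀ J τ, L ≤ τ → g J τ = 0) :
    ∑ j ∈ Finset.range L, ∑ τ ∈ Finset.range L,
      ((-1 : ℂ) ^ j * cb n j * cb (m + (n - j)) τ) • g j τ =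
    ∑ t ∈ Finset.range L, ∑ s ∈ Finset.range L, ∑ j ∈ Finset.range L,
      (cb m t * cb n s * ((-1) ^ j * cb (n - s) j)) • g j (t + s) := by
  have h1 : ∀ j : ℕ, ∑ τ ∈ Finset.range L, ((-1 : ℂ) ^ j * cb n j * cb (m + (n - j)) τ) • g j τ =
      ∑ t ∈ Finset.range L, ∑ s ∈ Finset.range L,
        ((-1 : ℂ) ^ j * cb n j * (cb m t * cb (n - j) s)) • g j (t + s) := by
    intro j
    rw [← sum_range_antidiagonal (F := fun t s =>
      ((-1 : ℂ) ^ j * cb n j * (cb m t * cb (n - j) s)) • g j (t + s))]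
    · refine Finset.sum_congr rfl fun r _ => ?_
      rw [cb_add, Finset.mul_sum, Finset.sum_smul]
      refine Finset.sum_congr rfl fun ij hij => ?_
      rw [Finset.HasAntidiagonal.mem_antidiagonal] at hij
      rw [hij]
    · intro t s hts
      rw [h _ _ hts, smul_zero]
  rw [Finset.sum_congr rfl fun J _ => h1 J, Finset.sum_comm]
  refine Finset.sum_congr rfl fun t _ => ?_
  rw [Finset.sum_comm]
  refine Finset.sum_congr rfl fun s _ => Finset.sum_congr rfl fun j _ => ?_
  congr 1
  linear_combination (-1) ^ j * cb m t * cb_mul_comm n j s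

theorem sum_range_choose_shift {f : ℕ → M} {L : ℕ} (n : ℤ) (s : ℕ) (h : ∀ J, L ≤ J → f J = 0) :
    ∑ j ∈ Finset.range L, ((-1 : ℂ) ^ j * cb n j * cb j s) • f j =
    ∑ j ∈ Finset.range L, ((-1 : ℂ) ^ s * cb n s * ((-1) ^ j * cb (n - s) j)) • f (s + j) := by
  rw [sum_range_shift (s := s)]
  · refine Finset.sum_congr rfl fun j _ => ?_
    congr 1
    rw [pow_add]
    linear_combination (-1) ^ s * (-1) ^ j * cb_mul_choose n s j
  · intro J hJ; rw [h J hJ, smul_zero]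
  · intro J hJ; rw [cb_natCast_of_lt hJ]; simp

end Sums

/-- Only finitely many rows are nonzero, so the maximum of their individual bounds is uniform.
Truncation bounds of fields depend on the vector already acted on, and this makes them uniform. -/
theorem eventually_box {M : Type*} [Zero M] {f : ℕ → ℕ → M}
    (h1 : ∃ I, ∀ i, I ≤ i → ∀ j, f i j = 0) (h2 : ∀ i, ∃ J, ∀ j, J ≤ j → f i j = 0) :
    ∀ᶠ L in Filter.atTop, ∀ i j : ℕ, L ≤ i ∨ L ≤ j → f i j = 0 := by
  obtain ⟨I, hI⟩ := h1
  choose J hJ using h2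
  refine Filter.eventually_atTop.mpr ⟨max I ((Finset.range I).sup J), fun L hL i j hij => ?_⟩
  by_cases hi : I ≤ i
  · exact hI i hi j
  · rcases hij with h | h
    · exact hI i (by omega) j
    · refine hJ i j (le_trans ?_ (le_trans (le_trans (le_max_right _ _) hL) h))
      exact Finset.le_sup (f := J) (Finset.mem_range.mpr (by omega))

/-! ### Fields and the Borcherds identity -/

section Fields

variable {V M : Type*} [AddCommGroup V] [Module ℂ V] [AddCommGroup M] [Module ℂ M]

/-- `YM` is a bilinear family of modes with the truncation property. -/
structure IsFieldMap (YM : V → ℤ → M → M) : Prop where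
  add_left : ∀ a b n v, YM (a + b) n v = YM a n v + YM b n v
  smul_left : ∀ (t : ℂ) a n v, YM (t • a) n v = t • YM a n v
  add_right : ∀ a n v w, YM a n (v + w) = YM a n v + YM a n w
  smul_right : ∀ (t : ℂ) a n v, YM a n (t • v) = t • YM a n v
  truncation : ∀ a v, ∃ N : ℤ, ∀ n, N ≤ n → YM a n v = 0

namespace IsFieldMap

variable {YM : V → ℤ → M → M} (h : IsFieldMap YM)
include h

/-- The modes as a bilinear map. -/
def lin (n : ℤ) : V →ₗ[ℂ] M →ₗ[ℂ] M :=
  LinearMap.mk₂ ℂ (fun a v => YM a n v) (fun a b v => h.add_left a b n v)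
    (fun t a v => h.smul_left t a n v) (fun a v w => h.add_right a n v w)
    (fun t a v => h.smul_right t a n v)

theorem lin_apply (n : ℤ) (a : V) (v : M) : h.lin n a v = YM a n v := rfl

theorem zero_left (n : ℤ) (v : M) : YM 0 n v = 0 := by
  rw [← h.lin_apply, map_zero, LinearMap.zero_apply]

theorem zero_right (a : V) (n : ℤ) : YM a n 0 = 0 := by rw [← h.lin_apply, map_zero]

theorem sub_left (a b : V) (n : ℤ) (v : M) : YM (a - b) n v = YM a n v - YM b n v := by
  rw [← h.lin_apply, map_sub, LinearMap.sub_apply, h.lin_apply, h.lin_apply]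

theorem sub_right (a : V) (n : ℤ) (v w : M) : YM a n (v - w) = YM a n v - YM a n w := by
  rw [← h.lin_apply, map_sub, h.lin_apply, h.lin_apply]

theorem sum_left {ι : Type*} (s : Finset ι) (f : ι → V) (n : ℤ) (v : M) :
    YM (∑ i ∈ s, f i) n v = ∑ i ∈ s, YM (f i) n v := by
  rw [← h.lin_apply, map_sum, LinearMap.sum_apply]; rfl

theorem sum_right {ι : Type*} (a : V) (s : Finset ι) (f : ι → M) (n : ℤ) :
    YM a n (∑ i ∈ s, f i) = ∑ i ∈ s, YM a n (f i) := by
  rw [← h.lin_apply, map_sum]; rfl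

theorem eventually_zero (a : V) (v : M) (n : ℤ) : ∃ J : ℕ, ∀ j : ℕ, J ≤ j → YM a (n + j) v = 0 := by
  obtain ⟨N, hN⟩ := h.truncation a v
  exact ⟨(N - n).toNat, fun j hj => hN _ (by omega)⟩

end IsFieldMap

theorem IsVertexModule.isFieldMap {vac : V} {Y : V → ℤ → V → V} {YM : V → ℤ → M → M}
    (h : IsVertexModule vac Y YM) : IsFieldMap YM :=
  ⟨h.add_left, h.smul_left, h.add_right, h.smul_right, h.truncation⟩

/-- The left-hand side of the Borcherds identity for two sequences of modes. -/
def jacobiLHS (A B : ℤ → M → M) (n m k : ℤ) (v : M) : M :=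
  ∑ᶠ j : ℕ, ((-1 : ℂ) ^ j * (Ring.choose n j : ℤ)) •
    (A (m + n - j) (B (k + j) v) - ((-1 : ℂ) ^ n) • B (k + n - j) (A (m + j) v))

/-- The right-hand side of the Borcherds identity. -/
def jacobiRHS (Y : V → ℤ → V → V) (YM : V → ℤ → M → M) (a b : V) (n m k : ℤ) (v : M) : M :=
  ∑ᶠ j : ℕ, ((Ring.choose m j : ℤ) : ℂ) • YM (Y a (n + j) b) (m + k - j) v

/-- The Borcherds identity holds on `M` for the pair of states `a`, `b`. -/
def Borcherds (Y : V → ℤ → V → V) (YM : V → ℤ → M → M) (a b : V) : Prop :=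
  ∀ (v : M) (m k n : ℤ), jacobiLHS (YM a) (YM b) n m k v = jacobiRHS Y YM a b n m k v

variable {Y : V → ℤ → V → V} {YM : V → ℤ → M → M}

theorem jacobiLHS_eq_range {A B : ℤ → M → M} {n m k : ℤ} {v : M} {L : ℕ}
    (h1 : ∀ j : ℕ, L ≤ j → A (m + n - j) (B (k + j) v) = 0)
    (h2 : ∀ j : ℕ, L ≤ j → B (k + n - j) (A (m + j) v) = 0) :
    jacobiLHS A B n m k v = ∑ j ∈ Finset.range L, ((-1 : ℂ) ^ j * cb n j) •
      (A (m + n - j) (B (k + j) v) - ((-1 : ℂ) ^ n) • B (k + n - j) (A (m + j) v)) :=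
  finsum_eq_range fun j hj => by simp [h1 j hj, h2 j hj]

theorem IsFieldMap.jacobiLHS_range (hM : IsFieldMap YM) (a b : V) (n m k : ℤ) (v : M) :
    ∃ L₀ : ℕ, ∀ L, L₀ ≤ L → jacobiLHS (YM a) (YM b) n m k v =
      ∑ j ∈ Finset.range L, ((-1 : ℂ) ^ j * cb n j) •
      (YM a (m + n - j) (YM b (k + j) v) - ((-1 : ℂ) ^ n) • YM b (k + n - j) (YM a (m + j) v)) := by
  obtain ⟨J, hJ⟩ := hM.eventually_zero b v k
  obtain ⟨J', hJ'⟩ := hM.eventually_zero a v m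
  refine ⟨max J J', fun L hL => jacobiLHS_eq_range (fun j hj => ?_) fun j hj => ?_⟩
  · rw [hJ j (by omega), hM.zero_right]
  · rw [hJ' j (by omega), hM.zero_right]

theorem jacobiRHS_eq_range {a b : V} {n m k : ℤ} {v : M} {L : ℕ}
    (h : ∀ j : ℕ, L ≤ j → YM (Y a (n + j) b) (m + k - j) v = 0) :
    jacobiRHS Y YM a b n m k v =
      ∑ j ∈ Finset.range L, cb m j • YM (Y a (n + j) b) (m + k - j) v :=
  finsum_eq_range fun j hj => by simp [h j hj]

theorem IsFieldMap.jacobiRHS_range (hY : IsFieldMap Y) (hM : IsFieldMap YM) (a b : V) (n : ℤ) :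
    ∃ L₀ : ℕ, ∀ L, L₀ ≤ L → ∀ m k v, jacobiRHS Y YM a b n m k v =
      ∑ j ∈ Finset.range L, cb m j • YM (Y a (n + j) b) (m + k - j) v := by
  obtain ⟨J, hJ⟩ := hY.eventually_zero a b n
  refine ⟨J, fun L hL m k v => jacobiRHS_eq_range fun j hj => ?_⟩
  rw [hJ j (by omega), hM.zero_left]

theorem jacobiRHS_zero (a b : V) (n k : ℤ) (v : M) :
    jacobiRHS Y YM a b n 0 k v = YM (Y a n b) k v := by
  rw [jacobiRHS, finsum_eq_single _ 0]
  · simp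
  · intro j hj
    obtain ⟨j, rfl⟩ := Nat.exists_eq_succ_of_ne_zero hj
    simp [Ring.choose_zero_succ]

theorem jacobiLHS_zero (A B : ℤ → M → M) (m k : ℤ) (v : M) :
    jacobiLHS A B 0 m k v = A m (B k v) - B k (A m v) := by
  rw [jacobiLHS, finsum_eq_single _ 0]
  · simp
  · intro j hj
    obtain ⟨j, rfl⟩ := Nat.exists_eq_succ_of_ne_zero hj
    simp [Ring.choose_zero_succ]

/-- Multiplication of (z - w)^n by z - w, in coefficients. The right-hand side obeys the same rule,
which is what `IsFieldMap.borcherds_of_base` exploits. -/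
theorem IsFieldMap.jacobiLHS_succ (hM : IsFieldMap YM) (a b : V) (n m k : ℤ) (v : M) :
    jacobiLHS (YM a) (YM b) (n + 1) m k v =
      jacobiLHS (YM a) (YM b) n (m + 1) k v - jacobiLHS (YM a) (YM b) n m (k + 1) v := by
  obtain ⟨L1, h1⟩ := hM.jacobiLHS_range a b (n + 1) m k v
  obtain ⟨L2, h2⟩ := hM.jacobiLHS_range a b n (m + 1) k v
  obtain ⟨L3, h3⟩ := hM.jacobiLHS_range a b n m (k + 1) v
  obtain ⟨J, hJ⟩ := hM.eventually_zero b v (k + 1)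
  obtain ⟨J', hJ'⟩ := hM.eventually_zero a v (m + 1)
  set L := L1 + L2 + L3 + J + J'
  rw [h1 (L + 1) (by omega), h2 (L + 1) (by omega), h3 (L + 1) (by omega)]
  -- Pascal's rule as a summation by parts; g L = 0 removes the boundary term.
  have key : ∀ (f g : ℕ → M), g L = 0 → (∀ j, f (j + 1) = g j) →
      ∑ j ∈ Finset.range (L + 1), ((-1 : ℂ) ^ j * cb (n + 1) j) • f j =
      ∑ j ∈ Finset.range (L + 1), ((-1 : ℂ) ^ j * cb n j) • f j -
      ∑ j ∈ Finset.range (L + 1), ((-1 : ℂ) ^ j * cb n j) • g j := by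
    intro f g hg hfg
    rw [Finset.sum_range_succ' _ L, Finset.sum_range_succ' (fun j => ((-1 : ℂ) ^ j * cb n j) • f j) L,
      Finset.sum_range_succ (fun j => ((-1 : ℂ) ^ j * cb n j) • g j) L, hg, smul_zero, add_zero,
      add_sub_right_comm, ← Finset.sum_sub_distrib]
    congr 1
    · refine Finset.sum_congr rfl fun j _ => ?_
      rw [hfg, cb_pascal, ← sub_smul]
      congr 1; ring
    · simp
  simp only [smul_sub, Finset.sum_sub_distrib]
  rw [key _ (fun j => YM a (m + n - j) (YM b (k + 1 + j) v))]
  · have e2 := key (fun j => YM b (k + 1 + n - j) (YM a (m + j) v))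
      (fun j => YM b (k + n - j) (YM a (m + 1 + j) v)) (by rw [hJ' _ (by omega), hM.zero_right])
      (by intro j; push_cast; ring_nf)
    simp only [smul_comm _ ((-1 : ℂ) ^ n), smul_comm _ ((-1 : ℂ) ^ (n + 1)), ← Finset.smul_sum]
    rw [show k + (n + 1) = k + 1 + n by ring, e2, neg_one_zpow_succ,
      show m + (n + 1) = m + 1 + n by ring]
    simp only [neg_smul, smul_sub]
    abel
  · rw [hJ _ (by omega), hM.zero_right]
  · intro j; push_cast; ring_nf

theorem IsFieldMap.jacobiRHS_succ (hY : IsFieldMap Y) (hM : IsFieldMap YM) (a b : V) (n m k : ℤ)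
    (v : M) : jacobiRHS Y YM a b (n + 1) m k v =
      jacobiRHS Y YM a b n (m + 1) k v - jacobiRHS Y YM a b n m (k + 1) v := by
  obtain ⟨L1, h1⟩ := IsFieldMap.jacobiRHS_range hY hM a b (n + 1)
  obtain ⟨L2, h2⟩ := IsFieldMap.jacobiRHS_range hY hM a b n
  set L := L1 + L2
  rw [h1 L (by omega), h2 (L + 1) (by omega), h2 (L + 1) (by omega), ← Finset.sum_sub_distrib,
    Finset.sum_range_succ']
  have e : m + 1 + k = m + (k + 1) := by ring
  simp only [cb_zero_right, one_smul, Nat.cast_zero, e, sub_self, add_zero]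
  refine Finset.sum_congr rfl fun j _ => ?_
  rw [← sub_smul, cb_pascal, add_sub_cancel_right]
  congr 2 <;> push_cast <;> ring_nf

/-- The Borcherds identity follows from locality and the iterate formula. -/
theorem IsFieldMap.borcherds_of_base (hY : IsFieldMap Y) (hM : IsFieldMap YM) {a b : V} (N : ℤ)
    (h1 : ∀ m k v, jacobiLHS (YM a) (YM b) N m k v = jacobiRHS Y YM a b N m k v)
    (h2 : ∀ n, n < N → ∀ k v, jacobiLHS (YM a) (YM b) n 0 k v = YM (Y a n b) k v) :
    Borcherds Y YM a b := by
  let E : ℤ → ℤ → ℤ → M → M := fun n m k v =>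
    jacobiLHS (YM a) (YM b) n m k v - jacobiRHS Y YM a b n m k v
  have hE : ∀ n m k v, E (n + 1) m k v = E n (m + 1) k v - E n m (k + 1) v := by
    intro n m k v
    simp only [E, hM.jacobiLHS_succ, IsFieldMap.jacobiRHS_succ hY hM]
    abel
  have up : ∀ r : ℕ, ∀ m k v, E (N + r) m k v = 0 := by
    intro r
    induction r with
    | zero => intro m k v; simp [E, h1]
    | succ r ih => intro m k v; push_cast; rw [← add_assoc, hE, ih, ih, sub_zero]
  have down : ∀ r : ℕ, ∀ m k v, E (N - r) m k v = 0 := by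
    intro r
    induction r with
    | zero => intro m k v; simp [E, h1]
    | succ r ih =>
      -- Vanishing one level above says that here the defect depends only on m + k, so its vanishing
      -- at m = 0, the iterate formula, spreads to all m in both directions.
      have hs : ∀ m k v, E (N - (r + 1 : ℕ)) (m + 1) k v = E (N - (r + 1 : ℕ)) m (k + 1) v := by
        intro m k v
        have := ih m k v
        rw [show N - (r : ℤ) = N - (r + 1 : ℕ) + 1 by push_cast; ring, hE] at this
        exact sub_eq_zero.mp this
      have h0 : ∀ k v, E (N - (r + 1 : ℕ)) 0 k v = 0 := by
        intro k v
        simp only [E, jacobiRHS_zero]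
        rw [h2 _ (by push_cast; omega), sub_self]
      intro m
      induction m using Int.induction_on with
      | zero => exact h0
      | succ m ihm => intro k v; rw [hs, ihm]
      | pred m ihm =>
        intro k v
        have := hs (-m - 1) (k - 1) v
        rw [sub_add_cancel, sub_add_cancel, ihm] at this
        exact this.symm
  intro v m k n
  rw [← sub_eq_zero]
  rcases le_total N n with h | h
  · have := up (n - N).toNat m k v
    rwa [show N + ((n - N).toNat : ℤ) = n by omega] at this
  · have := down (N - n).toNat m k v
    rwa [show N - ((N - n).toNat : ℤ) = n by omega] at this

theorem Borcherds.commutator {a b : V} (h : Borcherds Y YM a b) (m k : ℤ) (v : M) :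
    YM a m (YM b k v) - YM b k (YM a m v) = jacobiRHS Y YM a b 0 m k v := by
  rw [← jacobiLHS_zero, h]

theorem Borcherds.iterate {a b : V} (h : Borcherds Y YM a b) (n k : ℤ) (v : M) :
    YM (Y a n b) k v = jacobiLHS (YM a) (YM b) n 0 k v := by
  rw [h, jacobiRHS_zero]

end Fields

/-! ### Closure of the Borcherds identity under products. -/

section Closure

variable {V M : Type*} [AddCommGroup V] [Module ℂ V] [AddCommGroup M] [Module ℂ M]
variable {Y : V → ℤ → V → V} {YM : V → ℤ → M → M}

theorem eventually_box_swap {M : Type*} [Zero M] {f : ℕ → ℕ → M}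
    (h1 : ∃ J, ∀ j, J ≤ j → ∀ i, f i j = 0) (h2 : ∀ j, ∃ I, ∀ i, I ≤ i → f i j = 0) :
    ∀ᶠ L in Filter.atTop, ∀ i j : ℕ, L ≤ i ∨ L ≤ j → f i j = 0 := by
  filter_upwards [eventually_box (f := fun j i => f i j) h1 h2] with L hL i j hij
  exact hL j i hij.symm

theorem eventually_triangle {M : Type*} [Zero M] {f : ℕ → ℕ → M}
    (h : ∀ᶠ L in Filter.atTop, ∀ i j : ℕ, L ≤ i ∨ L ≤ j → f i j = 0) :
    ∀ᶠ L in Filter.atTop, ∀ i j : ℕ, L ≤ i + j → f i j = 0 := by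
  obtain ⟨L, hL⟩ := h.exists
  refine Filter.eventually_atTop.mpr ⟨2 * L, fun L' hL' i j hij => hL i j (by omega)⟩

set_option maxHeartbeats 1000000 in
/-- The set of states satisfying the Borcherds identity is closed under products. -/
theorem Borcherds.mode_left (hY : IsFieldMap Y) (hM : IsFieldMap YM) {h a b : V} (n : ℤ)
    (hha : Borcherds Y YM h a) (hab : Borcherds Y YM a b) (hhb : Borcherds Y YM h b)
    (hhc : ∀ k, Borcherds Y YM h (Y a k b)) (hac : ∀ s : ℕ, Borcherds Y YM a (Y h s b))
    (hV : Borcherds Y Y h a) : Borcherds Y YM (Y h n a) b := by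
  intro v m l k
  -- All bounds are recorded as eventual statements, so that a single L truncates every sum that
  -- occurs.
  have ev : ∀ {p : ℕ → Prop}, (∃ J, ∀ j, J ≤ j → p j) →
      ∀ᶠ L in Filter.atTop, ∀ j, L ≤ j → p j := fun ⟨J, hJ⟩ =>
    Filter.eventually_atTop.mpr ⟨J, fun L hL j hj => hJ j (hL.trans hj)⟩
  have eH : ∀ w, ∃ J : ℕ, ∀ j : ℕ, J ≤ j → YM h j w = 0 := fun w => by
    simpa using hM.eventually_zero h w 0
  have eh : ∃ J : ℕ, ∀ j : ℕ, J ≤ j → Y h j b = 0 := by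
    simpa using hY.eventually_zero h b 0
  have b0 := ev (hM.eventually_zero b v l)
  have b0' := ev (hM.eventually_zero a v m)
  have b0'' := ev (eH v)
  have b00 := ev (hY.eventually_zero a b k)
  have b01 := ev eh
  have b02 := ev (hY.eventually_zero (Y h n a) b k)
  have b1 : ∀ᶠ L in Filter.atTop, ∀ i j : ℕ, L ≤ i ∨ L ≤ j →
      YM a (m + k - i + j) (YM b (l + i) v) = 0 := by
    apply eventually_box
    · obtain ⟨J, hJ⟩ := hM.eventually_zero b v l
      exact ⟨J, fun i hi j => by rw [hJ i hi, hM.zero_right]⟩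
    · exact fun i => hM.eventually_zero a _ _
  have b2 : ∀ᶠ L in Filter.atTop, ∀ i j : ℕ, L ≤ i ∨ L ≤ j → YM h j (YM b (l + i) v) = 0 := by
    apply eventually_box
    · obtain ⟨J, hJ⟩ := hM.eventually_zero b v l
      exact ⟨J, fun i hi j => by rw [hJ i hi, hM.zero_right]⟩
    · exact fun i => eH _
  have b4 : ∀ᶠ L in Filter.atTop, ∀ i j : ℕ, L ≤ i ∨ L ≤ j →
      YM a (m + (n - j) + i) (YM h j v) = 0 := by
    apply eventually_box_swap
    · obtain ⟨J, hJ⟩ := eH v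
      exact ⟨J, fun j hj i => by rw [hJ j hj, hM.zero_right]⟩
    · exact fun j => hM.eventually_zero a _ _
  have b5 : ∀ᶠ L in Filter.atTop, ∀ i j : ℕ, L ≤ i ∨ L ≤ j → YM b (l + i) (YM h j v) = 0 := by
    apply eventually_box_swap
    · obtain ⟨J, hJ⟩ := eH v
      exact ⟨J, fun j hj i => by rw [hJ j hj, hM.zero_right]⟩
    · exact fun j => hM.eventually_zero b _ _
  have bP : ∀ᶠ L in Filter.atTop, ∀ J τ : ℕ, L ≤ J ∨ L ≤ τ →
      YM (Y a (k + τ) b) (m + l - τ + J) v = 0 := by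
    apply eventually_box_swap
    · obtain ⟨J, hJ⟩ := hY.eventually_zero a b k
      exact ⟨J, fun j hj i => by rw [hJ j hj, hM.zero_left]⟩
    · exact fun j => hM.eventually_zero _ _ _
  have bG : ∀ᶠ L in Filter.atTop, ∀ s r : ℕ, L ≤ s + r → YM (Y h s b) (l + r) v = 0 := by
    apply eventually_triangle
    apply eventually_box
    · obtain ⟨J, hJ⟩ := eh
      exact ⟨J, fun i hi j => by rw [hJ i hi, hM.zero_left]⟩
    · exact fun i => hM.eventually_zero _ _ _
  have b7 : ∀ᶠ L in Filter.atTop, ∀ s t : ℕ, L ≤ s ∨ L ≤ t →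
      Y a (n - s + k + t) (Y h s b) = 0 := by
    apply eventually_box
    · obtain ⟨J, hJ⟩ := eh
      exact ⟨J, fun i hi j => by rw [hJ i hi, hY.zero_right]⟩
    · exact fun i => hY.eventually_zero _ _ _
  obtain ⟨L, b0, b0', b0'', b00, b01, b02, b1, b2, b4, b5, bP, bG, b7⟩ := (b0.and <| b0'.and <|
    b0''.and <| b00.and <| b01.and <| b02.and <| b1.and <| b2.and <| b4.and <| b5.and <|
    bP.and <| bG.and b7).exists
  -- the modes of the product
  have hU : ∀ K w, (∀ j : ℕ, L ≤ j → YM a (K + j) w = 0) → (∀ j : ℕ, L ≤ j → YM h j w = 0) →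
      YM (Y h n a) K w = ∑ j ∈ Finset.range L, ((-1 : ℂ) ^ j * cb n j) •
        (YM h (n - j) (YM a (K + j) w) - (-1 : ℂ) ^ n • YM a (K + n - j) (YM h j w)) := by
    intro K w h1 h2
    rw [hha.iterate, jacobiLHS_eq_range (L := L)]
    · simp only [zero_add]
    · intro j hj; rw [h1 j hj, hM.zero_right]
    · intro j hj; rw [zero_add, h2 j hj, hM.zero_right]
  -- Expanding the modes of the product gives the words hab, ahb, bha, bah. Inserting the words X1 =
  -- hba and X2 = abh leaves h[a,b] and [a,b]h, governed by the identity for (a, b), and a[h,b] and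
  -- [h,b]a, governed by the commutator formula for (h, b).
  let t1 : ℕ → ℕ → M := fun i j => YM h (n - j) (YM a (m + k - i + j) (YM b (l + i) v))
  let t2 : ℕ → ℕ → M := fun i j => YM a (m + k - i + n - j) (YM h j (YM b (l + i) v))
  let t3 : ℕ → ℕ → M := fun i j => YM b (l + k - i) (YM h (n - j) (YM a (m + i + j) v))
  let t4 : ℕ → ℕ → M := fun i j => YM b (l + k - i) (YM a (m + i + n - j) (YM h j v))
  let X1 : ℕ → ℕ → M := fun i j => YM h (n - j) (YM b (l + k - i) (YM a (m + i + j) v))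
  let X2 : ℕ → ℕ → M := fun i j => YM a (m + k - i + n - j) (YM b (l + i) (YM h j v))
  let c : ℕ → ℕ → ℂ := fun i j => (-1 : ℂ) ^ i * cb k i * ((-1) ^ j * cb n j)
  let gP : ℕ → ℕ → M := fun J τ => YM h (n - J) (YM (Y a (k + τ) b) (m + l - τ + J) v)
  let gQ : ℕ → ℕ → M := fun j τ => YM (Y a (k + τ) b) (m + (n - j) + l - τ) (YM h j v)
  let G : ℕ → ℕ → M := fun s r => YM a (n - s + m + k - r) (YM (Y h s b) (l + r) v)
  let G' : ℕ → ℕ → M := fun s r => YM (Y h s b) (l + (n - s + k) - r) (YM a (m + r) v)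
  have lhs : jacobiLHS (YM (Y h n a)) (YM b) k m l v =
      ∑ i ∈ Finset.range L, ∑ j ∈ Finset.range L, c i j •
        (t1 i j - (-1 : ℂ) ^ n • t2 i j - (-1 : ℂ) ^ k • t3 i j +
          ((-1 : ℂ) ^ n * (-1 : ℂ) ^ k) • t4 i j) := by
    rw [jacobiLHS_eq_range (L := L)]
    · refine Finset.sum_congr rfl fun i _ => ?_
      rw [hU _ _ (fun j hj => b1 i j (Or.inr hj)) (fun j hj => b2 i j (Or.inr hj)),
        hU _ _ (fun j hj => by rw [add_assoc]; exact_mod_cast b0' (i + j) (by omega)) b0'',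
        hM.sum_right, Finset.smul_sum, ← Finset.sum_sub_distrib, Finset.smul_sum]
      refine Finset.sum_congr rfl fun j _ => ?_
      simp only [hM.smul_right, hM.sub_right, t1, t2, t3, t4, c]
      module
    · intro i hi; rw [b0 i hi, hM.zero_right]
    · intro i hi
      rw [hU _ _ (fun j hj => by rw [add_assoc]; exact_mod_cast b0' (i + j) (by omega)) b0'']
      rw [Finset.sum_eq_zero, hM.zero_right]
      intro j _
      have e1 : YM a (m + i + j) v = 0 := by
        rw [add_assoc]; exact_mod_cast b0' (i + j) (by omega)
      have e2 : YM a (m + i + n - j) (YM h j v) = 0 := by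
        rw [show m + i + n - j = m + (n - j) + i by ring]; exact b4 i j (Or.inl hi)
      rw [e1, e2]; simp [hM.zero_right]
  have hPA : ∑ i ∈ Finset.range L, ∑ j ∈ Finset.range L, c i j • (t1 i j - (-1 : ℂ) ^ k • X1 i j) =
      ∑ t ∈ Finset.range L, ∑ s ∈ Finset.range L, ∑ j ∈ Finset.range L,
      (cb m t * ((-1) ^ s * cb n s) * ((-1) ^ j * cb (n - s) j)) • gP (s + j) (t + s) := by
    rw [← sum_range_reindex_left (g := gP), Finset.sum_comm]
    · refine Finset.sum_congr rfl fun j _ => ?_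
      have := hab v (m + j) l k
      rw [jacobiLHS_eq_range (L := L), jacobiRHS_eq_range (L := L)] at this
      · have e := congrArg (fun w => ((-1 : ℂ) ^ j * cb n j) • YM h (n - j) w) this
        simp only [hM.sum_right, hM.smul_right, hM.sub_right, Finset.smul_sum, smul_smul] at e
        simp only [gP, t1, X1, c]
        convert e using 2 with i _ i _
        · rw [mul_comm, show m + k - i + (j : ℤ) = m + j + k - i by ring,
            show m + i + (j : ℤ) = m + j + i by ring]
        · rw [show m + l - i + (j : ℤ) = m + j + l - i by ring]
      · intro t ht; rw [b00 t ht, hM.zero_left]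
      · intro i hi; rw [b0 i hi, hM.zero_right]
      · intro i hi
        rw [show m + j + i = m + (i + j : ℕ) by push_cast; ring, b0' _ (by omega), hM.zero_right]
    · intro J τ hJ
      simp only [gP]
      rw [bP J τ hJ, hM.zero_right]
  have hPQ : ∑ i ∈ Finset.range L, ∑ j ∈ Finset.range L, c i j • (X2 i j - (-1 : ℂ) ^ k • t4 i j) =
      ∑ t ∈ Finset.range L, ∑ s ∈ Finset.range L, ∑ j ∈ Finset.range L,
      (cb m t * cb n s * ((-1) ^ j * cb (n - s) j)) • gQ j (t + s) := by
    rw [← sum_range_reindex_right (g := gQ), Finset.sum_comm]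
    · refine Finset.sum_congr rfl fun j _ => ?_
      have := hab (YM h j v) (m + (n - j)) l k
      rw [jacobiLHS_eq_range (L := L), jacobiRHS_eq_range (L := L)] at this
      · have e := congrArg (fun w => ((-1 : ℂ) ^ j * cb n j) • w) this
        simp only [Finset.smul_sum, smul_smul] at e
        simp only [gQ, X2, t4, c]
        convert e using 2 with i _ i _
        rw [mul_comm, show m + k - i + n - (j : ℤ) = m + (n - j) + k - i by ring,
          show m + i + n - (j : ℤ) = m + (n - j) + i by ring]
      · intro t ht; rw [b00 t ht, hM.zero_left]
      · intro i hi; rw [b5 i j (Or.inl hi), hM.zero_right]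
      · intro i hi; rw [b4 i j (Or.inl hi), hM.zero_right]
    · intro J τ hJ
      simp only [gQ]
      rw [b00 τ hJ, hM.zero_left]
  have hR1 : ∑ i ∈ Finset.range L, ∑ j ∈ Finset.range L, c i j • (t2 i j - X2 i j) =
      ∑ s ∈ Finset.range L, ((-1 : ℂ) ^ s * cb n s) •
        ∑ r ∈ Finset.range L, ((-1 : ℂ) ^ r * cb (n - s + k) r) • G s r := by
    have e1 : ∀ i j : ℕ, t2 i j - X2 i j = ∑ s ∈ Finset.range L, cb j s •
        YM a (m + k - i + n - j) (YM (Y h s b) (j + (l + i) - s) v) := by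
      intro i j
      simp only [t2, X2]
      rw [← hM.sub_right, hhb.commutator, jacobiRHS_eq_range (L := L), hM.sum_right]
      · simp only [hM.smul_right, zero_add]
      · intro s hs; rw [zero_add, b01 s hs, hM.zero_left]
    simp only [e1, Finset.smul_sum]
    rw [Finset.sum_congr rfl fun i _ => Finset.sum_comm, Finset.sum_comm]
    refine Finset.sum_congr rfl fun s _ => ?_
    have e2 : ∀ i : ℕ, ∑ j ∈ Finset.range L, c i j • cb j s •
        YM a (m + k - i + n - j) (YM (Y h s b) (j + (l + i) - s) v) =
        ∑ j ∈ Finset.range L, ((-1 : ℂ) ^ s * cb n s) • (((-1 : ℂ) ^ i * cb k i *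
          ((-1) ^ j * cb (n - s) j)) • G s (i + j)) := by
      intro i
      have := sum_range_choose_shift (L := L) n s (f := fun j =>
        YM a (m + k - i + n - j) (YM (Y h s b) (j + (l + i) - s) v)) (by
          intro J hJ
          by_cases hsJ : s ≤ J
          · have := bG s (i + (J - s)) (by omega)
            rw [show (J : ℤ) + (l + i) - s = l + (i + (J - s) : ℕ) by push_cast [hsJ]; ring, this,
              hM.zero_right]
          · rw [b01 s (by omega), hM.zero_left, hM.zero_right])
      have e3 := congrArg (fun w => ((-1 : ℂ) ^ i * cb k i) • w) this
      simp only [Finset.smul_sum, smul_smul] at e3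
      simp only [c, G, smul_smul]
      convert e3 using 2 with j _ j _
      · congr 1; ring
      · congr 1
        · ring
        · push_cast
          rw [show n - s + m + k - (i + j : ℤ) = m + k - i + n - (s + j) by ring,
            show l + (i + j : ℤ) = s + j + (l + i) - s by ring]
    rw [Finset.sum_congr rfl fun i _ => e2 i, ← Finset.smul_sum]
    simp only [← Finset.smul_sum]
    rw [sum_range_vandermonde (g := G s), add_comm k]
    intro r hr
    simp only [G]
    rw [bG s r (by omega), hM.zero_right]
  have hR2 : ∑ i ∈ Finset.range L, ∑ j ∈ Finset.range L, c i j • (X1 i j - t3 i j) =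
      ∑ s ∈ Finset.range L, cb n s •
        ∑ r ∈ Finset.range L, ((-1 : ℂ) ^ r * cb (n - s + k) r) • G' s r := by
    have e1 : ∀ i j : ℕ, X1 i j - t3 i j = ∑ s ∈ Finset.range L, cb (n - j) s •
        G' s (i + j) := by
      intro i j
      simp only [X1, t3]
      rw [hhb.commutator, jacobiRHS_eq_range (L := L)]
      · refine Finset.sum_congr rfl fun s _ => ?_
        simp only [G', zero_add]
        push_cast
        rw [show m + (i + j : ℤ) = m + i + j by ring,
          show l + (n - s + k) - (i + j : ℤ) = n - j + (l + k - i) - s by ring]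
      · intro s hs; rw [zero_add, b01 s hs, hM.zero_left]
    simp only [e1, Finset.smul_sum]
    rw [Finset.sum_congr rfl fun i _ => Finset.sum_comm, Finset.sum_comm]
    refine Finset.sum_congr rfl fun s _ => ?_
    rw [← Finset.smul_sum, add_comm, ← sum_range_vandermonde (g := G' s)]
    · simp only [Finset.smul_sum, smul_smul, c]
      refine Finset.sum_congr rfl fun i _ => Finset.sum_congr rfl fun j _ => ?_
      congr 1
      linear_combination (-1) ^ i * cb k i * (-1) ^ j * cb_mul_comm n j s
    · intro r hr
      simp only [G']
      rw [b0' r hr, hM.zero_right]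
  have total : jacobiLHS (YM (Y h n a)) (YM b) k m l v =
      (∑ i ∈ Finset.range L, ∑ j ∈ Finset.range L, c i j • (t1 i j - (-1 : ℂ) ^ k • X1 i j)) -
      (-1 : ℂ) ^ n • (∑ i ∈ Finset.range L, ∑ j ∈ Finset.range L,
        c i j • (X2 i j - (-1 : ℂ) ^ k • t4 i j)) -
      (-1 : ℂ) ^ n • (∑ i ∈ Finset.range L, ∑ j ∈ Finset.range L, c i j • (t2 i j - X2 i j)) +
      (-1 : ℂ) ^ k • (∑ i ∈ Finset.range L, ∑ j ∈ Finset.range L, c i j • (X1 i j - t3 i j)) := by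
    rw [lhs]
    simp only [Finset.smul_sum, ← Finset.sum_sub_distrib, ← Finset.sum_add_distrib]
    refine Finset.sum_congr rfl fun i _ => Finset.sum_congr rfl fun j _ => ?_
    module
  rw [total, hPA, hPQ, hR1, hR2]
  -- the right-hand side
  have rhs1 : ∀ t s : ℕ, YM (Y h (n - s) (Y a (k + t + s) b)) (m + l - t) v =
      ∑ j ∈ Finset.range L, ((-1) ^ j * cb (n - s) j) •
        (gP (s + j) (t + s) - ((-1 : ℂ) ^ n * (-1) ^ s) • gQ j (t + s)) := by
    intro t s
    rw [(hhc (k + t + s)).iterate, jacobiLHS_eq_range (L := L)]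
    · refine Finset.sum_congr rfl fun j _ => ?_
      rw [neg_one_zpow_sub_natCast]
      simp only [gP, gQ]
      push_cast
      rw [show n - (s + j : ℤ) = n - s - j by ring, show k + (t + s : ℤ) = k + t + s by ring,
        show m + l - (t + s : ℤ) + (s + j) = m + l - t + j by ring,
        show m + (n - j) + l - (t + s : ℤ) = m + l - t + (n - s) - j by ring, zero_add, zero_add]
    · intro j hj
      have := bP (s + j) (t + s) (Or.inl (by omega))
      push_cast at this
      rw [show k + (t : ℤ) + s = k + (t + s) by ring,
        show m + l - t + (j : ℤ) = m + l - (t + s) + (s + j) by ring, this, hM.zero_right]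
    · intro j hj
      rw [zero_add, b0'' j hj, hM.zero_right]
  have rhs2 : ∀ s : ℕ, ∑ t ∈ Finset.range L, cb m t •
      YM (Y a (k + t + n - s) (Y h s b)) (m + l - t) v =
      ∑ r ∈ Finset.range L, ((-1 : ℂ) ^ r * cb (n - s + k) r) •
        (G s r - ((-1 : ℂ) ^ n * (-1) ^ s * (-1) ^ k) • G' s r) := by
    intro s
    have := hac s v m l (n - s + k)
    rw [jacobiLHS_eq_range (L := L), jacobiRHS_eq_range (L := L)] at this
    · convert this.symm using 2 with t _ r _
      · congr 3; ring
      · rw [zpow_add₀ (by norm_num), neg_one_zpow_sub_natCast]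
        simp only [G, G']
        rw [show n - s + m + k - (r : ℤ) = m + (n - s + k) - r by ring]
    · intro t ht; rw [b7 s t (Or.inr ht), hM.zero_left]
    · intro r hr; rw [bG s r (by omega), hM.zero_right]
    · intro r hr; rw [b0' r hr, hM.zero_right]
  rw [jacobiRHS_eq_range (L := L)]
  · have e1 : ∀ t : ℕ, Y (Y h n a) (k + t) b = ∑ s ∈ Finset.range L, ((-1 : ℂ) ^ s * cb n s) •
        (Y h (n - s) (Y a (k + t + s) b) - (-1 : ℂ) ^ n • Y a (k + t + n - s) (Y h s b)) := by
      intro t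
      rw [hV.iterate, jacobiLHS_eq_range (L := L)]
      · simp only [zero_add]
      · intro s hs
        rw [add_assoc, ← Nat.cast_add, b00 _ (by omega), hY.zero_right]
      · intro s hs
        rw [zero_add, b01 s hs, hY.zero_right]
    have e2 : ∀ t : ℕ, cb m t • YM (Y (Y h n a) (k + t) b) (m + l - t) v =
        (∑ s ∈ Finset.range L, ∑ j ∈ Finset.range L,
          (cb m t * ((-1) ^ s * cb n s) * ((-1) ^ j * cb (n - s) j)) •
          (gP (s + j) (t + s) - ((-1 : ℂ) ^ n * (-1) ^ s) • gQ j (t + s))) -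
        ∑ s ∈ Finset.range L, ((-1 : ℂ) ^ n * ((-1) ^ s * cb n s)) •
          (cb m t • YM (Y a (k + t + n - s) (Y h s b)) (m + l - t) v) := by
      intro t
      rw [e1, hM.sum_left, ← Finset.sum_sub_distrib, Finset.smul_sum]
      refine Finset.sum_congr rfl fun s _ => ?_
      rw [hM.smul_left, hM.sub_left, hM.smul_left, rhs1, smul_sub, smul_sub, Finset.smul_sum,
        Finset.smul_sum]
      simp only [smul_smul]
      congr 1
      · refine Finset.sum_congr rfl fun j _ => ?_
        congr 1; ring
      · congr 1; ring
    rw [Finset.sum_congr rfl fun t _ => e2 t, Finset.sum_sub_distrib, Finset.sum_comm (γ := ℕ)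
      (f := fun t s => ((-1 : ℂ) ^ n * ((-1) ^ s * cb n s)) •
          (cb m t • YM (Y a (k + t + n - s) (Y h s b)) (m + l - t) v))]
    simp only [← Finset.smul_sum, rhs2]
    simp only [Finset.smul_sum, smul_sub, Finset.sum_sub_distrib, smul_smul]
    have s1 : ∀ s : ℕ, ((-1 : ℂ) ^ s) * (-1) ^ s = 1 := neg_one_pow_mul_self
    have s2 := neg_one_zpow_mul_self n
    have key : ∀ P Q R S Q' R' S' : M, Q = Q' → R = R' → S = S' →
        P - Q - R + S = P - Q' - (R' - S') := by
      rintro P Q R S _ _ _ rfl rfl rfl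
      abel
    apply key
    · refine Finset.sum_congr rfl fun t _ => Finset.sum_congr rfl fun s _ =>
        Finset.sum_congr rfl fun j _ => ?_
      congr 1
      linear_combination -((-1 : ℂ) ^ n * cb m t * cb n s * (-1) ^ j * cb (n - s) j) * s1 s
    · refine Finset.sum_congr rfl fun s _ => Finset.sum_congr rfl fun r _ => ?_
      congr 1; ring
    · refine Finset.sum_congr rfl fun s _ => Finset.sum_congr rfl fun r _ => ?_
      congr 1
      linear_combination -((-1 : ℂ) ^ k * cb n s * (-1) ^ r * cb (n - s + k) r) *
        ((-1 : ℂ) ^ n * (-1) ^ n * s1 s + s2)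
  · intro t ht
    rw [b02 t ht, hM.zero_left]

end Closure

/-! ### Reduction of the Borcherds identity to generators. -/

section Generation

variable {V M : Type*} [AddCommGroup V] [Module ℂ V] [AddCommGroup M] [Module ℂ M]
variable {Y : V → ℤ → V → V} {YM : V → ℤ → M → M}

theorem Borcherds.add_left (hY : IsFieldMap Y) (hM : IsFieldMap YM) {a a' b : V}
    (h : Borcherds Y YM a b) (h' : Borcherds Y YM a' b) : Borcherds Y YM (a + a') b := by
  intro v m k n
  obtain ⟨L1, h1⟩ := hM.jacobiLHS_range a b n m k v
  obtain ⟨L2, h2⟩ := hM.jacobiLHS_range a' b n m k v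
  obtain ⟨L3, h3⟩ := hM.jacobiLHS_range (a + a') b n m k v
  obtain ⟨L4, h4⟩ := hY.jacobiRHS_range hM a b n
  obtain ⟨L5, h5⟩ := hY.jacobiRHS_range hM a' b n
  obtain ⟨L6, h6⟩ := hY.jacobiRHS_range hM (a + a') b n
  set L := L1 + L2 + L3 + L4 + L5 + L6
  have e1 := h v m k n
  have e2 := h' v m k n
  rw [h1 L (by omega), h4 L (by omega)] at e1
  rw [h2 L (by omega), h5 L (by omega)] at e2
  rw [h3 L (by omega), h6 L (by omega)]
  simp only [hM.add_left, hM.add_right, hY.add_left, smul_add, Finset.sum_add_distrib]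
  rw [← e1, ← e2, ← Finset.sum_add_distrib]
  refine Finset.sum_congr rfl fun j _ => ?_
  module

theorem Borcherds.smul_left (hY : IsFieldMap Y) (hM : IsFieldMap YM) {a b : V} (t : ℂ)
    (h : Borcherds Y YM a b) : Borcherds Y YM (t • a) b := by
  intro v m k n
  have e := congrArg (fun w => t • w) (h v m k n)
  simp only [jacobiLHS, jacobiRHS, smul_finsum] at e
  simp only [jacobiLHS, jacobiRHS, hM.smul_left, hM.smul_right, hY.smul_left]
  convert e using 3 with j j
  · module
  · module

theorem Borcherds.smul_right (hY : IsFieldMap Y) (hM : IsFieldMap YM) {a b : V} (t : ℂ)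
    (h : Borcherds Y YM a b) : Borcherds Y YM a (t • b) := by
  intro v m k n
  have e := congrArg (fun w => t • w) (h v m k n)
  simp only [jacobiLHS, jacobiRHS, smul_finsum] at e
  simp only [jacobiLHS, jacobiRHS, hM.smul_left, hM.smul_right, hY.smul_right]
  convert e using 3 with j j
  · module
  · module

theorem Borcherds.zero_left (hY : IsFieldMap Y) (hM : IsFieldMap YM) (b : V) :
    Borcherds Y YM 0 b := by
  intro v m k n
  simp [jacobiLHS, jacobiRHS, hM.zero_left, hM.zero_right, hY.zero_left]

/-- Exchanging the fields replaces (z - w)^n by (w - z)^n, and the commutator-like difference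
changes sign once more. -/
theorem jacobiLHS_swap (A B : ℤ → M → M) (n m k : ℤ) (v : M) :
    jacobiLHS B A n m k v = -(-1 : ℂ) ^ n • jacobiLHS A B n k m v := by
  rw [jacobiLHS, jacobiLHS, smul_finsum]
  refine finsum_congr fun j => ?_
  have := neg_one_zpow_mul_self n
  rw [smul_comm, neg_smul, smul_sub ((-1 : ℂ) ^ n), smul_smul ((-1 : ℂ) ^ n), this, one_smul,
    neg_sub]

/-- The translation covariance of the fields, `(c₍₋₁₋ⱼ₎ 1)₍ₖ₎ = (-1)^j binom(k, j) c₍ₖ₋ⱼ₎`. -/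
theorem Borcherds.translate {vac c : V} (hM : IsFieldMap YM) (h : Borcherds Y YM c vac)
    (hvac : ∀ n v, YM vac n v = if n = -1 then v else 0) (j : ℕ) (k : ℤ) (v : M) :
    YM (Y c (-1 - j) vac) k v = ((-1 : ℂ) ^ j * cb k j) • YM c (k - j) v := by
  rw [h.iterate, jacobiLHS]
  simp only [hvac]
  -- The vacuum has the single mode -1, so at most one summand survives: for k < 0 one where the
  -- vacuum acts first, for k ≥ j one where it acts last, and none for 0 ≤ k < j.
  rcases lt_or_ge k 0 with hk | hk
  · obtain ⟨i, rfl⟩ : ∃ i : ℕ, k = -1 - i := ⟨(-1 - k).toNat, by omega⟩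
    rw [finsum_eq_single _ i]
    · rw [if_pos (by ring), if_neg (by omega), smul_zero, sub_zero]
      congr 1
      · change (-1 : ℂ) ^ i * cb (-1 - j) i = _
        rw [show (-1 - j : ℤ) = -(j + 1 : ℕ) by push_cast; ring, cb_neg,
          show (-1 - i : ℤ) = -(i + 1 : ℕ) by push_cast; ring, cb_neg, ← mul_assoc, ← mul_assoc,
          neg_one_pow_mul_self, neg_one_pow_mul_self,
          show ((j + 1 : ℕ) + i - 1 : ℤ) = (j + i : ℕ) by push_cast; ring,
          show ((i + 1 : ℕ) + j - 1 : ℤ) = (j + i : ℕ) by push_cast; ring, cb_natCast, cb_natCast,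
          Nat.choose_symm_add]
      · congr 1; ring
    · intro i' hi'
      rw [if_neg (by omega), if_neg (by omega), hM.zero_right]; simp
  · obtain ⟨i, rfl⟩ : ∃ i : ℕ, k = i := ⟨k.toNat, by omega⟩
    rcases lt_or_ge i j with hij | hij
    · rw [cb_natCast_of_lt hij, mul_zero, zero_smul, finsum_eq_zero_of_forall_eq_zero]
      intro i'
      rw [if_neg (by omega), if_neg (by omega), hM.zero_right]; simp
    · obtain ⟨i, rfl⟩ := Nat.exists_eq_add_of_le hij
      rw [finsum_eq_single _ i]
      · rw [if_neg (by omega), if_pos (by push_cast; ring), hM.zero_right, zero_sub, ← neg_smul,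
          smul_smul]
        congr 1
        · change (-1 : ℂ) ^ i * cb (-1 - j) i * _ = _
          rw [show (-1 - j : ℤ) = -(j + 1 : ℕ) by push_cast; ring, cb_neg, ← mul_assoc,
            neg_one_pow_mul_self, show ((j + 1 : ℕ) + i - 1 : ℤ) = (j + i : ℕ) by push_cast; ring,
            cb_natCast, cb_natCast, Nat.choose_symm_add, zpow_neg, zpow_natCast, pow_succ]
          rcases neg_one_pow_eq_or ℂ j with h | h <;> simp [h]
        · congr 1; push_cast; ring
      · intro i' hi'
        rw [if_neg (by omega), if_neg (by omega), hM.zero_right]; simp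

/-- Skew-symmetry. -/
theorem Borcherds.skew {vac a b : V} (hY : IsFieldMap Y) (h : Borcherds Y Y a b)
    (cra : Y a (-1) vac = a) (cra' : ∀ n, 0 ≤ n → Y a n vac = 0)
    (crb' : ∀ n, 0 ≤ n → Y b n vac = 0) (n : ℤ) :
    Y b n a = -(-1 : ℂ) ^ n • ∑ᶠ j : ℕ, (-1 : ℂ) ^ j • Y (Y a (n + j) b) (-1 - j) vac := by
  -- On the vacuum with m = -1 and k = 0 only the term b_n (a_{-1} 1) = b_n a remains on the left.
  have e := h vac (-1) 0 n
  rw [jacobiLHS, finsum_eq_single _ 0] at e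
  · rw [show jacobiRHS Y Y a b n (-1) 0 vac =
        ∑ᶠ j : ℕ, (-1 : ℂ) ^ j • Y (Y a (n + j) b) (-1 - j) vac from ?_] at e
    · rw [← e]
      simp only [pow_zero, Ring.choose_zero_right, Int.cast_one, mul_one, one_smul, Nat.cast_zero,
        add_zero, sub_zero, zero_add]
      rw [crb' 0 le_rfl, hY.zero_right, cra, zero_sub, neg_smul, smul_neg, neg_neg, smul_smul,
        neg_one_zpow_mul_self, one_smul]
    · refine finsum_congr fun j => ?_
      change cb (-1) j • _ = _
      rw [cb_neg, show (1 + j - 1 : ℤ) = j by ring, cb_natCast, Nat.choose_self, add_zero]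
      simp
  · intro j hj
    rw [crb' _ (by omega), cra' _ (by omega), hY.zero_right, hY.zero_right]; simp

/-- Past both truncation bounds the identity is mutual locality, which is symmetric. Below,
skew-symmetry in the algebra writes b_n a through translates of the products of a and b, and
translation covariance evaluates these on the module. -/
theorem Borcherds.symm {vac a b : V} (hY : IsFieldMap Y) (hM : IsFieldMap YM)
    (h : Borcherds Y YM a b) (hV : Borcherds Y Y a b)
    (cra : Y a (-1) vac = a) (cra' : ∀ n, 0 ≤ n → Y a n vac = 0)
    (crb' : ∀ n, 0 ≤ n → Y b n vac = 0) (hvac : ∀ n v, YM vac n v = if n = -1 then v else 0)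
    (htr : ∀ c, Borcherds Y YM c vac) : Borcherds Y YM b a := by
  obtain ⟨N1, hN1⟩ := hY.truncation a b
  obtain ⟨N2, hN2⟩ := hY.truncation b a
  refine hY.borcherds_of_base hM (max N1 N2) ?_ ?_
  · intro m k v
    rw [jacobiLHS_swap, h, jacobiRHS, jacobiRHS, finsum_eq_zero_of_forall_eq_zero,
      finsum_eq_zero_of_forall_eq_zero, smul_zero]
    · intro j; rw [hN2 _ (by omega), hM.zero_left, smul_zero]
    · intro j; rw [hN1 _ (by omega), hM.zero_left, smul_zero]
  · intro n _ k v
    obtain ⟨L, hL⟩ := hY.eventually_zero a b n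
    rw [jacobiLHS_swap, h, hV.skew hY cra cra' crb', hM.smul_left,
      finsum_eq_range (L := L), jacobiRHS_eq_range (L := L), hM.sum_left]
    · congr 1
      refine Finset.sum_congr rfl fun j _ => ?_
      rw [hM.smul_left, (htr _).translate hM hvac, smul_smul, ← mul_assoc, neg_one_pow_mul_self,
        one_mul, add_zero]
    · intro j hj; rw [hL j hj, hM.zero_left]
    · intro j hj; rw [hL j hj, hY.zero_left, smul_zero]

/-- The Borcherds identity on a module follows from the identity for generators. -/
theorem borcherds_of_generators {vac : V} (hY : IsFieldMap Y) (hM : IsFieldMap YM)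
    (cr : ∀ a, Y a (-1) vac = a) (cr' : ∀ a n, 0 ≤ n → Y a n vac = 0)
    (hvac : ∀ n v, YM vac n v = if n = -1 then v else 0)
    (S E : Set V) (hvacE : vac ∈ E)
    (hSV : ∀ h ∈ S, ∀ b, Borcherds Y Y h b) (hSM : ∀ h ∈ S, ∀ b, Borcherds Y YM h b)
    (hEV : ∀ e ∈ E, ∀ e' ∈ E, Borcherds Y Y e e') (hEM : ∀ e ∈ E, ∀ e' ∈ E, Borcherds Y YM e e')
    (hSE : ∀ h ∈ S, ∀ e ∈ E, ∀ s : ℕ, ∃ t : ℂ, Y h s e = t • e)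
    (ind : ∀ P : V → Prop, P 0 → (∀ a b, P a → P b → P (a + b)) → (∀ (t : ℂ) a, P a → P (t • a)) →
      (∀ e ∈ E, P e) → (∀ h ∈ S, ∀ n a, P a → P (Y h n a)) → ∀ a, P a) (a b : V) :
    Borcherds Y YM a b := by
  -- With a ground state in the second slot the induction closes up: h_s e is a multiple of e, so
  -- `Borcherds.mode_left` asks for nothing beyond the induction hypothesis.
  have h3V : ∀ e ∈ E, ∀ a, Borcherds Y Y a e := by
    intro e he
    refine ind _ (Borcherds.zero_left hY hY e) (fun a b => Borcherds.add_left hY hY)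
      (fun t a => Borcherds.smul_left hY hY t) (fun e' he' => hEV e' he' e he) ?_
    intro h hh n a ha
    refine Borcherds.mode_left hY hY n (hSV h hh a) ha (hSV h hh e) (fun k => hSV h hh _)
      (fun s => ?_) (hSV h hh a)
    obtain ⟨t, ht⟩ := hSE h hh e he s
    rw [ht]; exact ha.smul_right hY hY t
  have h3M : ∀ e ∈ E, ∀ a, Borcherds Y YM a e := by
    intro e he
    refine ind _ (Borcherds.zero_left hY hM e) (fun a b => Borcherds.add_left hY hM)
      (fun t a => Borcherds.smul_left hY hM t) (fun e' he' => hEM e' he' e he) ?_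
    intro h hh n a ha
    refine Borcherds.mode_left hY hM n (hSM h hh a) ha (hSM h hh e) (fun k => hSM h hh _)
      (fun s => ?_) (hSV h hh a)
    obtain ⟨t, ht⟩ := hSE h hh e he s
    rw [ht]; exact ha.smul_right hY hM t
  -- Symmetry moves the ground state to the first slot against an arbitrary state; this starts the
  -- final induction, run for all b simultaneously.
  have h4M : ∀ e ∈ E, ∀ a, Borcherds Y YM e a := fun e he a =>
    (h3M e he a).symm hY hM (h3V e he a) (cr a) (cr' a) (cr' e) hvac (h3M vac hvacE)
  revert a b
  refine ind _ (Borcherds.zero_left hY hM) (fun a a' h h' b => (h b).add_left hY hM (h' b))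
    (fun t a h b => (h b).smul_left hY hM t) h4M ?_
  intro h hh n a ha b
  exact Borcherds.mode_left hY hM n (hSM h hh a) (ha b) (hSM h hh b) (fun k => hSM h hh _)
    (fun s => ha _) (hSV h hh a)

end Generation

/-! ### Coefficients of the creation exponential. -/

section Creation

variable {I : Type*} [Fintype I]

/-- The creation operator `μ_{-k-1}` of `μ = ∑ u i • eᵢ`. -/
def creationVar (u : I → ℂ) (k : ℕ) : MvPolynomial (I × ℕ) ℂ := ∑ i, u i • MvPolynomial.X (i, k)

theorem creationCoeff_neg (u : I → ℂ) {N : ℤ} (h : N < 0) : creationCoeff u N = 0 := by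
  simp [creationCoeff, h]

theorem creationCoeff_zero (u : I → ℂ) : creationCoeff u 0 = 1 := by
  simp [creationCoeff]

/-- The inner series f has no constant term, so f^r starts in degree r and the exponential may be
cut at any R > N. A common R for several N makes differentiation possible. -/
theorem creationCoeff_eq (u : I → ℂ) (N R : ℕ) (h : N < R) : creationCoeff u N =
    PowerSeries.coeff N (∑ r ∈ Finset.range R, ((r.factorial : ℂ)⁻¹) •
      (PowerSeries.mk fun k : ℕ => if k = 0 then (0 : MvPolynomial (I × ℕ) ℂ) else
          ∑ i, (u i / (k : ℂ)) • MvPolynomial.X (i, k - 1)) ^ r) := by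
  set f := (PowerSeries.mk fun k : ℕ => if k = 0 then (0 : MvPolynomial (I × ℕ) ℂ) else
          ∑ i, (u i / (k : ℂ)) • MvPolynomial.X (i, k - 1)) with hf
  have hX : ∀ r, N < r → PowerSeries.coeff N (f ^ r) = 0 := by
    intro r hr
    have : (PowerSeries.X : PowerSeries (MvPolynomial (I × ℕ) ℂ)) ∣ f := by
      rw [PowerSeries.X_dvd_iff]; simp [hf]
    exact PowerSeries.X_pow_dvd_iff.mp (pow_dvd_pow_of_dvd this r) N hr
  rw [creationCoeff, if_neg (by omega), map_sum]
  simp only [Int.toNat_natCast]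
  rw [Finset.sum_subset (Finset.range_mono (show N + 1 ≤ R by omega))]
  · refine Finset.sum_congr rfl fun r _ => ?_
    rw [LinearMap.map_smul_of_tower]
  · intro r _ hr
    rw [hX r (by simpa using hr), smul_zero]

/-- The recursion for the coefficients of `exp (∑ μ_{-k} z^k / k)`. -/
theorem creationCoeff_succ (u : I → ℂ) (N : ℕ) : ((N : ℂ) + 1) • creationCoeff u (N + 1) =
    ∑ k ∈ Finset.range (N + 1), creationVar u k * creationCoeff u (N - k) := by
  set f := (PowerSeries.mk fun k : ℕ => if k = 0 then (0 : MvPolynomial (I × ℕ) ℂ) else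
          ∑ i, (u i / (k : ℂ)) • MvPolynomial.X (i, k - 1)) with hf
  have hE := creationCoeff_eq u (N + 1) (N + 2) (by omega)
  rw [← hf] at hE
  have h1 : ((N : ℂ) + 1) • creationCoeff u ((N + 1 : ℕ) : ℤ) = PowerSeries.coeff N
      (PowerSeries.derivative _ (∑ r ∈ Finset.range (N + 2), ((r.factorial : ℂ)⁻¹) • f ^ r)) := by
    rw [PowerSeries.coeff_derivative, hE, Algebra.smul_def, mul_comm]
    simp
  -- The equation E' = f' E for truncated exponentials; differentiation lowers the cut by one.
  have h2 : PowerSeries.derivative _ (∑ r ∈ Finset.range (N + 2), ((r.factorial : ℂ)⁻¹) • f ^ r) =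
      PowerSeries.derivative _ f * ∑ r ∈ Finset.range (N + 1), ((r.factorial : ℂ)⁻¹) • f ^ r := by
    rw [map_sum, Finset.sum_range_succ', Finset.mul_sum]
    simp only [pow_zero, Derivation.map_smul_of_tower, PowerSeries.derivative_pow]
    rw [PowerSeries.derivative_one, smul_zero, add_zero]
    refine Finset.sum_congr rfl fun r _ => ?_
    rw [Nat.factorial_succ, Nat.add_sub_cancel]
    have : ((r + 1 : ℕ) : PowerSeries (MvPolynomial (I × ℕ) ℂ)) * f ^ r =
        ((r + 1 : ℕ) : ℂ) • f ^ r := by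
      rw [Algebra.smul_def, map_natCast]
    rw [this, smul_mul_assoc, smul_smul, mul_smul_comm, mul_comm (f ^ r), Nat.cast_mul]
    congr 1
    field_simp
  rw [h2, PowerSeries.coeff_mul] at h1
  push_cast at h1
  rw [h1, Finset.Nat.sum_antidiagonal_eq_sum_range_succ_mk]
  refine Finset.sum_congr rfl fun k hk => ?_
  rw [Finset.mem_range] at hk
  rw [show (N : ℤ) - k = (N - k : ℕ) by omega, creationCoeff_eq u (N - k) (N + 1) (by omega), ← hf]
  congr 1
  rw [PowerSeries.coeff_derivative]
  simp only [hf, PowerSeries.coeff_mk, creationVar, Nat.add_sub_cancel]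
  rw [if_neg (by omega), Finset.sum_mul]
  refine Finset.sum_congr rfl fun i _ => ?_
  rw [show ((k : MvPolynomial (I × ℕ) ℂ) + 1) = algebraMap ℂ _ ((k : ℂ) + 1) by simp, mul_comm,
    ← Algebra.smul_def, smul_smul]
  congr 1
  push_cast
  have : (k : ℂ) + 1 ≠ 0 := by exact_mod_cast Nat.succ_ne_zero k
  field_simp

theorem pderiv_creationVar (u : I → ℂ) (j : I) (n k : ℕ) :
    MvPolynomial.pderiv (j, n) (creationVar u k) =
      if k = n then MvPolynomial.C (u j) else 0 := by
  classical
  simp only [creationVar, map_sum, Derivation.map_smul, MvPolynomial.pderiv_X, Pi.single_apply,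
    Prod.mk.injEq]
  split_ifs with h
  · simp [h, MvPolynomial.smul_eq_C_mul]
  · simp [h]

/-- The exponent depends on X (j, n) only through u j z^(n+1) / (n + 1) · X (j, n), so
differentiation multiplies the exponential by this coefficient. On coefficients the proof is a
strong induction through `creationCoeff_succ`. -/
theorem pderiv_creationCoeff (u : I → ℂ) (j : I) (n : ℕ) (N : ℤ) :
    MvPolynomial.pderiv (j, n) (creationCoeff u N) =
      (u j / ((n : ℂ) + 1)) • creationCoeff u (N - n - 1) := by
  rcases lt_or_ge N 0 with hN | hN
  · rw [creationCoeff_neg u hN, creationCoeff_neg u (by omega), map_zero, smul_zero]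
  obtain ⟨N, rfl⟩ := Int.eq_ofNat_of_zero_le hN
  induction N using Nat.strong_induction_on with
  | _ N ih =>
    have hn : (n : ℂ) + 1 ≠ 0 := by exact_mod_cast Nat.succ_ne_zero n
    rcases N with _ | N
    · rw [Nat.cast_zero, creationCoeff_zero, creationCoeff_neg u (by omega), smul_zero,
        MvPolynomial.pderiv_one]
    · have hN1 : (N : ℂ) + 1 ≠ 0 := by exact_mod_cast Nat.succ_ne_zero N
      refine smul_right_injective _ hN1 ?_
      simp only
      rw [← Derivation.map_smul]
      push_cast
      rw [creationCoeff_succ, map_sum]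
      have e : ∀ k ∈ Finset.range (N + 1), MvPolynomial.pderiv (j, n)
          (creationVar u k * creationCoeff u (N - k)) =
          (if k = n then (u j) • creationCoeff u (N - n) else 0) +
          (u j / ((n : ℂ) + 1)) • (creationVar u k * creationCoeff u (N - n - 1 - k)) := by
        intro k hk
        rw [Finset.mem_range] at hk
        have := ih (N - k) (by omega) (by omega)
        rw [show ((N - k : ℕ) : ℤ) = N - k by omega] at this
        rw [Derivation.leibniz, this, pderiv_creationVar, smul_eq_mul, smul_eq_mul, mul_smul_comm,
          show (N - k - n - 1 : ℤ) = N - n - 1 - k by ring, add_comm]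
        congr 1
        split_ifs with h
        · rw [h, mul_comm, MvPolynomial.smul_eq_C_mul]
        · simp
      rw [Finset.sum_congr rfl e, Finset.sum_add_distrib, ← Finset.smul_sum, Finset.sum_ite_eq']
      simp only [Finset.mem_range]
      rw [show ((N : ℤ) + 1 - n - 1) = N - n by ring]
      rcases lt_trichotomy N n with h | h | h
      · rw [if_neg (by omega), Finset.sum_eq_zero, creationCoeff_neg u (by omega)]
        · simp
        · intro k _; rw [creationCoeff_neg u (by omega), mul_zero]
      · subst h
        rw [if_pos (by omega), Finset.sum_eq_zero]
        · rw [smul_smul, mul_div_cancel₀ _ hN1, smul_zero, add_zero]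
        · intro k _; rw [creationCoeff_neg u (by omega), mul_zero]
      · obtain ⟨d, rfl⟩ := Nat.exists_eq_add_of_lt h
        rw [if_pos (by omega)]
        have e2 := creationCoeff_succ u d
        have e3 : ∑ k ∈ Finset.range (n + d + 1 + 1),
            creationVar u k * creationCoeff u (((n + d + 1 : ℕ) : ℤ) - n - 1 - k) =
            ((d : ℂ) + 1) • creationCoeff u (d + 1) := by
          rw [e2]
          symm
          have : ∀ k : ℕ, ((n + d + 1 : ℕ) : ℤ) - n - 1 - k = d - k := by intro k; push_cast; ring
          simp only [this]
          apply Finset.sum_subset (Finset.range_mono (by omega))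
          intro k _ hk
          rw [creationCoeff_neg u, mul_zero]
          rw [Finset.mem_range] at hk; omega
        rw [e3, show ((n + d + 1 : ℕ) : ℤ) - n = d + 1 by push_cast; ring, smul_smul, smul_smul,
          ← add_smul]
        congr 1
        push_cast
        field_simp
        ring

theorem constantCoeff_creationVar (u : I → ℂ) (k : ℕ) :
    MvPolynomial.constantCoeff (creationVar u k) = 0 := by
  simp [creationVar, MvPolynomial.smul_eq_C_mul]

theorem constantCoeff_creationCoeff (u : I → ℂ) (N : ℤ) :
    MvPolynomial.constantCoeff (creationCoeff u N) = if N = 0 then 1 else 0 := by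
  rcases lt_trichotomy N 0 with hN | hN | hN
  · rw [creationCoeff_neg u hN, if_neg (by omega), map_zero]
  · rw [hN, creationCoeff_zero, if_pos rfl, map_one]
  · obtain ⟨N, rfl⟩ : ∃ d : ℕ, N = d + 1 := ⟨(N - 1).toNat, by omega⟩
    have hN1 : (N : ℂ) + 1 ≠ 0 := by exact_mod_cast Nat.succ_ne_zero N
    have := congrArg MvPolynomial.constantCoeff (creationCoeff_succ u N)
    rw [map_sum, MvPolynomial.smul_eq_C_mul, map_mul, MvPolynomial.constantCoeff_C,
      Finset.sum_eq_zero] at this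
    · rw [if_neg (by omega)]
      exact (mul_eq_zero.mp this).resolve_left hN1
    · intro k _; rw [map_mul, constantCoeff_creationVar, zero_mul]

end Creation

/-! ### Exponential operators on a Fock space. -/

section ExpFock

variable {I : Type*} [Fintype I]

theorem creationCoeff_zero_left (N : ℤ) :
    creationCoeff (fun _ : I => (0 : ℂ)) N = if N = 0 then 1 else 0 := by
  rcases lt_trichotomy N 0 with hN | hN | hN
  · rw [creationCoeff_neg _ hN, if_neg (by omega)]
  · rw [hN, creationCoeff_zero, if_pos rfl]
  · obtain ⟨N, rfl⟩ : ∃ d : ℕ, N = d + 1 := ⟨(N - 1).toNat, by omega⟩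
    have hN1 : (N : ℂ) + 1 ≠ 0 := by exact_mod_cast Nat.succ_ne_zero N
    have := creationCoeff_succ (fun _ : I => (0 : ℂ)) N
    rw [Finset.sum_eq_zero (by simp [creationVar])] at this
    rw [if_neg (by omega)]
    exact (smul_eq_zero.mp this).resolve_left hN1

/-- Evaluation of `∑ pq z^(-q)` at `z^N` after multiplication by `exp (∑ μ_{-k} z^k / k)`. -/
def creationLsum (u : I → ℂ) (N : ℤ) :
    Polynomial (MvPolynomial (I × ℕ) ℂ) →ₗ[ℂ] MvPolynomial (I × ℕ) ℂ :=
  Polynomial.lsum fun q : ℕ => LinearMap.mulLeft ℂ (creationCoeff u (N + q))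

theorem creationLsum_monomial (u : I → ℂ) (N : ℤ) (q : ℕ) (c : MvPolynomial (I × ℕ) ℂ) :
    creationLsum u N (Polynomial.monomial q c) = creationCoeff u (N + q) * c := by
  simp [creationLsum, Polynomial.lsum_apply, Polynomial.sum_monomial_index]

theorem expFock_apply (u : I → ℂ) (w : I → ℤ) (N : ℤ) (Q : MvPolynomial (I × ℕ) ℂ) :
    expFock u w N Q = creationLsum u N (annihilationShift w Q) := rfl

theorem expFock_one (u : I → ℂ) (w : I → ℤ) (N : ℤ) : expFock u w N 1 = creationCoeff u N := by
  rw [expFock_apply, map_one, ← Polynomial.C_1, ← Polynomial.monomial_zero_left,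
    creationLsum_monomial]
  simp

theorem creationLsum_C_mul (u : I → ℂ) (N : ℤ) (x : MvPolynomial (I × ℕ) ℂ)
    (p : Polynomial (MvPolynomial (I × ℕ) ℂ)) :
    creationLsum u N (Polynomial.C x * p) = x * creationLsum u N p := by
  induction p using Polynomial.induction_on' with
  | add p q hp hq => rw [mul_add, map_add, map_add, hp, hq, mul_add]
  | monomial q c =>
    rw [Polynomial.C_mul_monomial, creationLsum_monomial, creationLsum_monomial]; ring

theorem creationLsum_monomial_mul (u : I → ℂ) (N : ℤ) (k : ℕ) (x : MvPolynomial (I × ℕ) ℂ)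
    (p : Polynomial (MvPolynomial (I × ℕ) ℂ)) :
    creationLsum u N (Polynomial.monomial k x * p) = x * creationLsum u (N + k) p := by
  induction p using Polynomial.induction_on' with
  | add p q hp hq => rw [mul_add, map_add, map_add, hp, hq, mul_add]
  | monomial q c =>
    rw [Polynomial.monomial_mul_monomial, creationLsum_monomial, creationLsum_monomial]
    push_cast
    rw [add_assoc]; ring

/-- The annihilation part substitutes X (j, n) - w j z^(-n-1) for X (j, n). Together with
`expFock_one` this determines the operator, and later inductions on polynomials use only these two
rules. -/
theorem expFock_X_mul (u : I → ℂ) (w : I → ℤ) (N : ℤ) (s : I × ℕ) (Q : MvPolynomial (I × ℕ) ℂ) :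
    expFock u w N (MvPolynomial.X s * Q) =
      MvPolynomial.X s * expFock u w N Q - (w s.1 : ℂ) • expFock u w (N + s.2 + 1) Q := by
  simp only [expFock_apply, map_mul]
  rw [show annihilationShift w (MvPolynomial.X s) = Polynomial.C (MvPolynomial.X s) -
      Polynomial.monomial (s.2 + 1) (MvPolynomial.C ((w s.1 : ℤ) : ℂ)) by simp [annihilationShift],
    sub_mul, map_sub, creationLsum_C_mul, creationLsum_monomial_mul, MvPolynomial.smul_eq_C_mul]
  push_cast
  rw [add_assoc]

theorem expFock_eventually_zero (u : I → ℂ) (w : I → ℤ) (Q : MvPolynomial (I × ℕ) ℂ) :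
    ∃ B : ℤ, ∀ N, N ≤ B → expFock u w N Q = 0 := by
  induction Q using MvPolynomial.induction_on with
  | C a =>
    refine ⟨-1, fun N hN => ?_⟩
    rw [← mul_one (MvPolynomial.C a), ← MvPolynomial.smul_eq_C_mul, map_smul, expFock_one,
      creationCoeff_neg u (by omega), smul_zero]
  | add p q hp hq =>
    obtain ⟨B1, h1⟩ := hp
    obtain ⟨B2, h2⟩ := hq
    exact ⟨min B1 B2, fun N hN => by rw [map_add, h1 N (by omega), h2 N (by omega), add_zero]⟩
  | mul_X p s hp =>
    obtain ⟨B, h⟩ := hp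
    refine ⟨B - s.2 - 1, fun N hN => ?_⟩
    rw [mul_comm, expFock_X_mul, h N (by omega), h _ (by omega), mul_zero, smul_zero, sub_zero]

/-- Derivatives commute with the translation of variables in the annihilation part and act on the
creation part by a scalar. -/
theorem pderiv_expFock (u : I → ℂ) (w : I → ℤ) (j : I) (n : ℕ) (Q : MvPolynomial (I × ℕ) ℂ)
    (N : ℤ) : MvPolynomial.pderiv (j, n) (expFock u w N Q) =
      (u j / ((n : ℂ) + 1)) • expFock u w (N - n - 1) Q +
        expFock u w N (MvPolynomial.pderiv (j, n) Q) := by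
  classical
  induction Q using MvPolynomial.induction_on generalizing N with
  | C a =>
    rw [MvPolynomial.pderiv_C, map_zero, add_zero, ← mul_one (MvPolynomial.C a),
      ← MvPolynomial.smul_eq_C_mul]
    simp only [map_smul, Derivation.map_smul, expFock_one, pderiv_creationCoeff]
    rw [smul_comm]
  | add p q hp hq => simp only [map_add, hp, hq, smul_add]; abel
  | mul_X p s hp =>
    rw [mul_comm p, expFock_X_mul, map_sub, Derivation.leibniz, Derivation.map_smul, hp, hp,
      expFock_X_mul, Derivation.leibniz, map_add, MvPolynomial.pderiv_X]
    simp only [smul_eq_mul, expFock_X_mul]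
    have : ∀ Q', expFock u w N (Q' * (Pi.single (j, n) 1 : I × ℕ → MvPolynomial (I × ℕ) ℂ) s) =
        expFock u w N Q' * (Pi.single (j, n) 1 : I × ℕ → MvPolynomial (I × ℕ) ℂ) s := by
      intro Q'
      rcases eq_or_ne s (j, n) with rfl | h
      · simp
      · simp [h]
    rw [this, show N + s.2 + 1 - n - 1 = N - n - 1 + s.2 + 1 by ring]
    simp only [mul_add, smul_add, smul_sub, mul_smul_comm]
    rw [smul_comm (w s.1 : ℂ)]
    abel

/-- The commutator of a Heisenberg mode with an exponential. -/
theorem heisFock_expFock {G : Matrix I I ℤ} {u : I → ℂ} {w : I → ℤ} {i : I}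
    (hw : (w i : ℂ) = ∑ j, (G i j : ℂ) * u j) (h p N : ℤ) (Q : MvPolynomial (I × ℕ) ℂ) :
    heisFock G (h + w i) i p (expFock u w N Q) =
      expFock u w N (heisFock G h i p Q) + (w i : ℂ) • expFock u w (N - p) Q := by
  rcases lt_trichotomy p 0 with hp | hp | hp
  · obtain ⟨n, rfl⟩ : ∃ n : ℕ, p = -n - 1 := ⟨(-p - 1).toNat, by omega⟩
    simp only [heisFock, if_pos hp, LinearMap.mulLeft_apply]
    rw [show (-(-(n : ℤ) - 1) - 1).toNat = n by omega, expFock_X_mul]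
    rw [show N - (-n - 1) = N + n + 1 by ring]
    simp
  · subst hp
    simp only [heisFock, lt_irrefl, if_false, if_true, LinearMap.smul_apply, LinearMap.id_apply,
      map_smul, sub_zero]
    push_cast
    module
  · obtain ⟨n, rfl⟩ : ∃ n : ℕ, p = n + 1 := ⟨(p - 1).toNat, by omega⟩
    have hn : (n : ℂ) + 1 ≠ 0 := by exact_mod_cast Nat.succ_ne_zero n
    simp only [heisFock, if_neg (not_lt.mpr hp.le), if_neg hp.ne', LinearMap.sum_apply,
      LinearMap.smul_apply, map_sum, map_smul]
    rw [show ((n : ℤ) + 1 - 1).toNat = n by omega]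
    simp only [Derivation.coeFn_coe, pderiv_expFock, smul_add, Finset.sum_add_distrib]
    rw [add_comm]
    congr 1
    rw [hw, Finset.sum_smul]
    refine Finset.sum_congr rfl fun j _ => ?_
    rw [smul_smul, show N - (n + 1 : ℤ) = N - n - 1 by ring]
    congr 1
    push_cast
    field_simp

end ExpFock

/-! ### Heisenberg modes and charged exponential fields. -/

section Heisenberg

variable {I : Type*} [Fintype I]

theorem heisFock_neg (G : Matrix I I ℤ) (h : ℤ) (i : I) (n : ℕ) (Q : MvPolynomial (I × ℕ) ℂ) :
    heisFock G h i (-n - 1) Q = MvPolynomial.X (i, n) * Q := by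
  rw [heisFock, if_pos (by omega), LinearMap.mulLeft_apply]
  congr 3; omega

theorem heisFock_zero (G : Matrix I I ℤ) (h : ℤ) (i : I) (Q : MvPolynomial (I × ℕ) ℂ) :
    heisFock G h i 0 Q = (h : ℂ) • Q := by
  simp [heisFock]

theorem heisFock_pos (G : Matrix I I ℤ) (h : ℤ) (i : I) (n : ℕ) (Q : MvPolynomial (I × ℕ) ℂ) :
    heisFock G h i (n + 1) Q =
      ∑ j, (((n : ℂ) + 1) * (G i j : ℂ)) • MvPolynomial.pderiv (j, n) Q := by
  rw [heisFock, if_neg (by omega), if_neg (by omega), LinearMap.sum_apply]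
  refine Finset.sum_congr rfl fun j _ => ?_
  rw [LinearMap.smul_apply, show ((n : ℤ) + 1 - 1).toNat = n by omega]
  push_cast; rfl

theorem heisFock_natCast_one (G : Matrix I I ℤ) (h : ℤ) (i : I) (n : ℕ) :
    heisFock G h i n 1 = if n = 0 then (h : ℂ) • 1 else 0 := by
  rcases n with _ | n
  · rw [Nat.cast_zero, heisFock_zero, if_pos rfl]
  · push_cast
    rw [heisFock_pos]
    simp

theorem heisFock_eventually_zero (G : Matrix I I ℤ) (h : ℤ) (i : I)
    (Q : MvPolynomial (I × ℕ) ℂ) : ∃ B : ℤ, ∀ p, B ≤ p → heisFock G h i p Q = 0 := by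
  classical
  obtain ⟨B, hB⟩ : ∃ B : ℕ, ∀ n, B ≤ n → ∀ j : I, MvPolynomial.pderiv (j, n) Q = 0 := by
    refine ⟨Q.vars.sup Prod.snd + 1, fun n hn j => MvPolynomial.pderiv_eq_zero_of_notMem_vars ?_⟩
    intro hv
    have := Finset.le_sup (f := Prod.snd) hv
    simp only at this
    omega
  refine ⟨B + 1, fun p hp => ?_⟩
  obtain ⟨n, rfl⟩ : ∃ n : ℕ, p = n + 1 := ⟨(p - 1).toNat, by omega⟩
  rw [heisFock_pos, Finset.sum_eq_zero]
  intro j _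
  rw [hB n (by omega), smul_zero]

variable {G : Matrix I I ℤ} {lam : I → ℤ}

theorem heisMode_single (i : I) (p : ℤ) (c : I → ℤ) (Q : MvPolynomial (I × ℕ) ℂ) :
    heisMode G lam i p (Finsupp.single c Q) =
      Finsupp.single c (heisFock G (chargePair G lam c i) i p Q) := by
  simp [heisMode]

theorem heisMode_apply (i : I) (p : ℤ) (v : LatticeFock I) (d : I → ℤ) :
    heisMode G lam i p v d = heisFock G (chargePair G lam d i) i p (v d) := by
  classical
  induction v using Finsupp.induction_linear with
  | zero => simp
  | add v w hv hw => simp only [map_add, Finsupp.add_apply, hv, hw]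
  | single c Q =>
    rw [heisMode_single, Finsupp.single_apply, Finsupp.single_apply]
    split_ifs with h
    · rw [h]
    · rw [map_zero]

theorem heisMode_eventually_zero (i : I) (v : LatticeFock I) :
    ∃ B : ℤ, ∀ p, B ≤ p → heisMode G lam i p v = 0 := by
  induction v using Finsupp.induction_linear with
  | zero => exact ⟨0, fun p _ => map_zero _⟩
  | add v w hv hw =>
    obtain ⟨B1, h1⟩ := hv
    obtain ⟨B2, h2⟩ := hw
    exact ⟨max B1 B2, fun p hp => by rw [map_add, h1 p (by omega), h2 p (by omega), add_zero]⟩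
  | single c Q =>
    obtain ⟨B, hB⟩ := heisFock_eventually_zero G (chargePair G lam c i) i Q
    exact ⟨B, fun p hp => by rw [heisMode_single, hB p hp, Finsupp.single_zero]⟩

theorem heisMode_natCast_ground (i : I) (n : ℕ) (c : I → ℤ) :
    heisMode G lam i n (Finsupp.single c 1) =
      if n = 0 then (chargePair G lam c i : ℂ) • Finsupp.single c 1 else 0 := by
  rw [heisMode_single, heisFock_natCast_one]
  split_ifs <;> simp

/-- A positive mode is a derivation. Against a multiplication operator it produces the contraction,
while it commutes with scalars and with other constant-coefficient derivations. -/
theorem heisFock_commutator_aux (h h' : ℤ) (i j : I) (n : ℕ) (r : ℤ)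
    (Q : MvPolynomial (I × ℕ) ℂ) :
    heisFock G h i (n + 1) (heisFock G h' j r Q) = heisFock G h' j r (heisFock G h i (n + 1) Q) +
      (if (n + 1 : ℤ) + r = 0 then (((n : ℂ) + 1) * (G i j : ℂ)) • Q else 0) := by
  classical
  rcases lt_trichotomy r 0 with hr | hr | hr
  · obtain ⟨m, rfl⟩ : ∃ m : ℕ, r = -m - 1 := ⟨(-r - 1).toNat, by omega⟩
    simp only [heisFock_neg, heisFock_pos, Derivation.leibniz, MvPolynomial.pderiv_X,
      smul_add, Finset.sum_add_distrib, Finset.mul_sum, smul_eq_mul, mul_smul_comm]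
    congr 1
    rcases eq_or_ne n m with rfl | h
    · rw [if_pos (by ring), Finset.sum_eq_single j]
      · simp
      · intro l _ hl
        rw [Pi.single_eq_of_ne (by simp [hl.symm])]; simp
      · simp
    · rw [if_neg (by omega), Finset.sum_eq_zero]
      intro l _
      rw [Pi.single_eq_of_ne (by simp [h.symm])]; simp
  · subst hr
    rw [if_neg (by omega), heisFock_zero, heisFock_zero, map_smul, add_zero]
  · obtain ⟨m, rfl⟩ : ∃ m : ℕ, r = m + 1 := ⟨(r - 1).toNat, by omega⟩
    rw [if_neg (by omega), add_zero]
    simp only [heisFock_pos, map_sum, Derivation.map_smul, Finset.smul_sum]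
    rw [Finset.sum_comm]
    refine Finset.sum_congr rfl fun l _ => Finset.sum_congr rfl fun l' _ => ?_
    rw [smul_comm, pderiv_comm']
where
  pderiv_comm' {x y : I × ℕ} {Q : MvPolynomial (I × ℕ) ℂ} :
      MvPolynomial.pderiv x (MvPolynomial.pderiv y Q) =
        MvPolynomial.pderiv y (MvPolynomial.pderiv x Q) := by
    classical
    ext s
    simp only [MvPolynomial.coeff_pderiv, add_right_comm s]
    rcases eq_or_ne x y with rfl | h
    · rfl
    · simp only [Finsupp.add_apply, Finsupp.single_eq_of_ne h, Finsupp.single_eq_of_ne h.symm]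
      ring

/-- The commutation relations of the Heisenberg algebra. -/
theorem heisFock_commutator (hs : ∀ i j, G i j = G j i) (h h' : ℤ) (i j : I) (p r : ℤ)
    (Q : MvPolynomial (I × ℕ) ℂ) :
    heisFock G h i p (heisFock G h' j r Q) = heisFock G h' j r (heisFock G h i p Q) +
      (if p + r = 0 then ((p : ℂ) * (G i j : ℂ)) • Q else 0) := by
  rcases lt_trichotomy p 0 with hp | hp | hp
  · rcases lt_trichotomy r 0 with hr | hr | hr
    · obtain ⟨n, rfl⟩ : ∃ n : ℕ, p = -n - 1 := ⟨(-p - 1).toNat, by omega⟩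
      obtain ⟨m, rfl⟩ : ∃ m : ℕ, r = -m - 1 := ⟨(-r - 1).toNat, by omega⟩
      rw [if_neg (by omega)]
      simp only [heisFock_neg]; ring
    · subst hr
      rw [if_neg (by omega), heisFock_zero, heisFock_zero, map_smul, add_zero]
    · obtain ⟨m, rfl⟩ : ∃ m : ℕ, r = m + 1 := ⟨(r - 1).toNat, by omega⟩
      rw [heisFock_commutator_aux, hs j i, add_comm p]
      split_ifs with hpr
      · obtain rfl : p = -(m + 1) := by omega
        push_cast
        module
      · abel
  · subst hp
    rw [heisFock_zero, heisFock_zero, map_smul]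
    simp
  · obtain ⟨n, rfl⟩ : ∃ n : ℕ, p = n + 1 := ⟨(p - 1).toNat, by omega⟩
    rw [heisFock_commutator_aux]
    push_cast; rfl

theorem heisMode_commutator (hs : ∀ i j, G i j = G j i) (i j : I) (p r : ℤ) (v : LatticeFock I) :
    heisMode G lam i p (heisMode G lam j r v) = heisMode G lam j r (heisMode G lam i p v) +
      (if p + r = 0 then ((p : ℂ) * (G i j : ℂ)) • v else 0) := by
  ext1 d
  rw [Finsupp.add_apply, heisMode_apply, heisMode_apply, heisMode_apply, heisMode_apply,
    heisFock_commutator hs]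
  congr 1
  split_ifs <;> rfl

/-- The modes of a charged free field: an exponential with creation part `u`, annihilation part
`w`, charge shift `σ`, exponent `κ` and scalar factor `ε`. -/
def expField (u : I → ℂ) (w σ : I → ℤ) (κ : (I → ℤ) → ℤ) (ε : (I → ℤ) → ℂ) (m : ℤ) :
    LatticeFock I →ₗ[ℂ] LatticeFock I :=
  Finsupp.lsum ℂ fun c => Finsupp.lsingle (σ + c) ∘ₗ (ε c • expFock u w (-m - 1 - κ c))

variable {u : I → ℂ} {w σ : I → ℤ} {κ : (I → ℤ) → ℤ} {ε : (I → ℤ) → ℂ}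

theorem expField_single (m : ℤ) (c : I → ℤ) (Q : MvPolynomial (I × ℕ) ℂ) :
    expField u w σ κ ε m (Finsupp.single c Q) =
      Finsupp.single (σ + c) (ε c • expFock u w (-m - 1 - κ c) Q) := by
  simp [expField]

theorem expField_eventually_zero (v : LatticeFock I) :
    ∃ B : ℤ, ∀ m, B ≤ m → expField u w σ κ ε m v = 0 := by
  induction v using Finsupp.induction_linear with
  | zero => exact ⟨0, fun p _ => map_zero _⟩
  | add v w hv hw =>
    obtain ⟨B1, h1⟩ := hv
    obtain ⟨B2, h2⟩ := hw
    exact ⟨max B1 B2, fun p hp => by rw [map_add, h1 p (by omega), h2 p (by omega), add_zero]⟩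
  | single c Q =>
    obtain ⟨B, hB⟩ := expFock_eventually_zero u w Q
    refine ⟨-B - 1 - κ c, fun p hp => ?_⟩
    rw [expField_single, hB _ (by omega), smul_zero, Finsupp.single_zero]

/-- `hw` accounts for the positive modes and `hc` for the zero modes. Source and target weights may
differ, as needed for screenings between different modules. -/
theorem heisMode_expField {lam' : I → ℤ} (hw : ∀ i, (w i : ℂ) = ∑ j, (G i j : ℂ) * u j)
    (hc : ∀ c i, chargePair G lam' (σ + c) i = chargePair G lam c i + w i) (i : I) (p m : ℤ)
    (v : LatticeFock I) : heisMode G lam' i p (expField u w σ κ ε m v) =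
      expField u w σ κ ε m (heisMode G lam i p v) + (w i : ℂ) • expField u w σ κ ε (m + p) v := by
  induction v using Finsupp.induction_linear with
  | zero => simp
  | add v w hv hw => simp only [map_add, hv, hw, smul_add]; abel
  | single c Q =>
    rw [expField_single, expField_single, heisMode_single, heisMode_single, expField_single, hc,
      map_smul, heisFock_expFock (hw i), Finsupp.smul_single, ← Finsupp.single_add]
    congr 1
    rw [smul_add, smul_comm, show -m - 1 - κ c - p = -(m + p) - 1 - κ c by ring]

theorem chargePair_add (c c' : I → ℤ) (i : I) :
    chargePair G lam (c + c') i = chargePair G lam c' i + ∑ j, G i j * c j := by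
  simp only [chargePair, Pi.add_apply, mul_add, Finset.sum_add_distrib]; ring

/-! ### Uniqueness of fields with given Heisenberg charges -/

open Classical in
/-- The Gram matrix is nondegenerate. -/
def GramNondegenerate (G : Matrix I I ℤ) : Prop :=
  ∃ K : I → I → ℂ, ∀ j l, ∑ i, K j i * (G i l : ℂ) = if j = l then 1 else 0

/-- Positive modes are Gram combinations of derivatives and do not see the zero mode, so inverting
the Gram matrix recovers each derivative, with any value of h. -/
theorem pderiv_eq_sum_heisFock {K : I → I → ℂ} [DecidableEq I]
    (hK : ∀ j l, ∑ i, K j i * (G i l : ℂ) = if j = l then 1 else 0) (h : I → ℤ) (j : I) (n : ℕ)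
    (Q : MvPolynomial (I × ℕ) ℂ) : MvPolynomial.pderiv (j, n) Q =
      ∑ i, (K j i / ((n : ℂ) + 1)) • heisFock G (h i) i (n + 1) Q := by
  have hn : (n : ℂ) + 1 ≠ 0 := by exact_mod_cast Nat.succ_ne_zero n
  simp only [heisFock_pos, Finset.smul_sum, smul_smul]
  rw [Finset.sum_comm]
  have : ∀ l i, K j i / ((n : ℂ) + 1) * (((n : ℂ) + 1) * (G i l : ℂ)) = K j i * (G i l : ℂ) := by
    intro l i; field_simp
  simp only [this, ← Finset.sum_smul, hK]
  simp

/-- A set of polynomials closed under partial derivatives whose members have no constant term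
contains only zero. -/
theorem mvPolynomial_eq_zero_of_pderiv_closed {ι : Type*} (U : Set (MvPolynomial ι ℂ))
    (h0 : ∀ u ∈ U, MvPolynomial.constantCoeff u = 0)
    (hU : ∀ u ∈ U, ∀ i, MvPolynomial.pderiv i u ∈ U) : ∀ u ∈ U, u = 0 := by
  classical
  -- Up to a positive integer factor, a coefficient of degree n + 1 is a degree-n coefficient of a
  -- derivative, which lies in U again.
  have key : ∀ (n : ℕ) (s : ι →₀ ℕ), s.degree = n → ∀ u ∈ U, MvPolynomial.coeff s u = 0 := by
    intro n
    induction n with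
    | zero =>
      intro s hs u hu
      rw [(Finsupp.degree_eq_zero_iff s).mp hs]
      exact h0 u hu
    | succ n ih =>
      intro s hs u hu
      obtain ⟨i, hi⟩ : ∃ i, s i ≠ 0 := by
        by_contra hc
        push Not at hc
        have : s = 0 := Finsupp.ext hc
        simp [this] at hs
      have e : s = (s - Finsupp.single i 1) + Finsupp.single i 1 := by
        rw [tsub_add_cancel_of_le]
        simpa [Finsupp.single_le_iff] using Nat.one_le_iff_ne_zero.mpr hi
      have hd : (s - Finsupp.single i 1).degree = n := by
        have := congrArg Finsupp.degree e
        rw [map_add, Finsupp.degree_single, hs] at this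
        omega
      have := ih _ hd _ (hU u hu i)
      rw [MvPolynomial.coeff_pderiv, ← e] at this
      refine (mul_eq_zero.mp this).resolve_right ?_
      exact_mod_cast Nat.succ_ne_zero ((s - (Finsupp.single i 1 : ι →₀ ℕ)) i)
  intro u hu
  ext s
  rw [key s.degree s rfl u hu, MvPolynomial.coeff_zero]

/-- A family of operators that is stable under commutators with the Heisenberg modes vanishes if
its vacuum expectations do. -/
theorem heis_family_eq_zero (hG : GramNondegenerate G) {lam' : I → ℤ} {w₁ w₂ : I → ℂ}
    (F : ℤ → ℤ → LatticeFock I → LatticeFock I)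
    (hadd : ∀ m k v v', F m k (v + v') = F m k v + F m k v')
    (hsmul : ∀ m k (t : ℂ) v, F m k (t • v) = t • F m k v)
    (hcomm : ∀ i p m k v, heisMode G lam' i p (F m k v) =
      F m k (heisMode G lam i p v) + w₁ i • F (m + p) k v + w₂ i • F m (k + p) v)
    (hvac : ∀ m k c d, MvPolynomial.constantCoeff (F m k (Finsupp.single c 1) d) = 0)
    (m k : ℤ) (v : LatticeFock I) : F m k v = 0 := by
  classical
  obtain ⟨K, hK⟩ := hG
  have hzero : ∀ m k, F m k 0 = 0 := fun m k => by
    have := hsmul m k 0 0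
    rwa [zero_smul, zero_smul] at this
  have hground : ∀ c m k, F m k (Finsupp.single c 1) = 0 := by
    intro c m k
    ext1 d
    -- All indices m and k enter the span, because the commutator with a Heisenberg mode shifts
    -- them. Positive modes kill the ground state, so only shifted members of the family remain.
    let U : Submodule ℂ (MvPolynomial (I × ℕ) ℂ) := Submodule.span ℂ
      (Set.range fun mk : ℤ × ℤ => F mk.1 mk.2 (Finsupp.single c 1) d)
    refine mvPolynomial_eq_zero_of_pderiv_closed (U : Set (MvPolynomial (I × ℕ) ℂ)) ?_ ?_ _
      (Submodule.subset_span ⟨(m, k), rfl⟩)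
    · intro u hu
      induction hu using Submodule.span_induction with
      | mem x hx => obtain ⟨⟨m, k⟩, rfl⟩ := hx; exact hvac m k c d
      | zero => exact map_zero _
      | add x y _ _ hx hy => rw [map_add, hx, hy, add_zero]
      | smul t x _ hx => rw [MvPolynomial.smul_eq_C_mul, map_mul, hx, mul_zero]
    · rintro u hu ⟨j, n⟩
      induction hu using Submodule.span_induction with
      | mem x hx =>
        obtain ⟨⟨m, k⟩, rfl⟩ := hx
        rw [pderiv_eq_sum_heisFock hK (fun i => chargePair G lam' d i)]
        refine Submodule.sum_mem _ fun i _ => Submodule.smul_mem _ _ ?_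
        rw [← heisMode_apply, hcomm]
        have := heisMode_natCast_ground (G := G) (lam := lam) i (n + 1) c
        rw [if_neg (by omega)] at this
        push_cast at this
        rw [this, hzero, zero_add]
        exact Submodule.add_mem _ (Submodule.smul_mem _ _ (Submodule.subset_span ⟨(m + (n + 1), k), rfl⟩))
          (Submodule.smul_mem _ _ (Submodule.subset_span ⟨(m, k + (n + 1)), rfl⟩))
      | zero => rw [map_zero]; exact Submodule.zero_mem _
      | add x y _ _ hx hy => rw [map_add]; exact Submodule.add_mem _ hx hy
      | smul t x _ hx => rw [Derivation.map_smul]; exact Submodule.smul_mem _ _ hx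
  induction v using Finsupp.induction_linear with
  | zero => exact hzero m k
  | add v v' hv hv' => rw [hadd, hv, hv', add_zero]
  | single c Q =>
    induction Q using MvPolynomial.induction_on generalizing m k with
    | C a =>
      rw [← mul_one (MvPolynomial.C a), ← MvPolynomial.smul_eq_C_mul, ← Finsupp.smul_single, hsmul,
        hground, smul_zero]
    | add p q hp hq => rw [Finsupp.single_add, hadd, hp, hq, add_zero]
    -- X s is the creation mode of index -s.2 - 1. The commutation rule expresses F on X s · p by
    -- values of F on p at shifted indices, which is why m and k are generalized.
    | mul_X p s hp =>
      have := hcomm s.1 (-s.2 - 1) m k (Finsupp.single c p)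
      rw [hp, hp, hp, heisMode_single, heisFock_neg, map_zero, smul_zero, smul_zero, add_zero,
        add_zero] at this
      rw [mul_comm]
      exact this.symm

end Heisenberg

/-! ### Binomial identities behind locality. -/

theorem cb_sum_alternating (N : ℤ) (R : ℕ) :
    ∑ k ∈ Finset.range (R + 1), (-1 : ℂ) ^ k * cb N (R - k) = cb (N - 1) R := by
  induction R with
  | zero => simp [cb_zero_right]
  | succ R ih =>
    rw [Finset.sum_range_succ']
    have : ∀ k ∈ Finset.range (R + 1), (-1 : ℂ) ^ (k + 1) * cb N (R + 1 - (k + 1)) =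
        -((-1) ^ k * cb N (R - k)) := fun k _ => by
      rw [Nat.add_sub_add_right, pow_succ]; ring
    rw [Finset.sum_congr rfl this, Finset.sum_neg_distrib, ih]
    have := cb_pascal (N - 1) R
    rw [sub_add_cancel] at this
    simp [this]

/-- The logarithmic derivative of (1 + z)^N is N / (1 + z). This form of the recursion matches the
one for `creationCoeff`, which identifies vacuum expectations with binomial coefficients. -/
theorem cb_recursion (N : ℤ) (R : ℕ) : ((R : ℂ) + 1) * cb N (R + 1) =
    N * ∑ k ∈ Finset.range (R + 1), (-1 : ℂ) ^ k * cb N (R - k) := by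
  rw [cb_sum_alternating, cb_succ_mul']

/-- Binomial coefficients with integral lower index. -/
def cbz (n R : ℤ) : ℂ := if 0 ≤ R then cb n R.toNat else 0

theorem cbz_natCast (n : ℤ) (R : ℕ) : cbz n R = cb n R := by simp [cbz]

theorem cbz_of_neg (n : ℤ) {R : ℤ} (h : R < 0) : cbz n R = 0 := if_neg (by omega)

theorem cbz_vandermonde (n N R : ℤ) {L : ℕ} (hL : R < L) :
    ∑ j ∈ Finset.range L, cb n j * cbz N (R - j) = cbz (n + N) R := by
  rcases lt_or_ge R 0 with hR | hR
  · rw [cbz_of_neg _ hR, Finset.sum_eq_zero]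
    intro j _
    rw [cbz_of_neg _ (by omega), mul_zero]
  · obtain ⟨r, rfl⟩ := Int.eq_ofNat_of_zero_le hR
    rw [cbz_natCast, cb_add, Finset.Nat.sum_antidiagonal_eq_sum_range_succ_mk]
    have hs : Finset.range r.succ ⊆ Finset.range L := Finset.range_subset_range.mpr (by omega)
    rw [← Finset.sum_subset hs]
    · refine Finset.sum_congr rfl fun j hj => ?_
      rw [Finset.mem_range] at hj
      rw [← cbz_natCast N (r - j), Nat.cast_sub (by omega)]
    · intro j _ hj
      rw [Finset.mem_range] at hj
      rw [cbz_of_neg _ (by omega), mul_zero]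

theorem cbz_symm {s R : ℤ} (hs : 0 ≤ s) : cbz s R = cbz s (s - R) := by
  obtain ⟨n, rfl⟩ := Int.eq_ofNat_of_zero_le hs
  have big : ∀ R : ℤ, (n : ℤ) < R → cbz n R = 0 := fun R hR => by
    obtain ⟨r, rfl⟩ := Int.eq_ofNat_of_zero_le (show 0 ≤ R by omega)
    rw [cbz_natCast, cb_natCast_of_lt (by omega)]
  rcases lt_or_ge R 0 with hR | hR
  · rw [cbz_of_neg _ hR, big _ (by omega)]
  · rcases lt_or_ge (n : ℤ) R with h | h
    · rw [big _ h, cbz_of_neg _ (by omega)]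
    · obtain ⟨r, rfl⟩ := Int.eq_ofNat_of_zero_le hR
      have hr : r ≤ n := by omega
      rw [← Nat.cast_sub hr, cbz_natCast, cbz_natCast, cb_natCast, cb_natCast, Nat.choose_symm hr]

theorem cbz_neg_succ (t r : ℕ) : (-1 : ℂ) ^ (r : ℤ) * cbz (-t - 1) r = ((t + r).choose r : ℂ) := by
  rw [cbz_natCast, show (-(t : ℤ) - 1) = -((t : ℤ) + 1) by ring, cb_neg,
    show (t : ℤ) + 1 + r - 1 = ((t + r : ℕ) : ℤ) by push_cast; ring, cb_natCast, ← mul_assoc,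
    zpow_natCast, neg_one_pow_mul_self, one_mul]

/-- The binomial identity behind the locality of two exponential fields. -/
theorem cbz_locality {s R R' : ℤ} (h : R + R' = s) :
    (-1 : ℂ) ^ R * cbz s R - (-1) ^ R * cbz s R' = cbz (-R' - 1) (-s - 1) := by
  -- For s ≥ 0 there is no pole, and the identity is the symmetry of binomial coefficients. For s <
  -- 0 the numbers R and R' cannot both be nonnegative, so at most one term on the left survives.
  rcases lt_or_ge s 0 with hs | hs
  · obtain ⟨t, rfl⟩ : ∃ t : ℕ, s = -t - 1 := ⟨(-s - 1).toNat, by omega⟩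
    rw [show -(-(t : ℤ) - 1) - 1 = t by ring, cbz_natCast]
    rcases lt_or_ge R 0 with hR | hR
    · rw [cbz_of_neg _ hR, mul_zero, zero_sub]
      rcases lt_or_ge R' 0 with hR' | hR'
      · obtain ⟨a, ha⟩ : ∃ a : ℕ, -R' - 1 = a := ⟨(-R' - 1).toNat, by omega⟩
        rw [cbz_of_neg _ hR', ha, cb_natCast_of_lt (by omega)]; simp
      · obtain ⟨r, rfl⟩ := Int.eq_ofNat_of_zero_le hR'
        obtain rfl : R = -t - 1 - r := by omega
        have := cbz_neg_succ r t
        rw [cbz_natCast, zpow_natCast] at this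
        have h2 := cbz_neg_succ t r
        rw [zpow_natCast] at h2
        have e : ((r + t).choose t : ℂ) = ((t + r).choose r : ℂ) := by
          rw [add_comm r t, Nat.choose_symm_add]
        rw [e, ← h2] at this
        have h3 := congrArg ((-1 : ℂ) ^ t * ·) this
        simp only [← mul_assoc, neg_one_pow_mul_self, one_mul] at h3
        rw [h3, show (-(t : ℤ) - 1 - r) = -((t + 1 + r : ℕ) : ℤ) by push_cast; ring, zpow_neg,
          zpow_natCast, ← inv_pow]
        norm_num [pow_add]
    · obtain ⟨r, rfl⟩ := Int.eq_ofNat_of_zero_le hR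
      rw [cbz_of_neg _ (show R' < 0 by omega), mul_zero, sub_zero, cbz_neg_succ,
        show -R' - 1 = ((t + r : ℕ) : ℤ) by push_cast; omega, cb_natCast, Nat.choose_symm_add]
  · rw [cbz_of_neg _ (show -s - 1 < 0 by omega), cbz_symm hs, show s - R = R' by omega, sub_self]

/-! ### Vacuum expectations of two exponential fields. -/

section VacuumExpectation

variable {I : Type*} [Fintype I]

theorem expFock_creationVar_mul (u u' : I → ℂ) (w : I → ℤ) (M : ℤ) (k : ℕ)
    (Q : MvPolynomial (I × ℕ) ℂ) : expFock u w M (creationVar u' k * Q) =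
      creationVar u' k * expFock u w M Q - (∑ i, w i * u' i) • expFock u w (M + k + 1) Q := by
  simp only [creationVar, Finset.sum_mul, map_sum, smul_mul_assoc, map_smul, expFock_X_mul,
    smul_sub, Finset.sum_sub_distrib, Finset.sum_smul, smul_smul]
  simp only [mul_comm (u' _)]

/-- Moving the annihilation part past the creation part costs the factor (1 - y/z)^N; this is its
coefficient at y^R. Both sides satisfy `cb_recursion`, and the induction runs for all M because each
step shifts M. -/
theorem constantCoeff_expFock_creationCoeff {u u' : I → ℂ} {w : I → ℤ} {N : ℤ}
    (hN : ∑ i, w i * u' i = (N : ℂ)) (M R : ℤ) :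
    MvPolynomial.constantCoeff (expFock u w M (creationCoeff u' R)) =
      if M + R = 0 then (-1) ^ R * cbz N R else 0 := by
  rcases lt_or_ge R 0 with hR | hR
  · rw [creationCoeff_neg _ hR, cbz_of_neg _ hR]; simp
  obtain ⟨R, rfl⟩ := Int.eq_ofNat_of_zero_le hR
  rw [cbz_natCast, zpow_natCast]
  induction R using Nat.strong_induction_on generalizing M with
  | _ R ih =>
    rcases R with _ | R
    · rw [Nat.cast_zero, creationCoeff_zero, expFock_one, constantCoeff_creationCoeff]
      simp [cb_zero_right]
    · have hR1 : (R : ℂ) + 1 ≠ 0 := by exact_mod_cast Nat.succ_ne_zero R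
      have key := congrArg (fun Q => MvPolynomial.constantCoeff (expFock u w M Q))
        (creationCoeff_succ u' R)
      simp only [map_smul, map_sum, expFock_creationVar_mul, map_sub, map_mul,
        constantCoeff_creationVar, zero_mul, zero_sub, MvPolynomial.constantCoeff_smul,
        smul_eq_mul, hN] at key
      have : ∀ k ∈ Finset.range (R + 1), -((N : ℂ) * MvPolynomial.constantCoeff
          (expFock u w (M + k + 1) (creationCoeff u' (R - k)))) =
          if M + (R + 1 : ℕ) = 0 then (-1) ^ (R + 1) * (N * ((-1 : ℂ) ^ k * cb N (R - k)))
          else 0 := by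
        intro k hk
        rw [Finset.mem_range] at hk
        rw [← Nat.cast_sub (by omega), ih (R - k) (by omega) _ (by omega)]
        have e : M + k + 1 + (R - k : ℕ) = M + (R + 1 : ℕ) := by
          rw [Nat.cast_sub (by omega)]; push_cast; ring
        rw [e]
        split_ifs
        · obtain ⟨d, rfl⟩ : ∃ d, R = d + k := ⟨R - k, by omega⟩
          rw [Nat.add_sub_cancel, pow_succ, pow_add]
          linear_combination (-(N : ℂ) * (-1) ^ d * cb N d) * (1 - neg_one_pow_mul_self k)
        · simp
      rw [Finset.sum_congr rfl this] at key
      push_cast at key ⊢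
      split_ifs at key ⊢ with h
      · rw [← Finset.mul_sum, ← Finset.mul_sum, ← cb_recursion] at key
        apply mul_left_cancel₀ hR1
        rw [key]; ring
      · simpa [hR1] using key

variable {u u' : I → ℂ} {w w' σ σ' : I → ℤ} {κ κ' : (I → ℤ) → ℤ} {ε ε' : (I → ℤ) → ℂ}

theorem expField_ground (m : ℤ) (c : I → ℤ) : expField u w σ κ ε m (Finsupp.single c 1) =
    Finsupp.single (σ + c) (ε c • creationCoeff u (-m - 1 - κ c)) := by
  rw [expField_single, expFock_one]

/-- The vacuum expectation of a product of two exponential fields. -/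
theorem constantCoeff_expField_expField {N : ℤ} (hN : ∑ i, w i * u' i = (N : ℂ)) (m k : ℤ)
    (c d : I → ℤ) :
    MvPolynomial.constantCoeff (expField u w σ κ ε m (expField u' w' σ' κ' ε' k
      (Finsupp.single c 1)) d) =
    if d = σ + (σ' + c) ∧ -m - 1 - κ (σ' + c) + (-k - 1 - κ' c) = 0 then
      ε (σ' + c) * ε' c * ((-1) ^ (-k - 1 - κ' c) * cbz N (-k - 1 - κ' c)) else 0 := by
  classical
  rw [expField_ground, expField_single, map_smul, Finsupp.single_apply]
  by_cases hd : d = σ + (σ' + c)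
  · subst hd
    rw [if_pos rfl, smul_smul, MvPolynomial.smul_eq_C_mul, map_mul,
      constantCoeff_expFock_creationCoeff hN]
    simp
  · rw [if_neg (Ne.symm hd), map_zero, if_neg (fun h => hd h.1)]

end VacuumExpectation

/-! ### Normally ordered products. -/

section NormalOrder

variable {M : Type*} [AddCommGroup M] [Module ℂ M]

/-- The modes of a field: linear operators, eventually zero on each vector. -/
structure IsOpField (F : ℤ → M → M) : Prop where
  add : ∀ n v w, F n (v + w) = F n v + F n w
  smul : ∀ (t : ℂ) n v, F n (t • v) = t • F n v
  truncation : ∀ v, ∃ N : ℤ, ∀ n, N ≤ n → F n v = 0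

namespace IsOpField

variable {F F' H H' : ℤ → M → M} (hF : IsOpField F)
include hF

theorem zero (n : ℤ) : F n 0 = 0 := by
  have := hF.smul 0 n 0
  rwa [zero_smul, zero_smul] at this

/-- The mode as a linear map. -/
def lin (n : ℤ) : M →ₗ[ℂ] M where
  toFun := F n
  map_add' := hF.add n
  map_smul' t v := hF.smul t n v

theorem lin_apply (n : ℤ) (v : M) : hF.lin n v = F n v := rfl

theorem sum {ι : Type*} (s : Finset ι) (n : ℤ) (f : ι → M) :
    F n (∑ i ∈ s, f i) = ∑ i ∈ s, F n (f i) := by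
  rw [← hF.lin_apply, map_sum]; rfl

theorem neg (n : ℤ) (v : M) : F n (-v) = -F n v := by rw [← hF.lin_apply, map_neg]; rfl

theorem eventually_zero (v : M) (n : ℤ) : ∀ᶠ L : ℕ in Filter.atTop, ∀ j : ℕ, L ≤ j →
    F (n + j) v = 0 := by
  obtain ⟨N, hN⟩ := hF.truncation v
  filter_upwards [Filter.eventually_ge_atTop (N - n).toNat] with L hL j hj
  exact hN _ (by omega)

end IsOpField

/-- The modes of the normally ordered product of `∂^n H(z) / n!` and `F(z)`. -/
def normalOrder (n : ℕ) (H F : ℤ → M → M) (m : ℤ) (v : M) : M :=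
  ∑ᶠ j : ℕ, ((n + j).choose j : ℂ) •
    (H (-(n : ℤ) - 1 - j) (F (m + j) v) + ((-1 : ℂ) ^ n) • F (m - n - 1 - j) (H j v))

theorem normalOrder_eq_range {n : ℕ} {H F : ℤ → M → M} {m : ℤ} {v : M} {L : ℕ} (hH : IsOpField H)
    (hF : IsOpField F)
    (h1 : ∀ j : ℕ, L ≤ j → F (m + j) v = 0) (h2 : ∀ j : ℕ, L ≤ j → H j v = 0) :
    normalOrder n H F m v = ∑ j ∈ Finset.range L, ((n + j).choose j : ℂ) •
      (H (-(n : ℤ) - 1 - j) (F (m + j) v) + ((-1 : ℂ) ^ n) • F (m - n - 1 - j) (H j v)) :=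
  finsum_eq_range fun j hj => by rw [h1 j hj, h2 j hj, hH.zero, hF.zero]; simp

theorem eventually_normalOrder_eq_range {H F : ℤ → M → M} (hH : IsOpField H)
    (hF : IsOpField F) (n : ℕ) (m : ℤ) (v : M) : ∀ᶠ L in Filter.atTop,
    normalOrder n H F m v = ∑ j ∈ Finset.range L, ((n + j).choose j : ℂ) •
      (H (-(n : ℤ) - 1 - j) (F (m + j) v) + ((-1 : ℂ) ^ n) • F (m - n - 1 - j) (H j v)) := by
  filter_upwards [hF.eventually_zero v m, hH.eventually_zero v 0] with L h1 h2
  exact normalOrder_eq_range hH hF h1 (by simpa using h2)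

theorem normalOrder_isOpField {n : ℕ} {H F : ℤ → M → M} (hH : IsOpField H) (hF : IsOpField F) :
    IsOpField (normalOrder n H F) where
  add m v w := by
    obtain ⟨L, h1, h2, h3⟩ := ((eventually_normalOrder_eq_range hH hF n m v).and
      ((eventually_normalOrder_eq_range hH hF n m w).and
        (eventually_normalOrder_eq_range hH hF n m (v + w)))).exists
    rw [h1, h2, h3, ← Finset.sum_add_distrib]
    refine Finset.sum_congr rfl fun j _ => ?_
    rw [hF.add, hH.add, hH.add, hF.add]
    module
  smul t m v := by
    obtain ⟨L, h1, h2⟩ := ((eventually_normalOrder_eq_range hH hF n m v).and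
        (eventually_normalOrder_eq_range hH hF n m (t • v))).exists
    rw [h1, h2, Finset.smul_sum]
    refine Finset.sum_congr rfl fun j _ => ?_
    rw [hF.smul, hH.smul, hH.smul, hF.smul]
    module
  truncation v := by
    obtain ⟨B, hB⟩ := hF.truncation v
    obtain ⟨L, hL⟩ := (hH.eventually_zero v 0).exists
    simp only [zero_add] at hL
    choose b hb using fun j : ℕ => hF.truncation (H j v)
    obtain ⟨C, hC⟩ : ∃ C, ∀ j < L, b j ≤ C := by
      obtain ⟨C, hC⟩ := ((Finset.range L).image b).bddAbove
      exact ⟨C, fun j hj => hC (by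
        simpa using ⟨j, hj, rfl⟩)⟩
    refine ⟨max B (C + n + 1 + L), fun m hm => ?_⟩
    rw [normalOrder, finsum_eq_zero_of_forall_eq_zero]
    intro j
    rw [hB _ (by omega), hH.zero]
    rcases lt_or_ge j L with hj | hj
    · rw [hb j _ (by have := hC j hj; omega)]; simp
    · rw [hL j hj, hF.zero]; simp

theorem normalOrder_add {n : ℕ} {H F F' : ℤ → M → M} (hH : IsOpField H)
    (hF : IsOpField F) (hF' : IsOpField F') (m : ℤ) (v : M) :
    normalOrder n H (fun m v => F m v + F' m v) m v =
      normalOrder n H F m v + normalOrder n H F' m v := by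
  obtain ⟨L, h1, h2, h3, h4, h5⟩ := ((eventually_normalOrder_eq_range hH hF n m v).and
    ((eventually_normalOrder_eq_range hH hF' n m v).and ((hF.eventually_zero v m).and
      ((hF'.eventually_zero v m).and (hH.eventually_zero v 0))))).exists
  rw [h1, h2, normalOrder, finsum_eq_range (L := L), ← Finset.sum_add_distrib]
  · refine Finset.sum_congr rfl fun j _ => ?_
    rw [hH.add]
    module
  · intro j hj
    have := h5 j hj
    rw [zero_add] at this
    rw [h3 j hj, h4 j hj, this, hF.zero, hF'.zero, add_zero, hH.zero]; simp

theorem normalOrder_smul {n : ℕ} {H F : ℤ → M → M} (hH : IsOpField H)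
    (t : ℂ) (m : ℤ) (v : M) :
    normalOrder n H (fun m v => t • F m v) m v = t • normalOrder n H F m v := by
  rw [normalOrder, normalOrder, smul_finsum]
  refine finsum_congr fun j => ?_
  rw [hH.smul]
  module

/-- The two halves of normal ordering are the two expansions of (z - w)^(-n-1). Hence the iterate
formula for Heisenberg states holds by construction of the modes. -/
theorem normalOrder_eq_jacobiLHS (n : ℕ) (H F : ℤ → M → M) (m : ℤ) (v : M) :
    normalOrder n H F m v = jacobiLHS H F (-n - 1) 0 m v := by
  refine finsum_congr fun j => ?_
  have h1 : (-1 : ℂ) ^ j * ((Ring.choose (-(n : ℤ) - 1) j : ℤ) : ℂ) = ((n + j).choose j : ℂ) := by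
    have := cbz_neg_succ n j
    rwa [cbz_natCast, zpow_natCast] at this
  have h2 : (-1 : ℂ) ^ (-(n : ℤ) - 1) = -(-1) ^ n := by
    rw [show -(n : ℤ) - 1 = -((n + 1 : ℕ) : ℤ) by push_cast; ring, zpow_neg, zpow_natCast,
      ← inv_pow, pow_succ]
    norm_num
  rw [h1, h2, neg_smul, sub_neg_eq_add, show (0 : ℤ) + (-n - 1) - j = -n - 1 - j by ring,
    show m + (-n - 1) - j = m - n - 1 - j by ring, zero_add]

theorem normalOrder_comm_range {H H' F : ℤ → M → M} (hH : IsOpField H) (hH' : IsOpField H')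
    (hF : IsOpField F) (n n' : ℕ) (m : ℤ) (v : M) : ∀ᶠ L in Filter.atTop,
    normalOrder n H (normalOrder n' H' F) m v =
      ∑ j ∈ Finset.range L, ∑ i ∈ Finset.range L,
        (((n + j).choose j : ℂ) * ((n' + i).choose i : ℂ)) •
        (H (-(n : ℤ) - 1 - j) (H' (-(n' : ℤ) - 1 - i) (F (m + j + i) v)) +
          (-1 : ℂ) ^ n' • H (-(n : ℤ) - 1 - j) (F (m + j - n' - 1 - i) (H' i v)) +
          (-1 : ℂ) ^ n • H' (-(n' : ℤ) - 1 - i) (F (m - n - 1 - j + i) (H j v)) +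
          ((-1 : ℂ) ^ n * (-1 : ℂ) ^ n') • F (m - n - 1 - j - n' - 1 - i) (H' i (H j v))) := by
  have e1 := hH'.eventually_zero v 0
  have e2 := hH.eventually_zero v 0
  simp only [zero_add] at e1 e2
  have e3 : ∀ᶠ L in Filter.atTop, ∀ j i : ℕ, L ≤ j ∨ L ≤ i →
      F (m - n - 1 - j + i) (H j v) = 0 := by
    obtain ⟨L, hL⟩ := e2.exists
    refine eventually_box ⟨L, fun j hj i => by rw [hL j hj, hF.zero]⟩ fun j => ?_
    exact (hF.eventually_zero _ _).exists
  have e4 : ∀ᶠ L in Filter.atTop, ∀ j i : ℕ, L ≤ j ∨ L ≤ i → H' i (H j v) = 0 := by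
    obtain ⟨L, hL⟩ := e2.exists
    refine eventually_box ⟨L, fun j hj i => by rw [hL j hj, hH'.zero]⟩ fun j => ?_
    simpa using (hH'.eventually_zero (H j v) 0).exists
  filter_upwards [eventually_normalOrder_eq_range hH (normalOrder_isOpField (n := n') hH' hF) n m v,
    hF.eventually_zero v m, e1, e2, e3, e4] with L h0 h1 h2 h3 h4 h5
  rw [h0]
  refine Finset.sum_congr rfl fun j _ => ?_
  rw [normalOrder_eq_range (L := L) hH' hF (fun i hi => by
      have := h1 (j + i) (by omega)
      push_cast at this
      rwa [← add_assoc] at this) h2,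
    normalOrder_eq_range (L := L) hH' hF (fun i hi => h4 j i (Or.inr hi))
      (fun i hi => h5 j i (Or.inr hi)), hH.sum, Finset.smul_sum,
    ← Finset.sum_add_distrib, Finset.smul_sum]
  refine Finset.sum_congr rfl fun i _ => ?_
  rw [hH.smul, hH.add, hH.smul]
  module

/-- Normally ordered products with two commuting free fields may be interchanged. -/
theorem normalOrder_comm {H H' F : ℤ → M → M} (hH : IsOpField H) (hH' : IsOpField H')
    (hF : IsOpField F)
    (hneg : ∀ p r, p < 0 → r < 0 → ∀ v, H p (H' r v) = H' r (H p v))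
    (hpos : ∀ p r, 0 ≤ p → 0 ≤ r → ∀ v, H p (H' r v) = H' r (H p v)) (n n' : ℕ) (m : ℤ) (v : M) :
    normalOrder n H (normalOrder n' H' F) m v = normalOrder n' H' (normalOrder n H F) m v := by
  obtain ⟨L, h1, h2⟩ := ((normalOrder_comm_range hH hH' hF n n' m v).and
    (normalOrder_comm_range hH' hH hF n' n m v)).exists
  rw [h1, h2, Finset.sum_comm]
  refine Finset.sum_congr rfl fun i _ => Finset.sum_congr rfl fun j _ => ?_
  rw [hneg _ _ (by omega) (by omega), hpos _ _ (by omega) (by omega),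
    show m + j + i = m + i + j by ring, show m + j - n' - 1 - i = m - n' - 1 - i + j by ring,
    show m - n - 1 - j + i = m + i - n - 1 - j by ring,
    show m - n - 1 - j - n' - 1 - i = m - n' - 1 - i - n - 1 - j by ring]
  module

end NormalOrder

/-! ### The modes of arbitrary lattice states. -/

section LatticeModes

variable {I : Type*} [Fintype I] {G : Matrix I I ℤ} {E : LatticeCocycle G} {lam : I → ℤ}

theorem heisMode_isOpField (i : I) : IsOpField fun m v => heisMode G lam i m v where
  add n := map_add _
  smul t n := map_smul _ t
  truncation v := heisMode_eventually_zero i v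

theorem expMode_eq_expField (γ : I → ℤ) (m : ℤ) : expMode G E lam γ m =
    expField (fun i => (γ i : ℂ)) (fun j => ∑ i, G j i * γ i) γ
      (fun c => ∑ i, γ i * chargePair G lam c i) (fun c => (E.ε γ c : ℂ)) m := rfl

theorem expMode_isOpField (γ : I → ℤ) : IsOpField fun m v => expMode G E lam γ m v where
  add n := map_add _
  smul t n := map_smul _ t
  truncation v := expField_eventually_zero (u := fun i => (γ i : ℂ))
    (w := fun j => ∑ i, G j i * γ i) (σ := γ) (κ := fun c => ∑ i, γ i * chargePair G lam c i)
    (ε := fun c => (E.ε γ c : ℂ)) v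

theorem stateMode_nil (γ : I → ℤ) :
    stateMode G E lam γ [] = fun m v => expMode G E lam γ m v := by
  funext m v; rw [stateMode]

theorem stateMode_cons (γ : I → ℤ) (s : I × ℕ) (L : List (I × ℕ)) :
    stateMode G E lam γ (s :: L) =
      normalOrder s.2 (fun m v => heisMode G lam s.1 m v) (stateMode G E lam γ L) := rfl

theorem stateMode_isOpField (γ : I → ℤ) (L : List (I × ℕ)) :
    IsOpField (stateMode G E lam γ L) := by
  induction L with
  | nil => rw [stateMode_nil]; exact expMode_isOpField γ
  | cons s L ih =>
    rw [stateMode_cons]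
    exact normalOrder_isOpField (heisMode_isOpField s.1) ih

/-- Exchanging two Heisenberg factors only commutes negative modes with negative ones and
nonnegative with nonnegative ones, where the central term vanishes. This makes the choice of a list
for a monomial harmless. -/
theorem stateMode_perm (hs : ∀ i j, G i j = G j i) (γ : I → ℤ) {L L' : List (I × ℕ)}
    (h : L.Perm L') : stateMode G E lam γ L = stateMode G E lam γ L' := by
  induction h with
  | nil => rfl
  | cons s _ ih => rw [stateMode_cons, stateMode_cons, ih]
  | swap s t L =>
    simp only [stateMode_cons]
    funext m v
    refine normalOrder_comm (heisMode_isOpField _) (heisMode_isOpField _)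
      (stateMode_isOpField γ L) ?_ ?_ _ _ m v
    · intro p r hp hr v
      rw [heisMode_commutator hs, if_neg (by omega), add_zero]
    · intro p r hp hr v
      rw [heisMode_commutator hs]
      split_ifs with h
      · obtain rfl : p = 0 := by omega
        simp
      · rw [add_zero]
  | trans _ _ h1 h2 => rw [h1, h2]

/-- The modes of a state as a linear map of the state. -/
def latticeModeLin (G : Matrix I I ℤ) (E : LatticeCocycle G) (lam : I → ℤ) (m : ℤ)
    (v : LatticeFock I) : LatticeFock I →ₗ[ℂ] LatticeFock I :=
  Finsupp.lsum ℂ fun γ => (MvPolynomial.basisMonomials (I × ℕ) ℂ).constr ℂ fun s =>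
    stateMode G E lam γ (Finsupp.toMultiset s).toList m v

/-- Sums over supports hide the linearity in the state; extension from the monomial basis exhibits
it. -/
theorem latticeMode_eq_lin (a : LatticeFock I) (m : ℤ) (v : LatticeFock I) :
    latticeMode G E lam a m v = latticeModeLin G E lam m v a := by
  rw [latticeModeLin, Finsupp.lsum_apply, Finsupp.sum]
  refine Finset.sum_congr rfl fun γ _ => ?_
  rw [Module.Basis.constr_apply]
  rfl

theorem latticeMode_add_left (a a' : LatticeFock I) (m : ℤ) (v : LatticeFock I) :
    latticeMode G E lam (a + a') m v = latticeMode G E lam a m v + latticeMode G E lam a' m v := by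
  simp only [latticeMode_eq_lin, map_add]

theorem latticeMode_smul_left (t : ℂ) (a : LatticeFock I) (m : ℤ) (v : LatticeFock I) :
    latticeMode G E lam (t • a) m v = t • latticeMode G E lam a m v := by
  simp only [latticeMode_eq_lin, map_smul]

theorem latticeMode_zero_left (m : ℤ) (v : LatticeFock I) :
    latticeMode G E lam 0 m v = 0 := by
  simp only [latticeMode_eq_lin, map_zero]

theorem latticeMode_single_monomial (γ : I → ℤ) (s : I × ℕ →₀ ℕ) (m : ℤ) (v : LatticeFock I) :
    latticeMode G E lam (Finsupp.single γ (MvPolynomial.monomial s 1)) m v =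
      stateMode G E lam γ (Finsupp.toMultiset s).toList m v := by
  rw [latticeMode_eq_lin, latticeModeLin, Finsupp.lsum_single,
    show MvPolynomial.monomial s (1 : ℂ) = MvPolynomial.basisMonomials (I × ℕ) ℂ s by simp,
    Module.Basis.constr_basis]

theorem latticeMode_single_one (γ : I → ℤ) (m : ℤ) (v : LatticeFock I) :
    latticeMode G E lam (Finsupp.single γ 1) m v = expMode G E lam γ m v := by
  rw [← MvPolynomial.C_1, ← MvPolynomial.monomial_zero', latticeMode_single_monomial]
  simp [stateMode]

/-- An induction principle for states. -/
theorem latticeFock_induction {P : LatticeFock I → Prop} (h0 : P 0)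
    (hadd : ∀ a b, P a → P b → P (a + b)) (hsmul : ∀ (t : ℂ) a, P a → P (t • a))
    (hone : ∀ γ, P (Finsupp.single γ 1))
    (hX : ∀ γ s Q, P (Finsupp.single γ Q) → P (Finsupp.single γ (MvPolynomial.X s * Q)))
    (a : LatticeFock I) : P a := by
  induction a using Finsupp.induction_linear with
  | zero => exact h0
  | add a b ha hb => exact hadd a b ha hb
  | single γ Q =>
    induction Q using MvPolynomial.induction_on with
    | C t =>
      rw [← mul_one (MvPolynomial.C t), ← MvPolynomial.smul_eq_C_mul, ← Finsupp.smul_single]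
      exact hsmul _ _ (hone γ)
    | add p q hp hq => rw [Finsupp.single_add]; exact hadd _ _ hp hq
    | mul_X p s hp => rw [mul_comm]; exact hX _ _ _ hp

theorem mvPolynomial_induction_monomial {R : MvPolynomial (I × ℕ) ℂ → Prop}
    (hadd : ∀ p q, R p → R q → R (p + q)) (hsmul : ∀ (t : ℂ) p, R p → R (t • p))
    (hmon : ∀ s, R (MvPolynomial.monomial s 1)) (Q : MvPolynomial (I × ℕ) ℂ) : R Q := by
  induction Q using MvPolynomial.induction_on' with
  | monomial s t =>
    have := hsmul t _ (hmon s)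
    rwa [MvPolynomial.smul_monomial, smul_eq_mul, mul_one] at this
  | add p q hp hq => exact hadd p q hp hq

/-- The two claims are proved together: additivity of normal ordering requires its arguments to be
fields. -/
theorem latticeMode_isOpField_and (hs : ∀ i j, G i j = G j i) (γ : I → ℤ) (s : I × ℕ)
    (Q : MvPolynomial (I × ℕ) ℂ) :
    IsOpField (latticeMode G E lam (Finsupp.single γ Q)) ∧
    latticeMode G E lam (Finsupp.single γ (MvPolynomial.X s * Q)) =
      normalOrder s.2 (fun m v => heisMode G lam s.1 m v)
        (latticeMode G E lam (Finsupp.single γ Q)) := by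
  induction Q using mvPolynomial_induction_monomial with
  | hadd p q hp hq =>
    have e : latticeMode G E lam (Finsupp.single γ (p + q)) = fun m v =>
        latticeMode G E lam (Finsupp.single γ p) m v +
          latticeMode G E lam (Finsupp.single γ q) m v := by
      funext m v; rw [Finsupp.single_add, latticeMode_add_left]
    refine ⟨?_, ?_⟩
    · rw [e]
      refine ⟨fun n v w => ?_, fun t n v => ?_, fun v => ?_⟩
      · simp only [hp.1.add, hq.1.add]; abel
      · simp only [hp.1.smul, hq.1.smul, smul_add]
      · obtain ⟨N, hN⟩ := hp.1.truncation v
        obtain ⟨N', hN'⟩ := hq.1.truncation v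
        exact ⟨max N N', fun n hn => by rw [hN n (by omega), hN' n (by omega), add_zero]⟩
    · funext m v
      rw [e, mul_add, Finsupp.single_add, latticeMode_add_left, hp.2, hq.2,
        normalOrder_add (heisMode_isOpField _) hp.1 hq.1]
  | hsmul t p hp =>
    have e : latticeMode G E lam (Finsupp.single γ (t • p)) = fun m v =>
        t • latticeMode G E lam (Finsupp.single γ p) m v := by
      funext m v; rw [← Finsupp.smul_single, latticeMode_smul_left]
    refine ⟨?_, ?_⟩
    · rw [e]
      refine ⟨fun n v w => ?_, fun t n v => ?_, fun v => ?_⟩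
      · simp only [hp.1.add, smul_add]
      · simp only [hp.1.smul]; rw [smul_comm]
      · obtain ⟨N, hN⟩ := hp.1.truncation v
        exact ⟨N, fun n hn => by rw [hN n hn, smul_zero]⟩
    · funext m v
      rw [e, mul_smul_comm, ← Finsupp.smul_single, latticeMode_smul_left, hp.2,
        normalOrder_smul (heisMode_isOpField _)]
  | hmon t =>
    have e : ∀ t, latticeMode G E lam (Finsupp.single γ (MvPolynomial.monomial t 1)) =
        stateMode G E lam γ (Finsupp.toMultiset t).toList :=
      fun t => funext fun m => funext fun v => latticeMode_single_monomial γ t m v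
    refine ⟨by rw [e]; exact stateMode_isOpField _ _, ?_⟩
    rw [MvPolynomial.X, MvPolynomial.monomial_mul, one_mul, e, e, ← stateMode_cons]
    apply stateMode_perm hs
    rw [← Multiset.coe_eq_coe, ← Multiset.cons_coe, Multiset.coe_toList, Multiset.coe_toList,
      map_add, Finsupp.toMultiset_single, one_smul, Multiset.singleton_add]

theorem latticeMode_X_mul (hs : ∀ i j, G i j = G j i) (γ : I → ℤ) (s : I × ℕ)
    (Q : MvPolynomial (I × ℕ) ℂ) :
    latticeMode G E lam (Finsupp.single γ (MvPolynomial.X s * Q)) =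
      normalOrder s.2 (fun m v => heisMode G lam s.1 m v)
        (latticeMode G E lam (Finsupp.single γ Q)) :=
  (latticeMode_isOpField_and hs γ s Q).2

theorem latticeMode_isOpField (hs : ∀ i j, G i j = G j i) (a : LatticeFock I) :
    IsOpField (latticeMode G E lam a) := by
  induction a using Finsupp.induction_linear with
  | zero => exact ⟨fun _ _ _ => by simp [latticeMode_zero_left], fun _ _ _ => by
      simp [latticeMode_zero_left], fun _ => ⟨0, fun _ _ => latticeMode_zero_left _ _⟩⟩
  | add a b ha hb =>
    refine ⟨fun n v w => ?_, fun t n v => ?_, fun v => ?_⟩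
    · simp only [latticeMode_add_left, ha.add, hb.add]; abel
    · simp only [latticeMode_add_left, ha.smul, hb.smul, smul_add]
    · obtain ⟨N, hN⟩ := ha.truncation v
      obtain ⟨N', hN'⟩ := hb.truncation v
      exact ⟨max N N', fun n hn => by
        rw [latticeMode_add_left, hN n (by omega), hN' n (by omega), add_zero]⟩
  | single γ Q =>
    -- `latticeMode_isOpField_and` needs some variable s. In rank zero there is none, but then every
    -- polynomial is a constant.
    rcases isEmpty_or_nonempty I with hI | ⟨⟨i⟩⟩
    · obtain ⟨t, rfl⟩ := MvPolynomial.C_surjective (I × ℕ) Q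
      have e : latticeMode G E lam (Finsupp.single γ (MvPolynomial.C t)) = fun m v =>
          t • expMode G E lam γ m v := by
        funext m v
        rw [← mul_one (MvPolynomial.C t), ← MvPolynomial.smul_eq_C_mul, ← Finsupp.smul_single,
          latticeMode_smul_left, latticeMode_single_one]
      rw [e]
      refine ⟨fun n v w => ?_, fun t n v => ?_, fun v => ?_⟩
      · simp only [map_add, smul_add]
      · simp only [map_smul]; rw [smul_comm]
      · obtain ⟨N, hN⟩ := (expMode_isOpField (G := G) (E := E) (lam := lam) γ).truncation v
        exact ⟨N, fun n hn => by rw [hN n hn, smul_zero]⟩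
    · exact (latticeMode_isOpField_and hs γ (i, 0) Q).1

theorem latticeMode_isFieldMap (hs : ∀ i j, G i j = G j i) :
    IsFieldMap (latticeMode G E lam) where
  add_left := latticeMode_add_left
  smul_left := latticeMode_smul_left
  add_right a := (latticeMode_isOpField hs a).add
  smul_right t a n v := (latticeMode_isOpField hs a).smul t n v
  truncation a := (latticeMode_isOpField hs a).truncation

theorem expFock_zero_zero (N : ℤ) (Q : MvPolynomial (I × ℕ) ℂ) :
    expFock (fun _ : I => (0 : ℂ)) (fun _ => 0) N Q = if N = 0 then Q else 0 := by
  induction Q using MvPolynomial.induction_on with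
  | C t =>
    rw [← mul_one (MvPolynomial.C t), ← MvPolynomial.smul_eq_C_mul, map_smul, expFock_one,
      creationCoeff_zero_left]
    split_ifs <;> simp
  | add p q hp hq => rw [map_add, hp, hq]; split_ifs <;> simp
  | mul_X p s hp =>
    rw [mul_comm, expFock_X_mul, hp]
    split_ifs <;> simp

theorem expMode_zero (m : ℤ) (v : LatticeFock I) :
    expMode G E lam 0 m v = if m = -1 then v else 0 := by
  rw [expMode_eq_expField]
  have e : expField (I := I) (fun i => (((0 : I → ℤ) i : ℤ) : ℂ))
      (fun j => ∑ i, G j i * (0 : I → ℤ) i) 0 (fun c => ∑ i, (0 : I → ℤ) i * chargePair G lam c i)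
      (fun c => (E.ε 0 c : ℂ)) m = if m = -1 then LinearMap.id else 0 := by
    refine Finsupp.lhom_ext fun c Q => ?_
    rw [expField_single]
    simp only [Pi.zero_apply, Int.cast_zero, mul_zero, Finset.sum_const_zero, zero_mul, zero_add,
      E.zero_left, Units.val_one, one_smul, expFock_zero_zero]
    split_ifs with h1 h2 h2
    · rfl
    · omega
    · omega
    · simp
  rw [e]
  split_ifs <;> rfl

theorem latticeMode_vac (m : ℤ) (v : LatticeFock I) :
    latticeMode G E lam (latticeVac I) m v = if m = -1 then v else 0 := by
  rw [latticeVac, latticeMode_single_one, expMode_zero]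

/-- The state `(eᵢ)_{-1} 1`. -/
def heisState (i : I) : LatticeFock I := Finsupp.single 0 (MvPolynomial.X (i, 0))

theorem latticeMode_heisState (hs : ∀ i j, G i j = G j i) (i : I) (m : ℤ) (v : LatticeFock I) :
    latticeMode G E lam (heisState i) m v = heisMode G lam i m v := by
  have e : latticeMode G E lam (Finsupp.single 0 1) = fun m v => if m = -1 then v else 0 :=
    funext fun m => funext fun v => latticeMode_vac m v
  rw [heisState, ← mul_one (MvPolynomial.X (i, 0)), latticeMode_X_mul hs, e, normalOrder]
  simp only [zero_add, Nat.choose_self, Nat.cast_one, one_smul, pow_zero, Nat.cast_zero, neg_zero,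
    zero_sub, sub_zero]
  rcases lt_or_ge m 0 with hm | hm
  · obtain ⟨n, rfl⟩ : ∃ n : ℕ, m = -1 - n := ⟨(-1 - m).toNat, by omega⟩
    rw [finsum_eq_single _ n]
    · rw [if_pos (by ring), if_neg (by omega), add_zero]
    · intro j hj
      rw [if_neg (by omega), if_neg (by omega), map_zero, add_zero]
  · obtain ⟨n, rfl⟩ := Int.eq_ofNat_of_zero_le hm
    rw [finsum_eq_single _ n]
    · rw [if_neg (by omega), if_pos (by omega), map_zero, zero_add]
    · intro j hj
      rw [if_neg (by omega), if_neg (by omega), map_zero, add_zero]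

/-- Iterates of the Heisenberg generators. -/
theorem latticeMode_heisState_neg (hs : ∀ i j, G i j = G j i) (i : I) (n : ℕ) (γ : I → ℤ)
    (Q : MvPolynomial (I × ℕ) ℂ) :
    latticeMode G E lam (heisState i) (-n - 1) (Finsupp.single γ Q) =
      Finsupp.single γ (MvPolynomial.X (i, n) * Q) := by
  rw [latticeMode_heisState hs, heisMode_single, heisFock_neg]

end LatticeModes

/-! ### Commutators of a free field with normally ordered products. -/

section HeisenbergCommutator

variable {M : Type*} [AddCommGroup M] [Module ℂ M]

namespace IsOpField

variable {F : ℤ → M → M}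

theorem const_smul (hF : IsOpField F) (t : ℂ) : IsOpField fun m v => t • F m v where
  add n v w := by rw [hF.add, smul_add]
  smul s n v := by rw [hF.smul, smul_comm]
  truncation v := by
    obtain ⟨N, hN⟩ := hF.truncation v
    exact ⟨N, fun n hn => by rw [hN n hn, smul_zero]⟩

theorem shift (hF : IsOpField F) (s : ℤ) : IsOpField fun m v => F (m + s) v where
  add n v w := hF.add _ v w
  smul t n v := hF.smul t _ v
  truncation v := by
    obtain ⟨N, hN⟩ := hF.truncation v
    exact ⟨N - s, fun n hn => hN _ (by omega)⟩

theorem range_sum {F : ℕ → ℤ → M → M} (hF : ∀ i, IsOpField (F i)) (L : ℕ) :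
    IsOpField fun m v => ∑ i ∈ Finset.range L, F i m v where
  add n v w := by simp only [(hF _).add, Finset.sum_add_distrib]
  smul t n v := by simp only [(hF _).smul, Finset.smul_sum]
  truncation v := by
    induction L with
    | zero => exact ⟨0, fun n _ => by simp⟩
    | succ L ih =>
      obtain ⟨N, hN⟩ := ih
      obtain ⟨N', hN'⟩ := (hF L).truncation v
      exact ⟨max N N', fun n hn => by
        rw [Finset.sum_range_succ, hN n (by omega), hN' n (by omega), add_zero]⟩

end IsOpField

theorem normalOrder_shift (n : ℕ) (H F : ℤ → M → M) (m s : ℤ) (v : M) :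
    normalOrder n H (fun m v => F (m + s) v) m v = normalOrder n H F (m + s) v := by
  refine finsum_congr fun j => ?_
  beta_reduce
  rw [show m + j + s = m + s + j by ring, show m - n - 1 - j + s = m + s - n - 1 - j by ring]

theorem normalOrder_range_sum {n : ℕ} {H : ℤ → M → M} {F : ℕ → ℤ → M → M} (hH : IsOpField H)
    (hF : ∀ i, IsOpField (F i)) (L : ℕ) (m : ℤ) (v : M) :
    normalOrder n H (fun m v => ∑ i ∈ Finset.range L, F i m v) m v =
      ∑ i ∈ Finset.range L, normalOrder n H (F i) m v := by
  induction L with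
  | zero =>
    simp only [Finset.range_zero, Finset.sum_empty, normalOrder, hH.zero]
    simp
  | succ L ih =>
    simp only [Finset.sum_range_succ]
    rw [normalOrder_add hH (IsOpField.range_sum hF L) (hF L), ih]

/-- The scalar contraction term in the commutator of a free field with a normally ordered
product. -/
theorem sum_contraction (F : ℤ → M) (c : ℂ) (n : ℕ) (m k : ℤ) {L : ℕ} (hL : m.natAbs < L) :
    ∑ j ∈ Finset.range L, ((n + j).choose j : ℂ) •
      ((if m + (-(n : ℤ) - 1 - j) = 0 then c • F (k + j) else 0) +
        (-1 : ℂ) ^ n • (if m + j = 0 then c • F (k - n - 1 - j) else 0)) =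
      (c * cb (m - 1) n) • F (k + m - n - 1) := by
  -- For m > 0 only the creation half can contract, at j = m - n - 1, and not at all if m ≤ n, where
  -- binom(m - 1, n) is zero too. For m ≤ 0 only the annihilation half contracts, at j = -m.
  rcases lt_or_ge 0 m with hm | hm
  · rcases lt_or_ge m (n + 1) with hmn | hmn
    · obtain ⟨r, hr⟩ := Int.eq_ofNat_of_zero_le (show 0 ≤ m - 1 by omega)
      rw [hr, cb_natCast_of_lt (by omega), mul_zero, zero_smul, Finset.sum_eq_zero]
      intro j _
      rw [if_neg (by omega), if_neg (by omega)]; simp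
    · obtain ⟨r, rfl⟩ : ∃ r : ℕ, m = n + 1 + r := ⟨(m - n - 1).toNat, by omega⟩
      rw [Finset.sum_eq_single_of_mem r (Finset.mem_range.mpr (by omega))]
      · rw [if_pos (by ring), if_neg (by omega),
          show (n : ℤ) + 1 + r - 1 = ((n + r : ℕ) : ℤ) by push_cast; ring, cb_natCast,
          ← Nat.choose_symm_add, show k + (n + 1 + r) - n - 1 = k + r by ring]
        module
      · intro j _ hj
        rw [if_neg (by omega), if_neg (by omega)]; simp
  · obtain ⟨r, rfl⟩ : ∃ r : ℕ, m = -r := ⟨(-m).toNat, by omega⟩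
    rw [Finset.sum_eq_single_of_mem r (Finset.mem_range.mpr (by omega))]
    · have := cbz_neg_succ r n
      rw [cbz_natCast, zpow_natCast] at this
      have h2 : cb (-(r : ℤ) - 1) n = (-1) ^ n * ((n + r).choose r : ℂ) := by
        rw [← Nat.choose_symm_add, add_comm n r, ← this, ← mul_assoc, neg_one_pow_mul_self,
          one_mul]
      rw [if_neg (by omega), if_pos (by ring), h2, show k + -(r : ℤ) - n - 1 = k - n - 1 - r by ring]
      module
    · intro j _ hj
      rw [if_neg (by omega), if_neg (by omega)]; simp

/-- Leibniz rule: passing F produces K inside the normal ordering, while passing H' produces scalars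
that collapse to a single mode of F by `sum_contraction`. -/
theorem normalOrder_commutator {H H' F K : ℤ → M → M} (hH : IsOpField H) (hH' : IsOpField H')
    (hF : IsOpField F) (hK : IsOpField K) {m : ℤ} {c : ℂ}
    (hc : ∀ r v, H m (H' r v) = H' r (H m v) + if m + r = 0 then c • v else 0)
    (hFK : ∀ q v, H m (F q v) = F q (H m v) + K q v) (n : ℕ) (k : ℤ) (v : M) :
    H m (normalOrder n H' F k v) = normalOrder n H' F k (H m v) + normalOrder n H' K k v +
      (c * cb (m - 1) n) • F (k + m - n - 1) v := by
  obtain ⟨L, h1, h2, h3, hL⟩ := ((eventually_normalOrder_eq_range hH' hF n k v).and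
    ((eventually_normalOrder_eq_range hH' hF n k (H m v)).and
    ((eventually_normalOrder_eq_range hH' hK n k v).and
    (Filter.eventually_gt_atTop m.natAbs)))).exists
  rw [h1, h2, h3, ← sum_contraction (fun q => F q v) c n m k hL, hH.sum,
    ← Finset.sum_add_distrib, ← Finset.sum_add_distrib]
  refine Finset.sum_congr rfl fun j _ => ?_
  have e : F (k - n - 1 - j) (if m + j = 0 then c • v else 0) =
      if m + j = 0 then c • F (k - n - 1 - j) v else 0 := by
    split_ifs
    · rw [hF.smul]
    · rw [hF.zero]
  rw [hH.smul, hH.add, hH.smul, hc, hFK, hFK, hc, hH'.add, hF.add, e]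
  module

end HeisenbergCommutator

/-! ### Linearity of the Borcherds identity in the second state. -/

section AddRight

variable {V M : Type*} [AddCommGroup V] [Module ℂ V] [AddCommGroup M] [Module ℂ M]
variable {Y : V → ℤ → V → V} {YM : V → ℤ → M → M}

theorem Borcherds.add_right (hY : IsFieldMap Y) (hM : IsFieldMap YM) {a b b' : V}
    (h : Borcherds Y YM a b) (h' : Borcherds Y YM a b') : Borcherds Y YM a (b + b') := by
  intro v m k n
  obtain ⟨L1, l1⟩ := hM.jacobiLHS_range a b n m k v
  obtain ⟨L2, l2⟩ := hM.jacobiLHS_range a b' n m k v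
  obtain ⟨L3, l3⟩ := hM.jacobiLHS_range a (b + b') n m k v
  obtain ⟨R1, r1⟩ := hY.jacobiRHS_range hM a b n
  obtain ⟨R2, r2⟩ := hY.jacobiRHS_range hM a b' n
  obtain ⟨R3, r3⟩ := hY.jacobiRHS_range hM a (b + b') n
  have e1 := h v m k n
  have e2 := h' v m k n
  rw [l1 (L1 + L2 + L3) (by omega), r1 (R1 + R2 + R3) (by omega)] at e1
  rw [l2 (L1 + L2 + L3) (by omega), r2 (R1 + R2 + R3) (by omega)] at e2
  rw [l3 (L1 + L2 + L3) (by omega), r3 (R1 + R2 + R3) (by omega)]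
  simp only [hY.add_right, hM.add_left, hM.add_right, smul_add, smul_sub,
    Finset.sum_add_distrib, Finset.sum_sub_distrib] at e1 e2 ⊢
  rw [← e1, ← e2]; abel

theorem Borcherds.zero_right (hY : IsFieldMap Y) (hM : IsFieldMap YM) (a : V) :
    Borcherds Y YM a 0 := by
  intro v m k n
  simp [jacobiLHS, jacobiRHS, hY.zero_right, hM.zero_left, hM.zero_right]

end AddRight

/-! ### The Borcherds identity for Heisenberg states. -/

section LatticeHeisenberg

variable {I : Type*} [Fintype I] {G : Matrix I I ℤ} {E : LatticeCocycle G} {lam : I → ℤ}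

theorem chargePair_zero (c : I → ℤ) (i : I) : chargePair G 0 c i = ∑ j, G i j * c j := by
  simp [chargePair]

theorem chargePair_add_charge (γ c : I → ℤ) (i : I) :
    chargePair G lam (γ + c) i = chargePair G lam c i + ∑ j, G i j * γ j := chargePair_add γ c i

theorem heisMode_expMode (i : I) (p m : ℤ) (γ : I → ℤ) (v : LatticeFock I) :
    heisMode G lam i p (expMode G E lam γ m v) = expMode G E lam γ m (heisMode G lam i p v) +
      (chargePair G 0 γ i : ℂ) • expMode G E lam γ (m + p) v := by
  rw [chargePair_zero]
  exact heisMode_expField (fun i => by push_cast; rfl) (fun c i => chargePair_add _ _ _) i p m v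

theorem jacobiRHS_heisState_add (hs : ∀ i j, G i j = G j i) (i : I) (a b : LatticeFock I)
    (m k : ℤ) (v : LatticeFock I) :
    jacobiRHS (latticeMode G E 0) (latticeMode G E lam) (heisState i) (a + b) 0 m k v =
      jacobiRHS (latticeMode G E 0) (latticeMode G E lam) (heisState i) a 0 m k v +
      jacobiRHS (latticeMode G E 0) (latticeMode G E lam) (heisState i) b 0 m k v := by
  have hY := latticeMode_isFieldMap (E := E) (lam := 0) hs
  have hM := latticeMode_isFieldMap (E := E) (lam := lam) hs
  obtain ⟨R1, r1⟩ := hY.jacobiRHS_range hM (heisState i) a 0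
  obtain ⟨R2, r2⟩ := hY.jacobiRHS_range hM (heisState i) b 0
  obtain ⟨R3, r3⟩ := hY.jacobiRHS_range hM (heisState i) (a + b) 0
  rw [r1 (R1 + R2 + R3) (by omega), r2 (R1 + R2 + R3) (by omega), r3 (R1 + R2 + R3) (by omega)]
  simp only [hY.add_right, hM.add_left, smul_add, Finset.sum_add_distrib]

theorem heisMode_natCast_mul_X (hs : ∀ i j, G i j = G j i) (i : I) (t : ℕ) (γ : I → ℤ)
    (s : I × ℕ) (Q : MvPolynomial (I × ℕ) ℂ) :
    heisMode G 0 i t (Finsupp.single γ (MvPolynomial.X s * Q)) =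
      heisMode G 0 s.1 (-s.2 - 1) (heisMode G 0 i t (Finsupp.single γ Q)) +
        if t = s.2 + 1 then ((t : ℂ) * (G i s.1 : ℂ)) • Finsupp.single γ Q else 0 := by
  have : Finsupp.single γ (MvPolynomial.X s * Q) =
      heisMode G 0 s.1 (-s.2 - 1) (Finsupp.single γ Q) := by
    rw [heisMode_single, heisFock_neg]
  rw [this, heisMode_commutator hs]
  congr 1
  split_ifs <;> first | omega | rfl

/-- The commutator formula for a free field and an arbitrary field. -/
theorem latticeMode_heisState_commutator (hs : ∀ i j, G i j = G j i) (i : I) (b : LatticeFock I)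
    (m k : ℤ) (v : LatticeFock I) :
    heisMode G lam i m (latticeMode G E lam b k v) = latticeMode G E lam b k (heisMode G lam i m v) +
      jacobiRHS (latticeMode G E 0) (latticeMode G E lam) (heisState i) b 0 m k v := by
  have hY := latticeMode_isFieldMap (E := E) (lam := 0) hs
  have hM := latticeMode_isFieldMap (E := E) (lam := lam) hs
  induction b using latticeFock_induction generalizing m k v with
  | h0 =>
    simp [latticeMode_zero_left, jacobiRHS, hY.zero_right]
  | hadd a b ha hb =>
    rw [jacobiRHS_heisState_add hs, latticeMode_add_left, latticeMode_add_left, map_add, ha, hb]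
    abel
  | hsmul t a ha =>
    obtain ⟨R1, r1⟩ := hY.jacobiRHS_range hM (heisState i) a 0
    obtain ⟨R2, r2⟩ := hY.jacobiRHS_range hM (heisState i) (t • a) 0
    rw [latticeMode_smul_left, latticeMode_smul_left, map_smul, ha, r1 (R1 + R2) (by omega),
      r2 (R1 + R2) (by omega), smul_add, Finset.smul_sum]
    simp only [hY.smul_right, hM.smul_left]
    congr 1
    exact Finset.sum_congr rfl fun _ _ => smul_comm _ _ _
  | hone γ =>
    rw [latticeMode_single_one, heisMode_expMode, latticeMode_single_one, jacobiRHS,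
      finsum_eq_single _ 0]
    · have := heisMode_natCast_ground (G := G) (lam := 0) i 0 γ
      rw [Nat.cast_zero, if_pos rfl] at this
      rw [Nat.cast_zero, add_zero, latticeMode_heisState hs, this, latticeMode_smul_left,
        latticeMode_single_one, sub_zero]
      simp [add_comm k m]
    · intro j hj
      rw [zero_add, latticeMode_heisState hs, heisMode_natCast_ground, if_neg hj,
        latticeMode_zero_left, smul_zero]
  | hX γ s Q ih =>
    obtain ⟨R1, r1⟩ := hY.jacobiRHS_range hM (heisState i) (Finsupp.single γ Q) 0
    obtain ⟨R2, r2⟩ := hY.jacobiRHS_range hM (heisState i)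
      (Finsupp.single γ (MvPolynomial.X s * Q)) 0
    obtain ⟨L, hL1, hL2, hL3⟩ : ∃ L, R1 ≤ L ∧ R2 ≤ L ∧ s.2 + 1 < L :=
      ⟨R1 + R2 + s.2 + 2, by omega, by omega, by omega⟩
    let T : ℕ → ℤ → LatticeFock I → LatticeFock I := fun t q v =>
        cb m t • latticeMode G E lam (heisMode G 0 i t (Finsupp.single γ Q)) (q + (m - t)) v
    have hop : ∀ t : ℕ, IsOpField (T t) :=
      fun t => ((latticeMode_isOpField hs _).shift _).const_smul _
    have hFK : ∀ q v, heisMode G lam i m (latticeMode G E lam (Finsupp.single γ Q) q v) =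
        latticeMode G E lam (Finsupp.single γ Q) q (heisMode G lam i m v) +
        ∑ t ∈ Finset.range L, T t q v := by
      intro q v
      refine (ih m q v).trans (congrArg _ ((r1 L hL1 m q v).trans ?_))
      refine Finset.sum_congr rfl fun t _ => ?_
      rw [zero_add, latticeMode_heisState hs, show m + q - t = q + (m - t) by ring]
    have hcomm := normalOrder_commutator (H := fun m v => heisMode G lam i m v)
      (H' := fun m v => heisMode G lam s.1 m v)
      (F := latticeMode G E lam (Finsupp.single γ Q)) (K := fun q v => ∑ t ∈ Finset.range L, T t q v)
      (heisMode_isOpField i) (heisMode_isOpField s.1) (latticeMode_isOpField hs _)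
      (IsOpField.range_sum hop L) (m := m) (c := (m : ℂ) * G i s.1)
      (fun r v => heisMode_commutator hs i s.1 m r v) hFK s.2 k v
    rw [normalOrder_range_sum (heisMode_isOpField _) hop] at hcomm
    rw [latticeMode_X_mul hs, hcomm, add_assoc]
    congr 1
    rw [r2 L hL2]
    -- Each product of eᵢ with X s · Q is X s times its product with Q, except for one contraction
    -- at t = s.2 + 1. That term matches the contraction term of `normalOrder_commutator`.
    have key : ∀ t ∈ Finset.range L, cb m t • latticeMode G E lam (latticeMode G E 0 (heisState i)
        (0 + t) (Finsupp.single γ (MvPolynomial.X s * Q))) (m + k - t) v =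
        normalOrder s.2 (fun m v => heisMode G lam s.1 m v) (T t) k v +
        if t = s.2 + 1 then (cb m t * ((t : ℂ) * (G i s.1 : ℂ))) •
          latticeMode G E lam (Finsupp.single γ Q) (m + k - t) v else 0 := by
      intro t _
      rw [zero_add, latticeMode_heisState hs, heisMode_natCast_mul_X hs, latticeMode_add_left,
        smul_add]
      simp only [T]
      rw [normalOrder_smul (heisMode_isOpField _), normalOrder_shift, heisMode_single,
        heisMode_single, heisFock_neg, latticeMode_X_mul hs, show k + (m - t) = m + k - t by ring]
      congr 1
      split_ifs
      · rw [latticeMode_smul_left, smul_smul]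
      · rw [latticeMode_zero_left, smul_zero]
    rw [Finset.sum_congr rfl key, Finset.sum_add_distrib]
    congr 1
    rw [Finset.sum_ite_eq' (Finset.range L) (s.2 + 1), if_pos (Finset.mem_range.mpr (by omega))]
    have e := cb_succ_mul' m s.2
    push_cast
    rw [show k + m - s.2 - 1 = m + k - (s.2 + 1) by ring]
    congr 1
    linear_combination (-(G i s.1 : ℂ)) * e

/-- The base level is N = 0: there the identity is the commutator formula, and for negative n the
iterate formula is the definition of normal ordering. -/
theorem borcherds_heisState (hs : ∀ i j, G i j = G j i) (i : I) (b : LatticeFock I) :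
    Borcherds (latticeMode G E 0) (latticeMode G E lam) (heisState i) b := by
  have hY := latticeMode_isFieldMap (E := E) (lam := 0) hs
  have hM := latticeMode_isFieldMap (E := E) (lam := lam) hs
  induction b using Finsupp.induction_linear with
  | zero => exact Borcherds.zero_right hY hM _
  | add a b ha hb => exact Borcherds.add_right hY hM ha hb
  | single γ Q =>
    have e : latticeMode G E lam (heisState i) = fun m v => heisMode G lam i m v :=
      funext fun m => funext fun v => latticeMode_heisState hs i m v
    refine hY.borcherds_of_base hM 0 (fun m k v => ?_) fun n hn k v => ?_
    · rw [jacobiLHS_zero, latticeMode_heisState hs, latticeMode_heisState hs,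
        latticeMode_heisState_commutator hs, add_sub_cancel_left]
    · obtain ⟨p, rfl⟩ : ∃ p : ℕ, n = -p - 1 := ⟨(-n - 1).toNat, by omega⟩
      rw [latticeMode_heisState_neg hs, latticeMode_X_mul hs, normalOrder_eq_jacobiLHS, e]

end LatticeHeisenberg

/-! ### Heisenberg covariance of the left-hand side of the identity. -/

section JacobiCommutator

variable {V M : Type*} [AddCommGroup V] [Module ℂ V] [AddCommGroup M] [Module ℂ M]

theorem IsOpField.jacobiLHS_range {A B : ℤ → M → M} (hA : IsOpField A) (hB : IsOpField B)
    (n m k : ℤ) (v : M) : ∀ᶠ L in Filter.atTop, jacobiLHS A B n m k v =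
      ∑ j ∈ Finset.range L, ((-1 : ℂ) ^ j * cb n j) •
      (A (m + n - j) (B (k + j) v) - ((-1 : ℂ) ^ n) • B (k + n - j) (A (m + j) v)) := by
  filter_upwards [hB.eventually_zero v k, hA.eventually_zero v m] with L h1 h2
  exact jacobiLHS_eq_range (fun j hj => by rw [h1 j hj, hA.zero])
    (fun j hj => by rw [h2 j hj, hB.zero])

theorem jacobiLHS_commutator {A B H : ℤ → M → M} (hA : IsOpField A) (hB : IsOpField B)
    (hH : IsOpField H) {w₁ w₂ : ℂ}
    (h1 : ∀ p m v, H p (A m v) = A m (H p v) + w₁ • A (m + p) v)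
    (h2 : ∀ p m v, H p (B m v) = B m (H p v) + w₂ • B (m + p) v) (p n m k : ℤ) (v : M) :
    H p (jacobiLHS A B n m k v) = jacobiLHS A B n m k (H p v) +
      w₁ • jacobiLHS A B n (m + p) k v + w₂ • jacobiLHS A B n m (k + p) v := by
  obtain ⟨L, e1, e2, e3, e4⟩ := ((hA.jacobiLHS_range hB n m k v).and
    ((hA.jacobiLHS_range hB n m k (H p v)).and ((hA.jacobiLHS_range hB n (m + p) k v).and
      (hA.jacobiLHS_range hB n m (k + p) v)))).exists
  rw [e1, e2, e3, e4, hH.sum, Finset.smul_sum, Finset.smul_sum, ← Finset.sum_add_distrib,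
    ← Finset.sum_add_distrib]
  refine Finset.sum_congr rfl fun j _ => ?_
  rw [hH.smul, sub_eq_add_neg, hH.add, hH.neg, hH.smul, h1, h2, h2, h1, hA.add, hA.smul, hB.add,
    hB.smul, show m + n - j + p = m + p + n - j by ring, show k + j + p = k + p + j by ring,
    show k + n - j + p = k + p + n - j by ring, show m + j + p = m + p + j by ring]
  module

end JacobiCommutator

/-! ### Vacuum expectations for exponential states and their products. -/

section LatticeExponential

variable {I : Type*} [Fintype I] {G : Matrix I I ℤ} {E : LatticeCocycle G} {lam : I → ℤ}

/-- The integer `(γ, λ + c)`. -/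
def chargeExp (G : Matrix I I ℤ) (lam γ c : I → ℤ) : ℤ := ∑ i, γ i * chargePair G lam c i

theorem chargeExp_add (γ δ c : I → ℤ) :
    chargeExp G lam γ (δ + c) = chargeExp G lam γ c + latPair G γ δ := by
  simp only [chargeExp, latPair, chargePair_add_charge, mul_add, Finset.sum_add_distrib,
    Finset.mul_sum, mul_assoc]

theorem chargeExp_add_left (γ δ c : I → ℤ) :
    chargeExp G lam (γ + δ) c = chargeExp G lam γ c + chargeExp G lam δ c := by
  simp only [chargeExp, Pi.add_apply, add_mul, Finset.sum_add_distrib]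

theorem latPair_comm (hs : ∀ i j, G i j = G j i) (γ δ : I → ℤ) :
    latPair G γ δ = latPair G δ γ := by
  rw [latPair, latPair, Finset.sum_comm]
  refine Finset.sum_congr rfl fun i _ => Finset.sum_congr rfl fun j _ => ?_
  rw [hs]; ring

theorem chargeExp_zero (γ δ : I → ℤ) : chargeExp G 0 γ δ = latPair G γ δ := by
  simp only [chargeExp, latPair, chargePair_zero, Finset.mul_sum, mul_assoc]

theorem sum_gram_mul_eq_latPair (hs : ∀ i j, G i j = G j i) (γ δ : I → ℤ) :
    ∑ i, ((∑ j, G i j * γ j : ℤ) : ℂ) * (δ i : ℂ) = (latPair G γ δ : ℂ) := by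
  rw [latPair_comm hs, latPair]
  push_cast
  refine Finset.sum_congr rfl fun i _ => ?_
  rw [Finset.sum_mul]
  exact Finset.sum_congr rfl fun j _ => by ring

theorem expMode_ground (γ c : I → ℤ) (m : ℤ) : expMode G E lam γ m (Finsupp.single c 1) =
    Finsupp.single (γ + c) ((E.ε γ c : ℂ) •
      creationCoeff (fun i => (γ i : ℂ)) (-m - 1 - chargeExp G lam γ c)) := expField_ground _ _

theorem constantCoeff_expMode_expMode (hs : ∀ i j, G i j = G j i) (γ δ : I → ℤ) (m k : ℤ)
    (c d : I → ℤ) :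
    MvPolynomial.constantCoeff (expMode G E lam γ m (expMode G E lam δ k
      (Finsupp.single c 1)) d) =
    if d = γ + (δ + c) ∧ -m - 1 - chargeExp G lam γ c - latPair G γ δ +
        (-k - 1 - chargeExp G lam δ c) = 0 then
      (E.ε γ (δ + c) * E.ε δ c : ℂ) * ((-1) ^ (-k - 1 - chargeExp G lam δ c) *
        cbz (latPair G γ δ) (-k - 1 - chargeExp G lam δ c)) else 0 := by
  have := constantCoeff_expField_expField (u := fun i => (γ i : ℂ)) (u' := fun i => (δ i : ℂ))
    (w := fun j => ∑ i, G j i * γ i) (w' := fun j => ∑ i, G j i * δ i) (σ := γ) (σ' := δ)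
    (κ := chargeExp G lam γ) (κ' := chargeExp G lam δ) (ε := fun c => (E.ε γ c : ℂ))
    (ε' := fun c => (E.ε δ c : ℂ)) (sum_gram_mul_eq_latPair hs γ δ) m k c d
  rw [chargeExp_add, ← sub_sub] at this
  exact this

/-- Creation modes leave no constant term, and on a ground state only the zero mode in the
annihilation half survives. -/
theorem constantCoeff_normalOrder_heis {F : ℤ → LatticeFock I → LatticeFock I} (hF : IsOpField F)
    (i : I) (k : ℕ) (q : ℤ) (c d : I → ℤ) :
    MvPolynomial.constantCoeff (normalOrder k (fun m v => heisMode G lam i m v) F q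
      (Finsupp.single c 1) d) = (-1) ^ k * chargePair G lam c i *
      MvPolynomial.constantCoeff (F (q - k - 1) (Finsupp.single c 1) d) := by
  obtain ⟨L, h1, h2⟩ := ((eventually_normalOrder_eq_range (heisMode_isOpField (G := G) (lam := lam)
    i) hF k q (Finsupp.single c 1)).and (Filter.eventually_gt_atTop 0)).exists
  rw [h1, Finsupp.finsetSum_apply, map_sum,
    Finset.sum_eq_single_of_mem 0 (Finset.mem_range.mpr h2)]
  · rw [heisMode_natCast_ground, if_pos rfl, hF.smul, Finsupp.smul_apply, Finsupp.add_apply,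
      heisMode_apply, show -(k : ℤ) - 1 - (0 : ℕ) = -k - 1 by simp, heisFock_neg]
    simp [MvPolynomial.constantCoeff_smul, mul_assoc]
  · intro j _ hj
    rw [heisMode_natCast_ground, if_neg hj, hF.zero, smul_zero, add_zero, Finsupp.smul_apply,
      heisMode_apply, show -(k : ℤ) - 1 - j = -((k + j : ℕ) : ℤ) - 1 by push_cast; ring,
      heisFock_neg, MvPolynomial.constantCoeff_smul, map_mul, MvPolynomial.constantCoeff_X]
    simp

theorem constantCoeff_creationVar_state (hs : ∀ i j, G i j = G j i) (u : I → ℂ) (γ c d : I → ℤ)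
    (k : ℕ) (Q : MvPolynomial (I × ℕ) ℂ) (q : ℤ) :
    MvPolynomial.constantCoeff (latticeMode G E lam (Finsupp.single γ (creationVar u k * Q)) q
      (Finsupp.single c 1) d) = (-1) ^ k * (∑ i, u i * chargePair G lam c i) *
    MvPolynomial.constantCoeff (latticeMode G E lam (Finsupp.single γ Q) (q - k - 1)
      (Finsupp.single c 1) d) := by
  simp only [latticeMode_eq_lin, creationVar, Finset.sum_mul, smul_mul_assoc]
  rw [show Finsupp.single γ (∑ i, u i • (MvPolynomial.X (i, k) * Q)) =
    ∑ i, u i • Finsupp.single γ (MvPolynomial.X (i, k) * Q) by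
      rw [← Finsupp.lsingle_apply (R := ℂ), map_sum]; simp, map_sum, Finsupp.finsetSum_apply,
    map_sum, Finset.mul_sum, Finset.sum_mul]
  refine Finset.sum_congr rfl fun i _ => ?_
  rw [map_smul, ← latticeMode_eq_lin, ← latticeMode_eq_lin, latticeMode_X_mul hs,
    Finsupp.smul_apply, MvPolynomial.constantCoeff_smul,
    constantCoeff_normalOrder_heis (latticeMode_isOpField hs _), smul_eq_mul]
  ring

/-- On constant terms every Heisenberg factor acts through its zero mode, so `creationCoeff_succ`
turns into `cb_recursion` with exponent K, the pairing of u with the charge. -/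
theorem constantCoeff_creationCoeff_state (hs : ∀ i j, G i j = G j i) {u : I → ℂ} {K : ℤ}
    (γ c d : I → ℤ) (hK : ∑ i, u i * (chargePair G lam c i : ℂ) = K) (R q : ℤ) :
    MvPolynomial.constantCoeff (latticeMode G E lam (Finsupp.single γ (creationCoeff u R)) q
      (Finsupp.single c 1) d) =
    if d = γ + c ∧ q - R = -1 - chargeExp G lam γ c then (E.ε γ c : ℂ) * cbz K R else 0 := by
  classical
  rcases lt_or_ge R 0 with hR | hR
  · rw [creationCoeff_neg _ hR, cbz_of_neg _ hR, Finsupp.single_zero, latticeMode_zero_left]; simp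
  obtain ⟨R, rfl⟩ := Int.eq_ofNat_of_zero_le hR
  rw [cbz_natCast]
  induction R using Nat.strong_induction_on generalizing q with
  | _ R ih =>
    rcases R with _ | R
    · rw [Nat.cast_zero, creationCoeff_zero, latticeMode_single_one, expMode_ground,
        Finsupp.single_apply]
      by_cases hd : d = γ + c
      · rw [if_pos hd.symm, MvPolynomial.constantCoeff_smul, constantCoeff_creationCoeff,
          cb_zero_right]
        by_cases hq : q = -1 - chargeExp G lam γ c
        · rw [if_pos (by omega), if_pos ⟨hd, by omega⟩]; rfl
        · rw [if_neg (by omega), if_neg (fun h => hq (by omega)), smul_zero]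
      · rw [if_neg (Ne.symm hd), if_neg (fun h => hd h.1), map_zero]
    · have hR1 : (R : ℂ) + 1 ≠ 0 := by exact_mod_cast Nat.succ_ne_zero R
      have key := congrArg (fun Q => MvPolynomial.constantCoeff
        (latticeMode G E lam (Finsupp.single γ Q) q (Finsupp.single c 1) d))
        (creationCoeff_succ u R)
      rw [← Finsupp.smul_single, latticeMode_smul_left, Finsupp.smul_apply,
        MvPolynomial.constantCoeff_smul, smul_eq_mul, latticeMode_eq_lin _ q,
        latticeMode_eq_lin _ q, Finsupp.single_finsetSum, map_sum, Finsupp.finsetSum_apply, map_sum] at key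
      have : ∀ k ∈ Finset.range (R + 1), MvPolynomial.constantCoeff
          (latticeModeLin G E lam q (Finsupp.single c 1) (Finsupp.single γ
            (creationVar u k * creationCoeff u (R - k))) d) =
          if d = γ + c ∧ q - (R + 1 : ℕ) = -1 - chargeExp G lam γ c then
            (E.ε γ c : ℂ) * (K * ((-1 : ℂ) ^ k * cb K (R - k))) else 0 := by
        intro k hk
        rw [Finset.mem_range] at hk
        rw [← latticeMode_eq_lin, constantCoeff_creationVar_state hs, hK,
          ← Nat.cast_sub (by omega), ih (R - k) (by omega) _ (by omega)]
        have e : q - k - 1 - (R - k : ℕ) = q - (R + 1 : ℕ) := by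
          rw [Nat.cast_sub (by omega)]; push_cast; ring
        rw [e]
        split_ifs
        · ring
        · simp
      rw [Finset.sum_congr rfl this] at key
      push_cast at key ⊢
      apply mul_left_cancel₀ hR1
      rw [latticeMode_eq_lin, key]
      split_ifs with h
      · rw [← Finset.mul_sum, ← Finset.mul_sum, ← cb_recursion]; ring
      · simp

theorem sum_cast_mul_chargePair (γ c : I → ℤ) :
    ∑ i, (γ i : ℂ) * (chargePair G lam c i : ℂ) = (chargeExp G lam γ c : ℂ) := by
  simp [chargeExp]

theorem expState_product (γ δ : I → ℤ) (n : ℤ) :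
    latticeMode G E 0 (Finsupp.single γ 1) n (Finsupp.single δ 1) =
      (E.ε γ δ : ℂ) • Finsupp.single (γ + δ)
        (creationCoeff (fun i => (γ i : ℂ)) (-n - 1 - latPair G γ δ)) := by
  rw [latticeMode_single_one, expMode_ground, chargeExp_zero, Finsupp.smul_single]

theorem constantCoeff_expState_product (hs : ∀ i j, G i j = G j i) (γ δ c d : I → ℤ) (n q : ℤ) :
    MvPolynomial.constantCoeff (latticeMode G E lam
      (latticeMode G E 0 (Finsupp.single γ 1) n (Finsupp.single δ 1)) q (Finsupp.single c 1) d) =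
    if d = γ + (δ + c) ∧ q + n + 1 + latPair G γ δ =
        -1 - chargeExp G lam γ c - chargeExp G lam δ c then
      (E.ε γ δ * E.ε (γ + δ) c : ℂ) * cbz (chargeExp G lam γ c) (-n - 1 - latPair G γ δ)
    else 0 := by
  rw [expState_product, latticeMode_smul_left, Finsupp.smul_apply,
    MvPolynomial.constantCoeff_smul, constantCoeff_creationCoeff_state hs _ _ _
      (sum_cast_mul_chargePair γ c), chargeExp_add_left, smul_eq_mul, add_assoc γ δ c]
  by_cases h : d = γ + (δ + c) ∧ q + n + 1 + latPair G γ δ =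
        -1 - chargeExp G lam γ c - chargeExp G lam δ c
  · rw [if_pos h, if_pos ⟨h.1, by omega⟩, mul_assoc]
  · rw [if_neg h, if_neg (fun h' => h ⟨h'.1, by omega⟩), mul_zero]

end LatticeExponential

/-! ### The Borcherds identity for exponentials, and the lattice vertex algebra. -/

section LatticeBorcherds

variable {I : Type*} [Fintype I] {G : Matrix I I ℤ} {E : LatticeCocycle G} {lam : I → ℤ}

theorem sum_range_cb_convolution {M : Type*} [AddCommGroup M] [Module ℂ M] {g : ℕ → M} {L : ℕ}
    (p q : ℤ) (h : ∀ r, L ≤ r → g r = 0) :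
    ∑ i ∈ Finset.range L, ∑ j ∈ Finset.range L, (cb p i * cb q j) • g (i + j) =
    ∑ r ∈ Finset.range L, cb (p + q) r • g r := by
  have := sum_range_vandermonde (g := fun r => (-1 : ℂ) ^ r • g r) p q
    (fun r hr => by rw [h r hr, smul_zero]) (L := L)
  simp only [smul_smul] at this
  convert this using 1
  · refine Finset.sum_congr rfl fun i _ => Finset.sum_congr rfl fun j _ => ?_
    congr 1
    rw [pow_add]
    linear_combination (-(cb p i * cb q j)) * (neg_one_pow_mul_self i) -
      (cb p i * cb q j) * ((-1) ^ i * (-1) ^ i) * (neg_one_pow_mul_self j)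
  · refine Finset.sum_congr rfl fun i _ => ?_
    congr 1
    linear_combination (-(cb (p + q) i)) * (neg_one_pow_mul_self i)

theorem heisMode_expState_product (i : I) (t : ℕ) (γ δ : I → ℤ) (n : ℤ) :
    heisMode G 0 i t (latticeMode G E 0 (Finsupp.single γ 1) n (Finsupp.single δ 1)) =
      (if t = 0 then (chargePair G 0 δ i : ℂ) •
        latticeMode G E 0 (Finsupp.single γ 1) n (Finsupp.single δ 1) else 0) +
      (chargePair G 0 γ i : ℂ) •
        latticeMode G E 0 (Finsupp.single γ 1) (n + t) (Finsupp.single δ 1) := by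
  simp only [latticeMode_single_one]
  rw [heisMode_expMode, heisMode_natCast_ground]
  split_ifs
  · rw [map_smul]
  · rw [map_zero]

/-- The t-th mode of eᵢ on the product of e^γ and e^δ with index n raises n by t, with factor the
charge of γ. Vandermonde resums these terms into the shift of m; the charge of δ enters only at t =
0 and shifts k. -/
theorem heisMode_jacobiRHS_exp (hs : ∀ i j, G i j = G j i) (γ δ : I → ℤ) (i : I)
    (p n m k : ℤ) (v : LatticeFock I) :
    heisMode G lam i p (jacobiRHS (latticeMode G E 0) (latticeMode G E lam) (Finsupp.single γ 1)
      (Finsupp.single δ 1) n m k v) =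
    jacobiRHS (latticeMode G E 0) (latticeMode G E lam) (Finsupp.single γ 1)
      (Finsupp.single δ 1) n m k (heisMode G lam i p v) +
    (chargePair G 0 γ i : ℂ) • jacobiRHS (latticeMode G E 0) (latticeMode G E lam)
      (Finsupp.single γ 1) (Finsupp.single δ 1) n (m + p) k v +
    (chargePair G 0 δ i : ℂ) • jacobiRHS (latticeMode G E 0) (latticeMode G E lam)
      (Finsupp.single γ 1) (Finsupp.single δ 1) n m (k + p) v := by
  have hY := latticeMode_isFieldMap (E := E) (lam := 0) hs
  have hM := latticeMode_isFieldMap (E := E) (lam := lam) hs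
  obtain ⟨J, hJ⟩ := hY.eventually_zero (Finsupp.single γ 1) (Finsupp.single δ 1) n
  obtain ⟨L, hLJ, hL⟩ : ∃ L : ℕ, J ≤ L ∧ 0 < L := ⟨J + 1, by omega, by omega⟩
  set a : ℤ → LatticeFock I := fun t =>
    latticeMode G E 0 (Finsupp.single γ 1) t (Finsupp.single δ 1) with ha
  have hz : ∀ j : ℕ, L ≤ j → a (n + j) = 0 := fun j hj => hJ j (by omega)
  have hr : ∀ m k v, jacobiRHS (latticeMode G E 0) (latticeMode G E lam) (Finsupp.single γ 1)
      (Finsupp.single δ 1) n m k v =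
      ∑ j ∈ Finset.range L, cb m j • latticeMode G E lam (a (n + j)) (m + k - j) v :=
    fun m k v => jacobiRHS_eq_range fun j hj =>
      (congrArg (fun x => latticeMode G E lam x (m + k - j) v) (hz j hj)).trans (hM.zero_left _ _)
  have hc : ∀ (j : ℕ) q v, heisMode G lam i p (latticeMode G E lam (a (n + j)) q v) =
      latticeMode G E lam (a (n + j)) q (heisMode G lam i p v) +
      (chargePair G 0 δ i : ℂ) • latticeMode G E lam (a (n + j)) (p + q) v +
      (chargePair G 0 γ i : ℂ) • ∑ t ∈ Finset.range L,
        cb p t • latticeMode G E lam (a (n + (j + t : ℕ))) (p + q - t) v := by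
    intro j q v
    have hterm : ∀ t : ℕ, latticeMode G E 0 (heisState i) (0 + t) (a (n + j)) =
        (if t = 0 then (chargePair G 0 δ i : ℂ) • a (n + j) else 0) +
          (chargePair G 0 γ i : ℂ) • a (n + (j + t : ℕ)) := by
      intro t
      rw [zero_add, latticeMode_heisState hs, ha]
      simp only
      rw [heisMode_expState_product]
      push_cast
      rw [add_assoc n]
    refine (latticeMode_heisState_commutator hs i (a (n + j)) p q v).trans ?_
    rw [add_assoc]
    congr 1
    rw [jacobiRHS_eq_range (L := L) fun t ht => by
      rw [hterm, if_neg (by omega), hz (j + t) (by omega), smul_zero, add_zero, hM.zero_left]]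
    simp only [hterm, hM.add_left, hM.smul_left, smul_add, Finset.sum_add_distrib]
    congr 1
    · rw [Finset.sum_eq_single_of_mem 0 (Finset.mem_range.mpr hL)]
      · rw [if_pos rfl, cb_zero_right, one_smul, hM.smul_left]; simp
      · intro t _ ht
        rw [if_neg ht, hM.zero_left, smul_zero]
    · rw [Finset.smul_sum]
      exact Finset.sum_congr rfl fun t _ => smul_comm _ _ _
  rw [hr, hr, hr, hr, map_sum]
  simp only [map_smul, hc, smul_add, Finset.sum_add_distrib]
  rw [add_right_comm]
  congr 1
  · congr 1
    have := sum_range_cb_convolution (L := L)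
      (g := fun r => latticeMode G E lam (a (n + r)) (m + p + k - r) v) m p
      (fun r hr => (congrArg (fun x => latticeMode G E lam x (m + p + k - r) v)
        (hz r hr)).trans (hM.zero_left _ _))
    rw [← this, Finset.smul_sum]
    refine Finset.sum_congr rfl fun j _ => ?_
    rw [smul_comm, Finset.smul_sum]
    congr 1
    refine Finset.sum_congr rfl fun t _ => ?_
    rw [smul_smul]
    push_cast
    rw [show p + (m + k - j) - t = m + p + k - (j + t) by ring]
  · rw [Finset.smul_sum]
    refine Finset.sum_congr rfl fun j _ => ?_
    rw [smul_comm, show p + (m + k - j) = m + (k + p) - j by ring]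

/-- The vacuum expectations of the Jacobi identity for two exponential fields. -/
theorem constantCoeff_jacobi_exp (hs : ∀ i j, G i j = G j i) (γ δ : I → ℤ) (n m k : ℤ)
    (c d : I → ℤ) :
    MvPolynomial.constantCoeff (jacobiLHS (latticeMode G E lam (Finsupp.single γ 1))
      (latticeMode G E lam (Finsupp.single δ 1)) n m k (Finsupp.single c 1) d) =
    MvPolynomial.constantCoeff (jacobiRHS (latticeMode G E 0) (latticeMode G E lam)
      (Finsupp.single γ 1) (Finsupp.single δ 1) n m k (Finsupp.single c 1) d) := by
  have hY := latticeMode_isFieldMap (E := E) (lam := 0) hs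
  have hM := latticeMode_isFieldMap (E := E) (lam := lam) hs
  obtain ⟨L1, l1⟩ := hM.jacobiLHS_range (Finsupp.single γ 1) (Finsupp.single δ 1) n m k
    (Finsupp.single c 1)
  obtain ⟨L2, l2⟩ := hY.jacobiRHS_range hM (Finsupp.single γ 1) (Finsupp.single δ 1) n
  set a := chargeExp G lam γ c with ha
  set b := chargeExp G lam δ c with hb
  set N := latPair G γ δ with hN
  -- R and R' are the creation degrees that e^δ and e^γ produce on the ground state of charge c when
  -- they act first with modes k and m.
  set R := -k - 1 - b with hR
  set R' := -m - 1 - a with hR'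
  obtain ⟨L, hL1, hL2, hL3, hL4, hL5⟩ : ∃ L : ℕ, L1 ≤ L ∧ L2 ≤ L ∧ R < L ∧ R' < L ∧
      -n - 1 - N < L :=
    ⟨L1 + L2 + R.natAbs + R'.natAbs + (-n - 1 - N).natAbs + 1, by omega, by omega, by omega,
      by omega, by omega⟩
  rw [l1 L hL1, l2 L hL2, Finsupp.finsetSum_apply, Finsupp.finsetSum_apply, map_sum, map_sum]
  -- The cocycle condition gives both orders of the exponentials and their product the same scalar,
  -- up to the sign (-1)^(γ, δ) from the commutator rule.
  have c1 : (E.ε γ (δ + c) * E.ε δ c : ℂ) = E.ε γ δ * E.ε (γ + δ) c := by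
    rw [mul_comm]; exact_mod_cast (E.cocycle γ δ c).symm
  have c2 : (E.ε δ (γ + c) * E.ε γ c : ℂ) = (-1) ^ N * (E.ε γ δ * E.ε (γ + δ) c) := by
    have h1 : (E.ε δ (γ + c) * E.ε γ c : ℂ) = E.ε δ γ * E.ε (δ + γ) c := by
      rw [mul_comm]; exact_mod_cast (E.cocycle δ γ c).symm
    have h2 : (E.ε γ δ : ℂ) = (-1) ^ N * E.ε δ γ := by
      have := congrArg (Units.val) (E.comm γ δ)
      simpa using this
    rw [h1, h2, add_comm δ γ]
    linear_combination (-(E.ε δ γ * E.ε (γ + δ) c : ℂ)) * neg_one_zpow_mul_self N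
  set ε₀ : ℂ := E.ε γ δ * E.ε (γ + δ) c with hε
  have t1 : ∀ j : ℕ, MvPolynomial.constantCoeff (((((-1 : ℂ) ^ j * cb n j) •
      (latticeMode G E lam (Finsupp.single γ 1) (m + n - j) (latticeMode G E lam
        (Finsupp.single δ 1) (k + j) (Finsupp.single c 1)) - (-1 : ℂ) ^ n • latticeMode G E lam
        (Finsupp.single δ 1) (k + n - j) (latticeMode G E lam (Finsupp.single γ 1) (m + j)
        (Finsupp.single c 1)))) : LatticeFock I) d) =
      if d = γ + (δ + c) ∧ R + R' = n + N then
        ε₀ * (-1) ^ R * (cb n j * cbz N (R - j)) - ε₀ * (-1) ^ R * (cb n j * cbz N (R' - j))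
      else 0 := by
    intro j
    rw [Finsupp.smul_apply, Finsupp.sub_apply, Finsupp.smul_apply, MvPolynomial.constantCoeff_smul,
      map_sub, MvPolynomial.constantCoeff_smul]
    simp only [latticeMode_single_one]
    rw [constantCoeff_expMode_expMode hs, constantCoeff_expMode_expMode hs, c1, c2,
      latPair_comm hs δ γ, show -(k + (j : ℤ)) - 1 - chargeExp G lam δ c = R - j by omega,
      show -(m + (j : ℤ)) - 1 - chargeExp G lam γ c = R' - j by omega, ← ha, ← hb, ← hN,
      show δ + (γ + c) = γ + (δ + c) by abel]
    by_cases h : d = γ + (δ + c) ∧ R + R' = n + N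
    · rw [if_pos ⟨h.1, by omega⟩, if_pos ⟨h.1, by omega⟩, if_pos h]
      have hR2 : R' = n + N - R := by omega
      have e1 : (-1 : ℂ) ^ (R - j) = (-1) ^ R * (-1) ^ j := neg_one_zpow_sub_natCast _ _
      have e2 : (-1 : ℂ) ^ n * (-1) ^ N * (-1) ^ (R' - j) = (-1) ^ R * (-1) ^ j := by
        have hne : (-1 : ℂ) ≠ 0 := by norm_num
        rw [neg_one_zpow_sub_natCast, hR2, zpow_sub₀ hne, zpow_add₀ hne,
          ← mul_assoc, mul_div_assoc', ← mul_assoc]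
        congr 1
        rw [div_eq_iff (zpow_ne_zero _ hne), neg_one_zpow_mul_self]
        linear_combination ((-1 : ℂ) ^ N * (-1) ^ N) * neg_one_zpow_mul_self n +
          neg_one_zpow_mul_self N
      rw [e1, smul_eq_mul, smul_eq_mul]
      linear_combination (-((-1 : ℂ) ^ j * cb n j * ε₀ * cbz N (R' - j))) * e2 +
        (ε₀ * (-1) ^ R * cb n j * (cbz N (R - j) - cbz N (R' - j))) * neg_one_pow_mul_self j
    · rw [if_neg (fun h' => h ⟨h'.1, by omega⟩), if_neg (fun h' => h ⟨h'.1, by omega⟩), if_neg h]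
      simp
  have t2 : ∀ j : ℕ, MvPolynomial.constantCoeff ((cb m j • latticeMode G E lam
      (latticeMode G E 0 (Finsupp.single γ 1) (n + j) (Finsupp.single δ 1)) (m + k - j)
      (Finsupp.single c 1) : LatticeFock I) d) =
      if d = γ + (δ + c) ∧ R + R' = n + N then
        ε₀ * (cb m j * cbz a (-n - 1 - N - j)) else 0 := by
    intro j
    rw [Finsupp.smul_apply, MvPolynomial.constantCoeff_smul, constantCoeff_expState_product hs,
      ← ha, ← hb, ← hN, show -(n + (j : ℤ)) - 1 - N = -n - 1 - N - j by ring]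
    by_cases h : d = γ + (δ + c) ∧ R + R' = n + N
    · rw [if_pos ⟨h.1, by omega⟩, if_pos h, smul_eq_mul]; ring
    · rw [if_neg (fun h' => h ⟨h'.1, by omega⟩), if_neg h, smul_zero]
  rw [Finset.sum_congr rfl fun j _ => t1 j, Finset.sum_congr rfl fun j _ => t2 j]
  split_ifs with h
  · rw [Finset.sum_sub_distrib, ← Finset.mul_sum, ← Finset.mul_sum, ← Finset.mul_sum,
      cbz_vandermonde _ _ _ hL3, cbz_vandermonde _ _ _ hL4, cbz_vandermonde _ _ _ hL5]
    -- After Vandermonde the three sums are binomials with parameters (n + N, R), (n + N, R') and (m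
    -- + a, -n - 1 - N), so locality applies with s = n + N.
    have := cbz_locality h.2
    rw [show m + a = -R' - 1 by omega, show -n - 1 - N = -(n + N) - 1 by ring, ← this]
    ring
  · simp

/-- For fixed n the two sides have the same Heisenberg commutators, with weights the charges of γ
and δ. Their difference falls under `heis_family_eq_zero`, and comparing vacuum expectations
suffices. -/
theorem borcherds_exp (hs : ∀ i j, G i j = G j i) (hG : GramNondegenerate G) (γ δ : I → ℤ) :
    Borcherds (latticeMode G E 0) (latticeMode G E lam) (Finsupp.single γ 1)
      (Finsupp.single δ 1) := by
  intro v m k n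
  have hY := latticeMode_isFieldMap (E := E) (lam := 0) hs
  have hM := latticeMode_isFieldMap (E := E) (lam := lam) hs
  rw [← sub_eq_zero]
  refine heis_family_eq_zero hG (lam := lam) (lam' := lam)
    (w₁ := fun i => (chargePair G 0 γ i : ℂ)) (w₂ := fun i => (chargePair G 0 δ i : ℂ))
    (fun m k v => jacobiLHS (latticeMode G E lam (Finsupp.single γ 1))
      (latticeMode G E lam (Finsupp.single δ 1)) n m k v -
      jacobiRHS (latticeMode G E 0) (latticeMode G E lam) (Finsupp.single γ 1)
      (Finsupp.single δ 1) n m k v) ?_ ?_ ?_ ?_ m k v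
  · intro m k v v'
    obtain ⟨L1, l1⟩ := hM.jacobiLHS_range (Finsupp.single γ 1) (Finsupp.single δ 1) n m k v
    obtain ⟨L2, l2⟩ := hM.jacobiLHS_range (Finsupp.single γ 1) (Finsupp.single δ 1) n m k v'
    obtain ⟨L3, l3⟩ := hM.jacobiLHS_range (Finsupp.single γ 1) (Finsupp.single δ 1) n m k (v + v')
    obtain ⟨R, r⟩ := hY.jacobiRHS_range hM (Finsupp.single γ 1) (Finsupp.single δ 1) n
    rw [l1 (L1 + L2 + L3) (by omega), l2 (L1 + L2 + L3) (by omega), l3 (L1 + L2 + L3) (by omega),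
      r R le_rfl, r R le_rfl, r R le_rfl]
    simp only [hM.add_right, smul_add, smul_sub, Finset.sum_add_distrib, Finset.sum_sub_distrib]
    abel
  · intro m k t v
    obtain ⟨L1, l1⟩ := hM.jacobiLHS_range (Finsupp.single γ 1) (Finsupp.single δ 1) n m k v
    obtain ⟨L3, l3⟩ := hM.jacobiLHS_range (Finsupp.single γ 1) (Finsupp.single δ 1) n m k (t • v)
    obtain ⟨R, r⟩ := hY.jacobiRHS_range hM (Finsupp.single γ 1) (Finsupp.single δ 1) n
    rw [l1 (L1 + L3) (by omega), l3 (L1 + L3) (by omega), r R le_rfl, r R le_rfl, smul_sub,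
      Finset.smul_sum, Finset.smul_sum]
    congr 1 <;> refine Finset.sum_congr rfl fun j _ => ?_
    · simp only [hM.smul_right]; module
    · simp only [hM.smul_right]; module
  · intro i p m k v
    have hcc : ∀ (γ : I → ℤ) p m v, heisMode G lam i p (latticeMode G E lam (Finsupp.single γ 1) m v)
        = latticeMode G E lam (Finsupp.single γ 1) m (heisMode G lam i p v) +
          (chargePair G 0 γ i : ℂ) • latticeMode G E lam (Finsupp.single γ 1) (m + p) v := by
      intro γ p m v
      simp only [latticeMode_single_one]
      exact heisMode_expMode _ _ _ _ _
    have h1 := jacobiLHS_commutator (H := fun p v => heisMode G lam i p v)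
      (latticeMode_isOpField (E := E) hs (Finsupp.single γ 1))
      (latticeMode_isOpField hs (Finsupp.single δ 1)) (heisMode_isOpField i) (hcc γ) (hcc δ)
      p n m k v
    have h2 := heisMode_jacobiRHS_exp (E := E) (lam := lam) hs γ δ i p n m k v
    rw [map_sub, h2]
    refine (congrArg (· - _) h1).trans ?_
    module
  · intro m k c d
    rw [Finsupp.sub_apply, map_sub, constantCoeff_jacobi_exp hs, sub_self]

theorem expMode_natCast_vac (γ : I → ℤ) {n : ℤ} (hn : -1 ≤ n) :
    expMode G E 0 γ n (latticeVac I) =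
      if n = -1 then Finsupp.single γ 1 else 0 := by
  rw [latticeVac, expMode_ground, E.zero_right, add_zero, chargeExp_zero]
  have : latPair G γ 0 = 0 := by simp [latPair]
  rw [this]
  split_ifs with h
  · subst h; simp [creationCoeff_zero]
  · rw [creationCoeff_neg _ (by omega)]; simp

theorem heisMode_natCast_vac (i : I) (n : ℕ) : heisMode G 0 i n (latticeVac I) = 0 := by
  rw [latticeVac, heisMode_natCast_ground]
  simp [chargePair]

theorem latticeMode_creation (hs : ∀ i j, G i j = G j i) (a : LatticeFock I) :
    latticeMode G E 0 a (-1) (latticeVac I) = a ∧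
      ∀ n, 0 ≤ n → latticeMode G E 0 a n (latticeVac I) = 0 := by
  induction a using latticeFock_induction with
  | h0 => exact ⟨latticeMode_zero_left _ _, fun n _ => latticeMode_zero_left _ _⟩
  | hadd a b ha hb =>
    refine ⟨by rw [latticeMode_add_left, ha.1, hb.1], fun n hn => ?_⟩
    rw [latticeMode_add_left, ha.2 n hn, hb.2 n hn, add_zero]
  | hsmul t a ha =>
    refine ⟨by rw [latticeMode_smul_left, ha.1], fun n hn => ?_⟩
    rw [latticeMode_smul_left, ha.2 n hn, smul_zero]
  | hone γ =>
    refine ⟨?_, fun n hn => ?_⟩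
    · rw [latticeMode_single_one, expMode_natCast_vac γ (by omega), if_pos rfl]
    · rw [latticeMode_single_one, expMode_natCast_vac γ (by omega), if_neg (by omega)]
  | hX γ s Q ih =>
    have hF := latticeMode_isOpField (E := E) (lam := 0) hs (Finsupp.single γ Q)
    rw [latticeMode_X_mul hs]
    refine ⟨?_, fun n hn => ?_⟩
    · rw [normalOrder, finsum_eq_single _ 0]
      · rw [heisMode_natCast_vac, hF.zero, Nat.cast_zero, add_zero (-1 : ℤ), ih.1, sub_zero, heisMode_single,
          heisFock_neg]
        simp
      · intro j hj
        rw [heisMode_natCast_vac, hF.zero, ih.2 _ (by omega), map_zero]; simp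
    · rw [normalOrder, finsum_eq_zero_of_forall_eq_zero]
      intro j
      rw [heisMode_natCast_vac, hF.zero, ih.2 _ (by omega), map_zero]; simp

theorem borcherds_lattice (hs : ∀ i j, G i j = G j i) (hG : GramNondegenerate G)
    (a b : LatticeFock I) : Borcherds (latticeMode G E 0) (latticeMode G E lam) a b := by
  refine borcherds_of_generators (vac := latticeVac I) (latticeMode_isFieldMap hs)
    (latticeMode_isFieldMap hs) (fun a => (latticeMode_creation hs a).1)
    (fun a => (latticeMode_creation hs a).2) latticeMode_vac
    (Set.range heisState) (Set.range fun γ => Finsupp.single γ 1) ⟨0, rfl⟩ ?_ ?_ ?_ ?_ ?_ ?_ a b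
  · rintro _ ⟨i, rfl⟩ b
    exact borcherds_heisState hs i b
  · rintro _ ⟨i, rfl⟩ b
    exact borcherds_heisState hs i b
  · rintro _ ⟨γ, rfl⟩ _ ⟨δ, rfl⟩
    exact borcherds_exp hs hG γ δ
  · rintro _ ⟨γ, rfl⟩ _ ⟨δ, rfl⟩
    exact borcherds_exp hs hG γ δ
  · rintro _ ⟨i, rfl⟩ _ ⟨γ, rfl⟩ s
    simp only
    rw [latticeMode_heisState hs, heisMode_natCast_ground]
    split_ifs
    · exact ⟨_, rfl⟩
    · exact ⟨0, by simp⟩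
  · intro P h0 hadd hsmul hE hS a
    refine latticeFock_induction h0 hadd hsmul (fun γ => hE _ ⟨γ, rfl⟩) (fun γ s Q h => ?_) a
    have := hS _ ⟨s.1, rfl⟩ (-s.2 - 1) _ h
    rwa [latticeMode_heisState_neg hs] at this

theorem lattice_isVertexModule (hs : ∀ i j, G i j = G j i) (hG : GramNondegenerate G) :
    IsVertexModule (latticeVac I) (latticeMode G E 0) (latticeMode G E lam) where
  add_left := latticeMode_add_left
  smul_left := latticeMode_smul_left
  add_right := (latticeMode_isFieldMap hs).add_right
  smul_right := (latticeMode_isFieldMap hs).smul_right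
  truncation := (latticeMode_isFieldMap hs).truncation
  vacuum := latticeMode_vac
  borcherds a b := borcherds_lattice hs hG a b

theorem lattice_isVertexAlgebra (hs : ∀ i j, G i j = G j i) (hG : GramNondegenerate G) :
    IsVertexAlgebra (latticeVac I) (latticeMode G E 0) where
  toIsVertexModule := lattice_isVertexModule hs hG
  creation a := (latticeMode_creation hs a).1
  creation_nonneg a := (latticeMode_creation hs a).2

end LatticeBorcherds

/-- A nonzero subspace of polynomials that is closed under derivatives contains `1`. -/
theorem one_mem_of_pderiv_closed {ι : Type*} (U : Submodule ℂ (MvPolynomial ι ℂ))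
    (hU : ∀ u ∈ U, ∀ i, MvPolynomial.pderiv i u ∈ U) {Q : MvPolynomial ι ℂ} (hQ : Q ∈ U)
    (h0 : Q ≠ 0) : 1 ∈ U := by
  classical
  have key : ∀ (n : ℕ) (Q : MvPolynomial ι ℂ), Q ∈ U → Q ≠ 0 →
      (∀ s : ι →₀ ℕ, n < s.degree → MvPolynomial.coeff s Q = 0) → 1 ∈ U := by
    intro n
    induction n with
    | zero =>
      intro Q hQ h0 hs
      have e : Q = MvPolynomial.C (MvPolynomial.coeff 0 Q) := by
        ext s
        rw [MvPolynomial.coeff_C]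
        split_ifs with h
        · rw [← h]
        · exact hs s (Nat.pos_of_ne_zero fun h' => h ((Finsupp.degree_eq_zero_iff s).mp h').symm)
      have hc : MvPolynomial.coeff 0 Q ≠ 0 := fun h => h0 (by rw [e, h, map_zero])
      have := U.smul_mem (MvPolynomial.coeff 0 Q)⁻¹ hQ
      rw [e, MvPolynomial.smul_eq_C_mul, ← map_mul, MvPolynomial.coeff_C, if_pos rfl,
        inv_mul_cancel₀ hc, map_one] at this
      exact this
    | succ n ih =>
      intro Q hQ h0 hs
      -- If all derivatives vanish, Q is constant and already meets the smaller degree bound;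
      -- otherwise a nonzero derivative does.
      by_cases hd : ∀ i, MvPolynomial.pderiv i Q = 0
      · refine ih Q hQ h0 fun s hsn => ?_
        obtain ⟨i, hi⟩ : ∃ i, s i ≠ 0 := by
          by_contra hc
          push Not at hc
          have : s = 0 := Finsupp.ext hc
          simp [this] at hsn
        have e : s = (s - Finsupp.single i 1) + Finsupp.single i 1 := by
          rw [tsub_add_cancel_of_le]
          simpa [Finsupp.single_le_iff] using Nat.one_le_iff_ne_zero.mpr hi
        have := congrArg (MvPolynomial.coeff (s - Finsupp.single i 1)) (hd i)
        rw [MvPolynomial.coeff_pderiv, ← e, MvPolynomial.coeff_zero] at this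
        refine (mul_eq_zero.mp this).resolve_right ?_
        exact_mod_cast Nat.succ_ne_zero ((s - (Finsupp.single i 1 : ι →₀ ℕ)) i)
      · push Not at hd
        obtain ⟨i, hi⟩ := hd
        refine ih _ (hU Q hQ i) hi fun s hsn => ?_
        rw [MvPolynomial.coeff_pderiv, hs, zero_mul]
        rw [map_add, Finsupp.degree_single]
        omega
  exact key (Q.support.sup Finsupp.degree) Q hQ h0 fun s hs => by
    by_contra h
    have := Finset.le_sup (f := Finsupp.degree) (MvPolynomial.mem_support_iff.mpr h)
    omega

/-! ### Simplicity and generation of the Fock modules. -/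

section Simplicity

variable {I : Type*} [Fintype I] {G : Matrix I I ℤ} {E : LatticeCocycle G} {lam : I → ℤ}

theorem chargePair_injective (hG : GramNondegenerate G) {c c' : I → ℤ}
    (h : ∀ i, chargePair G lam c i = chargePair G lam c' i) : c = c' := by
  classical
  obtain ⟨K, hK⟩ := hG
  have e : ∀ i, ∑ l, (G i l : ℂ) * (c l : ℂ) = ∑ l, (G i l : ℂ) * (c' l : ℂ) := fun i => by
    have := h i
    simp only [chargePair, add_right_inj] at this
    exact_mod_cast this
  have r : ∀ (c : I → ℤ) j, ∑ i, K j i * ∑ l, (G i l : ℂ) * (c l : ℂ) = c j := by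
    intro c j
    simp only [Finset.mul_sum, ← mul_assoc]
    rw [Finset.sum_comm]
    simp only [← Finset.sum_mul, hK]
    simp
  funext j
  have : (c j : ℂ) = c' j := by rw [← r c j, ← r c' j]; simp only [e]
  exact_mod_cast this

/-- At this index the creation coefficient has degree zero, so e^γ maps a ground state to an
invertible multiple of another one. -/
theorem expMode_top_ground (γ c : I → ℤ) :
    expMode G E lam γ (-1 - chargeExp G lam γ c) (Finsupp.single c 1) =
      (E.ε γ c : ℂ) • Finsupp.single (γ + c) 1 := by
  rw [expMode_ground, show -(-1 - chargeExp G lam γ c) - 1 - chargeExp G lam γ c = 0 by ring,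
    creationCoeff_zero, Finsupp.smul_single]

variable (hs : ∀ i j, G i j = G j i)
include hs

theorem modeStable_heis {N : Submodule ℂ (LatticeFock I)} (hN : IsModeStable (latticeMode G E lam) N)
    (i : I) (n : ℤ) {v : LatticeFock I} (hv : v ∈ N) : heisMode G lam i n v ∈ N := by
  rw [← latticeMode_heisState (E := E) hs]; exact hN _ _ _ hv

theorem modeStable_ground {N : Submodule ℂ (LatticeFock I)}
    (hN : IsModeStable (latticeMode G E lam) N) (γ c : I → ℤ)
    (h : Finsupp.single c 1 ∈ N) : Finsupp.single (γ + c) 1 ∈ N := by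
  have := N.smul_mem (E.ε γ c : ℂ)⁻¹
    (hN (Finsupp.single γ 1) (-1 - chargeExp G lam γ c) _ h)
  rwa [latticeMode_single_one, expMode_top_ground, smul_smul, inv_mul_cancel₀ (Units.ne_zero _),
    one_smul] at this

theorem eq_top_of_ground_mem {N : Submodule ℂ (LatticeFock I)}
    (hN : IsModeStable (latticeMode G E lam) N) (c : I → ℤ) (h : Finsupp.single c 1 ∈ N) :
    N = ⊤ := by
  rw [Submodule.eq_top_iff']
  intro a
  refine latticeFock_induction (P := fun a => a ∈ N) N.zero_mem (fun _ _ => N.add_mem)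
    (fun t _ => N.smul_mem t) (fun γ => ?_) (fun γ s Q h => ?_) a
  · have := modeStable_ground hs hN (γ - c) c h
    rwa [sub_add_cancel] at this
  · have := modeStable_heis hs hN s.1 (-s.2 - 1) h
    rwa [heisMode_single, heisFock_neg] at this

theorem lattice_isGeneratedBy :
    IsGeneratedBy (latticeMode G E lam) (latticeVac I) :=
  fun _ hN h => eq_top_of_ground_mem hs hN 0 h

/-- Zero modes separate charges by nondegeneracy. Subtracting the eigenvalue at one charge of the
support removes that charge and keeps another, so induction on the size of the support isolates a
single charge. -/
theorem exists_single_mem (hG : GramNondegenerate G) {N : Submodule ℂ (LatticeFock I)}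
    (hN : IsModeStable (latticeMode G E lam) N) (n : ℕ) :
    ∀ v ∈ N, v ≠ 0 → v.support.card ≤ n → ∃ c Q, Q ≠ 0 ∧ Finsupp.single c Q ∈ N := by
  classical
  induction n with
  | zero =>
    intro v _ h0 hc
    exact absurd (Finsupp.support_eq_empty.mp (Finset.card_eq_zero.mp (by omega))) h0
  | succ n ih =>
    intro v hv h0 hc
    obtain ⟨c, hcs⟩ := Finsupp.support_nonempty_iff.mpr h0
    by_cases h : ∃ c' ∈ v.support, c' ≠ c
    · obtain ⟨c', hc's, hne⟩ := h
      obtain ⟨i, hi⟩ : ∃ i, chargePair G lam c' i ≠ chargePair G lam c i := by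
        by_contra hcon
        push Not at hcon
        exact hne (chargePair_injective hG hcon)
      set w := heisMode G lam i 0 v - (chargePair G lam c i : ℂ) • v with hw
      have hwd : ∀ d, w d = ((chargePair G lam d i : ℂ) - chargePair G lam c i) • v d := by
        intro d
        rw [hw, Finsupp.sub_apply, heisMode_apply, heisFock_zero, Finsupp.smul_apply, sub_smul]
      refine ih w (N.sub_mem (modeStable_heis hs hN i 0 hv) (N.smul_mem _ hv)) ?_ ?_
      · intro hw0
        have := hwd c'
        rw [hw0, Finsupp.zero_apply, eq_comm, smul_eq_zero] at this
        rcases this with h1 | h1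
        · rw [sub_eq_zero] at h1; exact hi (by exact_mod_cast h1)
        · exact (Finsupp.mem_support_iff.mp hc's) h1
      · have hsub : w.support ⊆ v.support.erase c := by
          intro d hd
          rw [Finsupp.mem_support_iff, hwd] at hd
          rw [Finset.mem_erase, Finsupp.mem_support_iff]
          refine ⟨fun h => hd (by rw [h, sub_self, zero_smul]), fun h => hd (by rw [h, smul_zero])⟩
        have := Finset.card_le_card hsub
        rw [Finset.card_erase_of_mem hcs] at this
        omega
    · push Not at h
      have e : v = Finsupp.single c (v c) := by
        ext1 d
        rw [Finsupp.single_apply]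
        split_ifs with hd
        · rw [hd]
        · by_contra hv0
          exact hd (h d (Finsupp.mem_support_iff.mpr hv0)).symm
      exact ⟨c, v c, Finsupp.mem_support_iff.mp hcs, e ▸ hv⟩

theorem lattice_isSimple (hG : GramNondegenerate G) :
    IsSimpleVertexModule (latticeMode G E lam) := by
  classical
  refine ⟨⟨latticeVac I, 0, by simp [latticeVac]⟩, fun N hN => ?_⟩
  rw [or_iff_not_imp_left]
  intro hne
  obtain ⟨v, hv, h0⟩ := N.ne_bot_iff.mp hne
  obtain ⟨c, Q, hQ, hmem⟩ := exists_single_mem hs hG hN _ v hv h0 le_rfl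
  refine eq_top_of_ground_mem hs hN c ?_
  refine one_mem_of_pderiv_closed (N.comap (Finsupp.lsingle c)) (fun u hu => ?_) (Q := Q) hmem hQ
  rintro ⟨j, n⟩
  obtain ⟨K, hK⟩ := hG
  rw [pderiv_eq_sum_heisFock hK (fun i => chargePair G lam c i)]
  refine Submodule.sum_mem _ fun i _ => Submodule.smul_mem _ _ ?_
  have := modeStable_heis hs hN i (n + 1) (v := Finsupp.single c u) hu
  rwa [heisMode_single] at this

end Simplicity

/-! ### Intertwining operators obtained by skew-symmetry. -/

section Intertwiner

variable {V M : Type*} [AddCommGroup V] [Module ℂ V] [AddCommGroup M] [Module ℂ M]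

/-- The divided power `T^j / j!`. -/
def divPow (T : M →ₗ[ℂ] M) (j : ℕ) : M →ₗ[ℂ] M := ((j.factorial : ℂ)⁻¹) • T ^ j

theorem divPow_zero (T : M →ₗ[ℂ] M) (v : M) : divPow T 0 v = v := by simp [divPow]

theorem divPow_succ (T : M →ₗ[ℂ] M) (j : ℕ) (v : M) :
    ((j : ℂ) + 1) • divPow T (j + 1) v = divPow T j (T v) := by
  have h1 : (j.factorial : ℂ) ≠ 0 := by exact_mod_cast j.factorial_ne_zero
  have h2 : (j : ℂ) + 1 ≠ 0 := by exact_mod_cast Nat.succ_ne_zero j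
  rw [divPow, divPow, LinearMap.smul_apply, LinearMap.smul_apply, smul_smul, pow_succ,
    Module.End.mul_apply, Nat.factorial_succ]
  congr 1
  push_cast
  field_simp

theorem divPow_succ' (T : M →ₗ[ℂ] M) (j : ℕ) (v : M) :
    ((j : ℂ) + 1) • divPow T (j + 1) v = T (divPow T j v) := by
  rw [divPow_succ, divPow, LinearMap.smul_apply, LinearMap.smul_apply, map_smul,
    ← Module.End.mul_apply, ← Module.End.mul_apply, (Commute.self_pow T j).eq]

/-- `T` acts on the module `M` as a translation operator. -/
def IsTranslation (YM : V → ℤ → M → M) (T : M →ₗ[ℂ] M) : Prop :=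
  ∀ a n v, T (YM a n v) = YM a n (T v) - (n : ℂ) • YM a (n - 1) v

variable {vac : V} {Y : V → ℤ → V → V} {YM : V → ℤ → M → M} {T : M →ₗ[ℂ] M}

/-- These are the coefficients of e^(-yT) Y_M(a, z) e^(yT) = Y_M(a, z - y). -/
theorem IsTranslation.mode_divPow (hM : IsFieldMap YM) (hT : IsTranslation YM T) (a : V)
    (n : ℤ) (j : ℕ) (v : M) : YM a n (divPow T j v) =
      ∑ ij ∈ Finset.HasAntidiagonal.antidiagonal j, cb n ij.1 • divPow T ij.2 (YM a (n - ij.1) v) := by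
  induction j generalizing n v with
  | zero => simp [divPow_zero, cb_zero_right]
  | succ j ih =>
    have hj : (j : ℂ) + 1 ≠ 0 := by exact_mod_cast Nat.succ_ne_zero j
    apply smul_right_injective M hj
    simp only
    rw [← hM.smul_right, divPow_succ, ih]
    have e : ∀ n, YM a n (T v) = T (YM a n v) + (n : ℂ) • YM a (n - 1) v := fun n => by
      rw [hT]; abel
    simp only [e, map_add, map_smul, smul_add, Finset.sum_add_distrib, ← divPow_succ]
    rw [Finset.smul_sum]
    have h1 := Finset.Nat.sum_antidiagonal_succ' (n := j)
      (f := fun p => ((p.2 : ℕ) : ℂ) • cb n p.1 • divPow T p.2 (YM a (n - p.1) v))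
    have h2 := Finset.Nat.sum_antidiagonal_succ (n := j)
      (f := fun p => ((p.1 : ℕ) : ℂ) • cb n p.1 • divPow T p.2 (YM a (n - p.1) v))
    simp only [Nat.cast_zero, zero_smul, zero_add] at h1 h2
    rw [show (∑ p ∈ Finset.HasAntidiagonal.antidiagonal (j + 1), ((j : ℂ) + 1) •
        cb n p.1 • divPow T p.2 (YM a (n - p.1) v)) =
        (∑ p ∈ Finset.HasAntidiagonal.antidiagonal (j + 1), ((p.2 : ℕ) : ℂ) •
          cb n p.1 • divPow T p.2 (YM a (n - p.1) v)) +
        (∑ p ∈ Finset.HasAntidiagonal.antidiagonal (j + 1), ((p.1 : ℕ) : ℂ) •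
          cb n p.1 • divPow T p.2 (YM a (n - p.1) v)) by
      rw [← Finset.sum_add_distrib]
      refine Finset.sum_congr rfl fun p hp => ?_
      have := Finset.HasAntidiagonal.mem_antidiagonal.mp hp
      rw [← add_smul]
      congr 1
      rw [← Nat.cast_add, add_comm p.2, this]; push_cast; rfl, h1, h2]
    congr 1
    · refine Finset.sum_congr rfl fun p _ => ?_
      rw [smul_comm]; push_cast; rfl
    · refine Finset.sum_congr rfl fun p _ => ?_
      have := cb_succ_mul n p.1
      push_cast
      rw [smul_smul, smul_smul, this, mul_comm, show n - (p.1 + 1) = n - p.1 - 1 by ring]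

/-- The modes of the intertwining operator `e^{zT} Y_M(b, -z) w`. -/
def intertwiner (YM : V → ℤ → M → M) (T : M →ₗ[ℂ] M) (w : M) (m : ℤ) (b : V) : M :=
  ∑ᶠ j : ℕ, (-1 : ℂ) ^ (m + 1 + j) • divPow T j (YM b (m + j) w)

theorem intertwiner_eq_range {w : M} {m : ℤ} {b : V} {L : ℕ}
    (h : ∀ j : ℕ, L ≤ j → YM b (m + j) w = 0) : intertwiner YM T w m b =
      ∑ j ∈ Finset.range L, (-1 : ℂ) ^ (m + 1 + j) • divPow T j (YM b (m + j) w) :=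
  finsum_eq_range fun j hj => by rw [h j hj, map_zero, smul_zero]

theorem IsFieldMap.intertwiner_range (hM : IsFieldMap YM) (w : M) (m : ℤ) (b : V) :
    ∀ᶠ L in Filter.atTop, intertwiner YM T w m b =
      ∑ j ∈ Finset.range L, (-1 : ℂ) ^ (m + 1 + j) • divPow T j (YM b (m + j) w) := by
  obtain ⟨J, hJ⟩ := hM.eventually_zero b w m
  filter_upwards [Filter.eventually_ge_atTop J] with L hL
  exact intertwiner_eq_range fun j hj => hJ j (hL.trans hj)

theorem intertwiner_add (hM : IsFieldMap YM) (w w' : M) (m : ℤ) (b : V) :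
    intertwiner YM T (w + w') m b = intertwiner YM T w m b + intertwiner YM T w' m b := by
  obtain ⟨L, h1, h2, h3⟩ := ((hM.intertwiner_range (T := T) w m b).and
    ((hM.intertwiner_range (T := T) w' m b).and
      (hM.intertwiner_range (T := T) (w + w') m b))).exists
  rw [h1, h2, h3, ← Finset.sum_add_distrib]
  exact Finset.sum_congr rfl fun j _ => by rw [hM.add_right, map_add, smul_add]

theorem intertwiner_smul (hM : IsFieldMap YM) (t : ℂ) (w : M) (m : ℤ) (b : V) :
    intertwiner YM T (t • w) m b = t • intertwiner YM T w m b := by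
  rw [intertwiner, intertwiner, smul_finsum]
  exact finsum_congr fun j => by rw [hM.smul_right, map_smul, smul_comm]

theorem intertwiner_add_right (hM : IsFieldMap YM) (w : M) (m : ℤ) (b b' : V) :
    intertwiner YM T w m (b + b') = intertwiner YM T w m b + intertwiner YM T w m b' := by
  obtain ⟨L, h1, h2, h3⟩ := ((hM.intertwiner_range (T := T) w m b).and
    ((hM.intertwiner_range (T := T) w m b').and
      (hM.intertwiner_range (T := T) w m (b + b')))).exists
  rw [h1, h2, h3, ← Finset.sum_add_distrib]
  exact Finset.sum_congr rfl fun j _ => by rw [hM.add_left, map_add, smul_add]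

theorem intertwiner_smul_right (hM : IsFieldMap YM) (t : ℂ) (w : M) (m : ℤ) (b : V) :
    intertwiner YM T w m (t • b) = t • intertwiner YM T w m b := by
  rw [intertwiner, intertwiner, smul_finsum]
  exact finsum_congr fun j => by rw [hM.smul_left, map_smul, smul_comm]

theorem intertwiner_zero (hM : IsFieldMap YM) (m : ℤ) (b : V) :
    intertwiner YM T 0 m b = 0 := by
  have := intertwiner_smul (T := T) hM 0 0 m b
  rwa [zero_smul, zero_smul] at this

theorem intertwiner_sum (hM : IsFieldMap YM) {ι : Type*} (s : Finset ι) (f : ι → M) (m : ℤ)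
    (b : V) : intertwiner YM T (∑ i ∈ s, f i) m b = ∑ i ∈ s, intertwiner YM T (f i) m b := by
  classical
  induction s using Finset.induction_on with
  | empty => simp [intertwiner_zero hM]
  | insert i s hi ih => rw [Finset.sum_insert hi, Finset.sum_insert hi, intertwiner_add hM, ih]

/-- The intertwiner of T w is the derivative of that of w. In particular its zero mode vanishes, the
fact by which long screenings preserve kernels of short ones. -/
theorem intertwiner_translation (hM : IsFieldMap YM) (hT : IsTranslation YM T) (w : M) (m : ℤ)
    (b : V) : intertwiner YM T (T w) m b = -(m : ℂ) • intertwiner YM T w (m - 1) b := by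
  obtain ⟨J, hJ⟩ := hM.eventually_zero b w (m - 1)
  obtain ⟨L, hL, h1⟩ := ((Filter.eventually_ge_atTop (J + 1)).and
    (hM.intertwiner_range (T := T) (T w) m b)).exists
  rw [h1, intertwiner_eq_range (L := L) (fun j hj => hJ j (by omega)), Finset.smul_sum]
  have e : ∀ j : ℕ, (-1 : ℂ) ^ (m + 1 + j) • divPow T j (YM b (m + j) (T w)) =
      (((-1 : ℂ) ^ (m + 1 + j) * (j + 1)) • divPow T (j + 1) (YM b (m + j) w)) +
      ((-1 : ℂ) ^ (m + 1 + j) * (m + j)) • divPow T j (YM b (m - 1 + j) w) := by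
    intro j
    have : YM b (m + j) (T w) = T (YM b (m + j) w) + ((m + j : ℤ) : ℂ) • YM b (m + j - 1) w := by
      rw [hT]; abel
    rw [this, map_add, ← divPow_succ, map_smul, show m + (j : ℤ) - 1 = m - 1 + j by ring]
    push_cast
    module
  rw [Finset.sum_congr rfl fun j _ => e j, Finset.sum_add_distrib]
  have h2 : ∑ j ∈ Finset.range L, ((-1 : ℂ) ^ (m + 1 + j) * (j + 1)) •
      divPow T (j + 1) (YM b (m + j) w) =
      ∑ j ∈ Finset.range L, ((-1 : ℂ) ^ (m + j) * j) • divPow T j (YM b (m - 1 + j) w) := by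
    have h3 := Finset.sum_range_succ' (fun j : ℕ => ((-1 : ℂ) ^ (m + j) * j) •
      divPow T j (YM b (m - 1 + j) w)) L
    rw [Finset.sum_range_succ, hJ L (by omega), map_zero, smul_zero, add_zero, Nat.cast_zero, Nat.cast_zero,
      mul_zero, zero_smul, add_zero] at h3
    rw [h3]
    refine Finset.sum_congr rfl fun j _ => ?_
    push_cast
    rw [show m - 1 + ((j : ℤ) + 1) = m + j by ring, show m + ((j : ℤ) + 1) = m + 1 + j by ring]
  rw [h2, ← Finset.sum_add_distrib]
  refine Finset.sum_congr rfl fun j _ => ?_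
  rw [show m - 1 + 1 + (j : ℤ) = m + j by ring, show m + 1 + (j : ℤ) = m + j + 1 by ring,
    neg_one_zpow_succ, ← add_smul, smul_smul]
  congr 1
  ring

theorem intertwiner_divPow (hM : IsFieldMap YM) (hT : IsTranslation YM T) (w : M) (m : ℤ)
    (j : ℕ) (b : V) : intertwiner YM T (divPow T j w) m b =
      ((-1) ^ j * cb m j) • intertwiner YM T w (m - j) b := by
  induction j generalizing m with
  | zero => simp [divPow_zero, cb_zero_right]
  | succ j ih =>
    have hj : (j : ℂ) + 1 ≠ 0 := by exact_mod_cast Nat.succ_ne_zero j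
    apply smul_right_injective M hj
    simp only
    have := cb_succ_mul' m j
    rw [← intertwiner_smul hM, divPow_succ', intertwiner_translation hM hT, ih, smul_smul, smul_smul]
    push_cast
    rw [show m - 1 - (j : ℤ) = m - (j + 1) by ring]
    congr 1
    rw [pow_succ]
    linear_combination ((-1) ^ j) * this

/-- The commutator formula for an intertwining operator. -/
theorem intertwiner_commutator (hM : IsFieldMap YM)
    (hB : ∀ a b, Borcherds Y YM a b)
    (hT : IsTranslation YM T) (a b : V) (w : M) (n m : ℤ) :
    ∀ᶠ L in Filter.atTop,
    YM a n (intertwiner YM T w m b) - intertwiner YM T w m (Y a n b) =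
      ∑ i ∈ Finset.range L, cb n i • intertwiner YM T (YM a i w) (n + m - i) b := by
  obtain ⟨J, hJ⟩ := hM.eventually_zero b w m
  obtain ⟨J', hJ'⟩ := hM.eventually_zero a w 0
  simp only [zero_add] at hJ'
  have hbox : ∀ᶠ L in Filter.atTop, ∀ i s : ℕ, L ≤ i ∨ L ≤ s →
      YM b (n + m - i + s) (YM a i w) = 0 :=
    eventually_box ⟨J', fun i hi s => by rw [hJ' i hi, hM.zero_right]⟩
      fun i => hM.eventually_zero b (YM a i w) _
  filter_upwards [hM.intertwiner_range (T := T) w m (Y a n b), Filter.eventually_ge_atTop J,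
    Filter.eventually_ge_atTop J', hbox] with L h1 hL hL' hb
  rw [h1, intertwiner_eq_range (L := L) (fun j hj => hJ j (by omega)), hM.sum_right]
  have e1 : ∑ j ∈ Finset.range L, YM a n ((-1 : ℂ) ^ (m + 1 + j) • divPow T j (YM b (m + j) w)) =
      ∑ i ∈ Finset.range L, ∑ s ∈ Finset.range L, ((-1 : ℂ) ^ (m + 1 + (i + s : ℕ)) * cb n i) •
        divPow T s (YM a (n - i) (YM b (m + (i + s : ℕ)) w)) := by
    rw [← sum_range_antidiagonal (F := fun i s => ((-1 : ℂ) ^ (m + 1 + (i + s : ℕ)) * cb n i) •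
        divPow T s (YM a (n - i) (YM b (m + (i + s : ℕ)) w)))
        (fun i s h => by rw [hJ _ (by omega), hM.zero_right, map_zero, smul_zero])]
    refine Finset.sum_congr rfl fun j _ => ?_
    rw [hM.smul_right, hT.mode_divPow hM, Finset.smul_sum]
    refine Finset.sum_congr rfl fun p hp => ?_
    rw [Finset.HasAntidiagonal.mem_antidiagonal.mp hp, smul_smul]
  -- The iterate formula for a_n b reproduces all terms of `e1`, where b acts first. After
  -- cancellation only terms where a acts first on w are left.
  have e2 : ∀ s ∈ Finset.range L, (-1 : ℂ) ^ (m + 1 + s) • divPow T s (YM (Y a n b) (m + s) w) =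
      ∑ i ∈ Finset.range L, (((-1 : ℂ) ^ (m + 1 + (i + s : ℕ)) * cb n i) •
        divPow T s (YM a (n - i) (YM b (m + (i + s : ℕ)) w)) -
        (cb n i * (-1) ^ (n + m - i + 1 + s)) • divPow T s (YM b (n + m - i + s) (YM a i w))) := by
    intro s _
    have hz1 : ∀ j : ℕ, L ≤ j → YM a (0 + n - j) (YM b (m + s + j) w) = 0 := fun j hj => by
      have := hJ (s + j) (by omega)
      push_cast at this
      rw [add_assoc m, this, hM.zero_right]
    have hz2 : ∀ j : ℕ, L ≤ j → YM b (m + s + n - j) (YM a (0 + j) w) = 0 := fun j hj => by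
      rw [zero_add, hJ' j (by omega), hM.zero_right]
    rw [(hB a b).iterate n (m + s) w, jacobiLHS_eq_range hz1 hz2, map_sum, Finset.smul_sum]
    refine Finset.sum_congr rfl fun i _ => ?_
    have s1 : (-1 : ℂ) ^ (m + 1 + (i + s : ℕ)) = (-1) ^ (m + 1 + s) * (-1) ^ i := by
      rw [← neg_one_zpow_add_natCast]; push_cast; ring_nf
    have s2 : (-1 : ℂ) ^ (n + m - i + 1 + s) = (-1) ^ (m + 1 + s) * (-1) ^ i * (-1) ^ n := by
      rw [← neg_one_zpow_sub_natCast, ← zpow_add₀ (by norm_num)]; ring_nf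
    have i1 : m + (s : ℤ) + i = m + (i + s : ℕ) := by push_cast; ring
    rw [s1, s2, map_smul, map_sub, map_smul, zero_add, zero_add, i1,
      show m + (s : ℤ) + n - i = n + m - i + s by ring]
    module
  rw [e1, Finset.sum_congr rfl e2, Finset.sum_comm, ← Finset.sum_sub_distrib]
  simp only [← Finset.sum_sub_distrib, sub_sub_cancel]
  rw [Finset.sum_comm]
  refine Finset.sum_congr rfl fun i _ => ?_
  rw [intertwiner_eq_range (L := L) (fun s hs => hb i s (Or.inr hs)), Finset.smul_sum]
  exact Finset.sum_congr rfl fun s _ => by rw [smul_smul]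

/-- A state annihilated by the zero mode of an intertwining operator commutes with it. -/
theorem mode_intertwiner_of_mem_ker (hM : IsFieldMap YM)
    (hB : ∀ a b, Borcherds Y YM a b) (hT : IsTranslation YM T) {a : V} {w : M}
    (ha : intertwiner YM T w 0 a = 0) (n : ℤ) (b : V) :
    intertwiner YM T w 0 (Y a n b) = YM a n (intertwiner YM T w 0 b) := by
  obtain ⟨L, h1, h2⟩ := ((intertwiner_commutator hM hB hT a b w n 0).and
    (hM.intertwiner_range (T := T) w 0 a)).exists
  -- The hypothesis says that a signed sum of T^j / j! applied to a_j w is zero. Used as the module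
  -- vector of the intertwiner, with the powers of T pulled out, this sum becomes minus the
  -- commutator.
  have h3 := congrArg (fun u => intertwiner YM T u n b) (h2.symm.trans ha)
  simp only [intertwiner_sum hM, intertwiner_smul hM, intertwiner_divPow hM hT, zero_add,
    intertwiner_zero hM] at h3
  rw [eq_comm, ← sub_eq_zero, h1, ← neg_eq_zero, ← h3, ← Finset.sum_neg_distrib]
  refine Finset.sum_congr rfl fun i _ => ?_
  rw [add_zero, smul_smul, ← neg_smul]
  congr 1
  rw [neg_one_zpow_add_natCast, zpow_one]
  linear_combination (cb n i) * neg_one_pow_mul_self i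

/-- The commutator of zero modes. -/
theorem intertwiner_commutator_zero (hM : IsFieldMap YM)
    (hB : ∀ a b, Borcherds Y YM a b) (hT : IsTranslation YM T) (a b : V) (w : M) (m : ℤ) :
    YM a 0 (intertwiner YM T w m b) - intertwiner YM T w m (Y a 0 b) =
      intertwiner YM T (YM a 0 w) m b := by
  obtain ⟨L, h1, hL⟩ := ((intertwiner_commutator hM hB hT a b w 0 m).and
    (Filter.eventually_gt_atTop 0)).exists
  rw [h1, Finset.sum_eq_single_of_mem 0 (Finset.mem_range.mpr hL)]
  · simp [cb_zero_right]
  · intro i _ hi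
    rw [cb_zero_left, if_neg hi, zero_smul]

end Intertwiner

/-! ### The conformal vector and translation on the modules. -/

section Translation

variable {I : Type*} [Fintype I] {G : Matrix I I ℤ} {E : LatticeCocycle G} {lam : I → ℤ}

/-- The conformal vector `½ ∑ K i j (eᵢ)_{-1} (eⱼ)_{-1} 1`, where `K` is the inverse Gram
matrix. -/
def conformalState (K : I → I → ℂ) : LatticeFock I :=
  ∑ i, ∑ j, (K i j / 2) • Finsupp.single 0 (MvPolynomial.X (i, 0) * (MvPolynomial.X (j, 0) * 1))

theorem heisMode_quadratic (hs : ∀ i j, G i j = G j i) (l i j : I) (t : ℕ) :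
    heisMode G 0 l t
      (Finsupp.single 0 (MvPolynomial.X (i, 0) * (MvPolynomial.X (j, 0) * 1))) =
    if t = 1 then (G l j : ℂ) • heisState i + (G l i : ℂ) • heisState j else 0 := by
  have h0 := heisMode_natCast_vac (G := G) l t
  rw [latticeVac] at h0
  rw [heisMode_natCast_mul_X hs, heisMode_natCast_mul_X hs, h0, map_zero, zero_add]
  by_cases h : t = 1
  · subst h
    rw [if_pos rfl, if_pos rfl, if_pos rfl, map_smul, heisMode_single, heisFock_neg, mul_one,
      mul_one]
    simp [heisState]
  · rw [if_neg h, if_neg h, if_neg h, map_zero, add_zero]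

/-- Contracting eₗ with either factor of the quadratic state and inverting the Gram matrix gives
eₗ/2 each time. Hence the zero mode of the conformal vector acts on Heisenberg fields as a
derivative. -/
theorem heisMode_conformalState [DecidableEq I] (hs : ∀ i j, G i j = G j i) {K : I → I → ℂ}
    (hK : ∀ j l, ∑ i, K j i * (G i l : ℂ) = if j = l then 1 else 0) (l : I) (t : ℕ) :
    heisMode G 0 l t (conformalState K) = if t = 1 then heisState l else 0 := by
  simp only [conformalState, map_sum, map_smul, heisMode_quadratic hs]
  split_ifs with h
  · have h1 : (Matrix.of K) * (G.map (Int.cast : ℤ → ℂ)) = 1 := by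
      ext j l
      rw [Matrix.mul_apply, Matrix.one_apply, ← hK j l]
      simp
    -- The two contractions sum over different indices of K, so K is needed as a right inverse as
    -- well.
    have h2 := mul_eq_one_comm.mp h1
    have hK' : ∀ l j, ∑ i, K i j * (G l i : ℂ) = if l = j then 1 else 0 := by
      intro l j
      have := congrFun (congrFun h2 l) j
      rw [Matrix.mul_apply, Matrix.one_apply] at this
      rw [← this]
      refine Finset.sum_congr rfl fun i _ => ?_
      rw [Matrix.map_apply, Matrix.of_apply, mul_comm]
    simp only [smul_add, smul_smul, Finset.sum_add_distrib]
    have a1 : ∑ i, ∑ j, (K i j / 2 * (G l j : ℂ)) • heisState i =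
        ((1 : ℂ) / 2) • heisState (I := I) l := by
      simp only [← Finset.sum_smul]
      rw [Finset.sum_eq_single l]
      · congr 1
        have := hK l l
        rw [if_pos rfl] at this
        rw [← this, Finset.sum_div]
        exact Finset.sum_congr rfl fun j _ => by rw [hs l j]; ring
      · intro i _ hi
        have := hK i l
        rw [if_neg hi] at this
        rw [show ∑ j, K i j / 2 * (G l j : ℂ) = (∑ j, K i j * (G j l : ℂ)) / 2 by
          rw [Finset.sum_div]
          exact Finset.sum_congr rfl fun j _ => by rw [hs l j]; ring, this]
        simp
      · simp
    have a2 : ∑ i, ∑ j, (K i j / 2 * (G l i : ℂ)) • heisState j =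
        ((1 : ℂ) / 2) • heisState (I := I) l := by
      rw [Finset.sum_comm]
      simp only [← Finset.sum_smul]
      have : ∀ j, ∑ i, K i j / 2 * (G l i : ℂ) = (if l = j then 1 else 0) / 2 := fun j => by
        rw [← hK' l j, Finset.sum_div]
        exact Finset.sum_congr rfl fun j _ => by ring
      simp only [this]
      rw [Finset.sum_eq_single l]
      · simp
      · intro j _ hj
        rw [if_neg hj.symm]; simp
      · simp
    rw [a1, a2, ← add_smul]
    norm_num
  · simp

theorem conformalState_heis [DecidableEq I] (hs : ∀ i j, G i j = G j i) {K : I → I → ℂ}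
    (hK : ∀ j l, ∑ i, K j i * (G i l : ℂ) = if j = l then 1 else 0) (l : I) (p : ℤ)
    (v : LatticeFock I) : latticeMode G E lam (conformalState K) 0 (heisMode G lam l p v) =
      heisMode G lam l p (latticeMode G E lam (conformalState K) 0 v) -
        (p : ℂ) • heisMode G lam l (p - 1) v := by
  rw [latticeMode_heisState_commutator hs, jacobiRHS, finsum_eq_single _ 1]
  · rw [zero_add, latticeMode_heisState hs, heisMode_conformalState hs hK, if_pos rfl,
      latticeMode_heisState hs]
    simp
  · intro j hj
    rw [zero_add, latticeMode_heisState hs, heisMode_conformalState hs hK, if_neg hj,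
      latticeMode_zero_left, smul_zero]

theorem constantCoeff_conformalState_ground (hs : ∀ i j, G i j = G j i) (K : I → I → ℂ)
    (c d : I → ℤ) : MvPolynomial.constantCoeff
      (latticeMode G E lam (conformalState K) 0 (Finsupp.single c 1) d) = 0 := by
  rw [latticeMode_eq_lin, conformalState]
  simp only [map_sum, Finsupp.finsetSum_apply, map_smul, Finsupp.smul_apply,
    MvPolynomial.constantCoeff_smul, ← latticeMode_eq_lin]
  refine Finset.sum_eq_zero fun i _ => Finset.sum_eq_zero fun j _ => ?_
  rw [latticeMode_X_mul hs, constantCoeff_normalOrder_heis (latticeMode_isOpField hs _),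
    latticeMode_X_mul hs, constantCoeff_normalOrder_heis (latticeMode_isOpField hs _),
    ← latticeVac, latticeMode_vac]
  simp

theorem constantCoeff_heisMode_neg (i : I) (n : ℕ) (v : LatticeFock I) (d : I → ℤ) :
    MvPolynomial.constantCoeff (heisMode G lam i (-n - 1) v d) = 0 := by
  rw [heisMode_apply, heisFock_neg]; simp

theorem constantCoeff_conformalState [DecidableEq I] (hs : ∀ i j, G i j = G j i) {K : I → I → ℂ}
    (hK : ∀ j l, ∑ i, K j i * (G i l : ℂ) = if j = l then 1 else 0) (v : LatticeFock I)
    (d : I → ℤ) : MvPolynomial.constantCoeff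
      (latticeMode G E lam (conformalState K) 0 v d) = 0 := by
  have hF := latticeMode_isOpField (E := E) (lam := lam) hs (conformalState K)
  induction v using latticeFock_induction with
  | h0 => rw [hF.zero]; simp
  | hadd a b ha hb => rw [hF.add, Finsupp.add_apply, map_add, ha, hb, add_zero]
  | hsmul t a ha => rw [hF.smul, Finsupp.smul_apply, MvPolynomial.constantCoeff_smul, ha, smul_zero]
  | hone γ => exact constantCoeff_conformalState_ground hs K γ d
  | hX γ s Q _ =>
    have : Finsupp.single γ (MvPolynomial.X s * Q) =
        heisMode G lam s.1 (-s.2 - 1) (Finsupp.single γ Q) := by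
      rw [heisMode_single, heisFock_neg]
    rw [this, conformalState_heis hs hK, Finsupp.sub_apply, Finsupp.smul_apply, map_sub,
      MvPolynomial.constantCoeff_smul, constantCoeff_heisMode_neg,
      show (-(s.2 : ℤ) - 1 - 1) = -((s.2 + 1 : ℕ) : ℤ) - 1 by push_cast; ring,
      constantCoeff_heisMode_neg]
    simp

/-- Both vectors have the same images under positive Heisenberg modes and no constant term, so
nondegeneracy identifies them. The vector g represents the charge λ + c in the basis. -/
theorem conformalState_ground [DecidableEq I] (hs : ∀ i j, G i j = G j i) {K : I → I → ℂ}
    (hK : ∀ j l, ∑ i, K j i * (G i l : ℂ) = if j = l then 1 else 0) (c : I → ℤ) {g : I → ℂ}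
    (hg : ∀ i, ∑ l, (G i l : ℂ) * g l = chargePair G lam c i) :
    latticeMode G E lam (conformalState K) 0 (Finsupp.single c 1) =
      Finsupp.single c (creationVar g 0) := by
  rw [← sub_eq_zero]
  set D := latticeMode G E lam (conformalState K) 0 (Finsupp.single c 1) -
    Finsupp.single c (creationVar g 0) with hD
  have hh : ∀ l (n : ℕ), heisMode G lam l (n + 1) D = 0 := by
    intro l n
    have h1 := conformalState_heis (E := E) (lam := lam) hs hK l (n + 1) (Finsupp.single c 1)
    have h2 := heisMode_natCast_ground (G := G) (lam := lam) l (n + 1) c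
    have h3 := heisMode_natCast_ground (G := G) (lam := lam) l n c
    rw [if_neg (by omega)] at h2
    push_cast at h2
    rw [h2, (latticeMode_isOpField hs _).zero, add_sub_cancel_right, h3, eq_comm,
      sub_eq_zero] at h1
    rw [hD, map_sub, h1, heisMode_single, heisFock_pos]
    simp only [pderiv_creationVar]
    by_cases h4 : n = 0
    · subst h4
      have : ∑ j, (((0 : ℕ) : ℂ) + 1) * (G l j : ℂ) * g j = chargePair G lam c l := by
        rw [← hg]; simp
      simp only [if_true, MvPolynomial.smul_eq_C_mul, ← map_mul]
      rw [← map_sum, this, ← mul_one (MvPolynomial.C _), ← MvPolynomial.smul_eq_C_mul,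
        ← Finsupp.smul_single]
      simp
    · simp [h4, Ne.symm h4]
  ext1 d
  -- All derivatives of the difference vanish, so the difference and 0 already form a closed set.
  refine mvPolynomial_eq_zero_of_pderiv_closed {u | u = D d ∨ u = 0} ?_ ?_ (D d) (Or.inl rfl)
  · rintro u (rfl | rfl)
    · rw [hD, Finsupp.sub_apply, map_sub, constantCoeff_conformalState_ground hs,
        Finsupp.single_apply]
      split_ifs <;> simp [constantCoeff_creationVar]
    · exact map_zero _
  · rintro u (rfl | rfl) ⟨j, n⟩
    · right
      rw [pderiv_eq_sum_heisFock hK (fun i => chargePair G lam d i)]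
      refine Finset.sum_eq_zero fun i _ => ?_
      rw [← heisMode_apply, hh]
      simp
    · right; exact map_zero _

theorem creationCoeff_one (u : I → ℂ) : creationCoeff u 1 = creationVar u 0 := by
  have := creationCoeff_succ u 0
  simpa [creationCoeff_zero] using this

theorem conformalState_eq_derivative [DecidableEq I] (hs : ∀ i j, G i j = G j i) {K : I → I → ℂ}
    (hK : ∀ j l, ∑ i, K j i * (G i l : ℂ) = if j = l then 1 else 0) (a : LatticeFock I) :
    latticeMode G E 0 (conformalState K) 0 a = latticeMode G E 0 a (-2) (latticeVac I) := by
  have hF := latticeMode_isOpField (E := E) (lam := 0) hs (conformalState K)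
  induction a using latticeFock_induction with
  | h0 => rw [hF.zero, latticeMode_zero_left]
  | hadd a b ha hb => rw [hF.add, latticeMode_add_left, ha, hb]
  | hsmul t a ha => rw [hF.smul, latticeMode_smul_left, ha]
  | hone γ =>
    rw [conformalState_ground hs hK γ (g := fun i => (γ i : ℂ))
      (fun i => by rw [chargePair_zero]; push_cast; rfl), latticeMode_single_one, latticeVac,
      expMode_ground, E.zero_right, add_zero, chargeExp_zero, show latPair G γ 0 = 0 by
        simp [latPair], show (-(-2 : ℤ) - 1 - 0) = 1 by norm_num, creationCoeff_one]
    simp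
  | hX γ s Q ih =>
    have e : Finsupp.single γ (MvPolynomial.X s * Q) =
        heisMode G 0 s.1 (-s.2 - 1) (Finsupp.single γ Q) := by
      rw [heisMode_single, heisFock_neg]
    have hQ := latticeMode_isOpField (E := E) (lam := 0) hs (Finsupp.single γ Q)
    obtain ⟨cr, cr'⟩ := latticeMode_creation (E := E) hs (Finsupp.single γ Q)
    have v0 := heisMode_natCast_vac (G := G) s.1 0
    have v1 := heisMode_natCast_vac (G := G) s.1 1
    push_cast at v0 v1
    rw [latticeMode_X_mul hs, e, conformalState_heis hs hK, ih, normalOrder,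
      finsum_eq_range (L := 2) (fun j hj => by
        rw [heisMode_natCast_vac, hQ.zero, cr' _ (by omega), map_zero]; simp),
      Finset.sum_range_succ, Finset.sum_range_one]
    simp only [v0, v1, hQ.zero, smul_zero, add_zero, Nat.cast_zero, sub_zero,
      Nat.choose_zero_right, Nat.cast_one, one_smul, Nat.choose_one_right, Nat.cast_add]
    rw [show (-2 + 1 : ℤ) = -1 by norm_num, cr, sub_eq_add_neg, ← neg_smul]
    congr 2
    push_cast; ring

/-- The commutator with the zero mode of the conformal vector is a mode of a_{-2} 1 by
`conformalState_eq_derivative`, and covariance turns this into -n a_{n-1}. -/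
theorem conformalState_isTranslation [DecidableEq I] (hs : ∀ i j, G i j = G j i)
    (hG : GramNondegenerate G) {K : I → I → ℂ}
    (hK : ∀ j l, ∑ i, K j i * (G i l : ℂ) = if j = l then 1 else 0) :
    IsTranslation (latticeMode G E lam)
      ((latticeMode_isOpField (E := E) (lam := lam) hs (conformalState K)).lin 0) := by
  intro a n v
  simp only [IsOpField.lin_apply]
  have h1 := (borcherds_lattice (E := E) (lam := lam) hs hG (conformalState K) a).commutator 0 n v
  rw [jacobiRHS_zero, conformalState_eq_derivative hs hK] at h1
  have h2 := (borcherds_lattice (E := E) (lam := lam) hs hG a (latticeVac I)).translate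
    (latticeMode_isFieldMap hs) latticeMode_vac 1 n v
  rw [Nat.cast_one, show (-1 - 1 : ℤ) = -2 by norm_num, pow_one, cb_one_right] at h2
  rw [h2, sub_eq_iff_eq_add] at h1
  rw [h1]
  module

/-- These properties are all that the screening arguments use; the absence of constant terms
computes vacuum expectations of intertwiners. -/
theorem exists_lattice_translation (hs : ∀ i j, G i j = G j i) (hG : GramNondegenerate G)
    (E : LatticeCocycle G) (lam : I → ℤ) :
    ∃ T : LatticeFock I →ₗ[ℂ] LatticeFock I, IsTranslation (latticeMode G E lam) T ∧
      (∀ v d, MvPolynomial.constantCoeff (T v d) = 0) ∧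
      ∀ (c : I → ℤ) (g : I → ℂ), (∀ i, ∑ l, (G i l : ℂ) * g l = chargePair G lam c i) →
        T (Finsupp.single c 1) = Finsupp.single c (creationVar g 0) := by
  classical
  obtain ⟨K, hK⟩ := id hG
  refine ⟨(latticeMode_isOpField (E := E) (lam := lam) hs (conformalState K)).lin 0,
    conformalState_isTranslation hs hG (by convert hK), fun v d => ?_, fun c g hg => ?_⟩
  · exact constantCoeff_conformalState hs (by convert hK) v d
  · exact conformalState_ground hs (by convert hK) c hg

end Translation

/-! ### Restriction of the structure to a vertex subalgebra. -/

section Subalgebra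

variable {V : Type*} [AddCommGroup V] [Module ℂ V] {vac : V} {Y : V → ℤ → V → V}

theorem coe_finsum_submodule {W : Submodule ℂ V} (f : ℕ → W) :
    ((∑ᶠ j, f j : W) : V) = ∑ᶠ j, (f j : V) :=
  W.subtype.toAddMonoidHom.map_finsum_of_injective Subtype.val_injective f

theorem IsVertexSubalgebra.isVertexAlgebra {W : Submodule ℂ V}
    (hW : IsVertexSubalgebra vac Y W) (hV : IsVertexAlgebra vac Y) :
    IsVertexAlgebra hW.vac hW.mode where
  add_left a b n v := Subtype.ext (hV.add_left _ _ _ _)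
  smul_left t a n v := Subtype.ext (hV.smul_left _ _ _ _)
  add_right a n v w := Subtype.ext (hV.add_right _ _ _ _)
  smul_right t a n v := Subtype.ext (hV.smul_right _ _ _ _)
  truncation a v := by
    obtain ⟨N, hN⟩ := hV.truncation a v
    exact ⟨N, fun n hn => Subtype.ext (hN n hn)⟩
  vacuum n v := by
    apply Subtype.ext
    refine (hV.vacuum n v).trans ?_
    split_ifs <;> rfl
  borcherds a b v m k n := by
    apply Subtype.ext
    rw [coe_finsum_submodule, coe_finsum_submodule]
    exact hV.borcherds a b v m k n
  creation a := Subtype.ext (hV.creation _)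
  creation_nonneg a n hn := Subtype.ext (hV.creation_nonneg _ n hn)

end Subalgebra

/-! ### Short screenings and the Feigin–Tipunin algebra. -/

section FeiginTipunin

variable {I : Type*} [Fintype I]

/-- The exponential field `Y(e^{λ'}, z)` from the lattice vertex algebra to its module of weight
`λ'` is the intertwining operator of the ground state. -/
theorem expField_eq_intertwiner {G : Matrix I I ℤ} {E : LatticeCocycle G}
    (hs : ∀ i j, G i j = G j i) (hG : GramNondegenerate G) {lam' : I → ℤ} {u : I → ℂ}
    (hu : ∀ i, (lam' i : ℂ) = ∑ l, (G i l : ℂ) * u l) {T : LatticeFock I →ₗ[ℂ] LatticeFock I}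
    (hT : IsTranslation (latticeMode G E lam') T)
    (hTc : ∀ v d, MvPolynomial.constantCoeff (T v d) = 0) (m : ℤ) (v : LatticeFock I) :
    expField u lam' 0 (fun c => ∑ i, c i * lam' i) (fun c => (-1) ^ (-∑ i, c i * lam' i)) m v =
      intertwiner (latticeMode G E lam') T (Finsupp.single 0 1) m v := by
  classical
  have hM := latticeMode_isFieldMap (E := E) (lam := lam') hs
  rw [← sub_eq_zero]
  refine heis_family_eq_zero hG (lam := 0) (lam' := lam') (w₁ := fun i => (lam' i : ℂ))
    (w₂ := fun _ => 0) (fun m _ v => expField u lam' 0 (fun c => ∑ i, c i * lam' i)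
      (fun c => (-1) ^ (-∑ i, c i * lam' i)) m v -
      intertwiner (latticeMode G E lam') T (Finsupp.single 0 1) m v) ?_ ?_ ?_ ?_ m 0 v
  · intro m k v v'
    simp only [map_add, intertwiner_add_right hM]; abel
  · intro m k t v
    simp only [map_smul, intertwiner_smul_right hM, smul_sub]
  · intro i p m k v
    obtain ⟨L, h1, hL⟩ := ((intertwiner_commutator hM (borcherds_lattice (E := E) hs hG) hT
      (heisState i) v (Finsupp.single 0 1) p m).and (Filter.eventually_gt_atTop 0)).exists
    rw [Finset.sum_eq_single_of_mem 0 (Finset.mem_range.mpr hL) (fun j _ hj => by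
      rw [latticeMode_heisState hs, heisMode_natCast_ground, if_neg hj, intertwiner_zero hM,
        smul_zero]), latticeMode_heisState hs, latticeMode_heisState hs, latticeMode_heisState hs,
      heisMode_natCast_ground, if_pos rfl, intertwiner_smul hM, cb_zero_right, one_smul,
      show chargePair G lam' 0 i = lam' i by simp [chargePair], sub_eq_iff_eq_add] at h1
    have h2 := heisMode_expField (σ := 0) (κ := fun c => ∑ i, c i * lam' i)
      (ε := fun c => (-1) ^ (-∑ i, c i * lam' i)) (lam := 0) (lam' := lam') (G := G) hu
      (fun c i => by simp [chargePair, add_comm]) i p m v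
    rw [map_sub, h1, h2, Nat.cast_zero, sub_zero, add_comm p m]
    module
  · intro m k c d
    obtain ⟨L, h1, hL⟩ := ((hM.intertwiner_range (T := T) (Finsupp.single 0 1) m
      (Finsupp.single c 1)).and (Filter.eventually_gt_atTop 0)).exists
    -- Positive powers of T have no constant term, so only j = 0 enters the vacuum expectation.
    have hpow : ∀ j ≠ 0, ∀ v, MvPolynomial.constantCoeff ((divPow T j v : LatticeFock I) d) = 0 := by
      intro j hj v
      obtain ⟨j, rfl⟩ := Nat.exists_eq_succ_of_ne_zero hj
      rw [divPow, LinearMap.smul_apply, pow_succ', Module.End.mul_apply, Finsupp.smul_apply,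
        MvPolynomial.constantCoeff_smul, hTc, smul_zero]
    have hch : chargeExp G lam' c 0 = ∑ i, c i * lam' i := by simp [chargeExp, chargePair]
    rw [Finsupp.sub_apply, map_sub, h1, Finsupp.finsetSum_apply, map_sum,
      Finset.sum_eq_single_of_mem 0 (Finset.mem_range.mpr hL) (fun j _ hj => by
        rw [Finsupp.smul_apply, MvPolynomial.constantCoeff_smul, hpow j hj, smul_zero]),
      divPow_zero, latticeMode_single_one, expField_ground, Nat.cast_zero, add_zero, add_zero,
      expMode_ground, E.zero_right, hch, Finsupp.smul_apply, Finsupp.single_apply, zero_add,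
      add_zero, Finsupp.single_apply]
    by_cases hd : c = d
    · rw [if_pos hd, if_pos hd, MvPolynomial.constantCoeff_smul, MvPolynomial.constantCoeff_smul,
        MvPolynomial.constantCoeff_smul, constantCoeff_creationCoeff, constantCoeff_creationCoeff]
      split_ifs with h
      -- The sign (-1)^(m+1) of Y_M(b, -z) is the scalar put into the exponential field.
      · rw [show m + 1 = -∑ i, c i * lam' i by omega]
        simp
      · simp
    · rw [if_neg hd, if_neg hd]; simp

variable {A : Matrix I I ℤ} {q : I → ℕ} (hq : ∀ i, 0 < q i)
  (hs : ∀ i j, corootGram A q i j = corootGram A q j i) (hG : GramNondegenerate (corootGram A q))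

/-- The weight of the image of the short screening operator. -/
def shortWeight (A : Matrix I I ℤ) (i : I) (j : I) : ℤ := -A i j

theorem latticeBasis_self (i : I) : latticeBasis i i = 1 := by simp [latticeBasis]

theorem latticeBasis_ne {i j : I} (h : j ≠ i) : latticeBasis i j = 0 := by
  simp [latticeBasis, h]

theorem sum_mul_latticeBasis {R : Type*} [Ring R] (f : I → R) (i : I) :
    ∑ j, f j * (latticeBasis i j : R) = f i := by
  classical
  rw [Finset.sum_eq_single i]
  · simp [latticeBasis_self]
  · intro j _ hj; simp [latticeBasis_ne hj]
  · simp

include hq hs in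
-- The vector -αᵢ/√p is -eᵢ/qᵢ; symmetry of the Gram matrix turns its pairing with eⱼ into -A i j.
theorem shortWeight_eq (i j : I) : (shortWeight A i j : ℂ) =
    ∑ l, (corootGram A q j l : ℂ) * -((latticeBasis i l : ℂ) / (q i : ℂ)) := by
  have hq' : (q i : ℂ) ≠ 0 := by exact_mod_cast (hq i).ne'
  have : ∑ l, (corootGram A q j l : ℂ) * -((latticeBasis i l : ℂ) / (q i : ℂ)) =
      ∑ l, (-(corootGram A q j l : ℂ) / (q i : ℂ)) * (latticeBasis i l : ℂ) :=
    Finset.sum_congr rfl fun l _ => by ring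
  rw [this, sum_mul_latticeBasis, hs j i, shortWeight, corootGram]
  push_cast
  field_simp

theorem expField_apply {u : I → ℂ} {w : I → ℤ} {κ : (I → ℤ) → ℤ} {ε : (I → ℤ) → ℂ} (m : ℤ)
    (v : LatticeFock I) (d : I → ℤ) :
    expField u w 0 κ ε m v d = ε d • expFock u w (-m - 1 - κ d) (v d) := by
  classical
  induction v using Finsupp.induction_linear with
  | zero => simp
  | add v w hv hw => simp only [map_add, Finsupp.add_apply, hv, hw, smul_add]
  | single c Q =>
    rw [expField_single, Finsupp.single_apply, Finsupp.single_apply, zero_add]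
    split_ifs with h
    · rw [h]
    · simp

theorem shortScreening_eq_expField (i : I) : shortScreening A q i =
    expField (fun j => -((latticeBasis i j : ℂ) / (q i : ℂ))) (shortWeight A i) 0
      (fun c => ∑ j, c j * shortWeight A i j) (fun _ => 1) 0 := by
  refine Finsupp.lhom_ext fun c Q => ?_
  rw [expField_single, zero_add, one_smul, shortScreening, Finsupp.lsum_single,
    LinearMap.comp_apply, Finsupp.lsingle_apply]
  have : -1 + ∑ j, A i j * c j = -0 - 1 - ∑ j, c j * shortWeight A i j := by
    simp [shortWeight, mul_comm]
  rw [this]; rfl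

variable {E : LatticeCocycle (corootGram A q)}

include hq hs hG in
-- On each charge the screening and the intertwiner differ by a sign only, which a kernel does not
-- see.
theorem mem_ker_shortScreening_iff {i : I} {T : LatticeFock I →ₗ[ℂ] LatticeFock I}
    (hT : IsTranslation (latticeMode (corootGram A q) E (shortWeight A i)) T)
    (hTc : ∀ v d, MvPolynomial.constantCoeff (T v d) = 0) (v : LatticeFock I) :
    v ∈ LinearMap.ker (shortScreening A q i) ↔
      intertwiner (latticeMode (corootGram A q) E (shortWeight A i)) T (Finsupp.single 0 1) 0 v
        = 0 := by
  rw [← expField_eq_intertwiner hs hG (shortWeight_eq hq hs i) hT hTc, LinearMap.mem_ker,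
    shortScreening_eq_expField]
  constructor
  · intro h
    ext1 d
    have := DFunLike.congr_fun h d
    rw [expField_apply, one_smul] at this
    rw [expField_apply, this]; simp
  · intro h
    ext1 d
    have := DFunLike.congr_fun h d
    rw [expField_apply, Finsupp.zero_apply, smul_eq_zero] at this
    rw [expField_apply, this.resolve_left (zpow_ne_zero _ (by norm_num))]; simp

include hq hs hG in
theorem mode_mem_ker_shortScreening (i : I) {a b : LatticeFock I}
    (ha : a ∈ LinearMap.ker (shortScreening A q i))
    (hb : b ∈ LinearMap.ker (shortScreening A q i)) (n : ℤ) :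
    latticeMode (corootGram A q) E 0 a n b ∈ LinearMap.ker (shortScreening A q i) := by
  obtain ⟨T, hT, hTc, -⟩ := exists_lattice_translation hs hG E (shortWeight A i)
  have hM := latticeMode_isFieldMap (E := E) (lam := shortWeight A i) hs
  rw [mem_ker_shortScreening_iff hq hs hG hT hTc] at ha hb ⊢
  rw [mode_intertwiner_of_mem_ker hM (borcherds_lattice hs hG) hT ha, hb, hM.zero_right]

theorem shortScreening_ground (i : I) (c : I → ℤ) : shortScreening A q i (Finsupp.single c 1) =
    Finsupp.single c (creationCoeff (fun j => -((latticeBasis i j : ℂ) / (q i : ℂ)))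
      (-1 + ∑ j, A i j * c j)) := by
  rw [shortScreening, Finsupp.lsum_single, LinearMap.comp_apply, Finsupp.lsingle_apply, expFock_one]

include hq hs hG in
theorem feiginTipunin_isVertexSubalgebra : IsVertexSubalgebra (latticeVac I)
    (latticeMode (corootGram A q) E 0) (feiginTipunin A q) where
  vacuum_mem := by
    rw [feiginTipunin, Submodule.mem_iInf]
    intro i
    rw [LinearMap.mem_ker, latticeVac, shortScreening_ground, creationCoeff_neg _ (by simp)]
    simp
  mode_mem a ha n b hb := by
    rw [feiginTipunin, Submodule.mem_iInf] at *
    exact fun i => mode_mem_ker_shortScreening hq hs hG i (ha i) (hb i) n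

theorem creationVar_smul (t : ℂ) (u : I → ℂ) (k : ℕ) :
    creationVar (fun i => t * u i) k = t • creationVar u k := by
  simp only [creationVar, Finset.smul_sum, smul_smul]

include hq hs hG in
-- Commuting x₀ with the screening leaves the zero mode attached to x₀ w. Since eᵢ pairs to -2 with
-- the weight -αᵢ/√p, the vector x₀ w is the degree-one creation coefficient at charge eᵢ. Applying
-- T to the ground state there gives 1 - 1/qᵢ times that vector. For qᵢ ≠ 1 the vector x₀ w is thus
-- in the image of T.
theorem longScreening_mem_ker_self (hA : ∀ i, A i i = 2) {i : I} (hqi : q i ≠ 1)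
    {b : LatticeFock I} (hb : b ∈ LinearMap.ker (shortScreening A q i)) :
    latticeMode (corootGram A q) E 0 (longScreening i) 0 b ∈
      LinearMap.ker (shortScreening A q i) := by
  obtain ⟨T, hT, hTc, hTg⟩ := exists_lattice_translation hs hG E (shortWeight A i)
  have hM := latticeMode_isFieldMap (E := E) (lam := shortWeight A i) hs
  rw [mem_ker_shortScreening_iff hq hs hG hT hTc] at hb ⊢
  have h1 := intertwiner_commutator_zero hM (borcherds_lattice hs hG) hT (longScreening i) b
    (Finsupp.single 0 1) 0
  have hq' : (q i : ℂ) ≠ 0 := by exact_mod_cast (hq i).ne'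
  have ht : (1 : ℂ) - (q i : ℂ)⁻¹ ≠ 0 := by
    intro h
    rw [sub_eq_zero, eq_comm, inv_eq_one] at h
    exact hqi (by exact_mod_cast h)
  have hx : latticeMode (corootGram A q) E (shortWeight A i) (longScreening i) 0
      (Finsupp.single 0 1) = ((1 : ℂ) - (q i : ℂ)⁻¹)⁻¹ • T (Finsupp.single (latticeBasis i) 1) := by
    rw [hTg _ (fun j => (1 - (q i : ℂ)⁻¹) * (latticeBasis i j : ℂ)), creationVar_smul,
      ← Finsupp.smul_single, smul_smul, inv_mul_cancel₀ ht, one_smul, longScreening,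
      latticeMode_single_one, expMode_ground, E.zero_right, add_zero]
    · have : chargeExp (corootGram A q) (shortWeight A i) (latticeBasis i) 0 = -2 := by
        simp only [chargeExp, chargePair]
        simp only [Pi.zero_apply, mul_zero, Finset.sum_const_zero, add_zero]
        rw [← hA i]
        have := sum_mul_latticeBasis (fun j => shortWeight A i j) i
        simp only [Int.cast_id] at this
        rw [shortWeight] at this
        rw [← this]
        exact Finset.sum_congr rfl fun j _ => mul_comm _ _
      rw [this, show -(0 : ℤ) - 1 - -2 = 1 by norm_num, creationCoeff_one]
      simp
    · intro j
      have e1 := shortWeight_eq hq hs i j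
      have e2 := sum_mul_latticeBasis (fun l => (corootGram A q j l : ℂ)) i
      have e3 := sum_mul_latticeBasis (fun l => corootGram A q j l) i
      simp only [Int.cast_id] at e3
      rw [chargePair, e3]
      push_cast
      rw [e1, ← e2, ← Finset.sum_add_distrib]
      refine Finset.sum_congr rfl fun l _ => ?_
      ring
  rw [hb, hM.zero_right, hx, intertwiner_smul hM, intertwiner_translation hM hT] at h1
  simpa using h1

include hq hs hG in
-- For j ≠ i the j-th screening already kills e^{eᵢ}: the creation degree -1 + A j i is negative.
-- Closure of its kernel under products then applies; only j = i needs qᵢ ≠ 1.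
theorem longScreening_mem_feiginTipunin (hA : ∀ i, A i i = 2) (hA' : ∀ i j, i ≠ j → A i j ≤ 0)
    {i : I} (hqi : q i ≠ 1) {b : LatticeFock I} (hb : b ∈ feiginTipunin A q) :
    latticeMode (corootGram A q) E 0 (longScreening i) 0 b ∈ feiginTipunin A q := by
  rw [feiginTipunin, Submodule.mem_iInf] at *
  intro j
  by_cases hij : j = i
  · subst hij
    exact longScreening_mem_ker_self hq hs hG hA hqi (hb j)
  · refine mode_mem_ker_shortScreening hq hs hG j ?_ (hb j) 0
    have := sum_mul_latticeBasis (fun k => A j k) i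
    simp only [Int.cast_id] at this
    rw [LinearMap.mem_ker, longScreening, shortScreening_ground, this,
      creationCoeff_neg _ (by have := hA' j i hij; omega), Finsupp.single_zero]

end FeiginTipunin

/-! ### The Δ-operator and its differential equations. -/

section DeltaSeries

variable {V : Type*} [AddCommGroup V] [Module ℂ V] {Y : V → ℤ → V → V}

/-- The operator `x_n z^{-n}` on series in `log z` and `z⁻¹`. -/
def modeShift (hY : IsFieldMap Y) (x : V) (n : ℕ) : (ℕ → ℕ → V) →ₗ[ℂ] (ℕ → ℕ → V) where
  toFun F k q := if n ≤ q then Y x n (F k (q - n)) else 0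
  map_add' F F' := by
    funext k q
    simp only [Pi.add_apply]
    split_ifs
    · rw [hY.add_right]
    · rw [add_zero]
  map_smul' t F := by
    funext k q
    simp only [Pi.smul_apply, RingHom.id_apply]
    split_ifs
    · rw [hY.smul_right]
    · rw [smul_zero]

/-- The operator `x_0 log z`. -/
def logShift (hY : IsFieldMap Y) (x : V) : (ℕ → ℕ → V) →ₗ[ℂ] (ℕ → ℕ → V) where
  toFun F k q := if k = 0 then 0 else Y x 0 (F (k - 1) q)
  map_add' F F' := by
    funext k q
    simp only [Pi.add_apply]
    split_ifs
    · rw [add_zero]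
    · rw [hY.add_right]
  map_smul' t F := by
    funext k q
    simp only [Pi.smul_apply, RingHom.id_apply]
    split_ifs
    · rw [smul_zero]
    · rw [hY.smul_right]

/-- The operator `∑_{n ≥ 1} c n • x_n z^{-n}`. -/
def seriesShift (hY : IsFieldMap Y) (x : V) (c : ℕ → ℂ) : (ℕ → ℕ → V) →ₗ[ℂ] (ℕ → ℕ → V) where
  toFun F k q := ∑ n ∈ Finset.Icc 1 q, c n • modeShift hY x n F k q
  map_add' F F' := by
    funext k q
    simp only [map_add, Pi.add_apply, smul_add, Finset.sum_add_distrib]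
  map_smul' t F := by
    funext k q
    simp only [map_smul, Pi.smul_apply, RingHom.id_apply, Finset.smul_sum]
    exact Finset.sum_congr rfl fun n _ => smul_comm _ _ _

variable (hY : IsFieldMap Y) {x : V}

theorem modeShift_apply (n : ℕ) (F : ℕ → ℕ → V) (k q : ℕ) :
    modeShift hY x n F k q = if n ≤ q then Y x n (F k (q - n)) else 0 := rfl

theorem logShift_apply (F : ℕ → ℕ → V) (k q : ℕ) :
    logShift hY x F k q = if k = 0 then 0 else Y x 0 (F (k - 1) q) := rfl

theorem seriesShift_apply (c : ℕ → ℂ) (F : ℕ → ℕ → V) (k q : ℕ) :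
    seriesShift hY x c F k q = ∑ n ∈ Finset.Icc 1 q, c n • modeShift hY x n F k q := rfl

theorem seriesShift_eq (c : ℕ → ℂ) (F : ℕ → ℕ → V) (k : ℕ) {q N : ℕ} (h : q ≤ N) :
    seriesShift hY x c F k q = ∑ n ∈ Finset.Icc 1 N, c n • modeShift hY x n F k q := by
  rw [seriesShift_apply]
  refine Finset.sum_subset (Finset.Icc_subset_Icc le_rfl h) fun n _ hn => ?_
  have : ¬ n ≤ q := fun h' => by simp_all
  rw [modeShift_apply, if_neg this, smul_zero]

theorem modeShift_seriesShift (c : ℕ → ℂ) (F : ℕ → ℕ → V) (n k q : ℕ) :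
    modeShift hY x n (seriesShift hY x c F) k q =
      ∑ m ∈ Finset.Icc 1 q, c m • modeShift hY x n (modeShift hY x m F) k q := by
  rw [modeShift_apply]
  split_ifs with h
  · rw [seriesShift_eq hY c F k (Nat.sub_le q n), hY.sum_right]
    refine Finset.sum_congr rfl fun m _ => ?_
    rw [hY.smul_right, modeShift_apply _ n, if_pos h]
  · refine (Finset.sum_eq_zero fun m _ => ?_).symm
    rw [modeShift_apply, if_neg h, smul_zero]

variable (hxx : ∀ (m n : ℕ) v, Y x m (Y x n v) = Y x n (Y x m v))
include hY hxx

theorem modeShift_comm (n m : ℕ) (F : ℕ → ℕ → V) (k q : ℕ) :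
    modeShift hY x n (modeShift hY x m F) k q = modeShift hY x m (modeShift hY x n F) k q := by
  simp only [modeShift_apply]
  by_cases h : n + m ≤ q
  · rw [if_pos (by omega), if_pos (by omega), if_pos (by omega), if_pos (by omega), hxx,
      Nat.sub_right_comm]
  · by_cases h1 : n ≤ q
    · rw [if_pos h1, if_neg (show ¬ m ≤ q - n by omega), hY.zero_right]
      split_ifs <;> first | rfl | omega | simp [hY.zero_right]
    · rw [if_neg h1]
      split_ifs <;> first | rfl | omega | simp [hY.zero_right]

theorem seriesShift_comm (c c' : ℕ → ℂ) (F : ℕ → ℕ → V) :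
    seriesShift hY x c (seriesShift hY x c' F) = seriesShift hY x c' (seriesShift hY x c F) := by
  funext k q
  simp only [seriesShift_apply hY, modeShift_seriesShift hY, Finset.smul_sum]
  rw [Finset.sum_comm]
  refine Finset.sum_congr rfl fun m _ => Finset.sum_congr rfl fun n _ => ?_
  rw [modeShift_comm hY hxx, smul_comm]

theorem logShift_seriesShift (c : ℕ → ℂ) (F : ℕ → ℕ → V) :
    logShift hY x (seriesShift hY x c F) = seriesShift hY x c (logShift hY x F) := by
  funext k q
  rw [logShift_apply, seriesShift_apply hY c (logShift hY x F)]
  split_ifs with h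
  · rw [eq_comm, Finset.sum_eq_zero]
    intro n _
    rw [modeShift_apply, logShift_apply, if_pos h, hY.zero_right, ite_self, smul_zero]
  · rw [seriesShift_apply, hY.sum_right]
    refine Finset.sum_congr rfl fun n _ => ?_
    rw [hY.smul_right, modeShift_apply, modeShift_apply, logShift_apply, if_neg h]
    split_ifs
    · rw [← Nat.cast_zero, hxx]
    · rw [hY.zero_right]

omit hxx in
theorem deltaExponent_eq (F : ℕ → ℕ → V) : deltaExponent Y x F =
    (logShift hY x + seriesShift hY x fun n => (-1 : ℂ) ^ n / (-(n : ℂ))) F := by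
  funext k q
  rw [deltaExponent, LinearMap.add_apply, Pi.add_apply, Pi.add_apply, logShift_apply,
    seriesShift_apply]
  congr 1
  refine Finset.sum_congr rfl fun n hn => ?_
  rw [modeShift_apply, if_pos (Finset.mem_Icc.mp hn).2]

/-- The initial series `a`. -/
def deltaInit (a : V) : ℕ → ℕ → V := fun k q => if k = 0 ∧ q = 0 then a else 0

omit hxx in
theorem deltaExponent_iterate_eq_zero (a : V) (r : ℕ) : ∀ k q, k + q < r →
    (deltaExponent Y x)^[r] (deltaInit a) k q = 0 := by
  induction r with
  | zero => intro k q h; omega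
  | succ r ih =>
    intro k q h
    rw [Function.iterate_succ_apply', deltaExponent, Finset.sum_eq_zero, add_zero]
    · split_ifs
      · rfl
      · rw [ih _ _ (by omega), hY.zero_right]
    · intro n hn
      rw [Finset.mem_Icc] at hn
      rw [ih _ _ (by omega), hY.zero_right, smul_zero]

omit hxx in
theorem deltaCoeff_eq_range (a : V) {k q R : ℕ} (h : k + q < R) : deltaCoeff Y x a k q =
    ∑ r ∈ Finset.range R, ((r.factorial : ℂ)⁻¹) • (deltaExponent Y x)^[r] (deltaInit a) k q := by
  rw [deltaCoeff]
  refine Finset.sum_subset (Finset.range_subset_range.mpr h) fun r _ hr => ?_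
  rw [Finset.mem_range] at hr
  change _ • (deltaExponent Y x)^[r] (deltaInit a) k q = 0
  rw [deltaExponent_iterate_eq_zero hY a r k q (by omega), smul_zero]

omit hxx in
/-- A weight operator on series that has commutator `Q` with the exponent acts on the exponential
as `Q`. -/
theorem deltaCoeff_of_weight (W : ℕ → ℕ → ℂ) (hW : W 0 0 = 0)
    (Q : (ℕ → ℕ → V) →ₗ[ℂ] (ℕ → ℕ → V))
    (hloc : ∀ F F' k q, (∀ k' q', k' + q' ≤ k + q → F k' q' = F' k' q') → Q F k q = Q F' k q)
    (hWP : ∀ F k q, W k q • deltaExponent Y x F k q =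
      deltaExponent Y x (fun k q => W k q • F k q) k q + Q F k q)
    (hQP : ∀ F, Q (deltaExponent Y x F) = deltaExponent Y x (Q F)) (a : V) (k q : ℕ) :
    W k q • deltaCoeff Y x a k q = Q (deltaCoeff Y x a) k q := by
  set P := logShift hY x + seriesShift hY x fun n => (-1 : ℂ) ^ n / (-(n : ℂ)) with hP
  have hPe : deltaExponent Y x = P := funext fun F => deltaExponent_eq hY F
  -- With exponent P, the relations [W, P] = Q and QP = PQ give W P^(r+1) = (r + 1) Q P^r on the
  -- initial series, which W annihilates.
  have step : ∀ r, (fun k q => W k q • (deltaExponent Y x)^[r + 1] (deltaInit a) k q) =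
      ((r : ℂ) + 1) • Q ((deltaExponent Y x)^[r] (deltaInit a)) := by
    intro r
    induction r with
    | zero =>
      funext k q
      rw [Function.iterate_one, hWP, Function.iterate_zero_apply]
      have : (fun k q => W k q • deltaInit a k q) = 0 := by
        funext k q
        simp only [deltaInit, Pi.zero_apply]
        split_ifs with h
        · rw [h.1, h.2, hW, zero_smul]
        · rw [smul_zero]
      rw [this, hPe, map_zero]
      simp
    | succ r ih =>
      funext k q
      rw [Function.iterate_succ_apply', hWP, ih, hPe, map_smul, ← hPe, ← hQP,
        Function.iterate_succ_apply']
      simp only [Pi.smul_apply]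
      push_cast
      module
  obtain ⟨R, hR⟩ : ∃ R, k + q < R := ⟨_, Nat.lt_succ_self _⟩
  -- The truncated exponential agrees with Δ only up to total degree k + q, which is why Q must be
  -- local.
  have hQ : Q (deltaCoeff Y x a) k q = Q (∑ r ∈ Finset.range R, ((r.factorial : ℂ)⁻¹) •
      (deltaExponent Y x)^[r] (deltaInit a)) k q := by
    refine hloc _ _ _ _ fun k' q' h => ?_
    rw [deltaCoeff_eq_range hY a (show k' + q' < R by omega)]
    simp only [Finset.sum_apply, Pi.smul_apply]
  rw [hQ, map_sum, Finset.sum_apply, Finset.sum_apply, deltaCoeff_eq_range hY a (show k + q < R + 1 by omega), Finset.sum_range_succ',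
    smul_add, Finset.smul_sum]
  have h0 : W k q • ((Nat.factorial 0 : ℂ)⁻¹ • (deltaExponent Y x)^[0] (deltaInit a) k q) = 0 := by
    rw [Function.iterate_zero_apply, deltaInit]
    split_ifs with h
    · rw [h.1, h.2, hW, zero_smul]
    · simp
  rw [h0, add_zero]
  refine Finset.sum_congr rfl fun r _ => ?_
  have h1 : W k q • (deltaExponent Y x)^[r + 1] (deltaInit a) k q =
      (((r : ℂ) + 1) • Q ((deltaExponent Y x)^[r] (deltaInit a))) k q :=
    congrFun (congrFun (step r) k) q
  have hr : (r : ℂ) + 1 ≠ 0 := by exact_mod_cast Nat.succ_ne_zero r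
  rw [smul_comm, h1, map_smul, Pi.smul_apply, Pi.smul_apply, Pi.smul_apply, Pi.smul_apply,
    smul_smul, Nat.factorial_succ]
  congr 1
  push_cast
  field_simp

/-- `k ∂/∂(log z)`-recursion for the `Δ`-operator. -/
theorem deltaCoeff_succ_left (a : V) (k q : ℕ) :
    ((k : ℂ) + 1) • deltaCoeff Y x a (k + 1) q = Y x 0 (deltaCoeff Y x a k q) := by
  have := deltaCoeff_of_weight (x := x) hY (fun k _ => (k : ℂ)) (by simp) (logShift hY x) ?_ ?_ ?_ a
    (k + 1) q
  · rw [logShift_apply, if_neg (by omega), Nat.add_sub_cancel] at this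
    rw [← this]; push_cast; rfl
  · intro F F' k q h
    rw [logShift_apply, logShift_apply]
    split_ifs
    · rfl
    · rw [h _ _ (by omega)]
  · intro F k q
    rw [deltaExponent_eq hY, deltaExponent_eq hY, LinearMap.add_apply, LinearMap.add_apply,
      Pi.add_apply, Pi.add_apply, Pi.add_apply, Pi.add_apply, smul_add]
    have h1 : seriesShift hY x (fun n => (-1 : ℂ) ^ n / (-(n : ℂ)))
        (fun k q => (k : ℂ) • F k q) k q =
        (k : ℂ) • seriesShift hY x (fun n => (-1 : ℂ) ^ n / (-(n : ℂ))) F k q := by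
      rw [seriesShift_apply, seriesShift_apply, Finset.smul_sum]
      refine Finset.sum_congr rfl fun n _ => ?_
      rw [modeShift_apply, modeShift_apply, hY.smul_right, smul_comm]
      split_ifs
      · rfl
      · simp
    have h2 : (k : ℂ) • logShift hY x F k q =
        logShift hY x (fun k q => (k : ℂ) • F k q) k q + logShift hY x F k q := by
      simp only [logShift_apply]
      split_ifs with h
      · simp
      · rw [hY.smul_right, Nat.cast_sub (by omega)]
        push_cast
        module
    rw [h1, h2]; abel
  · intro F
    rw [deltaExponent_eq hY, deltaExponent_eq hY, LinearMap.add_apply, LinearMap.add_apply, map_add,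
      logShift_seriesShift hY hxx]

/-- The Euler recursion for the `Δ`-operator. -/
theorem deltaCoeff_euler (a : V) (k q : ℕ) : ((q : ℂ) + 1) • deltaCoeff Y x a k (q + 1) =
    ∑ p ∈ Finset.HasAntidiagonal.antidiagonal q,
      (-1 : ℂ) ^ p.1 • Y x (p.1 + 1 : ℕ) (deltaCoeff Y x a k p.2) := by
  have := deltaCoeff_of_weight (x := x) hY (fun _ q => (q : ℂ)) (by simp)
    (seriesShift hY x fun n => -(-1 : ℂ) ^ n) ?_ ?_ ?_ a k (q + 1)
  · rw [Nat.cast_add, Nat.cast_one] at this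
    rw [this, seriesShift_apply, Finset.Nat.sum_antidiagonal_eq_sum_range_succ_mk]
    refine Finset.sum_nbij' (fun n => n - 1) (fun p => p + 1) ?_ ?_ ?_ ?_ ?_
    · intro n hn; simp only [Finset.mem_Icc, Finset.mem_range] at *; omega
    · intro n hn; simp only [Finset.mem_Icc, Finset.mem_range] at *; omega
    · intro n hn; simp only [Finset.mem_Icc] at *; omega
    · intro n hn; simp
    · intro n hn
      rw [Finset.mem_Icc] at hn
      obtain ⟨p, rfl⟩ := Nat.exists_eq_add_of_le' hn.1
      rw [modeShift_apply, if_pos hn.2, pow_succ, Nat.add_sub_cancel, Nat.add_sub_add_right,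
        mul_neg_one, neg_neg]
  · intro F F' k q h
    rw [seriesShift_apply, seriesShift_apply]
    refine Finset.sum_congr rfl fun n _ => ?_
    rw [modeShift_apply, modeShift_apply]
    split_ifs
    · rw [h _ _ (by omega)]
    · rfl
  · intro F k q
    rw [deltaExponent_eq hY, deltaExponent_eq hY, LinearMap.add_apply, LinearMap.add_apply,
      Pi.add_apply, Pi.add_apply, Pi.add_apply, Pi.add_apply, smul_add, add_assoc]
    congr 1
    · rw [logShift_apply, logShift_apply, hY.smul_right]
      split_ifs
      · rw [smul_zero]
      · rfl
    · rw [seriesShift_apply, seriesShift_apply, seriesShift_apply, Finset.smul_sum,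
        ← Finset.sum_add_distrib]
      refine Finset.sum_congr rfl fun n hn => ?_
      rw [Finset.mem_Icc] at hn
      have hn0 : (n : ℂ) ≠ 0 := by exact_mod_cast (show n ≠ 0 by omega)
      rw [modeShift_apply, modeShift_apply, if_pos hn.2, if_pos hn.2, hY.smul_right,
        Nat.cast_sub hn.2, smul_smul, smul_smul, ← add_smul]
      congr 1
      field_simp
      ring
  · intro F
    rw [deltaExponent_eq hY, deltaExponent_eq hY, LinearMap.add_apply, LinearMap.add_apply, map_add,
      logShift_seriesShift hY hxx, seriesShift_comm hY hxx]

end DeltaSeries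

/-! ### Rearrangement of iterated antidiagonal sums. -/

section AntidiagonalSums

variable {M : Type*} [AddCommMonoid M]

theorem sum_antidiagonal_assoc (F : ℕ → ℕ → ℕ → M) (s : ℕ) :
    ∑ tr ∈ Finset.HasAntidiagonal.antidiagonal s,
      ∑ pt ∈ Finset.HasAntidiagonal.antidiagonal tr.1, F pt.1 pt.2 tr.2 =
    ∑ ps ∈ Finset.HasAntidiagonal.antidiagonal s,
      ∑ tr ∈ Finset.HasAntidiagonal.antidiagonal ps.2, F ps.1 tr.1 tr.2 := by
  rw [Finset.sum_sigma', Finset.sum_sigma']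
  refine Finset.sum_nbij' (fun z => ⟨(z.2.1, z.2.2 + z.1.2), (z.2.2, z.1.2)⟩)
    (fun z => ⟨(z.1.1 + z.2.1, z.2.2), (z.1.1, z.2.1)⟩) ?_ ?_ ?_ ?_ ?_
  all_goals
    rintro ⟨⟨a, b⟩, ⟨c, d⟩⟩ h
    simp only [Finset.mem_sigma, Finset.HasAntidiagonal.mem_antidiagonal] at h
    simp only [Finset.mem_sigma, Finset.HasAntidiagonal.mem_antidiagonal]
  · exact ⟨by omega, trivial⟩
  · exact ⟨by omega, trivial⟩
  · obtain ⟨h1, rfl⟩ := h; rfl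
  · obtain ⟨h1, rfl⟩ := h; rfl

theorem sum_antidiagonal_left_comm (F : ℕ → ℕ → ℕ → M) (s : ℕ) :
    ∑ tr ∈ Finset.HasAntidiagonal.antidiagonal s,
      ∑ pr ∈ Finset.HasAntidiagonal.antidiagonal tr.2, F pr.1 tr.1 pr.2 =
    ∑ ps ∈ Finset.HasAntidiagonal.antidiagonal s,
      ∑ tr ∈ Finset.HasAntidiagonal.antidiagonal ps.2, F ps.1 tr.1 tr.2 := by
  rw [Finset.sum_sigma', Finset.sum_sigma']
  refine Finset.sum_nbij' (fun z => ⟨(z.2.1, z.1.1 + z.2.2), (z.1.1, z.2.2)⟩)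
    (fun z => ⟨(z.2.1, z.1.1 + z.2.2), (z.1.1, z.2.2)⟩) ?_ ?_ ?_ ?_ ?_
  all_goals
    rintro ⟨⟨a, b⟩, ⟨c, d⟩⟩ h
    simp only [Finset.mem_sigma, Finset.HasAntidiagonal.mem_antidiagonal] at h
    simp only [Finset.mem_sigma, Finset.HasAntidiagonal.mem_antidiagonal]
  · exact ⟨by omega, trivial⟩
  · exact ⟨by omega, trivial⟩
  · obtain ⟨h1, rfl⟩ := h; rfl
  · obtain ⟨h1, rfl⟩ := h; rfl

theorem sum_antidiagonal_exchange (F : ℕ → ℕ → ℕ → ℕ → M) (s : ℕ) :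
    ∑ pt ∈ Finset.HasAntidiagonal.antidiagonal s,
      ∑ qj ∈ Finset.HasAntidiagonal.antidiagonal pt.2,
        ∑ il ∈ Finset.HasAntidiagonal.antidiagonal pt.1, F il.1 il.2 qj.1 qj.2 =
    ∑ QT ∈ Finset.HasAntidiagonal.antidiagonal s,
      ∑ iq ∈ Finset.HasAntidiagonal.antidiagonal QT.1,
        ∑ lj ∈ Finset.HasAntidiagonal.antidiagonal QT.2, F iq.1 lj.1 iq.2 lj.2 := by
  simp only [← Finset.sum_product']
  rw [Finset.sum_sigma', Finset.sum_sigma']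
  refine Finset.sum_nbij'
    (fun z => ⟨(z.2.2.1 + z.2.1.1, z.2.2.2 + z.2.1.2), ((z.2.2.1, z.2.1.1), (z.2.2.2, z.2.1.2))⟩)
    (fun z => ⟨(z.2.1.1 + z.2.2.1, z.2.1.2 + z.2.2.2), ((z.2.1.2, z.2.2.2), (z.2.1.1, z.2.2.1))⟩)
    ?_ ?_ ?_ ?_ ?_
  all_goals
    rintro ⟨⟨a, b⟩, ⟨⟨c, d⟩, ⟨e, f⟩⟩⟩ h
    simp only [Finset.mem_sigma, Finset.mem_product, Finset.HasAntidiagonal.mem_antidiagonal] at h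
    simp only [Finset.mem_sigma, Finset.mem_product, Finset.HasAntidiagonal.mem_antidiagonal]
  · exact ⟨by omega, trivial, trivial⟩
  · exact ⟨by omega, trivial, trivial⟩
  · obtain ⟨h1, rfl, rfl⟩ := h; rfl
  · obtain ⟨h1, rfl, rfl⟩ := h; rfl

end AntidiagonalSums

/-! ### Compatibility of the Δ-operator with products. -/

section DeltaProduct

variable {V : Type*} [AddCommGroup V] [Module ℂ V] {vac x : V} {Y : V → ℤ → V → V}

/-- The coefficient of `z^{-q}` in the logarithm-free part of `Δ(x, z) a`. -/
def deltaZ (Y : V → ℤ → V → V) (x : V) (q : ℕ) (a : V) : V := deltaCoeff Y x a 0 q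

theorem deltaInit_add (a b : V) : deltaInit (a + b) = deltaInit a + deltaInit b := by
  funext k q; simp only [deltaInit, Pi.add_apply]; split_ifs <;> simp

theorem deltaInit_smul (t : ℂ) (a : V) : deltaInit (t • a) = t • deltaInit a := by
  funext k q; simp only [deltaInit, Pi.smul_apply]; split_ifs <;> simp

theorem deltaExponent_iterate_eq (hY : IsFieldMap Y) (r : ℕ) (F : ℕ → ℕ → V) :
    (deltaExponent Y x)^[r] F =
      ((logShift hY x + seriesShift hY x fun n => (-1 : ℂ) ^ n / (-(n : ℂ))) ^ r) F := by
  rw [show deltaExponent Y x = ⇑(logShift hY x + seriesShift hY x fun n =>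
    (-1 : ℂ) ^ n / (-(n : ℂ))) from funext fun F => deltaExponent_eq hY F, Module.End.pow_apply]

theorem deltaCoeff_add (hY : IsFieldMap Y) (a b : V) (k q : ℕ) :
    deltaCoeff Y x (a + b) k q = deltaCoeff Y x a k q + deltaCoeff Y x b k q := by
  simp only [deltaCoeff_eq_range hY _ (Nat.lt_succ_self (k + q)), deltaExponent_iterate_eq hY,
    deltaInit_add, map_add, Pi.add_apply, smul_add, Finset.sum_add_distrib]

theorem deltaCoeff_smul (hY : IsFieldMap Y) (t : ℂ) (a : V) (k q : ℕ) :
    deltaCoeff Y x (t • a) k q = t • deltaCoeff Y x a k q := by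
  simp only [deltaCoeff_eq_range hY _ (Nat.lt_succ_self (k + q)), deltaExponent_iterate_eq hY,
    deltaInit_smul, map_smul, Pi.smul_apply, Finset.smul_sum]
  exact Finset.sum_congr rfl fun r _ => smul_comm _ _ _

theorem deltaZ_zero (a : V) : deltaZ Y x 0 a = a := by
  simp [deltaZ, deltaCoeff]

/-- `deltaZ` as a linear map. -/
def deltaZLin (hY : IsFieldMap Y) (x : V) (q : ℕ) : V →ₗ[ℂ] V where
  toFun := deltaZ Y x q
  map_add' a b := deltaCoeff_add hY a b 0 q
  map_smul' t a := deltaCoeff_smul hY t a 0 q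

theorem deltaZLin_apply (hY : IsFieldMap Y) (q : ℕ) (a : V) : deltaZLin hY x q a = deltaZ Y x q a :=
  rfl

theorem deltaZ_sub (hY : IsFieldMap Y) (q : ℕ) (a b : V) :
    deltaZ Y x q (a - b) = deltaZ Y x q a - deltaZ Y x q b := map_sub (deltaZLin hY x q) a b

theorem deltaZ_zero_right (hY : IsFieldMap Y) (q : ℕ) : deltaZ Y x q 0 = 0 :=
  map_zero (deltaZLin hY x q)

theorem mode_comm_of_products_zero (hV : IsVertexAlgebra vac Y) (hx : ∀ n : ℕ, Y x n x = 0)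
    (m n : ℤ) (v : V) : Y x m (Y x n v) = Y x n (Y x m v) := by
  have hY := hV.toIsVertexModule.isFieldMap
  have := Borcherds.commutator (a := x) (b := x) (hV.borcherds x x) m n v
  rw [sub_eq_iff_eq_add] at this
  rw [this, add_eq_right, jacobiRHS, finsum_eq_zero_of_forall_eq_zero]
  intro j
  rw [zero_add, hx, hY.zero_left, smul_zero]

theorem mode_commutator_antidiagonal (hV : IsVertexAlgebra vac Y) (p : ℕ) (c v : V) (k : ℤ) :
    Y x p (Y c k v) = Y c k (Y x p v) + ∑ il ∈ Finset.HasAntidiagonal.antidiagonal p,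
      cb p il.1 • Y (Y x il.1 c) (k + il.2) v := by
  have := Borcherds.commutator (a := x) (b := c) (hV.borcherds x c) p k v
  rw [sub_eq_iff_eq_add] at this
  rw [this, add_comm]
  congr 1
  rw [jacobiRHS, finsum_eq_range (L := p + 1) fun j hj => ?_,
    Finset.Nat.sum_antidiagonal_eq_sum_range_succ_mk]
  · refine Finset.sum_congr rfl fun j hj => ?_
    rw [Finset.mem_range] at hj
    rw [zero_add, Nat.cast_sub (by omega), show (p : ℤ) + k - j = k + (p - j) by ring]
    rfl
  · have := cb_natCast_of_lt (show p < j by omega)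
    rw [cb] at this
    rw [this, zero_smul]

/-- The mode `x_0` as a linear map. -/
def zeroMode (hY : IsFieldMap Y) (x : V) : V →ₗ[ℂ] V where
  toFun := Y x 0
  map_add' a b := hY.add_right x 0 a b
  map_smul' t a := hY.smul_right t x 0 a

section Binom

variable (D : V →ₗ[ℂ] V)

theorem binomOp_zero_right (m : ℤ) (a : V) : binomOp D m 0 a = a := rfl

theorem binomOp_succ (m : ℤ) (j : ℕ) (a : V) : ((j : ℂ) + 1) • binomOp D m (j + 1) a =
    ((m : ℂ) - j) • binomOp D m j a - D (binomOp D m j a) := by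
  rw [binomOp, smul_inv_smul₀ (by exact_mod_cast Nat.succ_ne_zero j)]

theorem binomOp_succ_left (m : ℤ) (j : ℕ) (a : V) : ((j : ℂ) + 1) • binomOp D m (j + 1) a =
    binomOp D (m - 1) j ((m : ℂ) • a - D a) := by
  induction j with
  | zero => rw [binomOp_succ, binomOp_zero_right, binomOp_zero_right]; simp
  | succ j ih =>
    have h : (j : ℂ) + 1 ≠ 0 := by exact_mod_cast Nat.succ_ne_zero j
    refine smul_right_injective V h ?_
    simp only
    rw [binomOp_succ D (m - 1), ← ih, binomOp_succ, smul_sub, map_smul]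
    push_cast
    module

end Binom

section Product

variable (hV : IsVertexAlgebra vac Y) (hx : ∀ n : ℕ, Y x n x = 0)
include hV hx

theorem deltaZ_euler (q : ℕ) (a : V) : ((q : ℂ) + 1) • deltaZ Y x (q + 1) a =
    ∑ p ∈ Finset.HasAntidiagonal.antidiagonal q,
      (-1 : ℂ) ^ p.1 • Y x (p.1 + 1 : ℕ) (deltaZ Y x p.2 a) :=
  deltaCoeff_euler hV.toIsVertexModule.isFieldMap
    (fun m n v => mode_comm_of_products_zero hV hx m n v) a 0 q

theorem deltaZ_zeroMode (q : ℕ) (a : V) : deltaZ Y x q (Y x 0 a) = Y x 0 (deltaZ Y x q a) := by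
  have hY := hV.toIsVertexModule.isFieldMap
  induction q using Nat.strong_induction_on with
  | _ q ih =>
    cases q with
    | zero => rw [deltaZ_zero, deltaZ_zero]
    | succ q =>
      have h : (q : ℂ) + 1 ≠ 0 := by exact_mod_cast Nat.succ_ne_zero q
      refine smul_right_injective V h ?_
      simp only
      rw [← hY.smul_right, deltaZ_euler hV hx, deltaZ_euler hV hx, hY.sum_right]
      refine Finset.sum_congr rfl fun p hp => ?_
      rw [Finset.HasAntidiagonal.mem_antidiagonal] at hp
      rw [ih _ (by omega), hY.smul_right, mode_comm_of_products_zero hV hx]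

/-- Adding the x₀ term to the Euler recursion gives a sum over all i ≥ 0, the shape in which
commutators produce it. -/
theorem sum_mode_deltaZ (Q : ℕ) (a : V) : ∑ iq ∈ Finset.HasAntidiagonal.antidiagonal Q,
    (-1 : ℂ) ^ iq.1 • Y x iq.1 (deltaZ Y x iq.2 a) =
      Y x 0 (deltaZ Y x Q a) - (Q : ℂ) • deltaZ Y x Q a := by
  cases Q with
  | zero => simp
  | succ Q =>
    rw [Finset.Nat.sum_antidiagonal_succ, Nat.cast_succ, deltaZ_euler hV hx, sub_eq_add_neg,
      ← Finset.sum_neg_distrib]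
    congr 1
    · simp
    · refine Finset.sum_congr rfl fun p _ => ?_
      rw [pow_succ, mul_neg_one, neg_smul]

/-- The homogeneous part of degree `t` of `∑ cb (m - q) j • Y (Δ_q a) (n + j)`. -/
def deltaMode (Y : V → ℤ → V → V) (x a : V) (m n : ℤ) (t : ℕ) (v : V) : V :=
  ∑ qj ∈ Finset.HasAntidiagonal.antidiagonal t,
    cb (m - qj.1) qj.2 • Y (deltaZ Y x qj.1 a) (n + qj.2) v

omit hx in
theorem deltaMode_add (a v w : V) (m n : ℤ) (t : ℕ) : deltaMode Y x a m n t (v + w) =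
    deltaMode Y x a m n t v + deltaMode Y x a m n t w := by
  have hY := hV.toIsVertexModule.isFieldMap
  simp only [deltaMode, hY.add_right, smul_add, Finset.sum_add_distrib]

omit hx in
theorem deltaMode_smul (a v : V) (c : ℂ) (m n : ℤ) (t : ℕ) : deltaMode Y x a m n t (c • v) =
    c • deltaMode Y x a m n t v := by
  have hY := hV.toIsVertexModule.isFieldMap
  simp only [deltaMode, hY.smul_right, Finset.smul_sum]
  exact Finset.sum_congr rfl fun _ _ => smul_comm _ _ _

omit hx in
theorem deltaMode_sum {ι : Type*} (s : Finset ι) (f : ι → V) (a : V) (m n : ℤ) (t : ℕ) :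
    deltaMode Y x a m n t (∑ i ∈ s, f i) = ∑ i ∈ s, deltaMode Y x a m n t (f i) :=
  map_sum (⟨⟨deltaMode Y x a m n t, fun v w => deltaMode_add hV a v w m n t⟩,
    fun c v => deltaMode_smul hV a v c m n t⟩ : V →ₗ[ℂ] V) f s

/-- Each commutator of x_p with a mode of Δ_q a is a sum of modes of x_i Δ_q a. After regrouping the
four indices, the sum over i + q = Q is `sum_mode_deltaZ`, and Vandermonde with upper index -i - 1
recombines the binomials. -/
theorem deltaMode_commutator_sum (a v : V) (m n : ℤ) (s : ℕ) :
    ∑ pt ∈ Finset.HasAntidiagonal.antidiagonal s, (-1 : ℂ) ^ pt.1 •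
      (Y x pt.1 (deltaMode Y x a m n pt.2 v) - deltaMode Y x a m n pt.2 (Y x pt.1 v)) =
    ∑ QT ∈ Finset.HasAntidiagonal.antidiagonal s, cb (m - 1 - QT.1) QT.2 •
      Y (Y x 0 (deltaZ Y x QT.1 a) - (QT.1 : ℂ) • deltaZ Y x QT.1 a) (n + QT.2) v := by
  have hY := hV.toIsVertexModule.isFieldMap
  have h1 : ∀ pt : ℕ × ℕ, (-1 : ℂ) ^ pt.1 •
      (Y x pt.1 (deltaMode Y x a m n pt.2 v) - deltaMode Y x a m n pt.2 (Y x pt.1 v)) =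
      ∑ qj ∈ Finset.HasAntidiagonal.antidiagonal pt.2,
        ∑ il ∈ Finset.HasAntidiagonal.antidiagonal pt.1,
          ((-1 : ℂ) ^ (il.1 + il.2) * cb (il.1 + il.2 : ℕ) il.1 * cb (m - qj.1) qj.2) •
            Y (Y x il.1 (deltaZ Y x qj.1 a)) (n + (il.2 + qj.2 : ℕ)) v := by
    intro pt
    rw [deltaMode, deltaMode, hY.sum_right, ← Finset.sum_sub_distrib, Finset.smul_sum]
    refine Finset.sum_congr rfl fun qj _ => ?_
    rw [hY.smul_right, mode_commutator_antidiagonal hV, ← smul_sub, add_sub_cancel_left,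
      smul_smul, Finset.smul_sum]
    refine Finset.sum_congr rfl fun il hil => ?_
    rw [Finset.HasAntidiagonal.mem_antidiagonal] at hil
    rw [smul_smul, hil, Nat.cast_add, show n + (qj.2 : ℤ) + il.2 = n + (il.2 + qj.2) by ring]
    congr 1
    ring
  rw [Finset.sum_congr rfl fun pt _ => h1 pt, sum_antidiagonal_exchange fun i l q j =>
    ((-1 : ℂ) ^ (i + l) * cb (i + l : ℕ) i * cb (m - q) j) •
            Y (Y x i (deltaZ Y x q a)) (n + (l + j : ℕ)) v]
  refine Finset.sum_congr rfl fun QT _ => ?_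
  rw [← sum_mode_deltaZ hV hx, hY.sum_left, Finset.smul_sum]
  refine Finset.sum_congr rfl fun iq hiq => ?_
  rw [Finset.HasAntidiagonal.mem_antidiagonal] at hiq
  rw [hY.smul_left, smul_smul,
    show m - 1 - (QT.1 : ℤ) = (-iq.1 - 1) + (m - iq.2) by rw [← hiq]; push_cast; ring, cb_add,
    Finset.sum_mul, Finset.sum_smul]
  refine Finset.sum_congr rfl fun lj hlj => ?_
  rw [Finset.HasAntidiagonal.mem_antidiagonal] at hlj
  rw [hlj]
  congr 1
  have : cb (-iq.1 - 1) lj.1 = (-1) ^ lj.1 * cb (iq.1 + lj.1 : ℕ) iq.1 := by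
    rw [show (-(iq.1 : ℤ) - 1) = -((iq.1 : ℤ) + 1) by ring, cb_neg,
      show (iq.1 : ℤ) + 1 + lj.1 - 1 = (iq.1 + lj.1 : ℕ) by push_cast; ring, cb_natCast, cb_natCast,
      Nat.choose_symm_add]
  rw [this, pow_add]
  ring

/-- The p = 0 part of the preceding commutator sum is x₀ acting as a derivation. Isolating it leaves
the Euler recursion, with the correction that a becomes (m - x₀) a; this is the recursion of binom(m
- x₀, j). -/
theorem deltaMode_succ (a v : V) (m n : ℤ) (t : ℕ) :
    ((t : ℂ) + 1) • deltaMode Y x a m n (t + 1) v =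
      ∑ pt ∈ Finset.HasAntidiagonal.antidiagonal t, (-1 : ℂ) ^ pt.1 •
        (Y x (pt.1 + 1 : ℕ) (deltaMode Y x a m n pt.2 v) -
          deltaMode Y x a m n pt.2 (Y x (pt.1 + 1 : ℕ) v)) +
      deltaMode Y x ((m : ℂ) • a - Y x 0 a) (m - 1) (n + 1) t v := by
  have hY := hV.toIsVertexModule.isFieldMap
  have key := deltaMode_commutator_sum hV hx a v m n (t + 1)
  rw [Finset.Nat.sum_antidiagonal_succ] at key
  have h0 : Y x 0 (deltaMode Y x a m n (t + 1) v) - deltaMode Y x a m n (t + 1) (Y x 0 v) =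
      ∑ qj ∈ Finset.HasAntidiagonal.antidiagonal (t + 1),
        cb (m - qj.1) qj.2 • Y (Y x 0 (deltaZ Y x qj.1 a)) (n + qj.2) v := by
    rw [deltaMode, deltaMode, hY.sum_right, ← Finset.sum_sub_distrib]
    refine Finset.sum_congr rfl fun qj _ => ?_
    have := mode_commutator_antidiagonal (x := x) hV 0 (deltaZ Y x qj.1 a) v (n + qj.2)
    simp only [Nat.cast_zero, Finset.Nat.antidiagonal_zero, Finset.sum_singleton, cb_zero_right,
      one_smul, add_zero] at this
    rw [hY.smul_right, this, ← smul_sub, add_sub_cancel_left]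
  simp only [Nat.cast_zero, pow_zero, one_smul, h0, pow_succ, mul_neg_one, neg_smul,
    Finset.sum_neg_distrib] at key
  rw [← sub_eq_add_neg, sub_eq_iff_eq_add, ← sub_eq_iff_eq_add'] at key
  rw [← key, deltaMode, deltaMode, Finset.smul_sum, ← Finset.sum_sub_distrib,
    Finset.Nat.sum_antidiagonal_succ', Finset.Nat.sum_antidiagonal_succ', add_assoc,
    ← Finset.sum_add_distrib]
  congr 1
  · simp only [cb_zero_right, hY.sub_left, hY.smul_left]
    push_cast
    module
  · refine Finset.sum_congr rfl fun qj hqj => ?_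
    rw [Finset.HasAntidiagonal.mem_antidiagonal] at hqj
    have e1 := cb_pascal (m - 1 - qj.1) qj.2
    have e2 := cb_succ_mul' (m - qj.1) qj.2
    rw [show m - 1 - (qj.1 : ℤ) + 1 = m - qj.1 by ring] at e1
    rw [show m - (qj.1 : ℤ) - 1 = m - 1 - qj.1 by ring] at e2
    rw [deltaZ_sub hY, deltaZ_zeroMode hV hx, show deltaZ Y x qj.1 ((m : ℂ) • a) =
      (m : ℂ) • deltaZ Y x qj.1 a from map_smul (deltaZLin hY x qj.1) _ _]
    simp only [hY.sub_left, hY.smul_left]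
    rw [show n + 1 + (qj.2 : ℤ) = n + (qj.2 + 1 : ℕ) by push_cast; ring, e1]
    have e3 : ((t : ℂ) + 1) * (cb (m - 1 - qj.1) qj.2 + cb (m - 1 - qj.1) (qj.2 + 1)) =
        qj.1 * cb (m - 1 - qj.1) (qj.2 + 1) + m * cb (m - 1 - qj.1) qj.2 := by
      have : (t : ℂ) = qj.1 + qj.2 := by exact_mod_cast hqj.symm
      rw [e1] at e2
      push_cast at e2
      rw [this]
      linear_combination e2
    rw [smul_smul, e3]
    module

/-- The `Δ`-operator intertwines the products of `V` with twisted products, in each homogeneous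
degree. -/
theorem sum_deltaMode_deltaZ (b : V) (s : ℕ) : ∀ (a : V) (m n : ℤ),
    ∑ tr ∈ Finset.HasAntidiagonal.antidiagonal s, deltaMode Y x a m n tr.1 (deltaZ Y x tr.2 b) =
    ∑ jq ∈ Finset.HasAntidiagonal.antidiagonal s,
      deltaZ Y x jq.2 (Y (binomOp (Y x 0) m jq.1 a) (n + jq.1) b) := by
  have hY := hV.toIsVertexModule.isFieldMap
  induction s using Nat.strong_induction_on with
  | _ s ih =>
    intro a m n
    cases s with
    | zero => simp [deltaMode, deltaZ_zero, binomOp]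
    | succ s =>
      have hs : (s : ℂ) + 1 ≠ 0 := by exact_mod_cast Nat.succ_ne_zero s
      refine smul_right_injective V hs ?_
      simp only
      -- Multiplied by s + 1, both sides obey one recursion: the Euler operator applied to lower
      -- degrees, plus the same sum for (m - x₀) a with m - 1 and n + 1.
      trans ∑ ps ∈ Finset.HasAntidiagonal.antidiagonal s, (-1 : ℂ) ^ ps.1 • Y x (ps.1 + 1 : ℕ)
          (∑ tr ∈ Finset.HasAntidiagonal.antidiagonal ps.2,
            deltaMode Y x a m n tr.1 (deltaZ Y x tr.2 b)) +
        ∑ tr ∈ Finset.HasAntidiagonal.antidiagonal s,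
          deltaMode Y x ((m : ℂ) • a - Y x 0 a) (m - 1) (n + 1) tr.1 (deltaZ Y x tr.2 b)
      · have h1 : ((s : ℂ) + 1) • ∑ tr ∈ Finset.HasAntidiagonal.antidiagonal (s + 1),
            deltaMode Y x a m n tr.1 (deltaZ Y x tr.2 b) =
          ∑ tr ∈ Finset.HasAntidiagonal.antidiagonal s,
            ((tr.1 : ℂ) + 1) • deltaMode Y x a m n (tr.1 + 1) (deltaZ Y x tr.2 b) +
          ∑ tr ∈ Finset.HasAntidiagonal.antidiagonal s,
            deltaMode Y x a m n tr.1 (((tr.2 : ℂ) + 1) • deltaZ Y x (tr.2 + 1) b) := by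
          trans ∑ tr ∈ Finset.HasAntidiagonal.antidiagonal (s + 1),
              (tr.1 : ℂ) • deltaMode Y x a m n tr.1 (deltaZ Y x tr.2 b) +
            ∑ tr ∈ Finset.HasAntidiagonal.antidiagonal (s + 1),
              (tr.2 : ℂ) • deltaMode Y x a m n tr.1 (deltaZ Y x tr.2 b)
          · rw [Finset.smul_sum, ← Finset.sum_add_distrib]
            refine Finset.sum_congr rfl fun tr htr => ?_
            rw [Finset.HasAntidiagonal.mem_antidiagonal] at htr
            rw [← add_smul]
            congr 1
            exact_mod_cast htr.symm
          · rw [Finset.Nat.sum_antidiagonal_succ, Finset.Nat.sum_antidiagonal_succ']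
            simp only [Nat.cast_zero, zero_smul, zero_add, Nat.cast_add, Nat.cast_one,
              deltaMode_smul hV]
        rw [h1]
        simp only [deltaMode_succ hV hx, deltaZ_euler hV hx, deltaMode_sum hV, deltaMode_smul hV,
          hY.sum_right, Finset.smul_sum, smul_sub, Finset.sum_add_distrib, Finset.sum_sub_distrib]
        rw [sum_antidiagonal_assoc fun p t r => (-1 : ℂ) ^ p •
            Y x (p + 1 : ℕ) (deltaMode Y x a m n t (deltaZ Y x r b)),
          sum_antidiagonal_assoc fun p t r => (-1 : ℂ) ^ p •
            deltaMode Y x a m n t (Y x (p + 1 : ℕ) (deltaZ Y x r b)),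
          sum_antidiagonal_left_comm fun p t r => (-1 : ℂ) ^ p •
            deltaMode Y x a m n t (Y x (p + 1 : ℕ) (deltaZ Y x r b))]
        abel
      · symm
        have h1 : ((s : ℂ) + 1) • ∑ jq ∈ Finset.HasAntidiagonal.antidiagonal (s + 1),
            deltaZ Y x jq.2 (Y (binomOp (Y x 0) m jq.1 a) (n + jq.1) b) =
          ∑ jq ∈ Finset.HasAntidiagonal.antidiagonal s, ((jq.2 : ℂ) + 1) •
            deltaZ Y x (jq.2 + 1) (Y (binomOp (Y x 0) m jq.1 a) (n + jq.1) b) +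
          ∑ jq ∈ Finset.HasAntidiagonal.antidiagonal s, ((jq.1 : ℂ) + 1) •
            deltaZ Y x jq.2 (Y (binomOp (Y x 0) m (jq.1 + 1) a) (n + (jq.1 + 1 : ℕ)) b) := by
          trans ∑ jq ∈ Finset.HasAntidiagonal.antidiagonal (s + 1), (jq.2 : ℂ) •
              deltaZ Y x jq.2 (Y (binomOp (Y x 0) m jq.1 a) (n + jq.1) b) +
            ∑ jq ∈ Finset.HasAntidiagonal.antidiagonal (s + 1), (jq.1 : ℂ) •
              deltaZ Y x jq.2 (Y (binomOp (Y x 0) m jq.1 a) (n + jq.1) b)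
          · rw [Finset.smul_sum, ← Finset.sum_add_distrib]
            refine Finset.sum_congr rfl fun jq hjq => ?_
            rw [Finset.HasAntidiagonal.mem_antidiagonal, add_comm] at hjq
            rw [← add_smul]
            congr 1
            exact_mod_cast hjq.symm
          · rw [Finset.Nat.sum_antidiagonal_succ', Finset.Nat.sum_antidiagonal_succ]
            simp only [Nat.cast_zero, zero_smul, zero_add, Nat.cast_add, Nat.cast_one]
        have h2 : ∀ jq : ℕ × ℕ, ((jq.1 : ℂ) + 1) •
            deltaZ Y x jq.2 (Y (binomOp (Y x 0) m (jq.1 + 1) a) (n + (jq.1 + 1 : ℕ)) b) =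
            deltaZ Y x jq.2 (Y (binomOp (Y x 0) (m - 1) jq.1 ((m : ℂ) • a - Y x 0 a))
              (n + 1 + jq.1) b) := by
          intro jq
          have h := binomOp_succ_left (zeroMode hY x) m jq.1 a
          rw [show ⇑(zeroMode hY x) = Y x 0 from rfl] at h
          rw [← h, hY.smul_left, ← deltaZLin_apply hY, ← deltaZLin_apply hY, map_smul,
            show n + 1 + (jq.1 : ℤ) = n + (jq.1 + 1 : ℕ) by push_cast; ring]
        rw [h1, Finset.sum_congr rfl fun jq _ => h2 jq, ← ih s (Nat.lt_succ_self s)]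
        congr 1
        simp only [deltaZ_euler hV hx]
        rw [sum_antidiagonal_left_comm fun p j q => (-1 : ℂ) ^ p • Y x (p + 1 : ℕ)
          (deltaZ Y x q (Y (binomOp (Y x 0) m j a) (n + j) b))]
        refine Finset.sum_congr rfl fun ps hps => ?_
        rw [Finset.HasAntidiagonal.mem_antidiagonal] at hps
        rw [ih ps.2 (by omega), hY.sum_right, Finset.smul_sum]

end Product

end DeltaProduct

/-! ### Twisted modules by Δ-deformation. -/

section TwistedModule

variable {V M : Type*} [AddCommGroup V] [Module ℂ V] [AddCommGroup M] [Module ℂ M]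
variable {vac x : V} {Y : V → ℤ → V → V} {YM : V → ℤ → M → M}

theorem exists_forall_ge_forall {P : ℕ → ℕ → Prop} (h1 : ∃ L, ∀ q, L ≤ q → ∀ j, P q j)
    (h2 : ∀ q, ∃ J, ∀ j, J ≤ j → P q j) : ∃ J, ∀ j, J ≤ j → ∀ q, P q j := by
  obtain ⟨L, hL⟩ := h1
  choose J hJ using h2
  refine ⟨(Finset.range L).sup J, fun j hj q => ?_⟩
  by_cases hq : L ≤ q
  · exact hL q hq j
  · exact hJ q j ((Finset.le_sup (f := J) (Finset.mem_range.mpr (not_le.mp hq))).trans hj)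

theorem binomOp_mem (D : V →ₗ[ℂ] V) {N : Submodule ℂ V} (hN : ∀ c ∈ N, D c ∈ N) (m : ℤ) (j : ℕ)
    {a : V} (ha : a ∈ N) : binomOp D m j a ∈ N := by
  induction j with
  | zero => exact ha
  | succ j ih => exact N.smul_mem _ (N.sub_mem (N.smul_mem _ ih) (hN _ ih))

/-- The vector binom(m - D, j) a changes with j but lies in every D-stable subspace containing a.
Only finitely many D^i a are nonzero, so one bound J works for the whole subspace. -/
theorem binomOp_mode_eventually_zero (hY : IsFieldMap Y) (D : V →ₗ[ℂ] V) (m n : ℤ) {a : V}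
    (b : V) (ha : ∃ B, ∀ i, B ≤ i → D^[i] a = 0) :
    ∃ J : ℕ, ∀ j, J ≤ j → Y (binomOp D m j a) (n + j) b = 0 := by
  obtain ⟨B, hB⟩ := ha
  obtain ⟨J, hJ⟩ := exists_forall_ge_forall (P := fun i j => Y (D^[i] a) (n + j) b = 0)
    ⟨B, fun i hi j => by rw [hB i hi, hY.zero_left]⟩ fun i => hY.eventually_zero _ _ _
  refine ⟨J, fun j hj => ?_⟩
  let N : Submodule ℂ V :=
    { carrier := {c | ∀ i, Y (D^[i] c) (n + j) b = 0}
      add_mem' := fun {c d} hc hd i => by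
        rw [show D^[i] (c + d) = D^[i] c + D^[i] d by simp only [← Module.End.pow_apply, map_add],
          hY.add_left, hc i, hd i, add_zero]
      zero_mem' := fun i => by
        rw [show D^[i] 0 = 0 by simp only [← Module.End.pow_apply, map_zero], hY.zero_left]
      smul_mem' := fun t c hc i => by
        rw [show D^[i] (t • c) = t • D^[i] c by simp only [← Module.End.pow_apply, map_smul],
          hY.smul_left, hc i, smul_zero] }
  exact binomOp_mem D (N := N) (fun c hc i => hc (i + 1)) m j (fun i => hJ j hj i) 0

section Formulas

variable (hV : IsVertexAlgebra vac Y) (hx : ∀ n : ℕ, Y x n x = 0)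
include hV

theorem zeroMode_vac (n : ℕ) : Y x n vac = 0 := hV.creation_nonneg x n (by omega)

theorem zeroMode_derivation : IsVertexDerivation vac Y (Y x 0) where
  add := hV.add_right x 0
  smul t a := hV.smul_right t x 0 a
  vacuum := hV.creation_nonneg x 0 le_rfl
  mode a n b := by
    have := mode_commutator_antidiagonal (x := x) hV 0 a b n
    simp only [Nat.cast_zero, Finset.Nat.antidiagonal_zero, Finset.sum_singleton, cb_zero_right,
      one_smul, add_zero] at this
    rw [this, add_comm]

include hx

theorem deltaZ_zeroMode_iterate (q k : ℕ) (a : V) :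
    deltaZ Y x q ((Y x 0)^[k] a) = (Y x 0)^[k] (deltaZ Y x q a) := by
  induction k generalizing a with
  | zero => rfl
  | succ k ih => rw [Function.iterate_succ_apply, ih, deltaZ_zeroMode hV hx,
      Function.iterate_succ_apply]

/-- In log z the operator Δ is exp(x₀ log z), so every coefficient reduces to the logarithm-free
part applied to an iterate of x₀. -/
theorem deltaCoeff_eq_iterate (a : V) (k q : ℕ) :
    (k.factorial : ℂ) • deltaCoeff Y x a k q = deltaZ Y x q ((Y x 0)^[k] a) := by
  have hY := hV.toIsVertexModule.isFieldMap
  rw [deltaZ_zeroMode_iterate hV hx]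
  induction k with
  | zero => simp [deltaZ]
  | succ k ih =>
    rw [Function.iterate_succ_apply', ← ih, hY.smul_right, ← deltaCoeff_succ_left hY
      (fun m n v => mode_comm_of_products_zero hV hx m n v), smul_smul, Nat.factorial_succ]
    push_cast
    congr 1
    ring

theorem deltaZ_vac (q : ℕ) : deltaZ Y x q vac = if q = 0 then vac else 0 := by
  have hY := hV.toIsVertexModule.isFieldMap
  induction q using Nat.strong_induction_on with
  | _ q ih =>
    cases q with
    | zero => simp [deltaZ_zero]
    | succ q =>
      have h : (q : ℂ) + 1 ≠ 0 := by exact_mod_cast Nat.succ_ne_zero q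
      refine smul_right_injective V h ?_
      simp only
      rw [deltaZ_euler hV hx, if_neg (by omega), smul_zero]
      refine Finset.sum_eq_zero fun p hp => ?_
      rw [Finset.HasAntidiagonal.mem_antidiagonal] at hp
      rw [ih _ (by omega)]
      split_ifs
      · rw [zeroMode_vac hV, smul_zero]
      · rw [hY.zero_right, smul_zero]

theorem deltaCoeff_vac (k q : ℕ) : deltaCoeff Y x vac k q = if k = 0 ∧ q = 0 then vac else 0 := by
  have h : (k.factorial : ℂ) ≠ 0 := by exact_mod_cast k.factorial_ne_zero
  refine smul_right_injective V h ?_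
  simp only
  rw [deltaCoeff_eq_iterate hV hx]
  cases k with
  | zero => simp [deltaZ_vac hV hx]
  | succ k =>
    have hz : (Y x 0)^[k] 0 = 0 := Function.iterate_fixed (hV.isFieldMap.zero_right x 0) k
    rw [Function.iterate_succ_apply, hV.creation_nonneg x 0 le_rfl, hz,
      deltaZ_zero_right hV.isFieldMap]
    simp

theorem deltaCoeff_iterate (a : V) (k r q : ℕ) : (k.factorial : ℂ) •
    deltaCoeff Y x ((Y x 0)^[r] a) k q = ((k + r).factorial : ℂ) • deltaCoeff Y x a (k + r) q := by
  rw [deltaCoeff_eq_iterate hV hx, deltaCoeff_eq_iterate hV hx, ← Function.iterate_add_apply]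

/-- This is the product formula for b = 1, m = 0, n = -2; the creation axioms leave only the terms
with j = 0 and j = 1. -/
theorem deltaZ_translate (a : V) (s : ℕ) : deltaZ Y x (s + 1) (Y a (-2) vac) =
    Y (deltaZ Y x (s + 1) a) (-2) vac - (s : ℂ) • deltaZ Y x s a + deltaZ Y x s (Y x 0 a) := by
  have hY := hV.isFieldMap
  have key := sum_deltaMode_deltaZ hV hx vac (s + 1) a 0 (-2)
  have hc : ∀ c (j : ℕ), Y c (-2 + (j + 1 : ℕ)) vac = if j = 0 then c else 0 := by
    intro c j
    split_ifs with h
    · rw [h]; exact hV.creation c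
    · exact hV.creation_nonneg c _ (by omega)
  have hl : ∑ tr ∈ Finset.HasAntidiagonal.antidiagonal (s + 1),
      deltaMode Y x a 0 (-2) tr.1 (deltaZ Y x tr.2 vac) =
      Y (deltaZ Y x (s + 1) a) (-2) vac - (s : ℂ) • deltaZ Y x s a := by
    rw [Finset.Nat.sum_antidiagonal_succ', Finset.sum_eq_zero, add_zero]
    · simp only [deltaZ_zero, deltaMode]
      rw [Finset.Nat.sum_antidiagonal_succ', Finset.sum_eq_single (s, 0)]
      · simp only [hc, if_true, cb_zero_right, one_smul, zero_add, cb_one_right]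
        push_cast
        rw [zero_sub, neg_smul, sub_eq_add_neg]
      · rintro ⟨q, j⟩ hq hne
        rw [Finset.HasAntidiagonal.mem_antidiagonal] at hq
        have : j ≠ 0 := by rintro rfl; exact hne (by simp_all)
        simp only [hc, if_neg this, smul_zero]
      · intro h; exact absurd (by simp) h
    · intro tr _
      rw [deltaZ_vac hV hx, if_neg (by omega)]
      simp [deltaMode, hY.zero_right]
  have hr : ∑ jq ∈ Finset.HasAntidiagonal.antidiagonal (s + 1),
      deltaZ Y x jq.2 (Y (binomOp (Y x 0) 0 jq.1 a) (-2 + jq.1) vac) =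
      deltaZ Y x (s + 1) (Y a (-2) vac) - deltaZ Y x s (Y x 0 a) := by
    rw [Finset.Nat.sum_antidiagonal_succ, Finset.sum_eq_single (0, s), sub_eq_add_neg]
    · simp only [hc, if_true]
      congr 1
      simp only [binomOp, ← deltaZLin_apply hY, ← map_neg]
      simp
    · rintro ⟨j, q⟩ hq hne
      rw [Finset.HasAntidiagonal.mem_antidiagonal] at hq
      have : j ≠ 0 := by rintro rfl; exact hne (by simp_all)
      simp only [hc, if_neg this, deltaZ_zero_right hY]
    · intro h; exact absurd (by simp) h
  rw [hl, hr] at key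
  rw [key]
  abel

theorem iterate_translate (a : V) (k : ℕ) :
    (Y x 0)^[k] (Y a (-2) vac) = Y ((Y x 0)^[k] a) (-2) vac := by
  have hD := zeroMode_derivation (x := x) hV
  induction k with
  | zero => rfl
  | succ k ih => rw [Function.iterate_succ_apply', ih, hD.mode, hD.vacuum,
      hV.isFieldMap.zero_right, add_zero, Function.iterate_succ_apply']

theorem deltaCoeff_translate (a : V) (k s : ℕ) : deltaCoeff Y x (Y a (-2) vac) k (s + 1) =
    Y (deltaCoeff Y x a k (s + 1)) (-2) vac - (s : ℂ) • deltaCoeff Y x a k s +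
      ((k : ℂ) + 1) • deltaCoeff Y x a (k + 1) s := by
  have hY := hV.isFieldMap
  have h : (k.factorial : ℂ) ≠ 0 := by exact_mod_cast k.factorial_ne_zero
  refine smul_right_injective V h ?_
  simp only
  rw [deltaCoeff_eq_iterate hV hx, iterate_translate hV hx, deltaZ_translate hV hx, smul_add,
    smul_sub, ← hY.smul_left, smul_comm _ (s : ℂ), deltaCoeff_eq_iterate hV hx,
    deltaCoeff_eq_iterate hV hx, smul_smul,
    show (k.factorial : ℂ) * (k + 1) = ((k + 1).factorial : ℂ) by
      rw [Nat.factorial_succ]; push_cast; ring,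
    deltaCoeff_eq_iterate hV hx, Function.iterate_succ_apply' (Y x 0)]

theorem deltaCoeff_translate_zero (a : V) (k : ℕ) : deltaCoeff Y x (Y a (-2) vac) k 0 =
    Y (deltaCoeff Y x a k 0) (-2) vac := by
  have hY := hV.isFieldMap
  have h : (k.factorial : ℂ) ≠ 0 := by exact_mod_cast k.factorial_ne_zero
  refine smul_right_injective V h ?_
  simp only
  rw [deltaCoeff_eq_iterate hV hx, iterate_translate hV hx, ← hY.smul_left,
    deltaCoeff_eq_iterate hV hx, deltaZ_zero, deltaZ_zero]

end Formulas

section Deform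

variable (hV : IsVertexAlgebra vac Y) (hM : IsVertexModule vac Y YM)
  (hx : ∀ n : ℕ, Y x n x = 0)
  (hnil : ∀ a, ∃ B : ℕ, ∀ k q, B ≤ k + q → deltaCoeff Y x a k q = 0)

omit hV hx hnil in
theorem deltaDeform_eq_range (hM : IsFieldMap YM) {a : V} {k S : ℕ}
    (hS : ∀ q, S ≤ q → deltaCoeff Y x a k q = 0) (n : ℤ) (v : M) :
    deltaDeform Y YM x a k n v = ∑ q ∈ Finset.range S, YM (deltaCoeff Y x a k q) (n - q) v :=
  finsum_eq_range fun q hq => by rw [hS q hq, hM.zero_left]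

include hM hnil

theorem deltaDeform_add_left (hY : IsFieldMap Y) (a b : V) (k : ℕ) (n : ℤ) (v : M) :
    deltaDeform Y YM x (a + b) k n v = deltaDeform Y YM x a k n v + deltaDeform Y YM x b k n v := by
  obtain ⟨B, hB⟩ := hnil a
  obtain ⟨C, hC⟩ := hnil b
  have h1 : ∀ q, max B C ≤ q → deltaCoeff Y x a k q = 0 := fun q hq => hB _ _ (by omega)
  have h2 : ∀ q, max B C ≤ q → deltaCoeff Y x b k q = 0 := fun q hq => hC _ _ (by omega)
  rw [deltaDeform_eq_range hM.isFieldMap h1, deltaDeform_eq_range hM.isFieldMap h2,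
    deltaDeform_eq_range (S := max B C) hM.isFieldMap fun q hq => by
      rw [deltaCoeff_add hY, h1 q hq, h2 q hq, add_zero], ← Finset.sum_add_distrib]
  exact Finset.sum_congr rfl fun q _ => by rw [deltaCoeff_add hY, hM.add_left]

theorem deltaDeform_smul_left (hY : IsFieldMap Y) (t : ℂ) (a : V) (k : ℕ) (n : ℤ) (v : M) :
    deltaDeform Y YM x (t • a) k n v = t • deltaDeform Y YM x a k n v := by
  obtain ⟨B, hB⟩ := hnil a
  have h1 : ∀ q, B ≤ q → deltaCoeff Y x a k q = 0 := fun q hq => hB _ _ (by omega)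
  rw [deltaDeform_eq_range hM.isFieldMap h1, deltaDeform_eq_range (S := B) hM.isFieldMap
    fun q hq => by rw [deltaCoeff_smul hY, h1 q hq, smul_zero], Finset.smul_sum]
  exact Finset.sum_congr rfl fun q _ => by rw [deltaCoeff_smul hY, hM.smul_left]

theorem deltaDeform_truncation (a : V) (v : M) :
    ∃ (K : ℕ) (N : ℤ), ∀ k n, K ≤ k ∨ N ≤ n → deltaDeform Y YM x a k n v = 0 := by
  obtain ⟨B, hB⟩ := hnil a
  have h1 : ∀ k q, B ≤ q → deltaCoeff Y x a k q = 0 := fun k q hq => hB _ _ (by omega)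
  choose N hN using fun kq : ℕ × ℕ => hM.truncation (deltaCoeff Y x a kq.1 kq.2) v
  obtain ⟨C, hC⟩ := ((Finset.range B ×ˢ Finset.range B).image N).exists_le
  refine ⟨B, C + B, fun k n hkn => ?_⟩
  rw [deltaDeform_eq_range hM.isFieldMap (h1 k)]
  refine Finset.sum_eq_zero fun q hq => ?_
  by_cases hk : B ≤ k
  · rw [hB k q (by omega), hM.isFieldMap.zero_left]
  · refine hN (k, q) _ ?_
    have := hC (N (k, q)) (Finset.mem_image_of_mem _ (by simp_all))
    rw [Finset.mem_range] at hq
    omega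

include hV hx

theorem deltaDeform_vac (k : ℕ) (n : ℤ) (v : M) :
    deltaDeform Y YM x vac k n v = if k = 0 ∧ n = -1 then v else 0 := by
  rw [deltaDeform_eq_range (S := 1) hM.isFieldMap fun q hq => by
    rw [deltaCoeff_vac hV hx, if_neg (by omega)], Finset.sum_range_one, deltaCoeff_vac hV hx]
  by_cases h : k = 0
  · simp [h, hM.vacuum]
  · simp [h, hM.isFieldMap.zero_left]

theorem zeroMode_iterate_eventually_zero (a : V) : ∃ B, ∀ i, B ≤ i → (Y x 0)^[i] a = 0 := by
  obtain ⟨B, hB⟩ := hnil a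
  refine ⟨B, fun i hi => ?_⟩
  rw [← deltaZ_zero (Y := Y) (x := x) ((Y x 0)^[i] a), ← deltaCoeff_eq_iterate hV hx,
    hB _ _ (by omega), smul_zero]

theorem deltaDeform_iterate (a : V) (k r : ℕ) (n : ℤ) (v : M) : (k.factorial : ℂ) •
    deltaDeform Y YM x ((Y x 0)^[r] a) k n v =
      ((k + r).factorial : ℂ) • deltaDeform Y YM x a (k + r) n v := by
  obtain ⟨B, hB⟩ := hnil a
  obtain ⟨C, hC⟩ := hnil ((Y x 0)^[r] a)
  rw [deltaDeform_eq_range (S := max B C) hM.isFieldMap fun q hq => hB _ _ (by omega),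
    deltaDeform_eq_range (S := max B C) hM.isFieldMap fun q hq => hC _ _ (by omega),
    Finset.smul_sum, Finset.smul_sum]
  exact Finset.sum_congr rfl fun q _ => by
    rw [← hM.smul_left, ← hM.smul_left, deltaCoeff_iterate hV hx]

/-- An iterate of x₀ on the state raises the power of log z by `deltaDeform_iterate`. The factorials
combine to the binomials of the substitution log z ↦ log z + t. -/
theorem deltaDeform_expOp (t : ℂ) (a : V) (k : ℕ) (n : ℤ) (v : M) :
    deltaDeform Y YM x (expOp (Y x 0) t a) k n v =
      ∑ᶠ j : ℕ, (((k + j).choose k : ℂ) * t ^ j) • deltaDeform Y YM x a (k + j) n v := by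
  obtain ⟨B, hB⟩ := zeroMode_iterate_eventually_zero hV hM hx hnil a
  obtain ⟨K, N, hK⟩ := deltaDeform_truncation hM hnil a v
  rw [expOp, finsum_eq_range (L := max B K) fun r hr => by rw [hB r (by omega), smul_zero],
    finsum_eq_range (L := max B K) fun r hr => by rw [hK _ _ (Or.inl (by omega)), smul_zero]]
  let φ : V →ₗ[ℂ] M := ⟨⟨fun a => deltaDeform Y YM x a k n v,
    fun a b => deltaDeform_add_left hM hnil hV.isFieldMap a b k n v⟩,
    fun t a => deltaDeform_smul_left hM hnil hV.isFieldMap t a k n v⟩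
  change φ _ = _
  rw [map_sum]
  refine Finset.sum_congr rfl fun r _ => ?_
  rw [map_smul]
  change _ • deltaDeform Y YM x ((Y x 0)^[r] a) k n v = _
  have hk : (k.factorial : ℂ) ≠ 0 := by exact_mod_cast k.factorial_ne_zero
  have hr : (r.factorial : ℂ) ≠ 0 := by exact_mod_cast r.factorial_ne_zero
  refine smul_right_injective M hk ?_
  simp only
  rw [smul_comm, deltaDeform_iterate hV hM hx hnil, smul_smul, smul_smul]
  congr 1
  have : ((k + r).factorial : ℂ) = (k + r).choose k * k.factorial * r.factorial := by
    have := Nat.choose_mul_factorial_mul_factorial (Nat.le_add_right k r)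
    rw [Nat.add_sub_cancel_left] at this
    exact_mod_cast this.symm
  rw [this]
  field_simp

theorem deltaDeform_translate (a : V) (k : ℕ) (n : ℤ) (v : M) :
    deltaDeform Y YM x (Y a (-2) vac) k n v = (-(n : ℂ)) • deltaDeform Y YM x a k (n - 1) v +
      ((k : ℂ) + 1) • deltaDeform Y YM x a (k + 1) (n - 1) v := by
  have hF := hM.isFieldMap
  obtain ⟨B, hB⟩ := hnil a
  obtain ⟨C, hC⟩ := hnil (Y a (-2) vac)
  have hT : ∀ c m, YM (Y c (-2) vac) m v = (-(m : ℂ)) • YM c (m - 1) v := by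
    intro c m
    have := Borcherds.translate (Y := Y) hF (c := c) (vac := vac) (hM.borcherds c vac) hM.vacuum 1 m v
    rw [cb_one_right] at this
    simpa using this
  rw [deltaDeform_eq_range (S := max B C + 1) hF fun q hq => hC _ _ (by omega),
    Finset.sum_range_succ', deltaDeform_eq_range (k := k) (S := max B C) hF fun q hq => hB _ _ (by omega),
    deltaDeform_eq_range (k := k + 1) (S := max B C) hF fun q hq => hB _ _ (by omega)]
  simp only [deltaCoeff_translate hV hx, deltaCoeff_translate_zero hV hx, hF.add_left, hF.sub_left,
    hF.smul_left, hT, Finset.sum_add_distrib, Finset.sum_sub_distrib]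
  have h1 : ∑ s ∈ Finset.range (max B C),
      (-((n - (s + 1 : ℕ) : ℤ) : ℂ)) • YM (deltaCoeff Y x a k (s + 1)) (n - (s + 1 : ℕ) - 1) v +
      (-((n - (0 : ℕ) : ℤ) : ℂ)) • YM (deltaCoeff Y x a k 0) (n - (0 : ℕ) - 1) v =
      ∑ s ∈ Finset.range (max B C),
        (-((n - (s : ℕ) : ℤ) : ℂ)) • YM (deltaCoeff Y x a k s) (n - (s : ℕ) - 1) v := by
    rw [← Finset.sum_range_succ' fun s : ℕ =>
      (-((n - (s : ℕ) : ℤ) : ℂ)) • YM (deltaCoeff Y x a k s) (n - (s : ℕ) - 1) v,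
      Finset.sum_range_succ, hB _ _ (by omega), hF.zero_left, smul_zero, add_zero]
  rw [add_right_comm, sub_add_eq_add_sub, h1, ← Finset.sum_sub_distrib, Finset.smul_sum,
    Finset.smul_sum]
  congr 1
  · refine Finset.sum_congr rfl fun s _ => ?_
    rw [show n - ((s + 1 : ℕ) : ℤ) = n - s - 1 by push_cast; ring, ← sub_smul,
      show n - 1 - (s : ℤ) = n - s - 1 by ring]
    congr 1
    push_cast
    ring
  · refine Finset.sum_congr rfl fun s _ => ?_
    rw [show n - ((s + 1 : ℕ) : ℤ) = n - 1 - s by push_cast; ring]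

/-- The untwisted identity is applied to each pair Δ_q a, Δ_r b at the indices m - q and k - r. Its
right-hand sides assemble into `deltaMode`, and `sum_deltaMode_deltaZ` rewrites them as Δ of the
twisted products. -/
theorem deltaDeform_borcherds (a b : V) (v : M) (m k n : ℤ) :
    (∑ᶠ j : ℕ, ((-1 : ℂ) ^ j * (Ring.choose n j : ℤ)) •
      (deltaDeform Y YM x a 0 (m + n - j) (deltaDeform Y YM x b 0 (k + j) v) -
        ((-1 : ℂ) ^ n) •
          deltaDeform Y YM x b 0 (k + n - j) (deltaDeform Y YM x a 0 (m + j) v))) =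
    ∑ᶠ j : ℕ, deltaDeform Y YM x (Y (binomOp (Y x 0) m j a) (n + j) b) 0 (m + k - j) v := by
  have hF := hM.isFieldMap
  have hY := hV.isFieldMap
  obtain ⟨Ba, hBa⟩ := hnil a
  obtain ⟨Bb, hBb⟩ := hnil b
  have ha : ∀ q, Ba ≤ q → deltaZ Y x q a = 0 := fun q hq => hBa _ _ (by omega)
  have hb : ∀ q, Bb ≤ q → deltaZ Y x q b = 0 := fun q hq => hBb _ _ (by omega)
  obtain ⟨J1, hJ1⟩ := exists_forall_ge_forall
    (P := fun q j => YM (deltaZ Y x q a) (m - q + j) v = 0)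
    ⟨Ba, fun q hq j => by rw [ha q hq, hF.zero_left]⟩ fun q => hF.eventually_zero _ _ _
  obtain ⟨J2, hJ2⟩ := exists_forall_ge_forall
    (P := fun q j => YM (deltaZ Y x q b) (k - q + j) v = 0)
    ⟨Bb, fun q hq j => by rw [hb q hq, hF.zero_left]⟩ fun q => hF.eventually_zero _ _ _
  obtain ⟨J3, hJ3⟩ := exists_forall_ge_forall
    (P := fun q j => ∀ r, Y (deltaZ Y x q a) (n + j) (deltaZ Y x r b) = 0)
    ⟨Ba, fun q hq j r => by rw [ha q hq, hY.zero_left]⟩ fun q => exists_forall_ge_forall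
      (P := fun r j => Y (deltaZ Y x q a) (n + j) (deltaZ Y x r b) = 0)
      ⟨Bb, fun q hq j => by rw [hb q hq, hY.zero_right]⟩ fun r => hY.eventually_zero _ _ _
  obtain ⟨J4, hJ4⟩ := binomOp_mode_eventually_zero hY (zeroMode hY x) m n b
    (zeroMode_iterate_eventually_zero hV hM hx hnil a)
  change ∀ j, J4 ≤ j → Y (binomOp (Y x 0) m j a) (n + j) b = 0 at hJ4
  obtain ⟨J5, hJ5⟩ := exists_forall_ge_forall
    (P := fun j q => deltaZ Y x q (Y (binomOp (Y x 0) m j a) (n + j) b) = 0)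
    ⟨J4, fun j hj q => by rw [hJ4 j hj, deltaZ_zero_right hY]⟩ fun j => by
      obtain ⟨B, hB⟩ := hnil (Y (binomOp (Y x 0) m j a) (n + j) b)
      exact ⟨B, fun q hq => hB _ _ (by omega)⟩
  obtain ⟨S, hS⟩ : ∃ S, S = Ba + Bb + J1 + J2 + J3 + J4 + J5 := ⟨_, rfl⟩
  have hda : ∀ N w, deltaDeform Y YM x a 0 N w =
      ∑ q ∈ Finset.range S, YM (deltaZ Y x q a) (N - q) w := fun N w =>
    deltaDeform_eq_range hF (fun q hq => ha q (by omega)) N w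
  have hdb : ∀ N w, deltaDeform Y YM x b 0 N w =
      ∑ q ∈ Finset.range S, YM (deltaZ Y x q b) (N - q) w := fun N w =>
    deltaDeform_eq_range hF (fun q hq => hb q (by omega)) N w
  have hL : ∀ j : ℕ, ((-1 : ℂ) ^ j * (Ring.choose n j : ℤ)) •
      (deltaDeform Y YM x a 0 (m + n - j) (deltaDeform Y YM x b 0 (k + j) v) -
        ((-1 : ℂ) ^ n) •
          deltaDeform Y YM x b 0 (k + n - j) (deltaDeform Y YM x a 0 (m + j) v)) =
      ∑ q ∈ Finset.range S, ∑ r ∈ Finset.range S, ((-1 : ℂ) ^ j * cb n j) •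
        (YM (deltaZ Y x q a) (m - q + n - j) (YM (deltaZ Y x r b) (k - r + j) v) -
          ((-1 : ℂ) ^ n) •
            YM (deltaZ Y x r b) (k - r + n - j) (YM (deltaZ Y x q a) (m - q + j) v)) := by
    intro j
    rw [hda (m + n - j), hdb (k + n - j), hdb (k + j), hda (m + j)]
    simp only [hF.sum_right, smul_sub, Finset.sum_sub_distrib, Finset.smul_sum]
    congr 1
    · refine Finset.sum_congr rfl fun q _ => Finset.sum_congr rfl fun r _ => ?_
      rw [show m + n - j - q = m - q + n - j by ring, show k + j - r = k - r + (j : ℤ) by ring, cb]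
    · rw [Finset.sum_comm]
      refine Finset.sum_congr rfl fun q _ => Finset.sum_congr rfl fun r _ => ?_
      rw [show k + n - j - r = k - r + n - j by ring, show m + j - q = m - q + (j : ℤ) by ring, cb]
  rw [finsum_congr hL, finsum_eq_range (L := S) fun j hj => by
    refine Finset.sum_eq_zero fun q _ => Finset.sum_eq_zero fun r _ => ?_
    rw [hJ1 j (by omega), hJ2 j (by omega), hF.zero_right, hF.zero_right, smul_zero, sub_zero,
      smul_zero]]
  have hJ : ∀ q r : ℕ, ∑ j ∈ Finset.range S, ((-1 : ℂ) ^ j * cb n j) •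
        (YM (deltaZ Y x q a) (m - q + n - j) (YM (deltaZ Y x r b) (k - r + j) v) -
          ((-1 : ℂ) ^ n) •
            YM (deltaZ Y x r b) (k - r + n - j) (YM (deltaZ Y x q a) (m - q + j) v)) =
      ∑ j ∈ Finset.range S, cb (m - q) j •
        YM (Y (deltaZ Y x q a) (n + j) (deltaZ Y x r b)) (m + k - ((q + j : ℕ) : ℤ) - r) v := by
    intro q r
    rw [← jacobiLHS_eq_range (fun j hj => by rw [hJ2 j (by omega), hF.zero_right])
      (fun j hj => by rw [hJ1 j (by omega), hF.zero_right]),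
      show jacobiLHS (YM (deltaZ Y x q a)) (YM (deltaZ Y x r b)) n (m - q) (k - r) v = _ from
        hM.borcherds _ _ _ _ _ _]
    refine (jacobiRHS_eq_range (Y := Y) (L := S) fun j hj => ?_).trans ?_
    · rw [hJ3 j (by omega), hF.zero_left]
    · refine Finset.sum_congr rfl fun j _ => ?_
      rw [show m - q + (k - r) - j = m + k - ((q + j : ℕ) : ℤ) - r by push_cast; ring]
  -- Three indices q, r, j each below S have sum below 3 * S, hence this common cut.
  have hR : ∀ j : ℕ,
      deltaDeform Y YM x (Y (binomOp (Y x 0) m j a) (n + j) b) 0 (m + k - j) v =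
      ∑ q ∈ Finset.range (3 * S), YM (deltaZ Y x q (Y (binomOp (Y x 0) m j a) (n + j) b))
        (m + k - j - q) v := fun j =>
    deltaDeform_eq_range hF (fun q hq => hJ5 q (by omega) j) _ v
  rw [finsum_congr hR, finsum_eq_range (L := 3 * S) fun j hj => Finset.sum_eq_zero fun q _ => by
    rw [hJ4 j (by omega), deltaZ_zero_right hY, hF.zero_left]]
  rw [← sum_range_antidiagonal (F := fun j q => YM (deltaZ Y x q
    (Y (binomOp (Y x 0) m j a) (n + j) b)) (m + k - j - q) v) fun j q hjq => by
      by_cases hj : J4 ≤ j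
      · rw [hJ4 j hj, deltaZ_zero_right hY, hF.zero_left]
      · rw [hJ5 q (by omega) j, hF.zero_left]]
  have hR2 : ∀ s, ∑ jq ∈ Finset.HasAntidiagonal.antidiagonal s, YM (deltaZ Y x jq.2
      (Y (binomOp (Y x 0) m jq.1 a) (n + jq.1) b)) (m + k - jq.1 - jq.2) v =
      ∑ tr ∈ Finset.HasAntidiagonal.antidiagonal s,
        YM (deltaMode Y x a m n tr.1 (deltaZ Y x tr.2 b)) (m + k - tr.1 - tr.2) v := by
    intro s
    trans YM (∑ tr ∈ Finset.HasAntidiagonal.antidiagonal s,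
      deltaMode Y x a m n tr.1 (deltaZ Y x tr.2 b)) (m + k - s) v
    · rw [sum_deltaMode_deltaZ hV hx, hF.sum_left]
      refine Finset.sum_congr rfl fun jq hjq => ?_
      rw [Finset.HasAntidiagonal.mem_antidiagonal] at hjq
      rw [← hjq, Nat.cast_add, sub_add_eq_sub_sub]
    · rw [hF.sum_left]
      refine Finset.sum_congr rfl fun jq hjq => ?_
      rw [Finset.HasAntidiagonal.mem_antidiagonal] at hjq
      rw [← hjq, Nat.cast_add, sub_add_eq_sub_sub]
  rw [Finset.sum_congr rfl fun s _ => hR2 s]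
  have hE : ∀ q r j : ℕ, S ≤ q ∨ S ≤ r ∨ S ≤ j →
      Y (deltaZ Y x q a) (n + j) (deltaZ Y x r b) = 0 := by
    rintro q r j (h | h | h)
    · rw [ha q (by omega), hY.zero_left]
    · rw [hb r (by omega), hY.zero_right]
    · exact hJ3 j (by omega) q r
  rw [sum_range_antidiagonal (F := fun t r =>
    YM (deltaMode Y x a m n t (deltaZ Y x r b)) (m + k - t - r) v) fun t r htr => by
      rw [deltaMode, Finset.sum_eq_zero, hF.zero_left]
      intro qj hqj
      rw [Finset.HasAntidiagonal.mem_antidiagonal] at hqj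
      rw [hE _ _ _ (by omega), smul_zero]]
  rw [Finset.sum_comm, Finset.sum_comm (s := Finset.range (3 * S))]
  have hsub : Finset.range S ⊆ Finset.range (3 * S) := Finset.range_subset_range.mpr (by omega)
  rw [Finset.sum_congr rfl fun q _ => Finset.sum_comm, Finset.sum_congr rfl fun q _ =>
    Finset.sum_congr rfl fun r _ => hJ q r, Finset.sum_comm]
  have hM1 : ∀ r : ℕ, ∑ t ∈ Finset.range (3 * S),
      YM (deltaMode Y x a m n t (deltaZ Y x r b)) (m + k - t - r) v =
      ∑ q ∈ Finset.range (3 * S), ∑ j ∈ Finset.range (3 * S), cb (m - q) j •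
        YM (Y (deltaZ Y x q a) (n + j) (deltaZ Y x r b)) (m + k - ((q + j : ℕ) : ℤ) - r) v := by
    intro r
    rw [← sum_range_antidiagonal (F := fun q j : ℕ => cb (m - q) j •
      YM (Y (deltaZ Y x q a) (n + j) (deltaZ Y x r b)) (m + k - ((q + j : ℕ) : ℤ) - r) v)
      fun q j hqj => by rw [hE q r j (by omega), hF.zero_left, smul_zero]]
    refine Finset.sum_congr rfl fun t _ => ?_
    rw [deltaMode, hF.sum_left]
    refine Finset.sum_congr rfl fun qj hqj => ?_
    rw [Finset.HasAntidiagonal.mem_antidiagonal] at hqj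
    rw [hF.smul_left, hqj]
  rw [Finset.sum_congr rfl fun r _ => hM1 r]
  have hout : ∀ {i : ℕ}, i ∉ Finset.range S → S ≤ i := fun h => by simpa using h
  rw [← Finset.sum_subset hsub fun r _ hr => Finset.sum_eq_zero fun q _ =>
    Finset.sum_eq_zero fun j _ => by
      rw [hE q r j (Or.inr (Or.inl (hout hr))), hF.zero_left, smul_zero]]
  refine Finset.sum_congr rfl fun r _ => ?_
  rw [← Finset.sum_subset hsub fun q _ hq => Finset.sum_eq_zero fun j _ => by
      rw [hE q r j (Or.inl (hout hq)), hF.zero_left, smul_zero]]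
  refine Finset.sum_congr rfl fun q _ => ?_
  exact Finset.sum_subset hsub fun j _ hj => by
    rw [hE q r j (Or.inr (Or.inr (hout hj))), hF.zero_left, smul_zero]

/-- The `Δ`-deformation of a module by a state `x` with `x_n x = 0` for `n ≥ 0` whose
`Δ`-operator is polynomial is an `x_0`-twisted module. -/
theorem deltaDeform_isTwistedModule :
    IsTwistedModule vac Y (Y x 0) (deltaDeform Y YM x) where
  add_left := deltaDeform_add_left hM hnil hV.isFieldMap
  smul_left := deltaDeform_smul_left hM hnil hV.isFieldMap
  add_right a k n v w := by
    obtain ⟨B, hB⟩ := hnil a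
    have h1 : ∀ q, B ≤ q → deltaCoeff Y x a k q = 0 := fun q hq => hB _ _ (by omega)
    simp only [deltaDeform_eq_range hM.isFieldMap h1, hM.add_right, Finset.sum_add_distrib]
  smul_right t a k n v := by
    obtain ⟨B, hB⟩ := hnil a
    have h1 : ∀ q, B ≤ q → deltaCoeff Y x a k q = 0 := fun q hq => hB _ _ (by omega)
    simp only [deltaDeform_eq_range hM.isFieldMap h1, hM.smul_right, Finset.smul_sum]
  truncation := deltaDeform_truncation hM hnil
  vacuum := deltaDeform_vac hV hM hx hnil
  monodromy := deltaDeform_expOp hV hM hx hnil _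
  derivative := deltaDeform_translate hV hM hx hnil
  borcherds := deltaDeform_borcherds hV hM hx hnil

end Deform

end TwistedModule

/-! ### Words in the modes of x. -/

section Words

variable {V : Type*} [AddCommGroup V] [Module ℂ V] {vac x : V} {Y : V → ℤ → V → V}

/-- `ModeWord Y x a r N w`: the vector `w` is `x_{n₁} ⋯ x_{n_r} a` with `∑ nᵢ = N`, `nᵢ ≥ 0`. -/
inductive ModeWord (Y : V → ℤ → V → V) (x a : V) : ℕ → ℕ → V → Prop
  | nil : ModeWord Y x a 0 0 a
  | cons {r N : ℕ} {w : V} (n : ℕ) : ModeWord Y x a r N w → ModeWord Y x a (r + 1) (N + n) (Y x n w)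

/-- The span of the words of total index `q` and length at least `k`. -/
def wordSpan (Y : V → ℤ → V → V) (x a : V) (k q : ℕ) : Submodule ℂ V :=
  Submodule.span ℂ {w | ∃ r, k ≤ r ∧ ModeWord Y x a r q w}

theorem mode_mem_wordSpan (hY : IsFieldMap Y) {a v : V} {k q : ℕ} (n : ℕ)
    (hv : v ∈ wordSpan Y x a k q) : Y x n v ∈ wordSpan Y x a (k + 1) (q + n) := by
  have : wordSpan Y x a k q ≤ (wordSpan Y x a (k + 1) (q + n)).comap (hY.lin n x) := by
    refine Submodule.span_le.mpr ?_
    rintro w ⟨r, hr, hw⟩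
    exact Submodule.subset_span ⟨r + 1, by omega, hw.cons n⟩
  exact this hv

theorem wordSpan_mono {a : V} {k k' q : ℕ} (h : k ≤ k') :
    wordSpan Y x a k' q ≤ wordSpan Y x a k q :=
  Submodule.span_mono fun _ ⟨r, hr, hw⟩ => ⟨r, h.trans hr, hw⟩

/-- The recursions only prepend letters: the Euler recursion adds one of positive index, the
logarithmic one adds x₀. Finiteness of Δ thereby becomes the vanishing of long words. -/
theorem deltaCoeff_mem_wordSpan (hV : IsVertexAlgebra vac Y) (hx : ∀ n : ℕ, Y x n x = 0)
    (a : V) (k q : ℕ) : deltaCoeff Y x a k q ∈ wordSpan Y x a k q := by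
  have hY := hV.isFieldMap
  induction k with
  | zero =>
    change deltaZ Y x q a ∈ _
    induction q using Nat.strong_induction_on with
    | _ q ih =>
      cases q with
      | zero => rw [deltaZ_zero]; exact Submodule.subset_span ⟨0, le_rfl, .nil⟩
      | succ q =>
        have h : (q : ℂ) + 1 ≠ 0 := by exact_mod_cast Nat.succ_ne_zero q
        rw [← Submodule.smul_mem_iff _ h, deltaZ_euler hV hx]
        refine Submodule.sum_mem _ fun p hp => Submodule.smul_mem _ _ ?_
        rw [Finset.HasAntidiagonal.mem_antidiagonal] at hp
        rw [show q + 1 = p.2 + (p.1 + 1) by omega]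
        exact wordSpan_mono (by omega) (mode_mem_wordSpan hY _ (ih _ (by omega)))
  | succ k ih =>
    have h : (k : ℂ) + 1 ≠ 0 := by exact_mod_cast Nat.succ_ne_zero k
    rw [← Submodule.smul_mem_iff _ h, deltaCoeff_succ_left hY
      fun m n v => mode_comm_of_products_zero hV hx m n v]
    exact mode_mem_wordSpan hY 0 ih

theorem deltaCoeff_eventually_zero_of_words (hV : IsVertexAlgebra vac Y)
    (hx : ∀ n : ℕ, Y x n x = 0) {a : V} {B : ℕ}
    (hB : ∀ r N w, B ≤ r + N → ModeWord Y x a r N w → w = 0) (k q : ℕ) (h : B ≤ k + q) :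
    deltaCoeff Y x a k q = 0 := by
  have := deltaCoeff_mem_wordSpan hV hx a k q
  rw [← Submodule.mem_bot ℂ]
  refine Submodule.span_le.mpr ?_ this
  rintro w ⟨r, hr, hw⟩
  exact hB r q w (by omega) hw

theorem modeWord_zero (a : V) (r : ℕ) : ModeWord Y x a r 0 ((Y x 0)^[r] a) := by
  induction r with
  | zero => exact .nil
  | succ r ih => rw [Function.iterate_succ_apply']; exact ih.cons 0

end Words

/-! ### Degree estimates and finiteness of the Δ-operator. -/

section FockDegree

variable {I : Type*} [Fintype I]

/-- `FockDeg D Q`: the polynomial `Q` has degree at most `D`, where `X (i, n)` has degree `n + 1`. -/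
inductive FockDeg : ℤ → MvPolynomial (I × ℕ) ℂ → Prop
  | zero (D : ℤ) : FockDeg D 0
  | one {D : ℤ} : 0 ≤ D → FockDeg D 1
  | X_mul {D : ℤ} {Q : MvPolynomial (I × ℕ) ℂ} (s : I × ℕ) :
      FockDeg D Q → FockDeg (D + s.2 + 1) (MvPolynomial.X s * Q)
  | add {D : ℤ} {P Q : MvPolynomial (I × ℕ) ℂ} : FockDeg D P → FockDeg D Q → FockDeg D (P + Q)
  | smul {D : ℤ} {Q : MvPolynomial (I × ℕ) ℂ} (t : ℂ) : FockDeg D Q → FockDeg D (t • Q)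

namespace FockDeg

theorem mono {D : ℤ} {Q : MvPolynomial (I × ℕ) ℂ} (h : FockDeg D Q) :
    ∀ {D'}, D ≤ D' → FockDeg D' Q := by
  induction h with
  | zero D => exact fun _ => .zero _
  | one h0 => exact fun h => .one (h0.trans h)
  | @X_mul D Q s _ ih =>
    intro D' h
    have := (ih (D' := D' - s.2 - 1) (by omega)).X_mul s
    rwa [show D' - s.2 - 1 + s.2 + 1 = D' by ring] at this
  | add _ _ ih1 ih2 => exact fun h => (ih1 h).add (ih2 h)
  | smul t _ ih => exact fun h => (ih h).smul t

theorem eq_zero {D : ℤ} {Q : MvPolynomial (I × ℕ) ℂ} (h : FockDeg D Q) (hD : D < 0) : Q = 0 := by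
  induction h with
  | zero D => rfl
  | one h0 => omega
  | X_mul s _ ih => rw [ih (by omega), mul_zero]
  | add _ _ ih1 ih2 => rw [ih1 hD, ih2 hD, add_zero]
  | smul t _ ih => rw [ih hD, smul_zero]

theorem sum {ι : Type*} {s : Finset ι} {f : ι → MvPolynomial (I × ℕ) ℂ} {D : ℤ}
    (h : ∀ i ∈ s, FockDeg D (f i)) : FockDeg D (∑ i ∈ s, f i) :=
  Finset.sum_induction f (FockDeg D) (fun _ _ => .add) (.zero D) h

theorem mul {D D' : ℤ} {P Q : MvPolynomial (I × ℕ) ℂ} (hP : FockDeg D P) (hQ : FockDeg D' Q) :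
    FockDeg (D + D') (P * Q) := by
  induction hP with
  | zero D => rw [zero_mul]; exact .zero _
  | one h0 => rw [one_mul]; exact hQ.mono (by omega)
  | @X_mul D Q s _ ih =>
    rw [mul_assoc, show D + s.2 + 1 + D' = D + D' + s.2 + 1 by ring]
    exact ih.X_mul s
  | add _ _ ih1 ih2 => rw [add_mul]; exact ih1.add ih2
  | smul t _ ih => rw [smul_mul_assoc]; exact ih.smul t

theorem exists_deg (Q : MvPolynomial (I × ℕ) ℂ) : ∃ D, FockDeg D Q := by
  induction Q using MvPolynomial.induction_on with
  | C t =>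
    refine ⟨0, ?_⟩
    rw [← mul_one (MvPolynomial.C t), ← MvPolynomial.smul_eq_C_mul]
    exact (FockDeg.one le_rfl).smul t
  | add P Q hP hQ =>
    obtain ⟨D, hD⟩ := hP
    obtain ⟨D', hD'⟩ := hQ
    exact ⟨max D D', (hD.mono (le_max_left _ _)).add (hD'.mono (le_max_right _ _))⟩
  | mul_X P s hP =>
    obtain ⟨D, hD⟩ := hP
    exact ⟨_, mul_comm (MvPolynomial.X s) P ▸ hD.X_mul s⟩

theorem creationVar (u : I → ℂ) (k : ℕ) : FockDeg (k + 1) (creationVar u k) := by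
  refine FockDeg.sum fun i _ => .smul _ ?_
  have := (FockDeg.one (I := I) le_rfl).X_mul (i, k)
  rwa [zero_add, mul_one] at this

theorem creationCoeff (u : I → ℂ) (N : ℤ) : FockDeg N (creationCoeff u N) := by
  rcases lt_or_ge N 0 with h | h
  · rw [creationCoeff_neg u h]; exact .zero _
  · lift N to ℕ using h
    induction N using Nat.strong_induction_on with
    | _ N ih =>
      cases N with
      | zero => rw [Nat.cast_zero, creationCoeff_zero]; exact .one le_rfl
      | succ N =>
        have hN : (N : ℂ) + 1 ≠ 0 := by exact_mod_cast Nat.succ_ne_zero N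
        rw [Nat.cast_succ, ← inv_smul_smul₀ hN (_root_.creationCoeff u (N + 1)), creationCoeff_succ]
        refine .smul _ (.sum fun k hk => ?_)
        rw [Finset.mem_range] at hk
        have := (creationVar u k).mul (ih (N - k) (by omega))
        rw [Nat.cast_sub (by omega)] at this
        exact this.mono (by omega)

theorem expFock {D : ℤ} {Q : MvPolynomial (I × ℕ) ℂ} (h : FockDeg D Q) (u : I → ℂ) (w : I → ℤ) :
    ∀ N, FockDeg (D + N) (expFock u w N Q) := by
  induction h with
  | zero D => intro N; rw [map_zero]; exact .zero _
  | one h0 =>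
    intro N
    rw [expFock_one]
    exact (creationCoeff u N).mono (by omega)
  | @X_mul D Q s _ ih =>
    intro N
    rw [expFock_X_mul, sub_eq_add_neg, ← neg_smul]
    refine .add (((ih N).X_mul s).mono (by omega)) (.smul _ ((ih _).mono (by omega)))
  | add _ _ ih1 ih2 => intro N; rw [map_add]; exact (ih1 N).add (ih2 N)
  | smul t _ ih => intro N; rw [map_smul]; exact (ih N).smul t

end FockDeg

variable {G : Matrix I I ℤ} {E : LatticeCocycle G}

theorem expMode_single_apply (lam γ c : I → ℤ) (m : ℤ) (Q : MvPolynomial (I × ℕ) ℂ) :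
    expMode G E lam γ m (Finsupp.single c Q) = Finsupp.single (γ + c) ((E.ε γ c : ℂ) •
      expFock (fun i => (γ i : ℂ)) (fun j => ∑ i, G j i * γ i)
        (-m - 1 - chargeExp G lam γ c) Q) := by
  rw [expMode, Finsupp.lsum_single]
  rfl

/-- Degrees of words in the modes of `e^γ`. -/
theorem modeWord_exp {γ : I → ℤ} {p : ℤ} (hp : latPair G γ γ = 2 * p) {c : I → ℤ}
    {Q : MvPolynomial (I × ℕ) ℂ} {D : ℤ} (hQ : FockDeg D Q) {r N : ℕ} {w : LatticeFock I}
    (hw : ModeWord (latticeMode G E 0) (Finsupp.single γ 1) (Finsupp.single c Q) r N w) :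
    ∃ c' Q', w = Finsupp.single c' Q' ∧ chargeExp G 0 γ c' = chargeExp G 0 γ c + 2 * p * r ∧
      FockDeg (D - N - r * (1 + chargeExp G 0 γ c) - p * r * (r - 1)) Q' := by
  induction hw with
  | nil => exact ⟨c, Q, rfl, by simp, hQ.mono (by simp)⟩
  | @cons r N w n _ ih =>
    obtain ⟨c', Q', rfl, hc, hQ'⟩ := ih
    -- A letter of index n lowers the degree by n + 1 plus the pairing of γ with the current charge.
    -- That pairing grows by 2p with every letter, hence the quadratic term.
    refine ⟨γ + c', _, (latticeMode_single_one γ n _).trans (expMode_single_apply 0 γ c' n Q'), ?_,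
      ((hQ'.expFock _ _ _).smul _).mono (le_of_eq ?_)⟩
    · have := chargeExp_add (G := G) (lam := 0) γ γ c'
      rw [this, hc, hp]
      push_cast
      ring
    · rw [hc]
      push_cast
      ring

/-- With K = |(γ, c)| + 1 the degree bound of `modeWord_exp` is smaller than -(r² - rK + K²) ≤ 0;
this explains the slack K². -/
theorem modeWord_exp_eq_zero {γ : I → ℤ} {p : ℤ} (hp : latPair G γ γ = 2 * p) (hp0 : 0 < p)
    {c : I → ℤ} {Q : MvPolynomial (I × ℕ) ℂ} {D : ℤ} (hQ : FockDeg D Q) {r N : ℕ}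
    (h : D + (|chargeExp G 0 γ c| + 1) ^ 2 < r + N) {w : LatticeFock I}
    (hw : ModeWord (latticeMode G E 0) (Finsupp.single γ 1) (Finsupp.single c Q) r N w) :
    w = 0 := by
  obtain ⟨c', Q', rfl, -, hQ'⟩ := modeWord_exp hp hQ hw
  rw [hQ'.eq_zero, Finsupp.single_zero]
  set κ := chargeExp G 0 γ c
  have h1 : (r : ℤ) * (r - 1) ≤ p * r * (r - 1) := by
    have : (0 : ℤ) ≤ r * (r - 1) := by
      rcases r with _ | r
      · simp
      · push_cast; rw [add_sub_cancel_right]; positivity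
    nlinarith
  have h2 : -|κ| ≤ κ := neg_abs_le κ
  have hr : (0 : ℤ) ≤ r := Int.natCast_nonneg r
  nlinarith [sq_nonneg ((r : ℤ) * 2 - (|κ| + 1)), mul_le_mul_of_nonneg_left h2 hr,
    sq_nonneg (|κ| + 1)]

theorem expState_products_zero {γ : I → ℤ} {p : ℤ} (hp : latPair G γ γ = 2 * p) (hp0 : 0 < p)
    (n : ℕ) : latticeMode G E 0 (Finsupp.single γ 1) n (Finsupp.single γ 1) = 0 := by
  rw [latticeMode_single_one, expMode_ground, chargeExp_zero, hp, creationCoeff_neg _ (by omega),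
    smul_zero, Finsupp.single_zero]

theorem deltaCoeff_exp_eventually_zero (hs : ∀ i j, G i j = G j i) (hG : GramNondegenerate G)
    {γ : I → ℤ} {p : ℤ} (hp : latPair G γ γ = 2 * p) (hp0 : 0 < p) (a : LatticeFock I) : ∃ B : ℕ, ∀ k q, B ≤ k + q →
      deltaCoeff (latticeMode G E 0) (Finsupp.single γ 1) a k q = 0 := by
  have hV := lattice_isVertexAlgebra (E := E) hs hG
  have hx := expState_products_zero (E := E) hp hp0
  induction a using Finsupp.induction_linear with
  | zero =>
    refine ⟨0, fun k q _ => ?_⟩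
    have := deltaCoeff_smul (x := Finsupp.single γ 1) hV.isFieldMap 0 0 k q
    rwa [zero_smul, zero_smul] at this
  | add a b ha hb =>
    obtain ⟨B, hB⟩ := ha
    obtain ⟨C, hC⟩ := hb
    exact ⟨max B C, fun k q h => by
      rw [deltaCoeff_add hV.isFieldMap, hB k q (by omega), hC k q (by omega), add_zero]⟩
  | single c Q =>
    obtain ⟨D, hD⟩ := FockDeg.exists_deg Q
    refine ⟨(D + (|chargeExp G 0 γ c| + 1) ^ 2 + 1).toNat,
      deltaCoeff_eventually_zero_of_words hV hx fun r N w h hw =>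
        modeWord_exp_eq_zero hp hp0 hD (by omega) hw⟩

/-- The Serre relation in its integrated form. -/
theorem expState_iterate_zero {γ c : I → ℤ} {p : ℤ} (hp : latPair G γ γ = 2 * p) {r : ℕ}
    (hr : 0 < r * (1 + latPair G γ c + p * (r - 1))) :
    (latticeMode G E 0 (Finsupp.single γ 1) 0)^[r] (Finsupp.single c 1) = 0 := by
  obtain ⟨c', Q', h, -, hQ'⟩ := modeWord_exp (E := E) (c := c) hp (FockDeg.one le_rfl)
    (modeWord_zero _ r)
  rw [h, hQ'.eq_zero, Finsupp.single_zero]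
  rw [chargeExp_zero]
  push_cast
  linarith

end FockDegree

/-! ### Exponentials of locally nilpotent derivations. -/

section Exponentials

variable {V : Type*} [AddCommGroup V] [Module ℂ V] {vac : V} {Y : V → ℤ → V → V} {D : V → V}

/-- A derivation as a linear map. -/
def IsVertexDerivation.toLin (hD : IsVertexDerivation vac Y D) : V →ₗ[ℂ] V where
  toFun := D
  map_add' := hD.add
  map_smul' := hD.smul

theorem IsVertexDerivation.iterate_eq (hD : IsVertexDerivation vac Y D) (r : ℕ) (a : V) :
    D^[r] a = (hD.toLin ^ r) a := by rw [Module.End.pow_apply]; rfl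

theorem IsLocallyNilpotent.eventually (hD : IsVertexDerivation vac Y D)
    (hn : IsLocallyNilpotent D) (a : V) : ∀ᶠ L in Filter.atTop, ∀ r : ℕ, L ≤ r → D^[r] a = 0 := by
  obtain ⟨s, hs⟩ := hn a
  refine Filter.eventually_atTop.mpr ⟨s, fun L hL r hr => ?_⟩
  rw [← Nat.sub_add_cancel (hL.trans hr), Function.iterate_add_apply, hs, hD.iterate_eq, map_zero]

theorem expOp_eq_range {a : V} {L : ℕ} (h : ∀ r, L ≤ r → D^[r] a = 0) (t : ℂ) :
    expOp D t a = ∑ r ∈ Finset.range L, (t ^ r / (r.factorial : ℂ)) • D^[r] a :=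
  finsum_eq_range fun r hr => by rw [h r hr, smul_zero]

theorem expOp_mem {W : Submodule ℂ V} (hW : ∀ a ∈ W, D a ∈ W) (t : ℂ) {a : V} (ha : a ∈ W) :
    expOp D t a ∈ W := by
  have h : ∀ r, D^[r] a ∈ W := fun r => by
    induction r with
    | zero => exact ha
    | succ r ih => rw [Function.iterate_succ_apply']; exact hW _ ih
  exact finsum_induction (· ∈ W) W.zero_mem (fun _ _ => W.add_mem) fun r => W.smul_mem _ (h r)

variable (hD : IsVertexDerivation vac Y D) (hn : IsLocallyNilpotent D)
include hD hn

theorem expOp_add (t : ℂ) (a b : V) : expOp D t (a + b) = expOp D t a + expOp D t b := by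
  obtain ⟨L, h1, h2, h3⟩ := ((hn.eventually hD a).and ((hn.eventually hD b).and
    (hn.eventually hD (a + b)))).exists
  rw [expOp_eq_range h1, expOp_eq_range h2, expOp_eq_range h3, ← Finset.sum_add_distrib]
  exact Finset.sum_congr rfl fun r _ => by simp only [hD.iterate_eq, map_add, smul_add]

theorem expOp_smul (t c : ℂ) (a : V) : expOp D t (c • a) = c • expOp D t a := by
  obtain ⟨L, h1, h2⟩ := ((hn.eventually hD a).and (hn.eventually hD (c • a))).exists
  rw [expOp_eq_range h1, expOp_eq_range h2, Finset.smul_sum]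
  exact Finset.sum_congr rfl fun r _ => by rw [hD.iterate_eq, map_smul, smul_comm, hD.iterate_eq]

theorem expOp_expOp_neg (t : ℂ) (a : V) : expOp D (-t) (expOp D t a) = a := by
  obtain ⟨L, hL, h1⟩ := ((Filter.eventually_gt_atTop 0).and (hn.eventually hD a)).exists
  have h2 : ∀ r, L ≤ r → D^[r] (expOp D t a) = 0 := by
    intro r hr
    rw [expOp_eq_range h1, hD.iterate_eq, map_sum]
    refine Finset.sum_eq_zero fun s _ => ?_
    rw [map_smul, ← hD.iterate_eq, ← Function.iterate_add_apply, h1 _ (by omega), smul_zero]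
  rw [expOp_eq_range h2]
  have h3 : ∀ r, ((-t) ^ r / (r.factorial : ℂ)) • D^[r] (expOp D t a) =
      ∑ s ∈ Finset.range L, ((-t) ^ r / (r.factorial : ℂ) * (t ^ s / (s.factorial : ℂ))) •
        D^[r + s] a := by
    intro r
    rw [expOp_eq_range h1, hD.iterate_eq, map_sum, Finset.smul_sum]
    refine Finset.sum_congr rfl fun s _ => ?_
    rw [map_smul, ← hD.iterate_eq, ← Function.iterate_add_apply, smul_smul]
  rw [Finset.sum_congr rfl fun r _ => h3 r, ← sum_range_antidiagonal
    (F := fun r s => ((-t) ^ r / (r.factorial : ℂ) * (t ^ s / (s.factorial : ℂ))) •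
        D^[r + s] a) fun r s hrs => by rw [h1 _ hrs, smul_zero]]
  have h4 : ∀ N : ℕ, ∑ rs ∈ Finset.HasAntidiagonal.antidiagonal N,
      ((-t) ^ rs.1 / (rs.1.factorial : ℂ) * (t ^ rs.2 / (rs.2.factorial : ℂ))) •
        D^[rs.1 + rs.2] a = if N = 0 then a else 0 := by
    intro N
    trans ((N.factorial : ℂ)⁻¹ * (-t + t) ^ N) • D^[N] a
    · rw [(Commute.all (-t) t).add_pow', Finset.mul_sum, Finset.sum_smul]
      refine Finset.sum_congr rfl fun rs hrs => ?_
      rw [Finset.HasAntidiagonal.mem_antidiagonal] at hrs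
      have h5 := Nat.add_choose_mul_factorial_mul_factorial rs.1 rs.2
      rw [← hrs, nsmul_eq_mul, ← h5, Nat.choose_symm_add]
      have h6 : ((rs.1 + rs.2).choose rs.2 : ℂ) ≠ 0 := by
        exact_mod_cast (Nat.choose_pos (Nat.le_add_left _ _)).ne'
      have h7 : (rs.1.factorial : ℂ) ≠ 0 := by exact_mod_cast rs.1.factorial_ne_zero
      have h8 : (rs.2.factorial : ℂ) ≠ 0 := by exact_mod_cast rs.2.factorial_ne_zero
      congr 1
      push_cast
      field_simp
    · cases N with
      | zero => simp
      | succ N => simp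
  rw [Finset.sum_congr rfl fun N _ => h4 N, Finset.sum_eq_single 0]
  · rw [if_pos rfl]
  · intro N _ hN; rw [if_neg hN]
  · intro h; exact absurd (Finset.mem_range.mpr hL) h

theorem expOp_mode (hY : IsFieldMap Y) (t : ℂ) (a b : V) (n : ℤ) :
    expOp D t (Y a n b) = Y (expOp D t a) n (expOp D t b) := by
  set P : ℕ → V → V := fun r a => (t ^ r / (r.factorial : ℂ)) • D^[r] a with hP
  have hs : ∀ (r : ℕ) c, ((r : ℂ) + 1) • P (r + 1) c = t • D (P r c) := by
    intro r c
    have h1 : (r.factorial : ℂ) ≠ 0 := by exact_mod_cast r.factorial_ne_zero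
    have h2 : (r : ℂ) + 1 ≠ 0 := by exact_mod_cast Nat.succ_ne_zero r
    simp only [hP]
    rw [hD.smul, Function.iterate_succ_apply', smul_smul, smul_smul, Nat.factorial_succ]
    congr 1
    push_cast
    field_simp
    ring
  -- The Leibniz rule for divided powers, where no binomial coefficients appear.
  have key : ∀ r, P r (Y a n b) = ∑ ij ∈ Finset.HasAntidiagonal.antidiagonal r,
      Y (P ij.1 a) n (P ij.2 b) := by
    intro r
    induction r with
    | zero => simp [hP]
    | succ r ih =>
      have h2 : (r : ℂ) + 1 ≠ 0 := by exact_mod_cast Nat.succ_ne_zero r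
      refine smul_right_injective V h2 ?_
      simp only
      have h3 : ((r : ℂ) + 1) • ∑ ij ∈ Finset.HasAntidiagonal.antidiagonal (r + 1),
          Y (P ij.1 a) n (P ij.2 b) =
          ∑ ij ∈ Finset.HasAntidiagonal.antidiagonal (r + 1), (ij.1 : ℂ) • Y (P ij.1 a) n (P ij.2 b) +
          ∑ ij ∈ Finset.HasAntidiagonal.antidiagonal (r + 1),
            (ij.2 : ℂ) • Y (P ij.1 a) n (P ij.2 b) := by
        rw [Finset.smul_sum, ← Finset.sum_add_distrib]
        refine Finset.sum_congr rfl fun ij hij => ?_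
        rw [Finset.HasAntidiagonal.mem_antidiagonal] at hij
        rw [← add_smul]
        congr 1
        exact_mod_cast hij.symm
      rw [h3, Finset.Nat.sum_antidiagonal_succ, Finset.Nat.sum_antidiagonal_succ', hs, ih]
      simp only [Nat.cast_zero, zero_smul, zero_add, Nat.cast_add, Nat.cast_one]
      rw [← Finset.sum_add_distrib, show ∀ w, D w = hD.toLin w from fun _ => rfl, map_sum,
        Finset.smul_sum]
      refine Finset.sum_congr rfl fun ij _ => ?_
      rw [show ∀ w, hD.toLin w = D w from fun _ => rfl, hD.mode, smul_add,
        ← hY.smul_left t, ← hY.smul_right t, ← hs, ← hs,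
        hY.smul_left ((ij.1 : ℂ) + 1) (P (ij.1 + 1) a), hY.smul_right ((ij.2 : ℂ) + 1)]
  obtain ⟨L, h1, h2⟩ := ((hn.eventually hD a).and (hn.eventually hD b)).exists
  have h4 : ∀ i j, 2 * L ≤ i + j → Y (P i a) n (P j b) = 0 := by
    intro i j hij
    by_cases hi : L ≤ i
    · simp only [hP, h1 i hi, smul_zero, hY.zero_left]
    · simp only [hP, h2 j (by omega), smul_zero, hY.zero_right]
  have h5 : expOp D t (Y a n b) = ∑ r ∈ Finset.range (2 * L), P r (Y a n b) := by
    refine finsum_eq_range fun r hr => ?_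
    change P r (Y a n b) = 0
    rw [key]
    refine Finset.sum_eq_zero fun ij hij => ?_
    rw [Finset.HasAntidiagonal.mem_antidiagonal] at hij
    exact h4 _ _ (by omega)
  rw [h5, Finset.sum_congr rfl fun r _ => key r,
    sum_range_antidiagonal (F := fun i j => Y (P i a) n (P j b)) h4,
    expOp_eq_range (L := 2 * L) (fun r hr => h1 r (by omega)),
    expOp_eq_range (a := b) (L := 2 * L) (fun r hr => h2 r (by omega)), hY.sum_left]
  exact Finset.sum_congr rfl fun i _ => (hY.sum_right _ _ _ _).symm

/-- The exponential of a locally nilpotent derivation is an automorphism. -/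
theorem expOp_isVertexAut (hY : IsFieldMap Y) (t : ℂ) : IsVertexAut vac Y (expOp D t) where
  bijective := Function.bijective_iff_has_inverse.mpr ⟨expOp D (-t), expOp_expOp_neg hD hn t,
    fun a => by simpa using expOp_expOp_neg hD hn (-t) a⟩
  add := expOp_add hD hn t
  smul := expOp_smul hD hn t
  vacuum := by
    rw [expOp, finsum_eq_single _ 0]
    · simp
    · intro r hr
      obtain ⟨r, rfl⟩ := Nat.exists_eq_succ_of_ne_zero hr
      rw [Function.iterate_succ_apply, hD.vacuum, hD.iterate_eq, map_zero, smul_zero]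
  mode a n b := expOp_mode hD hn hY t a b n

end Exponentials

/-! ### Automorphisms and restriction to subalgebras. -/

section Automorphisms

variable {V M : Type*} [AddCommGroup V] [Module ℂ V] [AddCommGroup M] [Module ℂ M]
variable {vac : V} {Y : V → ℤ → V → V}

theorem IsVertexAut.one : IsVertexAut vac Y (1 : Equiv.Perm V) where
  bijective := Equiv.bijective _
  add _ _ := rfl
  smul _ _ := rfl
  vacuum := rfl
  mode _ _ _ := rfl

theorem IsVertexAut.mul {g h : Equiv.Perm V} (hg : IsVertexAut vac Y g) (hh : IsVertexAut vac Y h) :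
    IsVertexAut vac Y (g * h : Equiv.Perm V) where
  bijective := Equiv.bijective _
  add a b := by simp only [Equiv.Perm.mul_apply, hh.add, hg.add]
  smul t a := by simp only [Equiv.Perm.mul_apply, hh.smul, hg.smul]
  vacuum := by simp only [Equiv.Perm.mul_apply, hh.vacuum, hg.vacuum]
  mode a n b := by simp only [Equiv.Perm.mul_apply, hh.mode, hg.mode]

theorem IsVertexAut.inv {g : Equiv.Perm V} (hg : IsVertexAut vac Y g) :
    IsVertexAut vac Y (g⁻¹ : Equiv.Perm V) where
  bijective := Equiv.bijective _
  add a b := by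
    rw [Equiv.Perm.inv_eq_iff_eq, hg.add]
    exact congrArg₂ _ (g.apply_symm_apply a).symm (g.apply_symm_apply b).symm
  smul t a := by
    rw [Equiv.Perm.inv_eq_iff_eq, hg.smul]
    exact congrArg _ (g.apply_symm_apply a).symm
  vacuum := by rw [Equiv.Perm.inv_eq_iff_eq, hg.vacuum]
  mode a n b := by
    rw [Equiv.Perm.inv_eq_iff_eq, hg.mode]
    exact congrArg₂ (Y · n ·) (g.apply_symm_apply a).symm (g.apply_symm_apply b).symm

variable {W : Submodule ℂ V} (hW : IsVertexSubalgebra vac Y W)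

/-- Stability alone gives injectivity on W; the converse implication places preimages in W and gives
surjectivity. -/
theorem IsVertexAut.restrict {g : V → V} (hg : IsVertexAut vac Y g) (h : ∀ a, g a ∈ W ↔ a ∈ W) :
    IsVertexAut hW.vac hW.mode (restrictMap fun a ha => (h a).mpr ha) where
  bijective := by
    refine ⟨fun a b hab => Subtype.ext (hg.bijective.1 (congrArg Subtype.val hab)), fun b => ?_⟩
    obtain ⟨a, ha⟩ := hg.bijective.2 b
    exact ⟨⟨a, (h a).mp (ha ▸ b.2)⟩, Subtype.ext ha⟩
  add _ _ := Subtype.ext (hg.add _ _)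
  smul _ _ := Subtype.ext (hg.smul _ _)
  vacuum := Subtype.ext hg.vacuum
  mode _ _ _ := Subtype.ext (hg.mode _ _ _)

variable {D : V → V} (hDW : ∀ a ∈ W, D a ∈ W)

theorem IsVertexDerivation.restrict (hD : IsVertexDerivation vac Y D) :
    IsVertexDerivation hW.vac hW.mode (restrictMap hDW) where
  add _ _ := Subtype.ext (hD.add _ _)
  smul _ _ := Subtype.ext (hD.smul _ _)
  vacuum := Subtype.ext hD.vacuum
  mode _ _ _ := Subtype.ext (hD.mode _ _ _)

theorem coe_restrictMap_iterate (r : ℕ) (a : W) :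
    (((restrictMap hDW)^[r] a : W) : V) = D^[r] a := by
  induction r generalizing a with
  | zero => rfl
  | succ r ih => rw [Function.iterate_succ_apply, ih, Function.iterate_succ_apply]; rfl

theorem IsLocallyNilpotent.restrict (hD : IsLocallyNilpotent D) :
    IsLocallyNilpotent (restrictMap hDW) := fun a => by
  obtain ⟨r, hr⟩ := hD a
  exact ⟨r, Subtype.ext ((coe_restrictMap_iterate hDW r a).trans hr)⟩

theorem coe_expOp_restrictMap (t : ℂ) (a : W) :
    ((expOp (restrictMap hDW) t a : W) : V) = expOp D t a := by
  rw [expOp, coe_finsum_submodule]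
  exact finsum_congr fun r => by rw [Submodule.coe_smul, coe_restrictMap_iterate]

theorem coe_binomOp_restrictMap (m : ℤ) (j : ℕ) (a : W) :
    ((binomOp (restrictMap hDW) m j a : W) : V) = binomOp D m j a := by
  induction j with
  | zero => rfl
  | succ j ih =>
    rw [binomOp, binomOp, Submodule.coe_smul, Submodule.coe_sub, Submodule.coe_smul, ih]
    simp only [restrictMap, ih]

theorem IsTwistedModule.restrict {YM : V → ℕ → ℤ → M → M} (h : IsTwistedModule vac Y D YM) :
    IsTwistedModule hW.vac hW.mode (restrictMap hDW) fun a : W => YM (a : V) where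
  add_left _ _ := h.add_left _ _
  smul_left _ _ := h.smul_left _ _
  add_right _ := h.add_right _
  smul_right _ _ := h.smul_right _ _
  truncation _ := h.truncation _
  vacuum := h.vacuum
  monodromy a k n v := by rw [coe_expOp_restrictMap]; exact h.monodromy _ _ _ _
  derivative _ := h.derivative _
  borcherds a b v m k n := by
    refine (h.borcherds _ _ _ _ _ _).trans (finsum_congr fun j => ?_)
    rw [← coe_binomOp_restrictMap hDW]
    rfl

end Automorphisms

/-! ### The torus, the Borel relations and the group action. -/

section BorelAction

variable {I : Type*} [Fintype I] {G : Matrix I I ℤ} {E : LatticeCocycle G} {lam : I → ℤ}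

theorem latPair_latticeBasis_left (i : I) (c : I → ℤ) :
    latPair G (latticeBasis i) c = ∑ l, G i l * c l := by
  rw [latPair, ← sum_mul_latticeBasis (fun j => ∑ l, G j l * c l) i]
  refine Finset.sum_congr rfl fun j _ => ?_
  rw [Int.cast_id, Finset.sum_mul]
  exact Finset.sum_congr rfl fun l _ => by ring

theorem latPair_latticeBasis (i j : I) : latPair G (latticeBasis i) (latticeBasis j) = G i j := by
  rw [latPair_latticeBasis_left]
  simpa only [Int.cast_id] using sum_mul_latticeBasis (fun l => G i l) j

theorem chargePair_latticeBasis (i j : I) : chargePair G 0 (latticeBasis j) i = G i j := by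
  rw [chargePair_zero]
  simpa only [Int.cast_id] using sum_mul_latticeBasis (fun l => G i l) j

theorem cartanState_eq (p : ℕ) (i : I) :
    cartanState p i = ((Real.sqrt p : ℝ) : ℂ)⁻¹ • heisState i := by
  rw [cartanState, heisState, Finsupp.smul_single]

section Torus

/-- The eigenvalue of `torusExp G p t` on the charge `c`. -/
def torusChar (G : Matrix I I ℤ) (p : ℕ) (t : I → ℂ) (c : I → ℤ) : ℂ :=
  Complex.exp (∑ i, t i * ((chargePair G 0 c i : ℂ) / ((Real.sqrt p : ℝ) : ℂ)))

variable {p : ℕ} {t : I → ℂ}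

theorem torusChar_add (c d : I → ℤ) :
    torusChar G p t (c + d) = torusChar G p t c * torusChar G p t d := by
  rw [torusChar, torusChar, torusChar, ← Complex.exp_add, ← Finset.sum_add_distrib]
  congr 1
  refine Finset.sum_congr rfl fun i _ => ?_
  rw [chargePair_add_charge, ← chargePair_zero]
  push_cast
  ring

theorem torusChar_zero : torusChar G p t 0 = 1 := by simp [torusChar, chargePair]

theorem torusChar_neg_mul (c : I → ℤ) : torusChar G p (-t) c * torusChar G p t c = 1 := by
  rw [torusChar, torusChar, ← Complex.exp_add, ← Finset.sum_add_distrib,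
    Finset.sum_eq_zero fun i _ => ?_, Complex.exp_zero]
  simp

theorem torusExp_apply (v : LatticeFock I) (c : I → ℤ) :
    torusExp G p t v c = torusChar G p t c • v c := by
  classical
  rw [torusExp, Finsupp.sum_apply, Finsupp.sum, Finset.sum_eq_single c]
  · rw [Finsupp.single_eq_same]; rfl
  · intro d _ hd; exact Finsupp.single_eq_of_ne hd.symm
  · intro h; simp [Finsupp.notMem_support_iff.mp h]

/-- `torusExp` as a linear map. -/
def torusLin (G : Matrix I I ℤ) (p : ℕ) (t : I → ℂ) : LatticeFock I →ₗ[ℂ] LatticeFock I where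
  toFun := torusExp G p t
  map_add' v w := by ext1 c; simp only [torusExp_apply, Finsupp.add_apply, smul_add]
  map_smul' s v := by
    ext1 c
    simp only [torusExp_apply, Finsupp.smul_apply, RingHom.id_apply]
    exact smul_comm _ _ _

theorem torusLin_apply (v : LatticeFock I) : torusLin G p t v = torusExp G p t v := rfl

theorem torusLin_single (c : I → ℤ) (Q : MvPolynomial (I × ℕ) ℂ) :
    torusLin G p t (Finsupp.single c Q) = torusChar G p t c • Finsupp.single c Q := by
  classical
  ext1 d
  rw [torusLin_apply, torusExp_apply, Finsupp.smul_apply, Finsupp.single_apply]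
  split_ifs with h
  · rw [h]
  · rw [smul_zero, smul_zero]

theorem torusExp_neg (v : LatticeFock I) : torusExp G p (-t) (torusExp G p t v) = v := by
  ext1 c
  rw [torusExp_apply, torusExp_apply, smul_smul, torusChar_neg_mul, one_smul]

theorem torusExp_bijective : Function.Bijective (torusExp G p t) :=
  Function.bijective_iff_has_inverse.mpr ⟨torusExp G p (-t), torusExp_neg,
    fun a => by simpa using torusExp_neg (t := -t) a⟩

theorem torusLin_expMode (γ : I → ℤ) (m : ℤ) (v : LatticeFock I) :
    torusLin G p t (expMode G E 0 γ m v) =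
      torusChar G p t γ • expMode G E 0 γ m (torusLin G p t v) := by
  induction v using Finsupp.induction_linear with
  | zero => simp only [map_zero, smul_zero]
  | add v w hv hw => simp only [map_add, smul_add, hv, hw]
  | single c Q =>
    rw [torusLin_single, map_smul, expMode_single_apply, torusLin_single, torusChar_add, mul_smul]

theorem torusLin_heisMode (i : I) (m : ℤ) (v : LatticeFock I) :
    torusLin G p t (heisMode G 0 i m v) = heisMode G 0 i m (torusLin G p t v) := by
  induction v using Finsupp.induction_linear with
  | zero => simp only [map_zero]
  | add v w hv hw => simp only [map_add, hv, hw]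
  | single c Q =>
    rw [torusLin_single, map_smul, heisMode_single, torusLin_single]

theorem torusLin_jacobiLHS (A B A' B' : ℤ → LatticeFock I → LatticeFock I)
    (hA : ∀ n v, torusLin G p t (A n v) = A' n (torusLin G p t v))
    (hB : ∀ n v, torusLin G p t (B n v) = B' n (torusLin G p t v)) (n m k : ℤ)
    (v : LatticeFock I) : torusLin G p t (jacobiLHS A B n m k v) =
      jacobiLHS A' B' n m k (torusLin G p t v) := by
  rw [jacobiLHS, jacobiLHS]
  refine ((torusLin G p t).toAddMonoidHom.map_finsum_of_injective
    (torusExp_bijective.1 : Function.Injective (torusExp G p t)) _).trans (finsum_congr fun j => ?_)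
  change torusLin G p t _ = _
  rw [map_smul, map_sub, map_smul, hA, hB, hB, hA]

/-- Exponential modes shift the charge and scale by its character; Heisenberg modes preserve charge.
The iterate formula carries compatibility to all states, since multiplication by X s is a product
with a Heisenberg state. -/
theorem torusLin_latticeMode (hs : ∀ i j, G i j = G j i) (hG : GramNondegenerate G)
    (a : LatticeFock I) : ∀ n v, torusLin G p t (latticeMode G E 0 a n v) =
      latticeMode G E 0 (torusLin G p t a) n (torusLin G p t v) := by
  have hV := lattice_isVertexAlgebra (E := E) hs hG
  have hY := hV.isFieldMap
  induction a using latticeFock_induction with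
  | h0 => intro n v; rw [map_zero, hY.zero_left, hY.zero_left, map_zero]
  | hadd a b ha hb => intro n v; rw [map_add, hY.add_left, hY.add_left, map_add, ha, hb]
  | hsmul c a ha => intro n v; rw [map_smul, hY.smul_left, hY.smul_left, map_smul, ha]
  | hone γ =>
    intro n v
    rw [torusLin_single, hY.smul_left, latticeMode_single_one, latticeMode_single_one,
      torusLin_expMode]
  | hX γ s Q ih =>
    intro n v
    have hT : torusLin G p t (heisState s.1) = heisState s.1 := by
      rw [heisState, torusLin_single, torusChar_zero, one_smul]
    have hH : ∀ n v, torusLin G p t (latticeMode G E 0 (heisState s.1) n v) =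
        latticeMode G E 0 (heisState s.1) n (torusLin G p t v) := by
      intro n v
      rw [latticeMode_heisState hs, latticeMode_heisState hs, torusLin_heisMode]
    have hX : Finsupp.single γ (MvPolynomial.X s * Q) =
        latticeMode G E 0 (heisState s.1) (-s.2 - 1) (Finsupp.single γ Q) :=
      (latticeMode_heisState_neg hs s.1 s.2 γ Q).symm
    rw [hX, hH, Borcherds.iterate (hV.borcherds _ _), Borcherds.iterate (hV.borcherds _ _)]
    exact torusLin_jacobiLHS _ _ _ _ hH ih _ _ _ _

theorem torusExp_isVertexAut (hs : ∀ i j, G i j = G j i) (hG : GramNondegenerate G) :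
    IsVertexAut (latticeVac I) (latticeMode G E 0) (torusExp G p t) where
  bijective := torusExp_bijective
  add := map_add (torusLin G p t)
  smul := map_smul (torusLin G p t)
  vacuum := by
    rw [← torusLin_apply, latticeVac, torusLin_single, torusChar_zero, one_smul]
  mode a n b := torusLin_latticeMode hs hG a n b

/-- With the shift by -αᵢ/√p absorbed into the target module, the screening preserves the label c,
on which the torus acts by scalars. -/
theorem shortScreening_torusLin (A : Matrix I I ℤ) (q : I → ℕ) (i : I) (v : LatticeFock I) :
    shortScreening A q i (torusLin G p t v) = torusLin G p t (shortScreening A q i v) := by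
  induction v using Finsupp.induction_linear with
  | zero => simp only [map_zero]
  | add v w hv hw => simp only [map_add, hv, hw]
  | single c Q =>
    rw [torusLin_single, map_smul, shortScreening, Finsupp.lsum_single, LinearMap.comp_apply,
      Finsupp.lsingle_apply, torusLin_single]

theorem torusExp_mem_feiginTipunin (A : Matrix I I ℤ) (q : I → ℕ) {v : LatticeFock I}
    (hv : v ∈ feiginTipunin A q) : torusExp G p t v ∈ feiginTipunin A q := by
  rw [feiginTipunin, Submodule.mem_iInf] at *
  intro i
  have := hv i
  rw [LinearMap.mem_ker] at *
  rw [← torusLin_apply, shortScreening_torusLin, this, map_zero]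

end Torus

section Relations

variable (hs : ∀ i j, G i j = G j i)
include hs

theorem cartanState_mode (p : ℕ) (i : I) (v : LatticeFock I) :
    latticeMode G E 0 (cartanState p i) 0 v =
      ((Real.sqrt p : ℝ) : ℂ)⁻¹ • heisMode G 0 i 0 v := by
  rw [cartanState_eq, latticeMode_smul_left, latticeMode_heisState hs]

theorem cartanState_mode_single (p : ℕ) (i : I) (c : I → ℤ) (Q : MvPolynomial (I × ℕ) ℂ) :
    latticeMode G E 0 (cartanState p i) 0 (Finsupp.single c Q) =
      ((chargePair G 0 c i : ℂ) / ((Real.sqrt p : ℝ) : ℂ)) • Finsupp.single c Q := by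
  rw [cartanState_mode hs, heisMode_single, heisFock_zero, ← Finsupp.smul_single, smul_smul,
    div_eq_inv_mul]

theorem opBracket_cartanState (p : ℕ) (i j : I) :
    opBracket (latticeMode G E 0 (cartanState p i) 0) (latticeMode G E 0 (cartanState p j) 0) =
      0 := by
  funext v
  have h := heisMode_commutator (lam := 0) hs i j 0 0 v
  rw [Int.cast_zero, zero_mul, zero_smul, ite_self, add_zero] at h
  rw [opBracket, cartanState_mode hs, cartanState_mode hs, cartanState_mode hs, cartanState_mode hs,
    map_smul, map_smul, h, sub_self, Pi.zero_apply]

theorem opBracket_cartanState_longScreening (p : ℕ) (i j : I) :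
    opBracket (latticeMode G E 0 (cartanState p i) 0) (latticeMode G E 0 (longScreening j) 0) =
      ((G i j : ℂ) / ((Real.sqrt p : ℝ) : ℂ)) • latticeMode G E 0 (longScreening j) 0 := by
  funext v
  rw [opBracket, cartanState_mode hs, cartanState_mode hs, Pi.smul_apply, longScreening,
    latticeMode_single_one, latticeMode_single_one, heisMode_expMode, chargePair_latticeBasis,
    map_smul, ← smul_sub, add_sub_cancel_left, smul_smul, add_zero, div_eq_inv_mul]

/-- Since x₀ is a derivation, its bracket with a zero mode is the zero mode of the image state.
Serre relations thus become statements about iterates of x₀ on a vector. -/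
theorem opBracket_longScreening_iterate (hG : GramNondegenerate G) (i : I) (c : LatticeFock I)
    (r : ℕ) : (opBracket (latticeMode G E 0 (longScreening i) 0))^[r] (latticeMode G E 0 c 0) =
      latticeMode G E 0 ((latticeMode G E 0 (longScreening i) 0)^[r] c) 0 := by
  have hD := zeroMode_derivation (x := longScreening i) (lattice_isVertexAlgebra (E := E) hs hG)
  induction r generalizing c with
  | zero => rfl
  | succ r ih =>
    rw [Function.iterate_succ_apply, Function.iterate_succ_apply, ← ih]
    congr 1
    funext v
    rw [opBracket, hD.mode, add_sub_cancel_right]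

end Relations

variable {A : Matrix I I ℤ} {q : I → ℕ}

theorem latPair_longScreening (hA : ∀ i, A i i = 2) (i : I) :
    latPair (corootGram A q) (latticeBasis i) (latticeBasis i) = 2 * (q i : ℤ) := by
  rw [latPair_latticeBasis, corootGram, hA, mul_comm]

theorem serre_longScreening {E : LatticeCocycle (corootGram A q)}
    (hs : ∀ i j, corootGram A q i j = corootGram A q j i) (hG : GramNondegenerate (corootGram A q))
    (hA : ∀ i, A i i = 2) {i j : I} (hij : A i j ≤ 0) :
    (opBracket (latticeMode (corootGram A q) E 0 (longScreening i) 0))^[(1 - A i j).toNat]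
      (latticeMode (corootGram A q) E 0 (longScreening j) 0) = 0 := by
  rw [opBracket_longScreening_iterate hs hG, longScreening, longScreening,
    expState_iterate_zero (p := q i) (latPair_longScreening hA i)]
  · funext v
    exact latticeMode_zero_left _ _
  -- For r = 1 - A i j the bracket in `hr` is 1 + qᵢ A i j - qᵢ A i j = 1, so the condition is just
  -- r > 0.
  · rw [latPair_latticeBasis, corootGram, Int.toNat_of_nonneg (by omega)]
    nlinarith

section Group

variable (hs : ∀ i j, G i j = G j i) (hG : GramNondegenerate G) {p : ℕ}
  (hnil : ∀ i, IsLocallyNilpotent (latticeMode G E 0 (longScreening i) 0))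
include hs hG hnil

theorem expOp_longScreening_isVertexAut (i : I) (t : ℂ) :
    IsVertexAut (latticeVac I) (latticeMode G E 0)
      (expOp (latticeMode G E 0 (longScreening i) 0) t) :=
  have hV := lattice_isVertexAlgebra hs hG
  expOp_isVertexAut (zeroMode_derivation hV) (hnil i) hV.isFieldMap t

theorem borelGroup_isVertexAut {g : Equiv.Perm (LatticeFock I)} (hg : g ∈ borelGroup G E p) :
    IsVertexAut (latticeVac I) (latticeMode G E 0) g := by
  induction hg using Subgroup.closure_induction with
  | mem g hg =>
    rcases hg with ⟨i, t, h⟩ | ⟨t, h⟩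
    · rw [h]; exact expOp_longScreening_isVertexAut hs hG hnil i t
    · rw [h]; exact torusExp_isVertexAut hs hG
  | one => exact .one
  | mul g h _ _ hg hh => exact hg.mul hh
  | inv g _ hg => exact hg.inv

/-- The inverse of each generator is a generator with parameter -t, so stability holds in both
directions; in this form it passes to products and inverses. -/
theorem borelGroup_mem_iff (q : I → ℕ) (hW : ∀ i, ∀ a ∈ feiginTipunin A q,
      latticeMode G E 0 (longScreening i) 0 a ∈ feiginTipunin A q)
    {g : Equiv.Perm (LatticeFock I)} (hg : g ∈ borelGroup G E p) :
    ∀ a, g a ∈ feiginTipunin A q ↔ a ∈ feiginTipunin A q := by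
  induction hg using Subgroup.closure_induction with
  | mem g hg =>
    intro a
    rcases hg with ⟨i, t, h⟩ | ⟨t, h⟩
    · rw [h]
      refine ⟨fun ha => ?_, expOp_mem (hW i) t⟩
      rw [← expOp_expOp_neg (zeroMode_derivation (lattice_isVertexAlgebra hs hG)) (hnil i) t a]
      exact expOp_mem (hW i) (-t) ha
    · rw [h]
      refine ⟨fun ha => ?_, torusExp_mem_feiginTipunin A q⟩
      rw [← torusExp_neg (G := G) (p := p) (t := t) a]
      exact torusExp_mem_feiginTipunin A q ha
  | one => exact fun a => Iff.rfl
  | mul g h _ _ hg hh => exact fun a => (hg _).trans (hh a)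
  | inv g _ hg =>
    intro a
    rw [← hg (g⁻¹ a)]
    exact iff_of_eq (congrArg (· ∈ feiginTipunin A q) (g.apply_symm_apply a).symm).symm

end Group

end BorelAction

/-! ### The Gram matrix of the rescaled coroot lattice. -/

section RootData

variable {ι V W : Type*} [Finite ι] [AddCommGroup V] [Module ℂ V] [AddCommGroup W] [Module ℂ W]
  {P : RootPairing ι ℂ V W} [P.IsRootSystem] [P.IsCrystallographic] (b : P.Base)
  {q : b.support → ℕ}

/-- The entry is 4p (αᵢ, αⱼ) / ((αᵢ, αᵢ)(αⱼ, αⱼ)), because qᵢ (αᵢ, αᵢ) = 2p and the Cartan entry is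
2 (αᵢ, αⱼ) / (αⱼ, αⱼ). Clearing the nonzero denominators leaves symmetry of the form. -/
theorem corootGram_symm (B : P.InvariantForm) {p : ℕ}
    (hB : ∀ i : b.support, 2 * (p : ℂ) = (q i : ℂ) * B.form (P.root i) (P.root i))
    (i j : b.support) : corootGram b.cartanMatrix q i j = corootGram b.cartanMatrix q j i := by
  have hA : ∀ i j : b.support, ((b.cartanMatrix i j : ℤ) : ℂ) * B.form (P.root j) (P.root j) =
      2 * B.form (P.root i) (P.root j) := by
    intro i j
    rw [B.two_mul_apply_root_root]
    congr 1
    exact P.algebraMap_pairingIn ℤ i j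
  have h0 : B.form (P.root i) (P.root i) * B.form (P.root j) (P.root j) ≠ 0 :=
    mul_ne_zero (B.ne_zero i) (B.ne_zero j)
  have h1 : B.form (P.root i) (P.root j) = B.form (P.root j) (P.root i) := B.symm.eq _ _
  have h : ((corootGram b.cartanMatrix q i j : ℤ) : ℂ) = (corootGram b.cartanMatrix q j i : ℤ) := by
    refine mul_right_cancel₀ h0 ?_
    simp only [corootGram]
    push_cast
    linear_combination (q i : ℂ) * B.form (P.root i) (P.root i) * hA i j -
      (q j : ℂ) * B.form (P.root j) (P.root j) * hA j i +
      2 * (q i : ℂ) * B.form (P.root i) (P.root i) * h1 +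
      2 * B.form (P.root j) (P.root i) * (hB j - hB i)
  exact_mod_cast h

/-- The Gram matrix is diag(q) times the Cartan matrix, and the latter is invertible for a base of a
finite root system. -/
theorem corootGram_nondegenerate (hq : ∀ i, 0 < q i) :
    GramNondegenerate (corootGram b.cartanMatrix q) := by
  classical
  have hdet : (b.cartanMatrix.map (Int.castRingHom ℂ)).det ≠ 0 := by
    have := Matrix.nondegenerate_iff_det_ne_zero.mp b.cartanMatrix_nondegenerate
    rw [← RingHom.mapMatrix_apply, ← RingHom.map_det]
    simpa using this
  refine ⟨fun j i => (b.cartanMatrix.map (Int.castRingHom ℂ))⁻¹ j i / (q i : ℂ), fun j l => ?_⟩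
  have h := congrFun (congrFun (Matrix.nonsing_inv_mul _ (Ne.isUnit hdet)) j) l
  rw [Matrix.mul_apply, Matrix.one_apply] at h
  refine Eq.trans ?_ (h.trans (by congr))
  · refine Finset.sum_congr rfl fun i _ => ?_
    have : (q i : ℂ) ≠ 0 := by exact_mod_cast (hq i).ne'
    simp only [corootGram, Matrix.map_apply, Int.coe_castRingHom]
    push_cast
    field_simp

end RootData

end

/-! ### The theorem. -/

theorem mainTheorem10
    {𝔤 : Type*} [LieRing 𝔤] [LieAlgebra ℂ 𝔤] [FiniteDimensional ℂ 𝔤] [LieAlgebra.IsSemisimple ℂ 𝔤]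
    (H : LieSubalgebra ℂ 𝔤) [H.IsCartanSubalgebra]
    (b : (LieAlgebra.IsKilling.rootSystem H).Base)
    -- the invariant form `( , )`, and `p` such that the rescaled coroot lattice is even:
    -- `(√p αᵢ^∨, √p αᵢ^∨) = 4 p / (αᵢ, αᵢ) = 2 q i` with positive integers `q i`
    (B : (LieAlgebra.IsKilling.rootSystem H).InvariantForm)
    (p : ℕ) (hp : 0 < p) (q : b.support → ℕ) (hq : ∀ i, 0 < q i)
    (hB : ∀ i : b.support, 2 * (p : ℂ) = (q i : ℂ) *
      B.form ((LieAlgebra.IsKilling.rootSystem H).root i)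
        ((LieAlgebra.IsKilling.rootSystem H).root i))
    (G : Matrix b.support b.support ℤ) (hG : G = corootGram b.cartanMatrix q)
    (E : LatticeCocycle G) :
    -- the lattice vertex algebra `𝒱_Λ` and its vertex subalgebra `𝒲_{𝔤,p}`
    IsVertexAlgebra (latticeVac b.support) (latticeMode G E 0) ∧
    ∃ hW : IsVertexSubalgebra (latticeVac b.support) (latticeMode G E 0)
        (feiginTipunin b.cartanMatrix q),
      IsVertexAlgebra hW.vac hW.mode ∧
      -- twisted modules
      (∀ (lam : b.support → ℤ) (i : b.support),
        -- `𝒱_λ` is the simple `𝒱_Λ`-module generated by `e^λ`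
        (IsVertexModule (latticeVac b.support) (latticeMode G E 0) (latticeMode G E lam) ∧
          IsSimpleVertexModule (latticeMode G E lam) ∧
          IsGeneratedBy (latticeMode G E lam) (latticeVac b.support)) ∧
        -- `x₀` is a locally nilpotent derivation of `𝒱_Λ`
        (IsVertexDerivation (latticeVac b.support) (latticeMode G E 0)
            (latticeMode G E 0 (longScreening i) 0) ∧
          IsLocallyNilpotent (latticeMode G E 0 (longScreening i) 0)) ∧
        -- `Δ(x, z) a` is a polynomial in `log z` and `z⁻¹`
        (∀ a, {kn : ℕ × ℕ |
          deltaCoeff (latticeMode G E 0) (longScreening i) a kn.1 kn.2 ≠ 0}.Finite) ∧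
        -- the deformation of `𝒱_λ` is an `x`-twisted module of `𝒱_Λ`
        IsTwistedModule (latticeVac b.support) (latticeMode G E 0)
          (latticeMode G E 0 (longScreening i) 0)
          (deltaDeform (latticeMode G E 0) (latticeMode G E lam) (longScreening i)) ∧
        -- its restriction is an `x`-twisted module of `𝒲_{𝔤,p}`
        (q i ≠ 1 → ∃ hD : ∀ a ∈ feiginTipunin b.cartanMatrix q,
            latticeMode G E 0 (longScreening i) 0 a ∈ feiginTipunin b.cartanMatrix q,
          (IsVertexDerivation hW.vac hW.mode (restrictMap hD) ∧
            IsLocallyNilpotent (restrictMap hD)) ∧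
          IsTwistedModule hW.vac hW.mode (restrictMap hD)
            (fun a => deltaDeform (latticeMode G E 0) (latticeMode G E lam) (longScreening i)
              (a : LatticeFock b.support)))) ∧
      -- the Borel action on `𝒱_Λ`, infinitesimally: derivations with the relations of the Borel
      -- subalgebra of the dual Lie algebra
      (∀ i j : b.support,
        IsVertexDerivation (latticeVac b.support) (latticeMode G E 0)
          (latticeMode G E 0 (cartanState p i) 0) ∧
        (∀ c Q, latticeMode G E 0 (cartanState p i) 0 (Finsupp.single c Q) =
          ((chargePair G 0 c i : ℂ) / ((Real.sqrt p : ℝ) : ℂ)) • Finsupp.single c Q) ∧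
        opBracket (latticeMode G E 0 (cartanState p i) 0)
          (latticeMode G E 0 (cartanState p j) 0) = 0 ∧
        opBracket (latticeMode G E 0 (cartanState p i) 0)
            (latticeMode G E 0 (longScreening j) 0) =
          ((G i j : ℂ) / ((Real.sqrt p : ℝ) : ℂ)) • latticeMode G E 0 (longScreening j) 0 ∧
        (i ≠ j → (opBracket (latticeMode G E 0 (longScreening i) 0))^[
            (1 - b.cartanMatrix i j).toNat] (latticeMode G E 0 (longScreening j) 0) = 0)) ∧
      -- its exponentials are automorphisms of `𝒱_Λ`
      (∀ (i : b.support) (t : ℂ), IsVertexAut (latticeVac b.support) (latticeMode G E 0)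
        (expOp (latticeMode G E 0 (longScreening i) 0) t)) ∧
      (∀ t : b.support → ℂ, IsVertexAut (latticeVac b.support) (latticeMode G E 0)
        (torusExp G p t)) ∧
      (∀ g ∈ borelGroup G E p,
        IsVertexAut (latticeVac b.support) (latticeMode G E 0) g) ∧
      -- the action descends to an action on `𝒲_{𝔤,p}` by automorphisms
      ((∀ i, q i ≠ 1) → ∀ g ∈ borelGroup G E p,
        ∃ hg : ∀ a ∈ feiginTipunin b.cartanMatrix q, g a ∈ feiginTipunin b.cartanMatrix q,
          IsVertexAut hW.vac hW.mode (restrictMap hg)) := by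
  subst hG
  have hs := corootGram_symm b B hB
  have hN := corootGram_nondegenerate b hq
  have hA : ∀ i, b.cartanMatrix i i = 2 := b.cartanMatrix_apply_same
  have hA' : ∀ i j, i ≠ j → b.cartanMatrix i j ≤ 0 := fun i j => b.cartanMatrix_le_zero_of_ne i j
  have hV := lattice_isVertexAlgebra (E := E) hs hN
  have hW := feiginTipunin_isVertexSubalgebra (E := E) hq hs hN
  have hq' : ∀ i, (0 : ℤ) < q i := fun i => by exact_mod_cast hq i
  have hx : ∀ (i : b.support) (n : ℕ), latticeMode _ E 0 (longScreening i) n (longScreening i) = 0 :=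
    fun i => expState_products_zero (latPair_longScreening hA i) (hq' i)
  have hfin : ∀ (i : b.support) a, ∃ C : ℕ, ∀ k n, C ≤ k + n →
      deltaCoeff (latticeMode _ E 0) (longScreening i) a k n = 0 := fun i =>
    deltaCoeff_exp_eventually_zero hs hN (latPair_longScreening hA i) (hq' i)
  have hder : ∀ a, IsVertexDerivation (latticeVac b.support) (latticeMode _ E 0)
      (latticeMode _ E 0 a 0) := fun a => zeroMode_derivation hV
  have hnil : ∀ i : b.support, IsLocallyNilpotent (latticeMode _ E 0 (longScreening i) 0) := by
    intro i a
    obtain ⟨C, hC⟩ :=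
      zeroMode_iterate_eventually_zero hV hV.toIsVertexModule (hx i) (hfin i) a
    exact ⟨C, hC C le_rfl⟩
  refine ⟨hV, hW, hW.isVertexAlgebra hV, fun lam i => ?_, fun i j => ?_,
    expOp_longScreening_isVertexAut hs hN hnil, fun t => torusExp_isVertexAut hs hN,
    fun g hg => borelGroup_isVertexAut hs hN hnil hg, fun hq1 g hg => ?_⟩
  · have hM : IsVertexModule (latticeVac b.support) (latticeMode _ E 0) (latticeMode _ E lam) :=
      lattice_isVertexModule hs hN
    have hT := deltaDeform_isTwistedModule hV hM (hx i) (hfin i)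
    refine ⟨⟨hM, lattice_isSimple hs hN, lattice_isGeneratedBy hs⟩, ⟨hder _, hnil i⟩, fun a => ?_,
      hT, fun hqi => ?_⟩
    · obtain ⟨C, hC⟩ := hfin i a
      refine (Finset.range C ×ˢ Finset.range C).finite_toSet.subset fun kn h => ?_
      by_contra hc
      refine h (hC _ _ ?_)
      simp only [Finset.coe_product, Finset.coe_range, Set.mem_prod, Set.mem_Iio] at hc
      omega
    · have hD : ∀ a ∈ feiginTipunin b.cartanMatrix q,
          latticeMode _ E 0 (longScreening i) 0 a ∈ feiginTipunin b.cartanMatrix q :=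
        fun a => longScreening_mem_feiginTipunin hq hs hN hA hA' hqi
      exact ⟨hD, ⟨(hder _).restrict hW hD, (hnil i).restrict hD⟩, hT.restrict hW hD⟩
  · exact ⟨hder _, cartanState_mode_single hs p i, opBracket_cartanState hs p i j,
      opBracket_cartanState_longScreening hs p i j,
      fun hij => serre_longScreening hs hN hA (hA' i j hij)⟩
  · have hmem := borelGroup_mem_iff hs hN hnil q
      (fun i a => longScreening_mem_feiginTipunin hq hs hN hA hA' (hq1 i)) hg
    exact ⟨fun a ha => (hmem a).mpr ha, (borelGroup_isVertexAut hs hN hnil hg).restrict hW hmem⟩
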